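/- Let $k\ge 3$ be odd, $\rho$ an integer coprime to $k$, $q=e^{2\pi i_0\rho/k}$ (with $i_0=\sqrt{-1}$), $q^x:=e^{2\pi i_0\rho x/k}$ for $x\in\mathbb C$, and $[x]=(q^x-q^{-x})/(q-q^{-1})$. Let $U'_q(\mathrm{so}_n)$ be the unital associative complex algebra generated by $I_{21},I_{32},\dots,I_{n,n-1}$ with the relations $$I_{s,s-1}^2I_{s+1,s}-(q+q^{-1})I_{s,s-1}I_{s+1,s}I_{s,s-1}+I_{s+1,s}I_{s,s-1}^2=-I_{s+1,s},$$ $$I_{s,s-1}I_{s+1,s}^2-(q+q^{-1})I_{s+1,s}I_{s,s-1}I_{s+1,s}+I_{s+1,s}^2I_{s,s-1}=-I_{s,s-1},$$ and $I_{s,s-1}I_{t,t-1}=I_{t,t-1}I_{s,s-1}$ for $|s-t|>1$. **Parameters.** Fix $1\le i<\lfloor n/2\rfloor$. Call $x\in\mathbb C$ *exceptional* if $2\rho x\in\mathbb Z$ (for $\rho=\pm1$: if $x\in\frac12\mathbb Z$). Fix complex numbers $m_{r,n}$ ($1\le r\le i$) and $h_{r,s}$, $c_{r,s}\neq0$ ($2\le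 s\le n-1$, $1\le r\le\min(i,\lfloor s/2\rfloor)$) such that none of the numbers $m_{r,n}$, $h_{r,s}$, $h_{r,s}-h_{r',s}$ ($r\ne r'$), $h_{r,s}+h_{r',s}$ ($r'=r$ allowed), $h_{r,s}\pm h_{r',s+1}$, $h_{r,n-1}\pm m_{r',n}$ is exceptional. Fix also numbers $m_{i+1,n},\dots,m_{\lfloor n/2\rfloor,n}$, all integers or all in $\frac12+\mathbb Z$, with $m_{i+1,n}\ge m_{i+2,n}\ge\dots\ge|m_{l,n}|$ if $n=2l$ (no condition if $i+1=l$), and $m_{i+1,n}\ge\dots\ge m_{l,n}\ge0$ if $n=2l+1$. Put $l_{j,2p+1}=m_{j,2p+1}+p-j+1$, $l_{j,2p}=m_{j,2p}+p-j$, and assume $l_{i+1,n}\pm l_{\lfloor n/2\rfloor,n}<k$. Let $\omega$ be the collection of all these numbers, and put $c_{j,s}=1$ for $j>i$. **Space.** $V$ has a basis $|\xi\rangle$ labelled by the tableaux $\xi=(m_{j,s})_{2\le s\le n,\,1\le j\le\lfloor s/2\rfloor}$ with the given top row, with $m_{j,s}\in\{h_{j,s},h_{j,s}+1,\dots,h_{j,s}+k-1\}$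 for $j\le i$, $s<n$, and with $m_{j,s}\in m_{i+1,n}+\mathbb Z$ for $j>i$ such that, in all rows up to $n$, $$m_{i+1,2r+1}\ge m_{i+1,2r}\ge m_{i+2,2r+1}\ge\dots\ge m_{r,2r+1}\ge m_{r,2r}\ge-m_{r,2r+1},$$ $$m_{i+1,2r}\ge m_{i+1,2r-1}\ge m_{i+2,2r}\ge\dots\ge m_{r-1,2r-1}\ge|m_{r,2r}|.$$ **Operators.** $\xi^{\pm j}_s$ is $\xi$ with $m_{j,s}$ replaced by $m_{j,s}\pm1$, cyclically in $\{h_{j,s},\dots,h_{j,s}+k-1\}$ if $j\le i$; terms with $j>i$ for which $\xi_s^{\pm j}$ is not a tableau are omitted. Consider $$T'(I_{2p+1,2p})|\xi\rangle=\sum_{j=1}^p\frac{c_{j,2p}A^j_{2p}(\xi)}{q^{l_{j,2p}}+q^{-l_{j,2p}}}|\xi^{+j}_{2p}\rangle-\sum_{j=1}^p\frac{c_{j,2p}^{-1}A^j_{2p}(\xi^{-j}_{2p})}{q^{l_{j,2p}}+q^{-l_{j,2p}}}|\xi^{-j}_{2p}\rangle,$$ $$T'(I_{2p,2p-1})|\xi\rangle=\sum_{j=1}^{p-1}\frac{c_{j,2p-1}B^j_{2p-1}(\xi)}{[2l_{j,2p-1}-1][l_{j,2p-1}]}|\xi^{+j}_{2p-1}\rangle-\sum_{j=1}^{p-1}\frac{c_{j,2p-1}^{-1}B^j_{2p-1}(\xi^{-j}_{2p-1})}{[2l_{j,2p-1}-1][l_{j,2p-1}-1]}|\xi^{-j}_{2p-1}\rangle+i_0\,C_{2p-1}(\xi)|\xi\rangle,$$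 where $A^j_{2p}(\xi)$, $B^j_{2p-1}(\xi)$ are square roots of $$\frac{\prod_{a=1}^p[l_{a,2p+1}+l_{j,2p}][l_{a,2p+1}-l_{j,2p}-1]\prod_{a=1}^{p-1}[l_{a,2p-1}+l_{j,2p}][l_{a,2p-1}-l_{j,2p}-1]}{\prod_{a\ne j}[l_{a,2p}+l_{j,2p}][l_{a,2p}-l_{j,2p}][l_{a,2p}+l_{j,2p}+1][l_{a,2p}-l_{j,2p}-1]},$$ $$\frac{\prod_{a=1}^p[l_{a,2p}+l_{j,2p-1}][l_{a,2p}-l_{j,2p-1}]\prod_{a=1}^{p-1}[l_{a,2p-2}+l_{j,2p-1}][l_{a,2p-2}-l_{j,2p-1}]}{\prod_{a\ne j}[l_{a,2p-1}+l_{j,2p-1}][l_{a,2p-1}-l_{j,2p-1}][l_{a,2p-1}+l_{j,2p-1}-1][l_{a,2p-1}-l_{j,2p-1}-1]},$$ and $$C_{2p-1}(\xi)=\frac{\prod_{a=1}^p[l_{a,2p}]\prod_{a=1}^{p-1}[l_{a,2p-2}]}{\prod_{a=1}^{p-1}[l_{a,2p-1}][l_{a,2p-1}-1]},$$ read as $0$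 if its denominator vanishes. **Theorem.** 1. The denominators $[2l_{j,2p-1}-1][l_{j,2p-1}]$ ($2p-1<n$) are non-zero on all basis tableaux if and only if either $i+1=\lfloor n/2\rfloor$ or $2(m_{i+1,n}+\lfloor n/2\rfloor-i-1)<k$. 2. Assume that this is the case, or that $i=1$ and $m_{2,n}=\dots=m_{\lfloor n/2\rfloor,n}=0$. Then $V$ is finite dimensional; the square roots can be chosen so that the operators above define a representation $T'_\omega$ of $U'_q(\mathrm{so}_n)$ on $V$; and for every choice of the square roots for which they define a representation, this representation is irreducible. 3. Let $i=1$ and $m_{2,n}=\dots=m_{\lfloor n/2\rfloor,n}=0$ (representations of minimal dimension). Then $\omega$ consists of $2n-3$ complex parameters $m_{1,n},h_{1,s},c_{1,s}$ ($2\le s\le n-1$) besides these zeros, and $\dim V=k^{n-2}$. After rescaling the basis vectors (by non-zero numbers) and with a suitable choice of the square roots, writing $m_s=m_{1,s}$, $m_1=0$, $c_s=c_{1,s}$, one has $T'_\omega(I_{21})|\xi\rangle=i_0[m_2]\,|\xi\rangle$ and, for $2\le s\le n-1$, $$T'_\omega(I_{s+1,s})|\xi\rangle=c_sS_s(\xi)|\xi^{+1}_s\rangle-c_s^{-1}S_s(\xi^{-1}_s)|\xi^{-1}_s\rangle,$$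 $$S_s(\xi)^2=\frac{[m_{s+1}+m_s+s-1][m_{s+1}-m_s][m_s+m_{s-1}+s-2][m_s-m_{s-1}+1]}{[2m_s+s][2m_s+s-2]}.$$ -/

import Mathlib

open Finset

noncomputable section

namespace NonstdSo

/-! ### The algebra `U'_q(so_n)` -/

/-- The defining trilinear relations; the generator number `t : Fin (n - 1)` stands for
`I_{t+2,t+1}`. -/
inductive Rel (q : ℂ) (n : ℕ) :
    FreeAlgebra ℂ (Fin (n - 1)) → FreeAlgebra ℂ (Fin (n - 1)) → Prop
  | left (a b : Fin (n - 1)) (hab : (b : ℕ) = (a : ℕ) + 1) :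
      Rel q n
        (FreeAlgebra.ι ℂ a ^ 2 * FreeAlgebra.ι ℂ b
          - (q + q⁻¹) • (FreeAlgebra.ι ℂ a * FreeAlgebra.ι ℂ b * FreeAlgebra.ι ℂ a)
          + FreeAlgebra.ι ℂ b * FreeAlgebra.ι ℂ a ^ 2)
        (-FreeAlgebra.ι ℂ b)
  | right (a b : Fin (n - 1)) (hab : (b : ℕ) = (a : ℕ) + 1) :
      Rel q n
        (FreeAlgebra.ι ℂ a * FreeAlgebra.ι ℂ b ^ 2
          - (q + q⁻¹) • (FreeAlgebra.ι ℂ b * FreeAlgebra.ι ℂ a * FreeAlgebra.ι ℂ b)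
          + FreeAlgebra.ι ℂ b ^ 2 * FreeAlgebra.ι ℂ a)
        (-FreeAlgebra.ι ℂ a)
  | comm (a b : Fin (n - 1)) (hab : (a : ℕ) + 1 < (b : ℕ)) :
      Rel q n (FreeAlgebra.ι ℂ a * FreeAlgebra.ι ℂ b)
        (FreeAlgebra.ι ℂ b * FreeAlgebra.ι ℂ a)

/-- The nonstandard deformation `U'_q(so_n)`: the unital associative complex algebra generated by
`I_{21}, I_{32}, …, I_{n,n-1}` subject to the relations `Rel`. -/
abbrev Uq (q : ℂ) (n : ℕ) : Type := RingQuot (Rel q n)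

/-- The generator `I_{t+2,t+1}`. -/
def gen (q : ℂ) (n : ℕ) (t : Fin (n - 1)) : Uq q n :=
  RingQuot.mkAlgHom ℂ (Rel q n) (FreeAlgebra.ι ℂ t)

/-- Irreducibility of a representation of an algebra: the space is nonzero and has no invariant
subspaces other than `0` and itself. -/
def IsIrreducibleRep {A V : Type*} [Ring A] [Algebra ℂ A] [AddCommGroup V] [Module ℂ V]
    (T : A →ₐ[ℂ] Module.End ℂ V) : Prop :=
  Nontrivial V ∧
    ∀ W : Submodule ℂ V, (∀ a : A, ∀ w ∈ W, T a w ∈ W) → W = ⊥ ∨ W = ⊤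

/-! ### The parameters -/

/-- The set of numbers `ω` together with `k`, `n`, `i` and the root of unity
`q = exp (2πiρ/k)`.  All indices start from `1`, and only the following values are used:
`m r = m_{r,n}` for `1 ≤ r ≤ i`, `M j = m_{j,n}` for `i < j ≤ ⌊n/2⌋`, and
`h r s = h_{r,s}`, `c r s = c_{r,s}` for `2 ≤ s ≤ n - 1`, `1 ≤ r ≤ min i ⌊s/2⌋`. -/
structure Omega where
  k : ℕ
  n : ℕ
  i : ℕ
  ρ : ℤ
  m : ℕ → ℂ
  M : ℕ → ℚ
  h : ℕ → ℕ → ℂ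
  c : ℕ → ℕ → ℂ

namespace Omega

variable (P : Omega)

/-- `q ^ x = exp (2πiρx/k)`. -/
def qp (x : ℂ) : ℂ := Complex.exp (2 * Real.pi * Complex.I * P.ρ * x / P.k)

/-- The root of unity `q`. -/
def q : ℂ := P.qp 1

/-- The `q`-number `[x] = (q ^ x - q ^ (-x)) / (q - q⁻¹)`. -/
def qn (x : ℂ) : ℂ := (P.qp x - P.qp (-x)) / (P.qp 1 - P.qp (-1))

/-- `x` does not belong to `(1 / (2ρ)) ℤ`; for `q = exp (± 2πi/k)` this says that `x` does not
belong to `½ ℤ`.  In general it says that `[x + a] ≠ 0` for all integers `a`. -/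
def Generic (x : ℂ) : Prop := ∀ a : ℤ, 2 * (P.ρ : ℂ) * x ≠ a

/-- `l_{j,n}` for `j > i`. -/
def topL (j : ℕ) : ℚ := P.M j + ((P.n + 1) / 2 : ℕ) - j

/-- The conditions on the numbers in `ω`. -/
structure Admissible : Prop where
  k_odd : Odd P.k
  k_ge : 3 ≤ P.k
  coprime : Int.gcd P.ρ P.k = 1
  i_pos : 1 ≤ P.i
  i_lt : P.i < P.n / 2
  c_ne : ∀ r s, 1 ≤ r → r ≤ P.i → 2 * r ≤ s → s < P.n → P.c r s ≠ 0
  m_gen : ∀ r, 1 ≤ r → r ≤ P.i → P.Generic (P.m r)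
  h_gen : ∀ r s, 1 ≤ r → r ≤ P.i → 2 * r ≤ s → s < P.n → P.Generic (P.h r s)
  h_sub : ∀ r r' s, 1 ≤ r → r ≤ P.i → 2 * r ≤ s → 1 ≤ r' → r' ≤ P.i → 2 * r' ≤ s → s < P.n →
    r ≠ r' → P.Generic (P.h r s - P.h r' s)
  h_add : ∀ r r' s, 1 ≤ r → r ≤ P.i → 2 * r ≤ s → 1 ≤ r' → r' ≤ P.i → 2 * r' ≤ s → s < P.n →
    P.Generic (P.h r s + P.h r' s)
  h_next : ∀ r r' s, 1 ≤ r → r ≤ P.i → 2 * r ≤ s → 1 ≤ r' → r' ≤ P.i → 2 * r' ≤ s + 1 →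
    s + 1 < P.n →
    P.Generic (P.h r s - P.h r' (s + 1)) ∧ P.Generic (P.h r s + P.h r' (s + 1))
  h_top : ∀ r r', 1 ≤ r → r ≤ P.i → 2 * r ≤ P.n - 1 → 1 ≤ r' → r' ≤ P.i →
    P.Generic (P.h r (P.n - 1) - P.m r') ∧ P.Generic (P.h r (P.n - 1) + P.m r')
  M_int : (∀ j, P.i < j → j ≤ P.n / 2 → ∃ a : ℤ, P.M j = a) ∨
    (∀ j, P.i < j → j ≤ P.n / 2 → ∃ a : ℤ, P.M j = a + 1 / 2)
  M_dom : ∀ j, P.i < j → j + 1 ≤ P.n / 2 → P.M (j + 1) ≤ P.M j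
  M_even : Even P.n → P.i + 1 < P.n / 2 → |P.M (P.n / 2)| ≤ P.M (P.n / 2 - 1)
  M_odd : Odd P.n → 0 ≤ P.M (P.n / 2)
  bound_add : P.topL (P.i + 1) + P.topL (P.n / 2) < P.k
  bound_sub : P.topL (P.i + 1) - P.topL (P.n / 2) < P.k

/-! ### The tableaux

A tableau is encoded by integers `ξ j s`, `1 ≤ j ≤ ⌊s/2⌋`, `2 ≤ s ≤ n - 1` (the remaining values
are `0`): `m_{j,s} = h_{j,s} + ξ j s` if `j ≤ i`, and `m_{j,s} = m_{i+1,n} + ξ j s` if `j > i`. -/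

/-- The (integral or half-integral) entry `m_{j,s}`, for `j > i`. -/
def w (ξ : ℕ → ℕ → ℤ) (j s : ℕ) : ℚ := if s = P.n then P.M j else P.M (P.i + 1) + ξ j s

/-- The entry `m_{j,s}` of a tableau. -/
def entry (ξ : ℕ → ℕ → ℤ) (j s : ℕ) : ℂ :=
  if j ≤ P.i then (if s = P.n then P.m j else P.h j s + ξ j s) else ((P.w ξ j s : ℚ) : ℂ)

/-- The tableaux labelling the basis: the entries with `j ≤ i` run over
`h_{j,s}, h_{j,s} + 1, …, h_{j,s} + k - 1`, those with `j > i` satisfy the betweenness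
conditions. -/
structure IsTableau (ξ : ℕ → ℕ → ℤ) : Prop where
  supp : ∀ j s, ¬(1 ≤ j ∧ 2 * j ≤ s ∧ s < P.n) → ξ j s = 0
  cyc : ∀ j s, 1 ≤ j → j ≤ P.i → 2 * j ≤ s → s < P.n → 0 ≤ ξ j s ∧ ξ j s < P.k
  /-- `m_{j,2r+1} ≥ m_{j,2r}` -/
  odd_ge : ∀ r j, 2 * r + 1 ≤ P.n → P.i < j → j ≤ r → P.w ξ j (2 * r) ≤ P.w ξ j (2 * r + 1)
  /-- `m_{j,2r} ≥ m_{j+1,2r+1}` -/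
  odd_le : ∀ r j, 2 * r + 1 ≤ P.n → P.i < j → j + 1 ≤ r →
    P.w ξ (j + 1) (2 * r + 1) ≤ P.w ξ j (2 * r)
  /-- `m_{r,2r} ≥ - m_{r,2r+1}` -/
  odd_last : ∀ r, 2 * r + 1 ≤ P.n → P.i < r → -P.w ξ r (2 * r + 1) ≤ P.w ξ r (2 * r)
  /-- `m_{j,2r} ≥ m_{j,2r-1}` -/
  even_ge : ∀ r j, 2 * r ≤ P.n → P.i < j → j + 1 ≤ r → P.w ξ j (2 * r - 1) ≤ P.w ξ j (2 * r)
  /-- `m_{j,2r-1} ≥ m_{j+1,2r}` -/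
  even_le : ∀ r j, 2 * r ≤ P.n → P.i < j → j + 2 ≤ r →
    P.w ξ (j + 1) (2 * r) ≤ P.w ξ j (2 * r - 1)
  /-- `m_{r-1,2r-1} ≥ |m_{r,2r}|` -/
  even_last : ∀ r, 2 * r ≤ P.n → P.i + 1 < r → |P.w ξ r (2 * r)| ≤ P.w ξ (r - 1) (2 * r - 1)

/-- The set of tableaux. -/
def Tab : Type := {ξ : ℕ → ℕ → ℤ // P.IsTableau ξ}

/-- The representation space: the complex vector space with the basis labelled by the tableaux;
the basis vector `|ξ⟩` is `Finsupp.single ξ 1`. -/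
abbrev V : Type := P.Tab →₀ ℂ

/-- Replacement of `m_{j,s}` by `m_{j,s} + e`, cyclically (modulo `k`) if `j ≤ i`. -/
def shift (ξ : ℕ → ℕ → ℤ) (j s : ℕ) (e : ℤ) : ℕ → ℕ → ℤ := fun j' s' =>
  if j' = j ∧ s' = s then (if j ≤ P.i then (ξ j s + e) % (P.k : ℤ) else ξ j s + e) else ξ j' s'

/-- The `l`-coordinates `l_{j,2p+1} = m_{j,2p+1} + p - j + 1`, `l_{j,2p} = m_{j,2p} + p - j`. -/
def l (ξ : ℕ → ℕ → ℤ) (j s : ℕ) : ℂ := P.entry ξ j s + ((s + 1) / 2 : ℕ) - j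

/-! ### The operators -/

/-- The expression under the root in `A^j_{2p}(ξ)`. -/
def radA (ξ : ℕ → ℕ → ℤ) (p j : ℕ) : ℂ :=
  (∏ a ∈ Icc 1 p, P.qn (P.l ξ a (2 * p + 1) + P.l ξ j (2 * p)) *
      P.qn (P.l ξ a (2 * p + 1) - P.l ξ j (2 * p) - 1)) *
    (∏ a ∈ Icc 1 (p - 1), P.qn (P.l ξ a (2 * p - 1) + P.l ξ j (2 * p)) *
      P.qn (P.l ξ a (2 * p - 1) - P.l ξ j (2 * p) - 1)) /
    ∏ a ∈ (Icc 1 p).erase j,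
      P.qn (P.l ξ a (2 * p) + P.l ξ j (2 * p)) * P.qn (P.l ξ a (2 * p) - P.l ξ j (2 * p)) *
      P.qn (P.l ξ a (2 * p) + P.l ξ j (2 * p) + 1) *
      P.qn (P.l ξ a (2 * p) - P.l ξ j (2 * p) - 1)

/-- The expression under the root in `B^j_{2p-1}(ξ)`. -/
def radB (ξ : ℕ → ℕ → ℤ) (p j : ℕ) : ℂ :=
  (∏ a ∈ Icc 1 p, P.qn (P.l ξ a (2 * p) + P.l ξ j (2 * p - 1)) *
      P.qn (P.l ξ a (2 * p) - P.l ξ j (2 * p - 1))) *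
    (∏ a ∈ Icc 1 (p - 1), P.qn (P.l ξ a (2 * p - 2) + P.l ξ j (2 * p - 1)) *
      P.qn (P.l ξ a (2 * p - 2) - P.l ξ j (2 * p - 1))) /
    ∏ a ∈ (Icc 1 (p - 1)).erase j,
      P.qn (P.l ξ a (2 * p - 1) + P.l ξ j (2 * p - 1)) *
      P.qn (P.l ξ a (2 * p - 1) - P.l ξ j (2 * p - 1)) *
      P.qn (P.l ξ a (2 * p - 1) + P.l ξ j (2 * p - 1) - 1) *
      P.qn (P.l ξ a (2 * p - 1) - P.l ξ j (2 * p - 1) - 1)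

/-- `C_{2p-1}(ξ)`.  The standard convention that `C_{2p-1}(ξ) = 0` if `m_{p-1,2p-1} = 0`
(then the factor `[l_{p-1,2p-1} - 1]` and two factors of the numerator vanish) is built in, since
the quotient by `0` is `0`. -/
def C (ξ : ℕ → ℕ → ℤ) (p : ℕ) : ℂ :=
  (∏ a ∈ Icc 1 p, P.qn (P.l ξ a (2 * p))) * (∏ a ∈ Icc 1 (p - 1), P.qn (P.l ξ a (2 * p - 2))) /
    ∏ a ∈ Icc 1 (p - 1), P.qn (P.l ξ a (2 * p - 1)) * P.qn (P.l ξ a (2 * p - 1) - 1)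

/-- `R ξ j s` is a choice of the square roots `A^j_{2p}(ξ)` (for `s = 2p`) and `B^j_{2p-1}(ξ)`
(for `s = 2p - 1`), for all pairs of basis tableaux `ξ`, `ξ^{+j}_s`. -/
def IsRootChoice (R : P.Tab → ℕ → ℕ → ℂ) : Prop :=
  ∀ (ξ : P.Tab) (j s : ℕ), 1 ≤ j → 2 * j ≤ s → s < P.n → P.IsTableau (P.shift ξ.1 j s 1) →
    R ξ j s ^ 2 = if Even s then P.radA ξ.1 (s / 2) j else P.radB ξ.1 ((s + 1) / 2) j

/-- `c_{j,s}`, with `c_{j,s} = 1` for `j > i`. -/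
def cc (j s : ℕ) : ℂ := if j ≤ P.i then P.c j s else 1

/-- The denominators in the first sums of the formulas for the operators. -/
def denUp (ξ : ℕ → ℕ → ℤ) (j s : ℕ) : ℂ :=
  if Even s then P.qp (P.l ξ j s) + P.qp (-P.l ξ j s)
  else P.qn (2 * P.l ξ j s - 1) * P.qn (P.l ξ j s)

/-- The denominators in the second sums of the formulas for the operators. -/
def denDown (ξ : ℕ → ℕ → ℤ) (j s : ℕ) : ℂ :=
  if Even s then P.qp (P.l ξ j s) + P.qp (-P.l ξ j s)
  else P.qn (2 * P.l ξ j s - 1) * P.qn (P.l ξ j s - 1)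

open Classical in
/-- The vector `f(η) |η⟩`, which is omitted (zero) if `η` is not a tableau of the basis. -/
def ket (η : ℕ → ℕ → ℤ) (f : P.Tab → ℂ) : P.V :=
  if hη : P.IsTableau η then Finsupp.single ⟨η, hη⟩ (f ⟨η, hη⟩) else 0

/-- The vector `T'(I_{s+1,s}) |ξ⟩`; for `s = 2p` and for `s = 2p - 1` the sum is over
`j = 1, …, p` and `j = 1, …, p - 1`, respectively. -/
def act (R : P.Tab → ℕ → ℕ → ℂ) (s : ℕ) (ξ : P.Tab) : P.V :=
  ∑ j ∈ Icc 1 (s / 2),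
    (P.ket (P.shift ξ.1 j s 1) (fun _ => P.cc j s * R ξ j s / P.denUp ξ.1 j s) -
      P.ket (P.shift ξ.1 j s (-1)) (fun η => (P.cc j s)⁻¹ * R η j s / P.denDown ξ.1 j s)) +
  (if Even s then 0 else Finsupp.single ξ (Complex.I * P.C ξ.1 ((s + 1) / 2)))

/-- The operator `T'(I_{s+1,s})`. -/
def op (R : P.Tab → ℕ → ℕ → ℂ) (s : ℕ) : Module.End ℂ P.V :=
  Finsupp.linearCombination ℂ (P.act R s)

/-- `T` is the representation `T'_ω` given by the formulas with the square roots `R`. -/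
def IsRep (R : P.Tab → ℕ → ℕ → ℂ) (T : Uq P.q P.n →ₐ[ℂ] Module.End ℂ P.V) : Prop :=
  ∀ t : Fin (P.n - 1), T (gen P.q P.n t) = P.op R (t + 1)

/-- The denominators `[2 l_{j,2p-1} - 1] [l_{j,2p-1}]` do not vanish on the basis tableaux. -/
def Regular : Prop :=
  ∀ (ξ : P.Tab) (j s : ℕ), 1 ≤ j → 2 * j ≤ s → s < P.n → Odd s → P.denUp ξ.1 j s ≠ 0

/-! ### The case of minimal dimension -/

/-- `i = 1` and `m_{2,n} = m_{3,n} = ⋯ = 0`. -/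
def IsMinimal : Prop := P.i = 1 ∧ ∀ j, 1 < j → j ≤ P.n / 2 → P.M j = 0

/-- The number of complex parameters `m_{r,n}`, `h_{r,s}`, `c_{r,s}` in `ω`. -/
def numParams : ℕ := P.i + 2 * ((Icc 2 (P.n - 1)).sigma fun s => Icc 1 (min P.i (s / 2))).card

/-- `m_s = m_{1,s}`, with `m_1 = 0`. -/
def mm (ξ : ℕ → ℕ → ℤ) (s : ℕ) : ℂ := if s = 1 then 0 else P.entry ξ 1 s

/-- The expression under the root in the formula for `T^min(I_{s+1,s})`. -/
def radMin (ξ : ℕ → ℕ → ℤ) (s : ℕ) : ℂ :=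
  P.qn (P.mm ξ (s + 1) + P.mm ξ s + s - 1) * P.qn (P.mm ξ (s + 1) - P.mm ξ s) *
    P.qn (P.mm ξ s + P.mm ξ (s - 1) + s - 2) * P.qn (P.mm ξ s - P.mm ξ (s - 1) + 1) /
    (P.qn (2 * P.mm ξ s + s) * P.qn (2 * P.mm ξ s + s - 2))

end Omega

end NonstdSo

end

noncomputable section

namespace NonstdSo

/-! Put `h = q^{1/2}` and attach to every entry the number `X = q^{m_{j,s} + s/2 - j}`. The operator
of row `s` is then a sum over moves: one entry of row `s` is multiplied by `q` or `q⁻¹`, or, for odd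
`s`, nothing moves (the diagonal term). Every radicand is a product of factors `[xy][x/y]`, which
are proportional to `yy x - yy y` (`yy_sub`). The square roots are chosen coherently: each bracket
of a pair of entries gets the fixed root `sg`, so that a root met twice along a path always
recombines to a bracket.

Relations. Generators of distant rows commute because a coefficient sees only adjacent rows. For
adjacent rows `r`, `r'`, fix a move `z` of `r'` and moves `x`, `y` of `r`; `ww` is their total
weight in the trilinear expression. If the same entry is moved twice in one direction, the weight
vanishes by `[a] + [a+2] = [2][a+1]` (`tt_self`). If `x`, `y` lie in different columns, the weights
of the two orders are opposite (`ww_ne`). If `y` undoes `x`, the weights summed over `x` form a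
Lagrange interpolation sum, whose nodes are the centres of the moves and whose numerator vanishes at
the neighbouring entries; its value is a leading coefficient, and this yields the right-hand side of
the relation (`sum_loops`). At a root of unity nodes may coincide, but then interlacing puts a
neighbour on the common node and the two factors cancel (`sum_prod_div_prod`, `phi_of_vv_eq`).
Cutting down to tableaux does no harm, since a move that breaks interlacing has coefficient zero
(`coef_border`), and the cyclic identification is harmless because `q ^ k = 1` (`xx_red`).

Range of parameters. For noncyclic entries `X` is a power of `q^{1/2}` with integral exponent `tw`,
and an odd-row denominator vanishes exactly if `k` divides `tw` or `tw + 1`. The bound `Low` on the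
top row keeps `tw` strictly between these values; if `Low` fails, a tableau with constant columns
reaches one of them (`Regular.low`).

Irreducibility. For an invariant subspace `W`, the functions on tableaux whose diagonal operators
preserve `W` form an algebra. If it separates tableaux, a nonzero `W` contains a basis vector, and
nonvanishing matrix entries then lead to all others (`single_mem`). Separation is proved row by row
(`Settled`). Row 2 is read off the diagonal operator of row 1. A product of two opposite matrix
entries of row `s` does not depend on the choice of roots and gives the radicand, hence a value of
the polynomial with roots `yy X_{a,s+1}`; rotating the cyclic entries of row `s` gives enough values
to determine it. This fixes row `s + 1` up to one sign, which the diagonal coefficient detects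
(`Settled.eq_of_last`).

Minimal dimension. All noncyclic entries are frozen, their brackets telescope (`prod_cancel`), and
rescaling by square roots of `gg` makes the upward and downward coefficients symmetric
(`minimal_form`). -/

/-! ### Brackets and their square roots -/

/-- The bracket `[x]` in multiplicative form, with `q = h ^ 2`. -/
def br (h x : ℂ) : ℂ := (x - x⁻¹) / (h ^ 2 - (h ^ 2)⁻¹)

/-- A square root of the bracket. -/
def sg (h x : ℂ) : ℂ := br h x ^ ((1 : ℂ) / 2)

lemma sg_mul_self (h x : ℂ) : sg h x * sg h x = br h x := by
  have := Complex.cpow_nat_inv_pow (br h x) (n := 2) (by norm_num)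
  rw [sg, ← sq]
  convert this using 2
  norm_num

lemma br_inv (h x : ℂ) : br h x⁻¹ = -br h x := by
  simp only [br, inv_inv]; ring

@[simp] lemma br_one (h : ℂ) : br h 1 = 0 := by simp [br]

/-- The variable `x ^ 2 + x ^ (-2)`. -/
def yy (x : ℂ) : ℂ := x ^ 2 + (x ^ 2)⁻¹

lemma yy_inv (x : ℂ) : yy x⁻¹ = yy x := by
  simp only [yy, inv_pow, inv_inv]; ring

lemma yy_sub {h x y : ℂ} (hw : h ^ 2 - (h ^ 2)⁻¹ ≠ 0) (hx : x ≠ 0) (hy : y ≠ 0) :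
    yy x - yy y = (h ^ 2 - (h ^ 2)⁻¹) ^ 2 * (br h (x * y) * br h (x * y⁻¹)) := by
  have e : ∀ z, (h ^ 2 - (h ^ 2)⁻¹) * br h z = z - z⁻¹ := fun z => by
    rw [br, mul_div_cancel₀ _ hw]
  rw [sq, mul_mul_mul_comm, e, e, yy, yy]
  field_simp
  ring

/-- Additively: `[a][b] - [2][a+1][b] + [a+1][b+1] = [a-b+1]`. Only the difference survives, so when
`x` and `y` are moves of different columns the third move `z` disappears from the weight, apart from
a common factor. -/
lemma br_trilinear {h z y : ℂ} (hh : h ≠ 0) (_hw : h ^ 2 - (h ^ 2)⁻¹ ≠ 0) (hz : z ≠ 0)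
    (hy : y ≠ 0) :
    br h z * br h y - (h ^ 2 + (h ^ 2)⁻¹) * (br h (z * h ^ 2) * br h y)
      + br h (z * h ^ 2) * br h (y * h ^ 2) = br h (z * y⁻¹ * h ^ 2) := by
  simp only [br]
  rw [← sub_eq_zero]
  field_simp
  ring

/-- The recursion `[a] + [a+2] = [2][a+1]`, which kills the contribution of a move performed twice.
-/
lemma br_three {h z : ℂ} (hh : h ≠ 0) (hz : z ≠ 0) :
    br h z - (h ^ 2 + (h ^ 2)⁻¹) * br h (z * h ^ 2) + br h (z * h ^ 2 * h ^ 2) = 0 := by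
  simp only [br]
  rw [← mul_div_assoc, ← sub_div, ← add_div]
  rw [div_eq_zero_iff]; left
  field_simp
  ring

/-- Factor of a root for a move `a ↦ a q` in a row of even number, with a neighbour `B`. -/
def pe (h a B : ℂ) : ℂ := sg h (B * a * h) * sg h (B * a⁻¹ * h⁻¹)

/-- Factor of a root for a move `B ↦ B q ^ e` in a row of odd number, with a neighbour `a`. -/
def po (h : ℂ) (e : ℤ) (B a : ℂ) : ℂ :=
  Complex.I * (sg h (B * a * h ^ e) * sg h (B * a⁻¹ * h ^ e))

lemma po_inv (h : ℂ) (e : ℤ) (B a : ℂ) : po h e B a⁻¹ = po h e B a := by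
  simp only [po, inv_inv]; ring

lemma po_zpow (h : ℂ) (e d : ℤ) (hd : d = 1 ∨ d = -1) (B a : ℂ) :
    po h e B (a ^ d) = po h e B a := by
  rcases hd with rfl | rfl <;> simp [po_inv]

lemma pe_sq {h a B : ℂ} (hh : h ≠ 0) (hw : h ^ 2 - (h ^ 2)⁻¹ ≠ 0) (ha : a ≠ 0) (hB : B ≠ 0) :
    pe h a B * pe h a B = (yy B - yy (a * h)) / (h ^ 2 - (h ^ 2)⁻¹) ^ 2 := by
  rw [yy_sub hw hB (mul_ne_zero ha hh), mul_div_cancel_left₀ _ (pow_ne_zero _ hw)]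
  rw [← mul_assoc, mul_inv, ← mul_assoc, ← sg_mul_self, ← sg_mul_self, pe]
  ring

/-- The factor `I` in `po` pays for writing both roots with `B` in the numerator. Thanks to it both
parities have squares of the same shape, neighbour minus centre, which is what the interpolation
needs. -/
lemma po_sq {h a B : ℂ} {e : ℤ} (he : e = 1 ∨ e = -1) (hh : h ≠ 0)
    (hw : h ^ 2 - (h ^ 2)⁻¹ ≠ 0) (ha : a ≠ 0) (hB : B ≠ 0) :
    po h e B a * po h e B a = (yy a - yy (B ^ e * h)) / (h ^ 2 - (h ^ 2)⁻¹) ^ 2 := by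
  have h1 : po h e B a * po h e B a = -(br h (B * a * h ^ e) * br h (B * a⁻¹ * h ^ e)) := by
    rw [← sg_mul_self, ← sg_mul_self, po]
    linear_combination (sg h (B * a * h ^ e) * sg h (B * a⁻¹ * h ^ e)) ^ 2 * Complex.I_mul_I
  rw [h1]
  rcases he with rfl | rfl
  · rw [yy_sub hw ha (mul_ne_zero (zpow_ne_zero _ hB) hh), mul_div_cancel_left₀ _ (pow_ne_zero _ hw),
      show a * (B ^ (1 : ℤ) * h)⁻¹ = (B * a⁻¹ * h)⁻¹ by rw [zpow_one]; field_simp, br_inv,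
      show a * (B ^ (1 : ℤ) * h) = B * a * h by rw [zpow_one]; ring, zpow_one]
    ring
  · rw [yy_sub hw ha (mul_ne_zero (zpow_ne_zero _ hB) hh), mul_div_cancel_left₀ _ (pow_ne_zero _ hw),
      show a * (B ^ (-1 : ℤ) * h)⁻¹ = B * a * h⁻¹ by rw [zpow_neg, zpow_one]; field_simp,
      show a * (B ^ (-1 : ℤ) * h) = (B * a⁻¹ * h⁻¹)⁻¹ by rw [zpow_neg, zpow_one]; field_simp,
      br_inv, zpow_neg, zpow_one]
    ring

/-- A downward move of `a` is an upward move of `a⁻¹`; the return step thus uses literally the same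
roots, with no sign ambiguity. -/
lemma pe_back {h a B : ℂ} (hh : h ≠ 0) :
    pe h (a * h ^ 2)⁻¹ B = pe h a B := by
  simp only [pe]
  rw [mul_comm]
  congr 2 <;> field_simp

lemma po_back {h a B : ℂ} {e : ℤ} (he : e = 1 ∨ e = -1) (hh : h ≠ 0) :
    po h (-e) (B * h ^ (2 * e)) a = po h e B a := by
  simp only [po]
  rcases he with rfl | rfl <;> norm_num <;> congr 2 <;> field_simp

/-! ### Interaction of moves in adjacent rows -/

section pair

variable {h a B : ℂ}

/-- Each side is a product of four roots. In either order of the two moves one root occurs twice and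
becomes a bracket, and the other two are the same and form `G`. Changing the order therefore only
shifts the argument of a single bracket by one. -/
lemma pe_po_one (hh : h ≠ 0) (ha : a ≠ 0) (hB : B ≠ 0) {e : ℤ} (he : e = 1 ∨ e = -1) :
    ∃ G, pe h a (B * h ^ (2 * e)) * po h e B a = br h (a * (B ^ e * h)⁻¹) * G ∧
      pe h a B * po h e B (a * h ^ 2) = br h (a * (B ^ e * h)⁻¹ * h ^ 2) * G := by
  rcases he with rfl | rfl
  · refine ⟨-Complex.I * (sg h (B * a * h ^ 3) * sg h (B * a * h)), ?_, ?_⟩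
    · rw [show a * (B ^ (1 : ℤ) * h)⁻¹ = (B * a⁻¹ * h)⁻¹ by simp; ring, br_inv, ← sg_mul_self]
      simp only [pe, po]
      rw [show B * h ^ (2 * (1 : ℤ)) * a * h = B * a * h ^ 3 by norm_cast; ring,
        show B * h ^ (2 * (1 : ℤ)) * a⁻¹ * h⁻¹ = B * a⁻¹ * h by norm_cast; field_simp, zpow_one]
      ring
    · rw [show a * (B ^ (1 : ℤ) * h)⁻¹ * h ^ 2 = (B * a⁻¹ * h⁻¹)⁻¹ by rw [zpow_one]; field_simp, br_inv,
        ← sg_mul_self]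
      simp only [pe, po]
      rw [show B * (a * h ^ 2) * h ^ (1 : ℤ) = B * a * h ^ 3 by norm_cast; ring,
        show B * (a * h ^ 2)⁻¹ * h ^ (1 : ℤ) = B * a⁻¹ * h⁻¹ by norm_cast; field_simp]
      ring
  · refine ⟨Complex.I * (sg h (B * a⁻¹ * (h ^ 3)⁻¹) * sg h (B * a⁻¹ * h⁻¹)), ?_, ?_⟩
    · rw [show a * (B ^ (-1 : ℤ) * h)⁻¹ = B * a * h⁻¹ by simp; ring, ← sg_mul_self]
      simp only [pe, po]
      rw [show B * h ^ (2 * (-1 : ℤ)) * a * h = B * a * h⁻¹ by simp; field_simp,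
        show B * h ^ (2 * (-1 : ℤ)) * a⁻¹ * h⁻¹ = B * a⁻¹ * (h ^ 3)⁻¹ by
          simp; field_simp, zpow_neg, zpow_one]
      ring
    · rw [show a * (B ^ (-1 : ℤ) * h)⁻¹ * h ^ 2 = B * a * h by rw [zpow_neg, zpow_one]; field_simp, ← sg_mul_self]
      simp only [pe, po]
      rw [show B * (a * h ^ 2) * h ^ (-1 : ℤ) = B * a * h by simp; field_simp,
        show B * (a * h ^ 2)⁻¹ * h ^ (-1 : ℤ) = B * a⁻¹ * (h ^ 3)⁻¹ by simp; field_simp]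
      ring

/-- The same mechanism for two successive moves of `a`, with the move of `B` after, between or
before them: the weights are proportional to three consecutive brackets. -/
lemma pe_po_two (hh : h ≠ 0) (ha : a ≠ 0) (hB : B ≠ 0) {e : ℤ} (he : e = 1 ∨ e = -1) :
    ∃ G, pe h a (B * h ^ (2 * e)) * pe h (a * h ^ 2) (B * h ^ (2 * e)) * po h e B a
        = br h (a * (B ^ e * h)⁻¹) * G ∧
      pe h a B * pe h (a * h ^ 2) (B * h ^ (2 * e)) * po h e B (a * h ^ 2)
        = br h (a * (B ^ e * h)⁻¹ * h ^ 2) * G ∧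
      pe h a B * pe h (a * h ^ 2) B * po h e B (a * h ^ 2 * h ^ 2)
        = br h (a * (B ^ e * h)⁻¹ * h ^ 2 * h ^ 2) * G := by
  rcases he with rfl | rfl
  · have e1 : B * h ^ (2 * (1 : ℤ)) * (a * h ^ 2) * h = B * a * h ^ 5 := by norm_cast; ring
    have e2 : B * h ^ (2 * (1 : ℤ)) * (a * h ^ 2)⁻¹ * h⁻¹ = B * a⁻¹ * h⁻¹ := by
      norm_cast; field_simp
    have e3 : B * h ^ (2 * (1 : ℤ)) * a * h = B * a * h ^ 3 := by norm_cast; ring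
    have e4 : B * h ^ (2 * (1 : ℤ)) * a⁻¹ * h⁻¹ = B * a⁻¹ * h := by norm_cast; field_simp
    have e5 : B * (a * h ^ 2) * h = B * a * h ^ 3 := by ring
    have e6 : B * (a * h ^ 2)⁻¹ * h⁻¹ = B * a⁻¹ * (h ^ 3)⁻¹ := by field_simp
    have e7 : B * (a * h ^ 2)⁻¹ * h = B * a⁻¹ * h⁻¹ := by field_simp
    have e8 : B * (a * h ^ 2 * h ^ 2) * h = B * a * h ^ 5 := by ring
    have e9 : B * (a * h ^ 2 * h ^ 2)⁻¹ * h = B * a⁻¹ * (h ^ 3)⁻¹ := by field_simp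
    refine ⟨-Complex.I * (sg h (B * a * h ^ 3) * sg h (B * a * h) * sg h (B * a * h ^ 5) *
      sg h (B * a⁻¹ * h⁻¹)), ?_, ?_, ?_⟩
    · rw [show a * (B ^ (1 : ℤ) * h)⁻¹ = (B * a⁻¹ * h)⁻¹ by simp; ring, br_inv, ← sg_mul_self]
      simp only [pe, po, e1, e2, e3, e4, zpow_one]
      ring
    · rw [show a * (B ^ (1 : ℤ) * h)⁻¹ * h ^ 2 = (B * a⁻¹ * h⁻¹)⁻¹ by rw [zpow_one]; field_simp, br_inv,
        ← sg_mul_self]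
      simp only [pe, po, e1, e2, e5, e7, zpow_one]
      ring
    · rw [show a * (B ^ (1 : ℤ) * h)⁻¹ * h ^ 2 * h ^ 2 = (B * a⁻¹ * (h ^ 3)⁻¹)⁻¹ by
        rw [zpow_one]; field_simp, br_inv, ← sg_mul_self]
      simp only [pe, po, e5, e6, e8, e9, zpow_one]
      ring
  · have e1 : B * h ^ (2 * (-1 : ℤ)) * (a * h ^ 2) * h = B * a * h := by
      rw [show h ^ (2 * (-1 : ℤ)) = (h ^ 2)⁻¹ by norm_num]; field_simp
    have e2 : B * h ^ (2 * (-1 : ℤ)) * (a * h ^ 2)⁻¹ * h⁻¹ = B * a⁻¹ * (h ^ 5)⁻¹ := by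
      simp; field_simp
    have e3 : B * h ^ (2 * (-1 : ℤ)) * a * h = B * a * h⁻¹ := by simp; field_simp
    have e4 : B * h ^ (2 * (-1 : ℤ)) * a⁻¹ * h⁻¹ = B * a⁻¹ * (h ^ 3)⁻¹ := by
      simp; field_simp
    have e5 : B * (a * h ^ 2) * h ^ (-1 : ℤ) = B * a * h := by simp; field_simp
    have e6 : B * (a * h ^ 2)⁻¹ * h⁻¹ = B * a⁻¹ * (h ^ 3)⁻¹ := by field_simp
    have e7 : B * (a * h ^ 2)⁻¹ * h ^ (-1 : ℤ) = B * a⁻¹ * (h ^ 3)⁻¹ := by simp; field_simp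
    have e8 : B * (a * h ^ 2 * h ^ 2) * h ^ (-1 : ℤ) = B * a * h ^ 3 := by simp; field_simp
    have e9 : B * (a * h ^ 2 * h ^ 2)⁻¹ * h ^ (-1 : ℤ) = B * a⁻¹ * (h ^ 5)⁻¹ := by
      simp; field_simp
    have e10 : B * (a * h ^ 2) * h = B * a * h ^ 3 := by ring
    refine ⟨Complex.I * (sg h (B * a⁻¹ * (h ^ 3)⁻¹) * sg h (B * a⁻¹ * h⁻¹) * sg h (B * a * h) *
      sg h (B * a⁻¹ * (h ^ 5)⁻¹)), ?_, ?_, ?_⟩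
    · rw [show a * (B ^ (-1 : ℤ) * h)⁻¹ = B * a * h⁻¹ by simp; ring, ← sg_mul_self]
      simp only [pe, po, e1, e2, e3, e4, zpow_neg, zpow_one]
      ring
    · rw [show a * (B ^ (-1 : ℤ) * h)⁻¹ * h ^ 2 = B * a * h by rw [zpow_neg, zpow_one]; field_simp, ← sg_mul_self]
      simp only [pe, po, e1, e2, e5, e7]
      ring
    · rw [show a * (B ^ (-1 : ℤ) * h)⁻¹ * h ^ 2 * h ^ 2 = B * a * h ^ 3 by simp; field_simp,
        ← sg_mul_self]
      simp only [pe, po, e6, e8, e9, e10]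
      ring

/-- Here `a` goes up and returns. On each of the three paths the roots pair off after one copy of
`po h e B a` is set aside, and what remains is the rational identity `key2`, in which `B` drops out.
-/
lemma pe_po_loop (hh : h ≠ 0) (hw : h ^ 2 - (h ^ 2)⁻¹ ≠ 0) (ha : a ≠ 0) (hB : B ≠ 0)
    {e : ℤ} (he : e = 1 ∨ e = -1) :
    pe h a (B * h ^ (2 * e)) * pe h a (B * h ^ (2 * e)) * po h e B a
      - (h ^ 2 + (h ^ 2)⁻¹) * (pe h a B * pe h a (B * h ^ (2 * e)) * po h e B (a * h ^ 2))
      + pe h a B * pe h a B * po h e B a = br h (a ^ 2 * h ^ 4) * po h e B a := by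
  have hw4 : h ^ 4 - 1 ≠ 0 := fun h0 => hw (by field_simp; linear_combination h0)
  rcases he with rfl | rfl
  · have e3 : B * h ^ (2 * (1 : ℤ)) * a * h = B * a * h ^ 3 := by norm_cast; ring
    have e4 : B * h ^ (2 * (1 : ℤ)) * a⁻¹ * h⁻¹ = B * a⁻¹ * h := by norm_cast; field_simp
    have e5 : B * (a * h ^ 2) * h = B * a * h ^ 3 := by ring
    have e7 : B * (a * h ^ 2)⁻¹ * h = B * a⁻¹ * h⁻¹ := by field_simp
    have key2 : br h (B * a * h ^ 3) * br h (B * a⁻¹ * h) - (h ^ 2 + (h ^ 2)⁻¹) *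
        (br h (B * a⁻¹ * h⁻¹) * br h (B * a * h ^ 3)) + br h (B * a * h) * br h (B * a⁻¹ * h⁻¹)
        = br h (a ^ 2 * h ^ 4) := by
      have e : ∀ z, br h z = (z - z⁻¹) * h ^ 2 / (h ^ 4 - 1) := fun z => by
        rw [br, div_eq_div_iff hw hw4]
        field_simp
      simp only [e]
      rw [← sub_eq_zero]
      field_simp
      ring
    rw [← key2]
    simp only [← sg_mul_self, pe, po, e3, e4, e5, e7, zpow_one]
    ring
  · have e3 : B * h ^ (2 * (-1 : ℤ)) * a * h = B * a * h⁻¹ := by simp; field_simp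
    have e4 : B * h ^ (2 * (-1 : ℤ)) * a⁻¹ * h⁻¹ = B * a⁻¹ * (h ^ 3)⁻¹ := by
      simp; field_simp
    have e5 : B * (a * h ^ 2) * h⁻¹ = B * a * h := by field_simp
    have e7 : B * (a * h ^ 2)⁻¹ * h⁻¹ = B * a⁻¹ * (h ^ 3)⁻¹ := by field_simp
    have key2 : br h (B * a * h⁻¹) * br h (B * a⁻¹ * (h ^ 3)⁻¹) - (h ^ 2 + (h ^ 2)⁻¹) *
        (br h (B * a⁻¹ * (h ^ 3)⁻¹) * br h (B * a * h)) + br h (B * a * h) * br h (B * a⁻¹ * h⁻¹)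
        = br h (a ^ 2 * h ^ 4) := by
      have e : ∀ z, br h z = (z - z⁻¹) * h ^ 2 / (h ^ 4 - 1) := fun z => by
        rw [br, div_eq_div_iff hw hw4]
        field_simp
      simp only [e]
      rw [← sub_eq_zero]
      field_simp
      ring
    rw [← key2]
    simp only [← sg_mul_self, pe, po, e3, e4, e5, e7, zpow_neg, zpow_one]
    ring

lemma po_pe_one (hh : h ≠ 0) (ha : a ≠ 0) (hB : B ≠ 0) {e : ℤ} (he : e = 1 ∨ e = -1) :
    ∃ G, po h e B (a * h ^ 2) * pe h a B = br h (B ^ e * (a * h)⁻¹) * G ∧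
      po h e B a * pe h a (B * h ^ (2 * e)) = br h (B ^ e * (a * h)⁻¹ * h ^ 2) * G := by
  obtain ⟨G, h1, h2⟩ := pe_po_one hh ha hB he
  have hB' : B ^ e ≠ 0 := zpow_ne_zero _ hB
  refine ⟨-G, ?_, ?_⟩
  · rw [mul_comm, h2, show B ^ e * (a * h)⁻¹ = (a * (B ^ e * h)⁻¹ * h ^ 2)⁻¹ by field_simp, br_inv]
    ring
  · rw [mul_comm, h1, show B ^ e * (a * h)⁻¹ * h ^ 2 = (a * (B ^ e * h)⁻¹)⁻¹ by field_simp, br_inv]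
    ring

lemma po_pe_two (hh : h ≠ 0) (ha : a ≠ 0) (hB : B ≠ 0) {e : ℤ} (he : e = 1 ∨ e = -1) :
    ∃ G, po h e B (a * h ^ 2) * po h e (B * h ^ (2 * e)) (a * h ^ 2) * pe h a B
        = br h (B ^ e * (a * h)⁻¹) * G ∧
      po h e B a * po h e (B * h ^ (2 * e)) (a * h ^ 2) * pe h a (B * h ^ (2 * e))
        = br h (B ^ e * (a * h)⁻¹ * h ^ 2) * G ∧
      po h e B a * po h e (B * h ^ (2 * e)) a * pe h a (B * h ^ (2 * e) * h ^ (2 * e))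
        = br h (B ^ e * (a * h)⁻¹ * h ^ 2 * h ^ 2) * G := by
  rcases he with rfl | rfl
  · have e1 : B * (a * h ^ 2) * h = B * a * h ^ 3 := by ring
    have e2 : B * (a * h ^ 2)⁻¹ * h = B * a⁻¹ * h⁻¹ := by field_simp
    have e3 : B * h ^ (2 * (1 : ℤ)) * (a * h ^ 2) * h = B * a * h ^ 5 := by norm_cast; ring
    have e4 : B * h ^ (2 * (1 : ℤ)) * (a * h ^ 2)⁻¹ * h = B * a⁻¹ * h := by norm_cast; field_simp
    have e5 : B * h ^ (2 * (1 : ℤ)) * a * h = B * a * h ^ 3 := by norm_cast; ring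
    have e6 : B * h ^ (2 * (1 : ℤ)) * a⁻¹ * h⁻¹ = B * a⁻¹ * h := by norm_cast; field_simp
    have e7 : B * h ^ (2 * (1 : ℤ)) * a⁻¹ * h = B * a⁻¹ * h ^ 3 := by norm_cast; field_simp
    have e8 : B * h ^ (2 * (1 : ℤ)) * h ^ (2 * (1 : ℤ)) * a * h = B * a * h ^ 5 := by
      norm_cast; ring
    have e9 : B * h ^ (2 * (1 : ℤ)) * h ^ (2 * (1 : ℤ)) * a⁻¹ * h⁻¹ = B * a⁻¹ * h ^ 3 := by
      simp only [mul_one]; norm_cast; field_simp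
    refine ⟨-(sg h (B * a * h ^ 3) * sg h (B * a * h) * sg h (B * a * h ^ 5) *
      sg h (B * a⁻¹ * h)), ?_, ?_, ?_⟩
    · rw [show B ^ (1 : ℤ) * (a * h)⁻¹ = B * a⁻¹ * h⁻¹ by rw [zpow_one]; field_simp, ← sg_mul_self]
      simp only [pe, po, zpow_one, e1, e2, e3, e4]
      linear_combination (sg h (B * a⁻¹ * h⁻¹)) ^ 2 * (sg h (B * a * h ^ 3) * sg h (B * a * h) *
        sg h (B * a * h ^ 5) * sg h (B * a⁻¹ * h)) * Complex.I_mul_I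
    · rw [show B ^ (1 : ℤ) * (a * h)⁻¹ * h ^ 2 = B * a⁻¹ * h by rw [zpow_one]; field_simp,
        ← sg_mul_self]
      simp only [pe, po, zpow_one, e3, e4, e5, e6]
      linear_combination (sg h (B * a⁻¹ * h)) ^ 2 * (sg h (B * a * h ^ 3) * sg h (B * a * h) *
        sg h (B * a * h ^ 5) * sg h (B * a⁻¹ * h)) * Complex.I_mul_I
    · rw [show B ^ (1 : ℤ) * (a * h)⁻¹ * h ^ 2 * h ^ 2 = B * a⁻¹ * h ^ 3 by
        rw [zpow_one]; field_simp, ← sg_mul_self]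
      simp only [pe, po, zpow_one, e5, e7, e8, e9]
      linear_combination (sg h (B * a⁻¹ * h ^ 3)) ^ 2 * (sg h (B * a * h ^ 3) * sg h (B * a * h) *
        sg h (B * a * h ^ 5) * sg h (B * a⁻¹ * h)) * Complex.I_mul_I
  · have e1 : B * (a * h ^ 2) * h⁻¹ = B * a * h := by field_simp
    have e2 : B * (a * h ^ 2)⁻¹ * h⁻¹ = B * a⁻¹ * (h ^ 3)⁻¹ := by field_simp
    have e0 : h ^ (2 * (-1 : ℤ)) = (h ^ 2)⁻¹ := by norm_num
    have e3 : B * (h ^ 2)⁻¹ * (a * h ^ 2) * h⁻¹ = B * a * h⁻¹ := by field_simp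
    have e4 : B * (h ^ 2)⁻¹ * (a * h ^ 2)⁻¹ * h⁻¹ = B * a⁻¹ * (h ^ 5)⁻¹ := by field_simp
    have e5 : B * (h ^ 2)⁻¹ * a * h = B * a * h⁻¹ := by field_simp
    have e6 : B * (h ^ 2)⁻¹ * a⁻¹ * h⁻¹ = B * a⁻¹ * (h ^ 3)⁻¹ := by field_simp
    have e7 : B * (h ^ 2)⁻¹ * a * h⁻¹ = B * a * (h ^ 3)⁻¹ := by field_simp
    have e8 : B * (h ^ 2)⁻¹ * (h ^ 2)⁻¹ * a * h = B * a * (h ^ 3)⁻¹ := by field_simp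
    have e9 : B * (h ^ 2)⁻¹ * (h ^ 2)⁻¹ * a⁻¹ * h⁻¹ = B * a⁻¹ * (h ^ 5)⁻¹ := by field_simp
    refine ⟨sg h (B * a⁻¹ * (h ^ 3)⁻¹) * sg h (B * a * h⁻¹) * sg h (B * a⁻¹ * (h ^ 5)⁻¹) *
      sg h (B * a⁻¹ * h⁻¹), ?_, ?_, ?_⟩
    · rw [show B ^ (-1 : ℤ) * (a * h)⁻¹ = (B * a * h)⁻¹ by
        rw [zpow_neg, zpow_one]; field_simp, br_inv, ← sg_mul_self]
      simp only [pe, po, zpow_neg, zpow_one, e0, e1, e2, e3, e4]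
      linear_combination (sg h (B * a * h)) ^ 2 * (sg h (B * a⁻¹ * (h ^ 3)⁻¹) *
        sg h (B * a * h⁻¹) * sg h (B * a⁻¹ * (h ^ 5)⁻¹) * sg h (B * a⁻¹ * h⁻¹)) * Complex.I_mul_I
    · rw [show B ^ (-1 : ℤ) * (a * h)⁻¹ * h ^ 2 = (B * a * h⁻¹)⁻¹ by
        rw [zpow_neg, zpow_one]; field_simp, br_inv, ← sg_mul_self]
      simp only [pe, po, zpow_neg, zpow_one, e0, e3, e4, e5, e6]
      linear_combination (sg h (B * a * h⁻¹)) ^ 2 * (sg h (B * a⁻¹ * (h ^ 3)⁻¹) *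
        sg h (B * a * h⁻¹) * sg h (B * a⁻¹ * (h ^ 5)⁻¹) * sg h (B * a⁻¹ * h⁻¹)) * Complex.I_mul_I
    · rw [show B ^ (-1 : ℤ) * (a * h)⁻¹ * h ^ 2 * h ^ 2 = (B * a * (h ^ 3)⁻¹)⁻¹ by
        rw [zpow_neg, zpow_one]; field_simp, br_inv, ← sg_mul_self]
      simp only [pe, po, zpow_neg, zpow_one, e0, e6, e7, e8, e9]
      linear_combination (sg h (B * a * (h ^ 3)⁻¹)) ^ 2 * (sg h (B * a⁻¹ * (h ^ 3)⁻¹) *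
        sg h (B * a * h⁻¹) * sg h (B * a⁻¹ * (h ^ 5)⁻¹) * sg h (B * a⁻¹ * h⁻¹)) * Complex.I_mul_I

lemma po_pe_loop (hh : h ≠ 0) (hw : h ^ 2 - (h ^ 2)⁻¹ ≠ 0) (ha : a ≠ 0) (hB : B ≠ 0)
    {e : ℤ} (he : e = 1 ∨ e = -1) :
    po h e B (a * h ^ 2) * po h e B (a * h ^ 2) * pe h a B
      - (h ^ 2 + (h ^ 2)⁻¹) * (po h e B a * po h e B (a * h ^ 2) * pe h a (B * h ^ (2 * e)))
      + po h e B a * po h e B a * pe h a B = br h ((B ^ e) ^ 2 * h ^ 4) * pe h a B := by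
  have hw4 : h ^ 4 - 1 ≠ 0 := fun h0 => hw (by field_simp; linear_combination h0)
  have e' : ∀ z, br h z = (z - z⁻¹) * h ^ 2 / (h ^ 4 - 1) := fun z => by
    rw [br, div_eq_div_iff hw hw4]
    field_simp
  rcases he with rfl | rfl
  · have e1 : B * (a * h ^ 2) * h = B * a * h ^ 3 := by ring
    have e2 : B * (a * h ^ 2)⁻¹ * h = B * a⁻¹ * h⁻¹ := by field_simp
    have e5 : B * h ^ (2 * (1 : ℤ)) * a * h = B * a * h ^ 3 := by norm_cast; ring
    have e6 : B * h ^ (2 * (1 : ℤ)) * a⁻¹ * h⁻¹ = B * a⁻¹ * h := by norm_cast; field_simp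
    have key : br h (B * a * h ^ 3) * br h (B * a⁻¹ * h⁻¹) - (h ^ 2 + (h ^ 2)⁻¹) *
        (br h (B * a⁻¹ * h) * br h (B * a * h ^ 3)) + br h (B * a * h) * br h (B * a⁻¹ * h)
        = -br h ((B ^ (1 : ℤ)) ^ 2 * h ^ 4) := by
      simp only [e', zpow_one]
      rw [← sub_eq_zero]
      field_simp
      ring
    rw [← neg_eq_iff_eq_neg] at key
    rw [← key]
    simp only [← sg_mul_self, pe, po, zpow_one, e1, e2, e5, e6]
    ring_nf
    rw [Complex.I_sq]
    ring
  · have e0 : h ^ (2 * (-1 : ℤ)) = (h ^ 2)⁻¹ := by norm_num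
    have e1 : B * (a * h ^ 2) * h⁻¹ = B * a * h := by field_simp
    have e2 : B * (a * h ^ 2)⁻¹ * h⁻¹ = B * a⁻¹ * (h ^ 3)⁻¹ := by field_simp
    have e5 : B * (h ^ 2)⁻¹ * a * h = B * a * h⁻¹ := by field_simp
    have e6 : B * (h ^ 2)⁻¹ * a⁻¹ * h⁻¹ = B * a⁻¹ * (h ^ 3)⁻¹ := by field_simp
    have key : br h (B * a * h) * br h (B * a⁻¹ * (h ^ 3)⁻¹) - (h ^ 2 + (h ^ 2)⁻¹) *
        (br h (B * a * h⁻¹) * br h (B * a⁻¹ * (h ^ 3)⁻¹)) + br h (B * a * h⁻¹) * br h (B * a⁻¹ * h⁻¹)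
        = -br h ((B ^ (-1 : ℤ)) ^ 2 * h ^ 4) := by
      simp only [e', zpow_neg, zpow_one]
      rw [← sub_eq_zero]
      field_simp
      ring
    rw [← neg_eq_iff_eq_neg] at key
    rw [← key]
    simp only [← sg_mul_self, pe, po, zpow_neg, zpow_one, e0, e1, e2, e5, e6]
    ring_nf
    rw [Complex.I_sq]
    ring

end pair

/-! ### Lagrange interpolation with cancellation -/

/-- The leading coefficient of an interpolated polynomial, in a form that tolerates repeated nodes.
The nodes in `S` are matched injectively with zeros of the numerator; deleting each matched node
together with its zero leaves an ordinary Lagrange sum over distinct nodes. -/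
lemma sum_prod_div_prod {ι κ : Type*} [DecidableEq ι] [DecidableEq κ] {s S : Finset ι}
    {F : Finset κ} {v : ι → ℂ} {u : κ → ℂ} {φ : ι → κ} (hS : S ⊆ s)
    (hφ : ∀ x ∈ S, φ x ∈ F ∧ u (φ x) = v x) (hφi : Set.InjOn φ S)
    (hv : Set.InjOn v (s \ S : Finset ι)) (hd : ∀ i ∈ s \ S, ∀ j ∈ S, v i ≠ v j)
    (hc : #s = #F + 1) :
    ∑ i ∈ s, (∏ f ∈ F, (u f - v i)) / ∏ j ∈ s.erase i, (v i - v j) = (-1) ^ #F := by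
  classical
  have hI : S.image φ ⊆ F := by
    intro f hf
    obtain ⟨x, hx, rfl⟩ := mem_image.1 hf
    exact (hφ x hx).1
  have hSF : #S ≤ #F := by
    rw [← card_image_of_injOn hφi]; exact card_le_card hI
  have hcard : #(s \ S) = #(F \ S.image φ) + 1 := by
    rw [card_sdiff_of_subset hS, card_sdiff_of_subset hI, card_image_of_injOn hφi]; omega
  -- The numerator without the factors matched with `S`; its degree is one less than the number of
  -- remaining nodes.
  set N : Polynomial ℂ := ∏ f ∈ F \ S.image φ, (Polynomial.C (u f) - Polynomial.X) with hN
  have hN' : N = Polynomial.C ((-1) ^ #(F \ S.image φ)) *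
      ∏ f ∈ F \ S.image φ, (Polynomial.X - Polynomial.C (u f)) := by
    rw [hN, Polynomial.C_pow, ← prod_const, ← prod_mul_distrib]
    refine prod_congr rfl fun f _ => ?_
    simp
  have hmon : (∏ f ∈ F \ S.image φ, (Polynomial.X - Polynomial.C (u f))).Monic :=
    Polynomial.monic_prod_X_sub_C _ _
  have hne : ((-1 : ℂ) ^ #(F \ S.image φ)) ≠ 0 := pow_ne_zero _ (by norm_num)
  have hdeg : N.degree = #(F \ S.image φ) := by
    rw [hN', Polynomial.degree_C_mul hne, Polynomial.degree_prod]
    simp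
  have hlead : N.leadingCoeff = (-1) ^ #(F \ S.image φ) := by
    rw [hN', Polynomial.leadingCoeff_mul, hmon.leadingCoeff, Polynomial.leadingCoeff_C, mul_one]
  have key := Lagrange.leadingCoeff_eq_sum hv (P := N) (by rw [hcard, hdeg]; rfl)
  rw [hlead] at key
  -- The numerator vanishes at matched nodes, so these terms are zero even where the denominator
  -- vanishes too.
  have h0 : ∑ i ∈ S, (∏ f ∈ F, (u f - v i)) / ∏ j ∈ s.erase i, (v i - v j) = 0 := by
    refine sum_eq_zero fun i hi => ?_
    rw [prod_eq_zero (hφ i hi).1 (by rw [(hφ i hi).2, sub_self]), zero_div]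
  rw [← sum_sdiff hS, h0, add_zero]
  have h1 : ∀ i ∈ s \ S, (∏ f ∈ F, (u f - v i)) / ∏ j ∈ s.erase i, (v i - v j)
      = (-1) ^ #S * (N.eval (v i) / ∏ j ∈ (s \ S).erase i, (v i - v j)) := by
    intro i hi
    have hP : ∏ j ∈ S, (v i - v j) ≠ 0 := prod_ne_zero_iff.2 fun j hj => sub_ne_zero.2 (hd i hi j hj)
    have e1 : ∏ f ∈ F, (u f - v i) = N.eval (v i) * ((-1) ^ #S * ∏ j ∈ S, (v i - v j)) := by
      rw [← prod_sdiff hI, prod_image hφi, hN, Polynomial.eval_prod]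
      congr 1
      · exact prod_congr rfl fun f _ => by simp
      · rw [← prod_const, ← prod_mul_distrib]
        exact prod_congr rfl fun j hj => by rw [(hφ j hj).2]; ring
    have e2 : ∏ j ∈ s.erase i, (v i - v j)
        = (∏ j ∈ (s \ S).erase i, (v i - v j)) * ∏ j ∈ S, (v i - v j) := by
      have : s.erase i \ S = (s \ S).erase i := by ext; simp; tauto
      rw [← this, prod_sdiff]
      intro j hj
      refine mem_erase.2 ⟨fun h => ?_, hS hj⟩
      exact (mem_sdiff.1 hi).2 (h ▸ hj)
    rw [e1, e2, ← mul_assoc, mul_div_mul_right _ _ hP, mul_comm (N.eval _), mul_div_assoc]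
  rw [sum_congr rfl h1, ← mul_sum, ← key, ← pow_add]
  congr 1
  rw [card_sdiff_of_subset hI, card_image_of_injOn hφi]; omega

/-! ### Arrays of multiplicative coordinates, moves and coefficients -/

/-- Column indices of the row `r`. -/
abbrev cols (r : ℕ) : Finset ℕ := Icc 1 (r / 2)

/-- The positions in the rows adjacent to the row `r`. -/
def nb (r : ℕ) : Finset (ℕ × ℕ) := cols (r + 1) ×ˢ {r + 1} ∪ cols (r - 1) ×ˢ {r - 1}

/-- The moves of the row `r`: a column and a sign, and the trivial move `(0, 0)` if `r` is odd. -/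
def moves (r : ℕ) : Finset (ℕ × ℤ) := cols r ×ˢ {1, -1} ∪ if Even r then ∅ else {(0, 0)}

/-- The effect of a move on an array. -/
def mv (h : ℂ) (X : ℕ → ℕ → ℂ) (r : ℕ) (x : ℕ × ℤ) : ℕ → ℕ → ℂ :=
  fun a s => if a = x.1 ∧ s = r then X a s * h ^ (2 * x.2) else X a s

/-- The factor of a root for a move in the row `r`. -/
def prr (h : ℂ) (r : ℕ) (e : ℤ) (A B : ℂ) : ℂ := if Even r then pe h (A ^ e) B else po h e A B

/-- The factor of the denominator of a root that comes from a pair of columns. -/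
def nn (h : ℂ) (X : ℕ → ℕ → ℂ) (r a b : ℕ) : ℂ :=
  sg h (X a r * X b r) * sg h (X (min a b) r * (X (max a b) r)⁻¹)

/-- The denominator of a root. -/
def dd (h : ℂ) (X : ℕ → ℕ → ℂ) (r : ℕ) (x : ℕ × ℤ) : ℂ :=
  ∏ b ∈ (cols r).erase x.1, (nn h X r x.1 b * nn h (mv h X r x) r x.1 b)

/-- The denominators in the formulas for the operators. -/
def den (h : ℂ) (r : ℕ) (e : ℤ) (A : ℂ) : ℂ :=
  if Even r then A + A⁻¹ else br h (A ^ 2) * br h (A * h ^ e)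

/-- The coefficient of a move, without the factor that comes from the position `p`. -/
def kk (h : ℂ) (c : ℕ → ℕ → ℂ) (X : ℕ → ℕ → ℂ) (r : ℕ) (p : ℕ × ℕ) (x : ℕ × ℤ) : ℂ :=
  if x.2 = 0 then
    Complex.I * (∏ f ∈ (nb r).erase p, br h (X f.1 f.2)) /
      ∏ b ∈ cols r, (br h (X b r * h) * br h (X b r * h⁻¹))
  else
    x.2 * c x.1 r ^ x.2 * (∏ f ∈ (nb r).erase p, prr h r x.2 (X x.1 r) (X f.1 f.2)) /
      (dd h X r x * den h r x.2 (X x.1 r))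

/-- The coefficient of a move in the operator attached to the row `r`. -/
def coef (h : ℂ) (c : ℕ → ℕ → ℂ) (X : ℕ → ℕ → ℂ) (r : ℕ) (x : ℕ × ℤ) : ℂ :=
  if x.2 = 0 then
    Complex.I * (∏ f ∈ nb r, br h (X f.1 f.2)) /
      ∏ b ∈ cols r, (br h (X b r * h) * br h (X b r * h⁻¹))
  else
    x.2 * c x.1 r ^ x.2 * (∏ f ∈ nb r, prr h r x.2 (X x.1 r) (X f.1 f.2)) /
      (dd h X r x * den h r x.2 (X x.1 r))

/-- The factor of the coefficient of the move `x` that comes from a neighbour `B` moved by `z`. -/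
def pp (h : ℂ) (r : ℕ) (z x : ℕ × ℤ) (A B : ℂ) : ℂ :=
  if z.2 = 0 then 1 else if x.2 = 0 then br h B else prr h r x.2 A B

/-- The factor of the coefficient of the move `z` of `B` that comes from a neighbour `A`. -/
def hf (h : ℂ) (r' : ℕ) (z : ℕ × ℤ) (B A : ℂ) : ℂ :=
  if z.2 = 0 then br h A else prr h r' z.2 B A

/-- The part of the coefficient of `z` that depends on the row `r`. -/
def ff (h : ℂ) (r r' : ℕ) (z : ℕ × ℤ) (X : ℕ → ℕ → ℂ) : ℂ :=
  ∏ a ∈ cols r, hf h r' z (X z.1 r') (X a r)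

/-- The part of the coefficient of `z` that does not depend on the row `r`. -/
def qq (h : ℂ) (c : ℕ → ℕ → ℂ) (r r' : ℕ) (z : ℕ × ℤ) (X : ℕ → ℕ → ℂ) : ℂ :=
  if z.2 = 0 then
    Complex.I * (∏ f ∈ (nb r').filter (fun f => f.2 ≠ r), br h (X f.1 f.2)) /
      ∏ b ∈ cols r', (br h (X b r' * h) * br h (X b r' * h⁻¹))
  else
    z.2 * c z.1 r' ^ z.2 *
      (∏ f ∈ (nb r').filter (fun f => f.2 ≠ r), prr h r' z.2 (X z.1 r') (X f.1 f.2)) /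
      (dd h X r' z * den h r' z.2 (X z.1 r'))

/-- Adjacent rows. -/
def Adj (r r' : ℕ) : Prop := 1 ≤ r ∧ 1 ≤ r' ∧ (r' = r + 1 ∨ r = r' + 1)

lemma Adj.symm {r r' : ℕ} (h : Adj r r') : Adj r' r := ⟨h.2.1, h.1, h.2.2.symm⟩

lemma Adj.ne {r r' : ℕ} (h : Adj r r') : r ≠ r' := by
  obtain ⟨h1, h2, h3 | h3⟩ := h <;> omega

lemma Adj.even {r r' : ℕ} (h : Adj r r') : Even r' ↔ ¬ Even r := by
  rw [Nat.even_iff, Nat.even_iff]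
  obtain ⟨h1, h2, h3 | h3⟩ := h <;> omega

lemma mem_nb {r : ℕ} {f : ℕ × ℕ} :
    f ∈ nb r ↔ (1 ≤ f.1 ∧ f.1 ≤ (r + 1) / 2 ∧ f.2 = r + 1) ∨
      (1 ≤ f.1 ∧ f.1 ≤ (r - 1) / 2 ∧ f.2 = r - 1) := by
  simp only [nb, mem_union, mem_product, mem_Icc, mem_singleton, and_assoc]

lemma Adj.mem_nb {r r' : ℕ} (h : Adj r r') {a : ℕ} : (a, r') ∈ nb r ↔ a ∈ cols r' := by
  rw [NonstdSo.mem_nb, mem_Icc]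
  obtain ⟨h1, h2, h3 | h3⟩ := h <;> subst h3 <;> simp <;> omega

lemma mem_moves {r : ℕ} {x : ℕ × ℤ} :
    x ∈ moves r ↔ (x.1 ∈ cols r ∧ (x.2 = 1 ∨ x.2 = -1)) ∨ (¬ Even r ∧ x = (0, 0)) := by
  rw [moves, mem_union, mem_product]
  split_ifs with h <;> simp [h]

lemma snd_ne_of_mem_nb {r : ℕ} (hr : 1 ≤ r) {f : ℕ × ℕ} (hf : f ∈ nb r) : f.2 ≠ r := by
  rw [mem_nb] at hf; omega

lemma prod_nb_filter {r r' : ℕ} (h : Adj r r') (F : ℕ × ℕ → ℂ) :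
    ∏ f ∈ nb r', F f = (∏ a ∈ cols r, F (a, r)) * ∏ f ∈ (nb r').filter (fun f => f.2 ≠ r), F f := by
  rw [← prod_filter_mul_prod_filter_not (nb r') (fun f => f.2 = r)]
  congr 1
  have : (nb r').filter (fun f => f.2 = r) = (cols r).map ⟨fun a => (a, r), fun a b h => by
      simpa using h⟩ := by
    ext ⟨a, s⟩
    rw [mem_filter, mem_map]
    constructor
    · rintro ⟨h1, rfl⟩
      exact ⟨a, h.symm.mem_nb.1 h1, rfl⟩
    · rintro ⟨b, hb, h1⟩
      obtain ⟨rfl, rfl⟩ := Prod.mk.inj h1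
      exact ⟨h.symm.mem_nb.2 hb, rfl⟩
  rw [this, prod_map]
  rfl

section

variable {h : ℂ} {c : ℕ → ℕ → ℂ} {X : ℕ → ℕ → ℂ} {r r' : ℕ} {x y z : ℕ × ℤ}

lemma mv_self (a : ℕ) (e : ℤ) : mv h X r (a, e) a r = X a r * h ^ (2 * e) := by simp [mv]

lemma mv_self' : mv h X r x x.1 r = X x.1 r * h ^ (2 * x.2) := by simp [mv]

lemma mv_row {a s : ℕ} (hs : s ≠ r) : mv h X r x a s = X a s := by simp [mv, hs]

lemma mv_col {a s : ℕ} (ha : a ≠ x.1) : mv h X r x a s = X a s := by simp [mv, ha]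

lemma mv_zero {a : ℕ} : mv h X r (a, 0) = X := by
  funext b s; simp [mv]

lemma mv_comm (r r' : ℕ) (x z : ℕ × ℤ) : mv h (mv h X r x) r' z = mv h (mv h X r' z) r x := by
  funext a s
  simp only [mv]
  split_ifs <;> ring

lemma mv_neg (hh : h ≠ 0) (a : ℕ) (e : ℤ) : mv h (mv h X r (a, e)) r (a, -e) = X := by
  funext b s
  simp only [mv]
  split_ifs
  · rw [mul_assoc, ← zpow_add₀ hh]; simp
  · rfl

/-- Together with `coef_eq_qq`, `kk_mv` and `qq_mv` this separates the interaction of `x` with `z`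
from the rest: `kk` ignores the move `z`, and `qq` ignores the row `r`. -/
lemma coef_eq_kk (hA : Adj r r') (hz : z ∈ moves r') :
    coef h c X r x = pp h r z x (X x.1 r) (X z.1 r') * kk h c X r (z.1, r') x := by
  rw [mem_moves] at hz
  by_cases hz0 : z.2 = 0
  · have hz' : z = (0, 0) := by
      rcases hz with ⟨_, h | h⟩ | h
      · omega
      · omega
      · exact h.2
    have hn : (z.1, r') ∉ nb r := by
      rw [hA.mem_nb, hz']; simp
    simp only [coef, kk, pp, erase_eq_of_notMem hn, hz0, if_true, one_mul]
  · have hn : (z.1, r') ∈ nb r := by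
      rw [hA.mem_nb]
      rcases hz with h | h
      · exact h.1
      · exact absurd (by rw [h.2]) hz0
    simp only [coef, kk, pp, hz0, if_false]
    split_ifs
    · rw [← mul_prod_erase _ _ hn]; ring
    · rw [← mul_prod_erase _ _ hn]; ring

lemma coef_eq_qq (hA : Adj r r') :
    coef h c X r' z = qq h c r r' z X * ff h r r' z X := by
  simp only [coef, qq, ff, hf]
  split_ifs
  · rw [prod_nb_filter hA]; ring
  · rw [prod_nb_filter hA]; ring

lemma dd_congr {Y : ℕ → ℕ → ℂ} (hY : ∀ a, Y a r = X a r) : dd h Y r x = dd h X r x := by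
  simp only [dd, nn, mv, hY]

lemma kk_mv (hA : Adj r r') : kk h c (mv h X r' z) r (z.1, r') x = kk h c X r (z.1, r') x := by
  have h1 : ∀ a, mv h X r' z a r = X a r := fun a => mv_row hA.ne
  have h2 : ∀ f ∈ (nb r).erase (z.1, r'), mv h X r' z f.1 f.2 = X f.1 f.2 := by
    intro f hf
    simp only [mv]
    rw [if_neg]
    rintro ⟨h3, h4⟩
    exact (mem_erase.1 hf).1 (Prod.ext h3 h4)
  simp only [kk, h1, dd_congr h1]
  split_ifs
  · rw [prod_congr rfl fun f hf => by rw [h2 f hf]]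
  · rw [prod_congr rfl fun f hf => by rw [h2 f hf]]

lemma qq_mv (hA : Adj r r') : qq h c r r' z (mv h X r x) = qq h c r r' z X := by
  have h1 : ∀ a, mv h X r x a r' = X a r' := fun a => mv_row hA.symm.ne
  have h2 : ∀ f ∈ (nb r').filter (fun f => f.2 ≠ r), mv h X r x f.1 f.2 = X f.1 f.2 :=
    fun f hf => mv_row (mem_filter.1 hf).2
  simp only [qq, h1, dd_congr h1]
  split_ifs
  · rw [prod_congr rfl fun f hf => by rw [h2 f hf]]
  · rw [prod_congr rfl fun f hf => by rw [h2 f hf]]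

/-- The contribution of the moves `z` of the row `r'` and `x`, `y` of the row `r` to the trilinear
expression. -/
def ww (h : ℂ) (c : ℕ → ℕ → ℂ) (X : ℕ → ℕ → ℂ) (r r' : ℕ) (z x y : ℕ × ℤ) : ℂ :=
  coef h c X r' z * coef h c (mv h X r' z) r x * coef h c (mv h (mv h X r' z) r x) r y
    - (h ^ 2 + (h ^ 2)⁻¹) *
      (coef h c X r x * coef h c (mv h X r x) r' z * coef h c (mv h (mv h X r x) r' z) r y)
    + coef h c X r x * coef h c (mv h X r x) r y * coef h c (mv h (mv h X r x) r y) r' z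

/-- The essential factor of `ww`. -/
def tt (h : ℂ) (X : ℕ → ℕ → ℂ) (r r' : ℕ) (z x y : ℕ × ℤ) : ℂ :=
  pp h r z x (X x.1 r) (X z.1 r' * h ^ (2 * z.2)) *
      pp h r z y (mv h X r x y.1 r) (X z.1 r' * h ^ (2 * z.2)) * ff h r r' z X
    - (h ^ 2 + (h ^ 2)⁻¹) * (pp h r z x (X x.1 r) (X z.1 r') *
      pp h r z y (mv h X r x y.1 r) (X z.1 r' * h ^ (2 * z.2)) * ff h r r' z (mv h X r x))
    + pp h r z x (X x.1 r) (X z.1 r') * pp h r z y (mv h X r x y.1 r) (X z.1 r') *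
      ff h r r' z (mv h (mv h X r x) r y)

/-- In the three positions of `z` relative to `x` and `y` all factors agree except those linking the
two rows; the common ones are pulled out, and `tt` keeps the interaction. -/
lemma ww_eq (hA : Adj r r') (hz : z ∈ moves r') :
    ww h c X r r' z x y = kk h c X r (z.1, r') x * kk h c (mv h X r x) r (z.1, r') y *
      qq h c r r' z X * tt h X r r' z x y := by
  have e1 : mv h (mv h X r' z) r x = mv h (mv h X r x) r' z := mv_comm _ _ _ _
  simp only [ww, tt, e1, coef_eq_qq (z := z) hA, qq_mv hA, coef_eq_kk (x := x) hA hz,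
    coef_eq_kk (x := y) hA hz, kk_mv hA, mv_self', mv_row hA.ne, mv_row hA.symm.ne]
  ring

lemma ff_split {a : ℕ} (ha : a ∈ cols r) (Y : ℕ → ℕ → ℂ) :
    ff h r r' z Y = hf h r' z (Y z.1 r') (Y a r) *
      ∏ b ∈ (cols r).erase a, hf h r' z (Y z.1 r') (Y b r) := (mul_prod_erase _ _ ha).symm

end

/-- The exponential of the signed coordinate of a move of `A`. -/
def ev (h : ℂ) (x : ℕ × ℤ) (A : ℂ) : ℂ := if x.2 = 0 then h⁻¹ else A ^ x.2

/-- The point at which a move `z` of `B` is centred. -/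
def tv (h : ℂ) (z : ℕ × ℤ) (B : ℂ) : ℂ := if z.2 = 0 then 1 else B ^ z.2 * h

section

variable {h : ℂ} {c : ℕ → ℕ → ℂ} {X : ℕ → ℕ → ℂ} {r r' : ℕ} {x y z : ℕ × ℤ} {A B : ℂ}

lemma zpow_shift {e : ℤ} (he : e = 1 ∨ e = -1) : (A * h ^ (2 * e)) ^ e = A ^ e * h ^ 2 := by
  rcases he with rfl | rfl
  · simp
  · simp [mul_comm]

lemma br_zpow {e : ℤ} (he : e = 1 ∨ e = -1) : br h (A ^ e) = e * br h A := by
  rcases he with rfl | rfl <;> simp [br_inv]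

lemma br_zpow' {e : ℤ} (he : e = 1 ∨ e = -1) : br h A = e * br h (A ^ e) := by
  rcases he with rfl | rfl <;> simp [br_inv]

lemma ev_ne_zero (hh : h ≠ 0) (hA : A ≠ 0) : ev h x A ≠ 0 := by
  rw [ev]; split_ifs
  · exact inv_ne_zero hh
  · exact zpow_ne_zero _ hA

lemma tv_ne_zero (hh : h ≠ 0) (hB : B ≠ 0) : tv h z B ≠ 0 := by
  rw [tv]; split_ifs
  · exact one_ne_zero
  · exact mul_ne_zero (zpow_ne_zero _ hB) hh

lemma sign_of_mem (hx : x ∈ moves r) (h0 : x.2 ≠ 0) : x.2 = 1 ∨ x.2 = -1 := by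
  rcases mem_moves.1 hx with h1 | h1
  · exact h1.2
  · exact absurd (by rw [h1.2]) h0

lemma col_of_mem (hx : x ∈ moves r) (h0 : x.2 ≠ 0) : x.1 ∈ cols r := by
  rcases mem_moves.1 hx with h1 | h1
  · exact h1.1
  · exact absurd (by rw [h1.2]) h0

lemma eq_zero_of_mem (hx : x ∈ moves r) (h0 : x.2 = 0) : ¬ Even r ∧ x = (0, 0) := by
  rcases mem_moves.1 hx with ⟨_, h1 | h1⟩ | h1
  · omega
  · omega
  · exact h1

/-- The values `h⁻¹` in `ev` and `1` in `tv` for a trivial move are chosen so that the diagonal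
terms obey the same rule as genuine moves. One formula then covers both parities and all
combinations. -/
lemma pair_one (hh : h ≠ 0) (hA0 : A ≠ 0) (hB0 : B ≠ 0) (hA : Adj r r') (hx : x ∈ moves r)
    (hz : z ∈ moves r') :
    ∃ G, pp h r z x A (B * h ^ (2 * z.2)) * (if x.2 = 0 then 1 else hf h r' z B A)
        = br h (ev h x A * (tv h z B)⁻¹) * G ∧
      pp h r z x A B * (if x.2 = 0 then 1 else hf h r' z B (A * h ^ (2 * x.2)))
        = br h (ev h x A * (tv h z B)⁻¹ * h ^ 2) * G := by
  by_cases hz0 : z.2 = 0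
  · by_cases hx0 : x.2 = 0
    -- Adjacent rows have opposite parity, and only odd rows have a trivial move.
    · exact absurd (hA.even.2 (eq_zero_of_mem hx hx0).1) (eq_zero_of_mem hz hz0).1
    · have he := sign_of_mem hx hx0
      refine ⟨x.2, ?_, ?_⟩
      · simp only [pp, hf, ev, tv, hz0, hx0, if_true, if_false, inv_one, mul_one, one_mul]
        rw [br_zpow' he, mul_comm]
      · simp only [pp, hf, ev, tv, hz0, hx0, if_true, if_false, inv_one, mul_one, one_mul]
        rw [br_zpow' he, zpow_shift he, mul_comm]
  · have hs := sign_of_mem hz hz0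
    by_cases hx0 : x.2 = 0
    · refine ⟨-z.2, ?_, ?_⟩
      · simp only [pp, hf, ev, tv, hz0, hx0, if_true, if_false, mul_one]
        rw [br_zpow' hs, zpow_shift hs,
          show h⁻¹ * (B ^ z.2 * h)⁻¹ = (B ^ z.2 * h ^ 2)⁻¹ by field_simp, br_inv]
        ring
      · simp only [pp, hf, ev, tv, hz0, hx0, if_true, if_false, mul_one]
        rw [br_zpow' hs, show h⁻¹ * (B ^ z.2 * h)⁻¹ * h ^ 2 = (B ^ z.2)⁻¹ by field_simp, br_inv]
        ring
    · have he := sign_of_mem hx hx0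
      by_cases hr : Even r
      · have hr' : ¬ Even r' := fun h1 => hA.even.1 h1 hr
        obtain ⟨G, h1, h2⟩ := pe_po_one hh (zpow_ne_zero x.2 hA0) hB0 hs
        refine ⟨G, ?_, ?_⟩
        · simp only [pp, hf, ev, tv, hz0, hx0, if_false, prr, hr, hr', if_true]
          rw [← h1, po_zpow _ _ _ he]
        · simp only [pp, hf, ev, tv, hz0, hx0, if_false, prr, hr, hr', if_true]
          rw [← h2, ← po_zpow _ _ _ he _ (A * h ^ (2 * x.2)), zpow_shift he]
      · have hr' : Even r' := hA.even.2 hr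
        obtain ⟨G, h1, h2⟩ := po_pe_one hh (zpow_ne_zero z.2 hB0) hA0 he
        refine ⟨G, ?_, ?_⟩
        · simp only [pp, hf, ev, tv, hz0, hx0, if_false, prr, hr, hr', if_true]
          rw [← h1, ← po_zpow _ _ _ hs _ (B * h ^ (2 * z.2)), zpow_shift hs]
        · simp only [pp, hf, ev, tv, hz0, hx0, if_false, prr, hr, hr', if_true]
          rw [← h2, po_zpow _ _ _ hs]

lemma pair_two (hh : h ≠ 0) (hA0 : A ≠ 0) (hB0 : B ≠ 0) (hA : Adj r r') (hx : x ∈ moves r)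
    (hx0 : x.2 ≠ 0) (hz : z ∈ moves r') :
    ∃ G, pp h r z x A (B * h ^ (2 * z.2)) * pp h r z x (A * h ^ (2 * x.2)) (B * h ^ (2 * z.2)) *
        hf h r' z B A = br h (ev h x A * (tv h z B)⁻¹) * G ∧
      pp h r z x A B * pp h r z x (A * h ^ (2 * x.2)) (B * h ^ (2 * z.2)) *
        hf h r' z B (A * h ^ (2 * x.2)) = br h (ev h x A * (tv h z B)⁻¹ * h ^ 2) * G ∧
      pp h r z x A B * pp h r z x (A * h ^ (2 * x.2)) B *
        hf h r' z B (A * h ^ (2 * x.2) * h ^ (2 * x.2))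
        = br h (ev h x A * (tv h z B)⁻¹ * h ^ 2 * h ^ 2) * G := by
  have he := sign_of_mem hx hx0
  by_cases hz0 : z.2 = 0
  · refine ⟨x.2, ?_, ?_, ?_⟩ <;>
    simp only [pp, hf, ev, tv, hz0, hx0, if_true, if_false, inv_one, mul_one, one_mul] <;>
    rw [br_zpow' he] <;> (try simp only [zpow_shift he]) <;> ring
  · have hs := sign_of_mem hz hz0
    by_cases hr : Even r
    · have hr' : ¬ Even r' := fun h1 => hA.even.1 h1 hr
      obtain ⟨G, h1, h2, h3⟩ := pe_po_two hh (zpow_ne_zero x.2 hA0) hB0 hs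
      refine ⟨G, ?_, ?_, ?_⟩ <;>
        simp only [pp, hf, ev, tv, hz0, hx0, if_false, prr, hr, hr', if_true, zpow_shift he]
      · rw [← h1, po_zpow _ _ _ he]
      · rw [← h2, ← po_zpow _ _ _ he _ (A * h ^ (2 * x.2)), zpow_shift he]
      · rw [← h3, ← po_zpow _ _ _ he _ (A * h ^ (2 * x.2) * h ^ (2 * x.2)), zpow_shift he,
          zpow_shift he]
    · have hr' : Even r' := hA.even.2 hr
      obtain ⟨G, h1, h2, h3⟩ := po_pe_two hh (zpow_ne_zero z.2 hB0) hA0 he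
      have e1 : ∀ A, po h x.2 A (B * h ^ (2 * z.2)) = po h x.2 A (B ^ z.2 * h ^ 2) := fun A => by
        rw [← po_zpow _ _ _ hs _ (B * h ^ (2 * z.2)), zpow_shift hs]
      have e2 : ∀ A, po h x.2 A B = po h x.2 A (B ^ z.2) := fun A => (po_zpow _ _ _ hs _ _).symm
      refine ⟨G, ?_, ?_, ?_⟩ <;>
        simp only [pp, hf, ev, tv, hz0, hx0, if_false, prr, hr, hr', if_true, e1]
      · rw [← h1]
      · rw [← h2, e2]
      · rw [← h3, e2 A, e2]

lemma pp_back (hh : h ≠ 0) {e : ℤ} (he : e = 1 ∨ e = -1) {a : ℕ} :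
    pp h r z (a, -e) (A * h ^ (2 * e)) B = pp h r z (a, e) A B := by
  have h0 : e ≠ 0 := by omega
  simp only [pp, prr, h0, neg_eq_zero, if_false]
  by_cases hr : Even r
  · simp only [hr, if_true]
    rw [zpow_neg, zpow_shift he, pe_back hh]
  · simp only [hr, if_false]
    rw [po_back he hh]

lemma pair_loop (hh : h ≠ 0) (hw : h ^ 2 - (h ^ 2)⁻¹ ≠ 0) (hA0 : A ≠ 0) (hB0 : B ≠ 0)
    (hA : Adj r r') (hx : x ∈ moves r) (hx0 : x.2 ≠ 0) (hz : z ∈ moves r') (hz0 : z.2 ≠ 0) :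
    pp h r z x A (B * h ^ (2 * z.2)) * pp h r z x A (B * h ^ (2 * z.2)) * hf h r' z B A
      - (h ^ 2 + (h ^ 2)⁻¹) * (pp h r z x A B * pp h r z x A (B * h ^ (2 * z.2)) *
        hf h r' z B (A * h ^ (2 * x.2)))
      + pp h r z x A B * pp h r z x A B * hf h r' z B A
      = br h ((ev h x A) ^ 2 * h ^ 4) * hf h r' z B A := by
  have he := sign_of_mem hx hx0
  have hs := sign_of_mem hz hz0
  by_cases hr : Even r
  · have hr' : ¬ Even r' := fun h1 => hA.even.1 h1 hr
    have h1 := pe_po_loop hh hw (zpow_ne_zero x.2 hA0) hB0 hs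
    simp only [pp, hf, ev, hz0, hx0, if_false, prr, hr, hr', if_true]
    rw [← po_zpow _ _ _ he _ (A * h ^ (2 * x.2)), zpow_shift he, ← po_zpow _ _ _ he _ A, ← h1]
  · have hr' : Even r' := hA.even.2 hr
    have h1 := po_pe_loop hh hw (zpow_ne_zero z.2 hB0) hA0 he
    have e1 : ∀ A, po h x.2 A (B * h ^ (2 * z.2)) = po h x.2 A (B ^ z.2 * h ^ 2) := fun A => by
      rw [← po_zpow _ _ _ hs _ (B * h ^ (2 * z.2)), zpow_shift hs]
    have e2 : ∀ A, po h x.2 A B = po h x.2 A (B ^ z.2) := fun A => (po_zpow _ _ _ hs _ _).symm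
    simp only [pp, hf, ev, hz0, hx0, if_false, prr, hr, hr', if_true, e1]
    rw [e2, ← h1]

lemma split_erase {s : Finset ℕ} (F : ℕ → ℂ)
    (hx : (x.2 ≠ 0 → x.1 ∈ s)) (hx' : x.2 = 0 → x.1 ∉ s) :
    ∏ a ∈ s, F a = (if x.2 = 0 then 1 else F x.1) * ∏ b ∈ s.erase x.1, F b := by
  split_ifs with h0
  · rw [erase_eq_of_notMem (hx' h0), one_mul]
  · rw [mul_prod_erase _ _ (hx h0)]

lemma notMem_cols_of_mem (hx : x ∈ moves r) (h0 : x.2 = 0) : x.1 ∉ cols r := by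
  rw [(eq_zero_of_mem hx h0).2]; simp

/-- The two orders of a pair of moves of different columns. -/
lemma tt_ne (hh : h ≠ 0) (hw : h ^ 2 - (h ^ 2)⁻¹ ≠ 0) (hX : ∀ a s, X a s ≠ 0) (hA : Adj r r')
    (hx : x ∈ moves r) (hy : y ∈ moves r) (hxy : x.1 ≠ y.1) (hz : z ∈ moves r') :
    ∃ R, tt h X r r' z x y = br h (ev h x (X x.1 r) * (ev h y (X y.1 r))⁻¹ * h ^ 2) * R ∧
      tt h X r r' z y x = br h (ev h y (X y.1 r) * (ev h x (X x.1 r))⁻¹ * h ^ 2) * R := by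
  obtain ⟨G, h1, h2⟩ := pair_one hh (hX x.1 r) (hX z.1 r') hA hx hz
  obtain ⟨G', h3, h4⟩ := pair_one hh (hX y.1 r) (hX z.1 r') hA hy hz
  -- The columns of `x` and `y` are split off; for a trivial move there is no column and the factor
  -- is `1`.
  have hsx : ∀ F : ℕ → ℂ, ∏ a ∈ cols r, F a = (if x.2 = 0 then 1 else F x.1) *
      ((if y.2 = 0 then 1 else F y.1) * ∏ b ∈ ((cols r).erase x.1).erase y.1, F b) := by
    intro F
    rw [split_erase (x := x) F (col_of_mem hx) (notMem_cols_of_mem hx)]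
    rw [split_erase (x := y) (s := (cols r).erase x.1) F
      (fun h0 => mem_erase.2 ⟨hxy.symm, col_of_mem hy h0⟩)
      (fun h0 hm => notMem_cols_of_mem hy h0 (mem_of_mem_erase hm))]
  set S := ∏ b ∈ ((cols r).erase x.1).erase y.1, hf h r' z (X z.1 r') (X b r) with hS
  have key : ∀ Y : ℕ → ℕ → ℂ, (∀ b s, b ≠ x.1 → b ≠ y.1 → Y b s = X b s) →
      (∀ b, Y b r' = X b r') → ff h r r' z Y = (if x.2 = 0 then 1 else hf h r' z (X z.1 r')
        (Y x.1 r)) * ((if y.2 = 0 then 1 else hf h r' z (X z.1 r') (Y y.1 r)) * S) := by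
    intro Y hY hY'
    rw [ff, hsx]
    simp only [hY', hS]
    congr 2
    refine prod_congr rfl fun b hb => ?_
    rw [hY b r (ne_of_mem_erase (mem_of_mem_erase hb)) (ne_of_mem_erase hb)]
  have k1 := key X (fun _ _ _ _ => rfl) (fun _ => rfl)
  have k2 := key (mv h X r x) (fun b s h1 h2 => mv_col h1) (fun b => mv_row hA.symm.ne)
  have k3 := key (mv h X r y) (fun b s h1 h2 => mv_col h2) (fun b => mv_row hA.symm.ne)
  have k4 := key (mv h (mv h X r x) r y) (fun b s h1 h2 => by rw [mv_col h2, mv_col h1])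
    (fun b => by rw [mv_row hA.symm.ne, mv_row hA.symm.ne])
  have k5 : mv h (mv h X r y) r x = mv h (mv h X r x) r y := mv_comm _ _ _ _
  rw [mv_self', mv_col hxy.symm] at k2
  rw [mv_self', mv_col hxy] at k3
  rw [mv_self', mv_col hxy, mv_self', mv_col hxy.symm] at k4
  set zx := ev h x (X x.1 r) * (tv h z (X z.1 r'))⁻¹ with hzx
  set zy := ev h y (X y.1 r) * (tv h z (X z.1 r'))⁻¹ with hzy
  have ht := tv_ne_zero (z := z) hh (hX z.1 r')
  have hzx0 : zx ≠ 0 := mul_ne_zero (ev_ne_zero hh (hX _ _)) (inv_ne_zero ht)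
  have hzy0 : zy ≠ 0 := mul_ne_zero (ev_ne_zero hh (hX _ _)) (inv_ne_zero ht)
  have r1 : ev h x (X x.1 r) * (ev h y (X y.1 r))⁻¹ = zx * zy⁻¹ := by
    rw [hzx, hzy]; field_simp
  have r2 : ev h y (X y.1 r) * (ev h x (X x.1 r))⁻¹ = zy * zx⁻¹ := by
    rw [hzx, hzy]; field_simp
  refine ⟨G * G' * S, ?_, ?_⟩
  -- Each interaction factor is replaced by a bracket times `G` or `G'`, and `br_trilinear` adds up
  -- the three products of brackets.
  · rw [r1, ← br_trilinear hh hw hzx0 hzy0, tt, k1, k2, k4, mv_col hxy.symm]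
    linear_combination
      (S * pp h r z y (X y.1 r) (X z.1 r' * h ^ (2 * z.2)) *
        (if y.2 = 0 then 1 else hf h r' z (X z.1 r') (X y.1 r))) * h1 +
      S * br h zx * G * h3
      - (h ^ 2 + (h ^ 2)⁻¹) * S * (pp h r z y (X y.1 r) (X z.1 r' * h ^ (2 * z.2)) *
        (if y.2 = 0 then 1 else hf h r' z (X z.1 r') (X y.1 r))) * h2
      - (h ^ 2 + (h ^ 2)⁻¹) * S * br h (zx * h ^ 2) * G * h3
      + S * (pp h r z y (X y.1 r) (X z.1 r') *
        (if y.2 = 0 then 1 else hf h r' z (X z.1 r') (X y.1 r * h ^ (2 * y.2)))) * h2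
      + S * br h (zx * h ^ 2) * G * h4
  · rw [r2, ← br_trilinear hh hw hzy0 hzx0, tt, k1, k3, k5, k4, mv_col hxy]
    linear_combination
      (S * pp h r z x (X x.1 r) (X z.1 r' * h ^ (2 * z.2)) *
        (if x.2 = 0 then 1 else hf h r' z (X z.1 r') (X x.1 r))) * h3 +
      S * br h zy * G' * h1
      - (h ^ 2 + (h ^ 2)⁻¹) * S * (pp h r z x (X x.1 r) (X z.1 r' * h ^ (2 * z.2)) *
        (if x.2 = 0 then 1 else hf h r' z (X z.1 r') (X x.1 r))) * h4
      - (h ^ 2 + (h ^ 2)⁻¹) * S * br h (zy * h ^ 2) * G' * h1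
      + S * (pp h r z x (X x.1 r) (X z.1 r') *
        (if x.2 = 0 then 1 else hf h r' z (X z.1 r') (X x.1 r * h ^ (2 * x.2)))) * h4
      + S * br h (zy * h ^ 2) * G' * h2

/-- The three positions of `z` have weights proportional to three consecutive brackets, so
`br_three` applies. -/
lemma tt_self (hh : h ≠ 0) (hX : ∀ a s, X a s ≠ 0) (hA : Adj r r')
    (hx : x ∈ moves r) (hx0 : x.2 ≠ 0) (hz : z ∈ moves r') : tt h X r r' z x x = 0 := by
  obtain ⟨G, h1, h2, h3⟩ := pair_two hh (hX x.1 r) (hX z.1 r') hA hx hx0 hz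
  have hc := col_of_mem hx hx0
  have e : ∀ Y : ℕ → ℕ → ℂ, (∀ b s, b ≠ x.1 → Y b s = X b s) → (∀ b, Y b r' = X b r') →
      ff h r r' z Y = hf h r' z (X z.1 r') (Y x.1 r) *
        ∏ b ∈ (cols r).erase x.1, hf h r' z (X z.1 r') (X b r) := by
    intro Y hY hY'
    rw [ff_split hc, hY']
    congr 1
    exact prod_congr rfl fun b hb => by rw [hY b r (ne_of_mem_erase hb)]
  have hzz := mul_ne_zero (ev_ne_zero (x := x) hh (hX x.1 r))
    (inv_ne_zero (tv_ne_zero (z := z) hh (hX z.1 r')))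
  have h4 := br_three hh hzz
  rw [tt, e X (fun _ _ _ => rfl) (fun _ => rfl), e (mv h X r x) (fun b s h1 => mv_col h1)
    (fun b => mv_row hA.symm.ne), e (mv h (mv h X r x) r x) (fun b s h1 => by
      rw [mv_col h1, mv_col h1]) (fun b => by rw [mv_row hA.symm.ne, mv_row hA.symm.ne])]
  simp only [mv_self']
  set S := ∏ b ∈ (cols r).erase x.1, hf h r' z (X z.1 r') (X b r)
  linear_combination S * h1 - (h ^ 2 + (h ^ 2)⁻¹) * S * h2 + S * h3 + S * G * h4

/-- The result is a number depending on `x` alone times the original factor of `z`. Hence closed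
paths reproduce the coefficient of `z`, and the relation reduces to a scalar sum over `x`. -/
lemma tt_loop (hh : h ≠ 0) (hw : h ^ 2 - (h ^ 2)⁻¹ ≠ 0) (hX : ∀ a s, X a s ≠ 0) (hA : Adj r r')
    (hx : x ∈ moves r) (hz : z ∈ moves r') (hz0 : z.2 ≠ 0) :
    tt h X r r' z x (x.1, -x.2) = br h ((ev h x (X x.1 r)) ^ 2 * h ^ 4) * ff h r r' z X := by
  by_cases hx0 : x.2 = 0
  · obtain ⟨hr, rfl⟩ := eq_zero_of_mem hx hx0
    have hs := sign_of_mem hz hz0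
    have hB := hX z.1 r'
    have hw4 : h ^ 4 - 1 ≠ 0 := fun h0 => hw (by field_simp; linear_combination h0)
    have e' : ∀ z, br h z = (z - z⁻¹) * h ^ 2 / (h ^ 4 - 1) := fun z => by
      rw [br, div_eq_div_iff hw hw4]
      field_simp
    simp only [tt, neg_zero, mv_zero, pp, hz0, if_true, if_false, ev]
    generalize X z.1 r' = B at hB
    have : br h (B * h ^ (2 * z.2)) * br h (B * h ^ (2 * z.2)) - (h ^ 2 + (h ^ 2)⁻¹) *
        (br h B * br h (B * h ^ (2 * z.2))) + br h B * br h B = br h (h⁻¹ ^ 2 * h ^ 4) := by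
      rcases hs with h1 | h1
      · rw [h1, show h ^ (2 * (1 : ℤ)) = h ^ 2 by norm_cast]
        simp only [e']
        rw [← sub_eq_zero]
        field_simp
        ring
      · rw [h1, show h ^ (2 * (-1 : ℤ)) = (h ^ 2)⁻¹ by norm_num]
        simp only [e']
        rw [← sub_eq_zero]
        field_simp
        ring
    linear_combination ff h r r' z X * this
  · have he := sign_of_mem hx hx0
    have hc := col_of_mem hx hx0
    obtain ⟨a, e⟩ := x
    have h1 := pair_loop hh hw (hX a r) (hX z.1 r') hA hx hx0 hz hz0
    have e2 : ff h r r' z (mv h X r (a, e)) = hf h r' z (X z.1 r') (X a r * h ^ (2 * e)) *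
        ∏ b ∈ (cols r).erase a, hf h r' z (X z.1 r') (X b r) := by
      rw [ff_split hc, mv_row hA.symm.ne, mv_self]
      congr 1
      exact prod_congr rfl fun b hb => by rw [mv_col (x := (a, e)) (ne_of_mem_erase hb)]
    simp only [tt, mv_neg hh, mv_self, pp_back hh he]
    rw [e2, ff_split hc]
    set S := ∏ b ∈ (cols r).erase a, hf h r' z (X z.1 r') (X b r)
    linear_combination S * h1

/-- For a trivial `z` the bracket of the moving column is absorbed into the three-term combination
and does not reappear. Leaving it out, rather than dividing by it, keeps the formula usable when
that bracket is zero. -/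
lemma tt_loop_zero (hh : h ≠ 0) (hw : h ^ 2 - (h ^ 2)⁻¹ ≠ 0) (hX : ∀ a s, X a s ≠ 0)
    (hA : Adj r r') (hx : x ∈ moves r) (hx0 : x.2 ≠ 0) (hz0 : z.2 = 0) :
    tt h X r r' z x (x.1, -x.2) = -(x.2 * (X x.1 r ^ x.2 * h ^ 2 + (X x.1 r ^ x.2 * h ^ 2)⁻¹)) *
      ∏ b ∈ (cols r).erase x.1, br h (X b r) := by
  have he := sign_of_mem hx hx0
  have hc := col_of_mem hx hx0
  obtain ⟨a, e⟩ := x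
  have hA0 : X a r ^ e ≠ 0 := zpow_ne_zero _ (hX a r)
  have e2 : ff h r r' z (mv h X r (a, e)) = hf h r' z (X z.1 r') (X a r * h ^ (2 * e)) *
      ∏ b ∈ (cols r).erase a, hf h r' z (X z.1 r') (X b r) := by
    rw [ff_split hc, mv_row hA.symm.ne, mv_self]
    congr 1
    exact prod_congr rfl fun b hb => by rw [mv_col (x := (a, e)) (ne_of_mem_erase hb)]
  simp only [tt, mv_neg hh]
  rw [e2, ff_split hc]
  simp only [pp, hf, hz0, if_true]
  rw [br_zpow' he, br_zpow' (A := X a r * h ^ (2 * e)) he, zpow_shift he]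
  generalize X a r ^ e = a' at hA0
  have : br h a' - (h ^ 2 + (h ^ 2)⁻¹) * br h (a' * h ^ 2) + br h a'
      = -(a' * h ^ 2 + (a' * h ^ 2)⁻¹) := by
    have hw4 : h ^ 4 - 1 ≠ 0 := fun h0 => hw (by field_simp; linear_combination h0)
    have e' : ∀ z, br h z = (z - z⁻¹) * h ^ 2 / (h ^ 4 - 1) := fun z => by
      rw [br, div_eq_div_iff hw hw4]
      field_simp
    simp only [e']
    rw [← sub_eq_zero]
    field_simp
    ring
  linear_combination (e * ∏ b ∈ (cols r).erase a, br h (X b r)) * this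

end

/-! ### Two moves of different columns cancel -/

section

variable {h : ℂ} {c : ℕ → ℕ → ℂ} {X : ℕ → ℕ → ℂ} {r r' : ℕ} {x y z : ℕ × ℤ} {A B : ℂ}
  {p : ℕ × ℕ}

lemma nn_comm (a b : ℕ) : nn h X r a b = nn h X r b a := by
  rw [nn, nn, mul_comm (X a r), min_comm, max_comm]

lemma nn_sq (a b : ℕ) : nn h X r a b * nn h X r a b =
    br h (X a r * X b r) * br h (X (min a b) r * (X (max a b) r)⁻¹) := by
  rw [← sg_mul_self, ← sg_mul_self, nn]; ring

lemma dd_split {b : ℕ} (hb : b ∈ cols r) (hxb : x.1 ≠ b) :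
    dd h X r x = nn h X r x.1 b * nn h (mv h X r x) r x.1 b *
      ∏ d ∈ ((cols r).erase x.1).erase b, (nn h X r x.1 d * nn h (mv h X r x) r x.1 d) := by
  exact (mul_prod_erase _ (fun d => nn h X r x.1 d * nn h (mv h X r x) r x.1 d)
    (mem_erase.2 ⟨hxb.symm, hb⟩)).symm

lemma dd_split_mv {b : ℕ} (hb : b ∈ cols r) (hxb : x.1 ≠ b) (hy : y.1 = b) :
    dd h (mv h X r y) r x = nn h (mv h X r y) r x.1 b * nn h (mv h (mv h X r x) r y) r x.1 b *
      ∏ d ∈ ((cols r).erase x.1).erase b, (nn h X r x.1 d * nn h (mv h X r x) r x.1 d) := by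
  rw [dd_split hb hxb, mv_comm r r y x]
  congr 1
  refine prod_congr rfl fun d hd => ?_
  have h1 : d ≠ y.1 := hy ▸ ne_of_mem_erase hd
  have h2 : x.1 ≠ y.1 := hy ▸ hxb
  simp only [nn, mv_col h1, mv_col h2]
  congr 2
  · rcases le_total x.1 d with h | h <;> simp only [min_eq_left, min_eq_right, max_eq_left,
      max_eq_right, h, mv_col h1, mv_col h2]
  · rcases le_total x.1 d with h | h <;> simp only [min_eq_left, min_eq_right, max_eq_left,
      max_eq_right, h, mv_col h1, mv_col h2]

lemma br_pair {e e' : ℤ} (he : e = 1 ∨ e = -1) (he' : e' = 1 ∨ e' = -1)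
    (hh : h ≠ 0) (hA : A ≠ 0) (hB : B ≠ 0) :
    br h (A ^ e * (B ^ e')⁻¹ * h ^ 2) *
        (br h (A * (B * h ^ (2 * e'))) * br h (A * (B * h ^ (2 * e'))⁻¹)) +
      br h (B ^ e' * (A ^ e)⁻¹ * h ^ 2) *
        (br h (A * h ^ (2 * e) * B) * br h (A * h ^ (2 * e) * B⁻¹)) = 0 := by
  have e0 : h ^ (2 * (-1 : ℤ)) = (h ^ 2)⁻¹ := by norm_num
  have e1 : h ^ (2 * (1 : ℤ)) = h ^ 2 := by norm_cast
  rcases he with rfl | rfl <;> rcases he' with rfl | rfl <;>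
    simp only [e0, e1, zpow_neg, zpow_one]
  · rw [show B * A⁻¹ * h ^ 2 = (A * (B * h ^ 2)⁻¹)⁻¹ by field_simp, br_inv,
      show A * B⁻¹ * h ^ 2 = A * h ^ 2 * B⁻¹ by ring, show A * (B * h ^ 2) = A * h ^ 2 * B by ring]
    ring
  · rw [show A * B⁻¹⁻¹ * h ^ 2 = A * h ^ 2 * B by rw [inv_inv]; ring,
      show B⁻¹ * A⁻¹ * h ^ 2 = (A * (B * (h ^ 2)⁻¹))⁻¹ by field_simp, br_inv,
      show A * (B * (h ^ 2)⁻¹)⁻¹ = A * h ^ 2 * B⁻¹ by field_simp]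
    ring
  · rw [show B * A⁻¹⁻¹ * h ^ 2 = A * (B * h ^ 2) by rw [inv_inv]; ring,
      show A⁻¹ * B⁻¹ * h ^ 2 = (A * (h ^ 2)⁻¹ * B)⁻¹ by field_simp, br_inv,
      show A * (B * h ^ 2)⁻¹ = A * (h ^ 2)⁻¹ * B⁻¹ by field_simp]
    ring
  · rw [show A⁻¹ * B⁻¹⁻¹ * h ^ 2 = (A * (h ^ 2)⁻¹ * B⁻¹)⁻¹ by field_simp, br_inv,
      show A * (B * (h ^ 2)⁻¹) = A * (h ^ 2)⁻¹ * B by ring,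
      show B⁻¹ * A⁻¹⁻¹ * h ^ 2 = A * (B * (h ^ 2)⁻¹)⁻¹ by field_simp]
    ring

/-- The two orders pass through different intermediate arrays. The squares of the pair factors there
are in minus the ratio of the brackets from `tt_ne`, which is the source of the cancellation. -/
lemma nn_mv_pair (hh : h ≠ 0) (hX : ∀ a s, X a s ≠ 0) {e e' : ℤ} (he : e = 1 ∨ e = -1)
    (he' : e' = 1 ∨ e' = -1) {a b : ℕ} (hab : a ≠ b) :
    br h (X a r ^ e * (X b r ^ e')⁻¹ * h ^ 2) *
        (nn h (mv h X r (b, e')) r a b * nn h (mv h X r (b, e')) r a b) +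
      br h (X b r ^ e' * (X a r ^ e)⁻¹ * h ^ 2) *
        (nn h (mv h X r (a, e)) r a b * nn h (mv h X r (a, e)) r a b) = 0 := by
  rw [nn_sq, nn_sq]
  have k := br_pair he he' hh (hX a r) (hX b r)
  rcases lt_or_gt_of_ne hab with h1 | h1
  · rw [min_eq_left h1.le, max_eq_right h1.le]
    simpa only [mv_self, mv_col (x := (a, e)) hab.symm, mv_col (x := (b, e')) hab] using k
  · rw [min_eq_right h1.le, max_eq_left h1.le]
    simp only [mv_self, mv_col (x := (a, e)) hab.symm, mv_col (x := (b, e')) hab]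
    rw [show X b r * h ^ (2 * e') * (X a r)⁻¹ = (X a r * (X b r * h ^ (2 * e'))⁻¹)⁻¹ by
      rw [mul_inv, inv_inv]; ring, br_inv,
      show X b r * (X a r * h ^ (2 * e))⁻¹ = (X a r * h ^ (2 * e) * (X b r)⁻¹)⁻¹ by
      rw [mul_inv, mul_inv, inv_inv, mul_inv]; ring, br_inv]
    linear_combination -k

/-- Apart from common factors the two orders carry the inverse squares of the pair factor at their
intermediate arrays. The nonvanishing hypotheses are needed because the inverse of `0` is `0`. -/
lemma kk_comm (hh : h ≠ 0) (hX : ∀ a s, X a s ≠ 0) (hr : 1 ≤ r)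
    (hx : x ∈ moves r) (hx0 : x.2 ≠ 0) (hy : y ∈ moves r) (hy0 : y.2 ≠ 0) (hxy : x.1 ≠ y.1)
    (h1 : nn h (mv h X r x) r x.1 y.1 ≠ 0) (h2 : nn h (mv h X r y) r x.1 y.1 ≠ 0) :
    kk h c X r p x * kk h c (mv h X r x) r p y *
        br h (ev h x (X x.1 r) * (ev h y (X y.1 r))⁻¹ * h ^ 2) +
      kk h c X r p y * kk h c (mv h X r y) r p x *
        br h (ev h y (X y.1 r) * (ev h x (X x.1 r))⁻¹ * h ^ 2) = 0 := by
  have hF : ∀ (w : ℕ × ℤ) (e : ℤ) (A : ℂ), ∏ f ∈ (nb r).erase p, prr h r e A (mv h X r w f.1 f.2)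
      = ∏ f ∈ (nb r).erase p, prr h r e A (X f.1 f.2) := fun w e A =>
    prod_congr rfl fun f hf => by rw [mv_row (snd_ne_of_mem_nb hr (mem_of_mem_erase hf))]
  have k := nn_mv_pair (r := r) hh hX (sign_of_mem hx hx0) (sign_of_mem hy hy0) hxy
  simp only [kk, hx0, hy0, if_false, ev]
  rw [dd_split (X := X) (col_of_mem hy hy0) hxy, dd_split (X := X) (col_of_mem hx hx0) hxy.symm,
    dd_split_mv (col_of_mem hy hy0) hxy rfl, dd_split_mv (col_of_mem hx hx0) hxy.symm rfl,
    mv_col hxy, mv_col hxy.symm, hF, hF, nn_comm y.1 x.1, nn_comm y.1 x.1,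
    nn_comm y.1 x.1, nn_comm y.1 x.1, mv_comm r r y x]
  simp only [Prod.mk.eta] at k
  generalize br h (X x.1 r ^ x.2 * (X y.1 r ^ y.2)⁻¹ * h ^ 2) = b1 at k ⊢
  generalize br h (X y.1 r ^ y.2 * (X x.1 r ^ x.2)⁻¹ * h ^ 2) = b2 at k ⊢
  generalize nn h (mv h X r x) r x.1 y.1 = n1 at h1 k ⊢
  generalize nn h (mv h X r y) r x.1 y.1 = n2 at h2 k ⊢
  have k' : b1 * (n1⁻¹ * n1⁻¹) + b2 * (n2⁻¹ * n2⁻¹) = 0 := by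
    have : b1 * (n1⁻¹ * n1⁻¹) + b2 * (n2⁻¹ * n2⁻¹) =
      (b1 * (n2 * n2) + b2 * (n1 * n1)) * (n1⁻¹ * n1⁻¹ * (n2⁻¹ * n2⁻¹)) := by field_simp
    rw [this, k, zero_mul]
  simp only [div_eq_mul_inv, mul_inv]
  generalize ((x.2 : ℤ) : ℂ) * c x.1 r ^ x.2 *
    ∏ f ∈ (nb r).erase p, prr h r x.2 (X x.1 r) (X f.1 f.2) = u
  generalize ((y.2 : ℤ) : ℂ) * c y.1 r ^ y.2 *
    ∏ f ∈ (nb r).erase p, prr h r y.2 (X y.1 r) (X f.1 f.2) = v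
  linear_combination (u * v * (nn h X r x.1 y.1)⁻¹ * (nn h (mv h (mv h X r x) r y) r x.1 y.1)⁻¹ *
    (∏ d ∈ ((cols r).erase x.1).erase y.1, (nn h X r x.1 d * nn h (mv h X r x) r x.1 d))⁻¹ *
    (∏ d ∈ ((cols r).erase y.1).erase x.1, (nn h X r y.1 d * nn h (mv h X r y) r y.1 d))⁻¹ *
    (den h r x.2 (X x.1 r))⁻¹ * (den h r y.2 (X y.1 r))⁻¹) * k'

/-- The diagonal coefficient is taken before or after `x`. The bracket produced by `tt_ne` cancels
exactly the denominator factor that distinguishes the two values; if that factor may vanish, a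
vanishing numerator of the diagonal coefficient serves instead. -/
lemma kk_comm_zero (hh : h ≠ 0) (hX : ∀ a s, X a s ≠ 0) (hr : 1 ≤ r)
    (hx : x ∈ moves r) (hx0 : x.2 ≠ 0)
    (h1 : (br h (X x.1 r ^ x.2 * h⁻¹) ≠ 0 ∧ br h (X x.1 r ^ x.2 * h ^ 3) ≠ 0) ∨
      ∏ f ∈ (nb r).erase p, br h (X f.1 f.2) = 0) :
    kk h c X r p (0, 0) * kk h c (mv h X r (0, 0)) r p x *
        br h (ev h (0, 0) (X 0 r) * (ev h x (X x.1 r))⁻¹ * h ^ 2) +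
      kk h c X r p x * kk h c (mv h X r x) r p (0, 0) *
        br h (ev h x (X x.1 r) * (ev h (0, 0) (X 0 r))⁻¹ * h ^ 2) = 0 := by
  have hF : ∏ f ∈ (nb r).erase p, br h (mv h X r x f.1 f.2) =
      ∏ f ∈ (nb r).erase p, br h (X f.1 f.2) :=
    prod_congr rfl fun f hf => by rw [mv_row (snd_ne_of_mem_nb hr (mem_of_mem_erase hf))]
  have e1 : kk h c X r p (0, 0) = Complex.I * (∏ f ∈ (nb r).erase p, br h (X f.1 f.2)) /
      ∏ b ∈ cols r, (br h (X b r * h) * br h (X b r * h⁻¹)) := by simp [kk]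
  have e2 : kk h c (mv h X r x) r p (0, 0) =
      Complex.I * (∏ f ∈ (nb r).erase p, br h (X f.1 f.2)) /
      ∏ b ∈ cols r, (br h (mv h X r x b r * h) * br h (mv h X r x b r * h⁻¹)) := by
    rw [← hF]; simp [kk]
  rw [mv_zero, e1, e2]
  rcases h1 with ⟨h1, h2⟩ | h1
  · have he := sign_of_mem hx hx0
    have hc := col_of_mem hx hx0
    have e0 : ∏ b ∈ (cols r).erase x.1, (br h (mv h X r x b r * h) * br h (mv h X r x b r * h⁻¹)) =
        ∏ b ∈ (cols r).erase x.1, (br h (X b r * h) * br h (X b r * h⁻¹)) :=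
      prod_congr rfl fun b hb => by rw [mv_col (x := x) (ne_of_mem_erase hb)]
    rw [← mul_prod_erase _ _ hc, ← mul_prod_erase _ _ hc, e0, mv_self']
    have hA := hX x.1 r
    simp only [ev, hx0, if_false, if_true]
    have e3 : br h (X x.1 r * h) * br h (X x.1 r * h⁻¹) =
        br h (X x.1 r ^ x.2 * h) * br h (X x.1 r ^ x.2 * h⁻¹) := by
      rcases he with h0 | h0 <;> rw [h0]
      · simp
      · rw [show X x.1 r ^ (-1 : ℤ) * h = (X x.1 r * h⁻¹)⁻¹ by simp [mul_comm],
          show X x.1 r ^ (-1 : ℤ) * h⁻¹ = (X x.1 r * h)⁻¹ by simp [mul_comm], br_inv, br_inv]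
        ring
    have e4 : br h (X x.1 r * h ^ (2 * x.2) * h) * br h (X x.1 r * h ^ (2 * x.2) * h⁻¹) =
        br h (X x.1 r ^ x.2 * h ^ 3) * br h (X x.1 r ^ x.2 * h) := by
      rcases he with h0 | h0 <;> rw [h0]
      · congr 2
        · norm_cast; simp; ring
        · norm_cast; simp; field_simp
      · rw [show X x.1 r ^ (-1 : ℤ) * h ^ 3 = (X x.1 r * h ^ (2 * (-1 : ℤ)) * h⁻¹)⁻¹ by
            norm_num; field_simp,
          show X x.1 r ^ (-1 : ℤ) * h = (X x.1 r * h ^ (2 * (-1 : ℤ)) * h)⁻¹ by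
            norm_num; field_simp, br_inv, br_inv]
        ring
    rw [e3, e4]
    have hA' : X x.1 r ^ x.2 ≠ 0 := zpow_ne_zero _ hA
    generalize X x.1 r ^ x.2 = a at *
    rw [show h⁻¹ * a⁻¹ * h ^ 2 = (a * h⁻¹)⁻¹ by field_simp, br_inv,
      show a * h⁻¹⁻¹ * h ^ 2 = a * h ^ 3 by rw [inv_inv]; ring]
    have e5 : br h (a * h⁻¹) * (br h (a * h⁻¹))⁻¹ = 1 := mul_inv_cancel₀ h1
    have e6 : br h (a * h ^ 3) * (br h (a * h ^ 3))⁻¹ = 1 := mul_inv_cancel₀ h2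
    simp only [div_eq_mul_inv, mul_inv]
    set P := ∏ f ∈ (nb r).erase p, br h (X f.1 f.2)
    set U := Complex.I * P * (br h (a * h))⁻¹ * kk h c X r p x *
      (∏ b ∈ (cols r).erase x.1, (br h (X b r * h) * br h (X b r * h⁻¹)))⁻¹
    linear_combination -U * e5 + U * e6
  · rw [h1]; simp

/-- Two moves of different columns cancel, provided that no denominator vanishes. -/
lemma ww_ne (hh : h ≠ 0) (hw : h ^ 2 - (h ^ 2)⁻¹ ≠ 0) (hX : ∀ a s, X a s ≠ 0) (hA : Adj r r')
    (hx : x ∈ moves r) (hy : y ∈ moves r) (hxy : x.1 ≠ y.1) (hz : z ∈ moves r')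
    (h1 : kk h c X r (z.1, r') x * kk h c (mv h X r x) r (z.1, r') y *
        br h (ev h x (X x.1 r) * (ev h y (X y.1 r))⁻¹ * h ^ 2) +
      kk h c X r (z.1, r') y * kk h c (mv h X r y) r (z.1, r') x *
        br h (ev h y (X y.1 r) * (ev h x (X x.1 r))⁻¹ * h ^ 2) = 0) :
    ww h c X r r' z x y + ww h c X r r' z y x = 0 := by
  obtain ⟨R, h2, h3⟩ := tt_ne hh hw hX hA hx hy hxy hz
  rw [ww_eq hA hz, ww_eq hA hz, h2, h3]
  linear_combination qq h c r r' z X * R * h1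

/-! ### Closed paths -/

/-- The interpolation node of a move. -/
def vv (h : ℂ) (X : ℕ → ℕ → ℂ) (r : ℕ) (x : ℕ × ℤ) : ℂ := yy (ev h x (X x.1 r) * h)

lemma prr_back (hh : h ≠ 0) {e : ℤ} (he : e = 1 ∨ e = -1) :
    prr h r (-e) (A * h ^ (2 * e)) B = prr h r e A B := by
  simp only [prr]
  by_cases hr : Even r
  · simp only [hr, if_true]
    rw [zpow_neg, zpow_shift he, pe_back hh]
  · simp only [hr, if_false]
    rw [po_back he hh]

lemma prr_sq (hh : h ≠ 0) (hw : h ^ 2 - (h ^ 2)⁻¹ ≠ 0) {e : ℤ} (he : e = 1 ∨ e = -1)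
    (hA : A ≠ 0) (hB : B ≠ 0) :
    prr h r e A B * prr h r e A B = (yy B - yy (A ^ e * h)) / (h ^ 2 - (h ^ 2)⁻¹) ^ 2 := by
  simp only [prr]
  split_ifs
  · exact pe_sq hh hw (zpow_ne_zero _ hA) hB
  · exact po_sq he hh hw hB hA

/-- The squared denominators of the roots are products of differences of nodes, as the denominators
in Lagrange's formula should be. -/
lemma vv_sub_pair (hh : h ≠ 0) (hw : h ^ 2 - (h ^ 2)⁻¹ ≠ 0) (hX : ∀ a s, X a s ≠ 0)
    {a b : ℕ} {e : ℤ} (he : e = 1 ∨ e = -1) (hab : a ≠ b) :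
    (vv h X r (a, e) - vv h X r (b, 1)) * (vv h X r (a, e) - vv h X r (b, -1)) =
      ((h ^ 2 - (h ^ 2)⁻¹) ^ 2) ^ 2 * ((nn h X r a b * nn h (mv h X r (a, e)) r a b) *
        (nn h X r a b * nn h (mv h X r (a, e)) r a b)) := by
  have h0 : e ≠ 0 := by omega
  have hA := hX a r
  have hB := hX b r
  have e1 : vv h X r (a, e) = yy (X a r ^ e * h) := by simp [vv, ev, h0]
  have e2 : vv h X r (b, 1) = yy (X b r * h) := by simp [vv, ev]
  have e3 : vv h X r (b, -1) = yy ((X b r)⁻¹ * h) := by simp [vv, ev]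
  have hAe : X a r ^ e ≠ 0 := zpow_ne_zero _ hA
  rw [e1, e2, e3, yy_sub hw (mul_ne_zero hAe hh) (mul_ne_zero hB hh),
    yy_sub hw (mul_ne_zero hAe hh) (mul_ne_zero (inv_ne_zero hB) hh),
    mul_mul_mul_comm (nn h X r a b), nn_sq, nn_sq]
  have e4 : br h (X (min a b) r * (X (max a b) r)⁻¹) *
      br h (mv h X r (a, e) (min a b) r * (mv h X r (a, e) (max a b) r)⁻¹) =
      br h (X a r * (X b r)⁻¹) * br h (X a r * h ^ (2 * e) * (X b r)⁻¹) := by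
    rcases lt_or_gt_of_ne hab with h1 | h1
    · rw [min_eq_left h1.le, max_eq_right h1.le, mv_self, mv_col hab.symm]
    · rw [min_eq_right h1.le, max_eq_left h1.le, mv_self, mv_col hab.symm,
        show X b r * (X a r)⁻¹ = (X a r * (X b r)⁻¹)⁻¹ by rw [mul_inv, inv_inv]; ring, br_inv,
        show X b r * (X a r * h ^ (2 * e))⁻¹ = (X a r * h ^ (2 * e) * (X b r)⁻¹)⁻¹ by
          rw [mul_inv, mul_inv, inv_inv, mul_inv]; ring, br_inv]
      ring
  rw [mul_mul_mul_comm (br h (X a r * X b r)), e4, mv_self, mv_col hab.symm]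
  rcases he with rfl | rfl
  · simp only [zpow_one]
    rw [show X a r * h * (X b r * h) = X a r * h ^ (2 * (1 : ℤ)) * X b r by norm_cast; ring,
      show X a r * h * (X b r * h)⁻¹ = X a r * (X b r)⁻¹ by field_simp,
      show X a r * h * ((X b r)⁻¹ * h) = X a r * h ^ (2 * (1 : ℤ)) * (X b r)⁻¹ by norm_cast; ring,
      show X a r * h * ((X b r)⁻¹ * h)⁻¹ = X a r * X b r by field_simp]
    ring
  · simp only [zpow_neg, zpow_one]
    rw [show h ^ (2 * (-1 : ℤ)) = (h ^ 2)⁻¹ by norm_num,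
      show (X a r)⁻¹ * h * (X b r * h) = (X a r * (h ^ 2)⁻¹ * (X b r)⁻¹)⁻¹ by field_simp, br_inv,
      show (X a r)⁻¹ * h * (X b r * h)⁻¹ = (X a r * X b r)⁻¹ by field_simp, br_inv,
      show (X a r)⁻¹ * h * ((X b r)⁻¹ * h) = (X a r * (h ^ 2)⁻¹ * X b r)⁻¹ by field_simp, br_inv,
      show (X a r)⁻¹ * h * ((X b r)⁻¹ * h)⁻¹ = (X a r * (X b r)⁻¹)⁻¹ by field_simp, br_inv]
    ring

lemma dd_back (hh : h ≠ 0) {a : ℕ} {e : ℤ} :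
    dd h (mv h X r (a, e)) r (a, -e) = dd h X r (a, e) := by
  simp only [dd, mv_neg hh]
  exact prod_congr rfl fun b _ => mul_comm _ _

/-- The product of the coefficients of a move and of the opposite one. -/
lemma kk_mul_kk (hh : h ≠ 0) (hw : h ^ 2 - (h ^ 2)⁻¹ ≠ 0) (hX : ∀ a s, X a s ≠ 0) (hr : 1 ≤ r)
    {a : ℕ} {e : ℤ} (he : e = 1 ∨ e = -1) (hc : c a r ≠ 0) :
    kk h c X r p (a, e) * kk h c (mv h X r (a, e)) r p (a, -e) =
      -((∏ f ∈ (nb r).erase p, (yy (X f.1 f.2) - vv h X r (a, e))) *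
        ((h ^ 2 - (h ^ 2)⁻¹) ^ 2) ^ (2 * #((cols r).erase a)) /
        ((h ^ 2 - (h ^ 2)⁻¹) ^ 2) ^ #((nb r).erase p) /
        (∏ b ∈ (cols r).erase a,
          ((vv h X r (a, e) - vv h X r (b, 1)) * (vv h X r (a, e) - vv h X r (b, -1)))) /
        (den h r e (X a r) * den h r (-e) (X a r * h ^ (2 * e)))) := by
  have h0 : e ≠ 0 := by omega
  have hF : ∀ f ∈ (nb r).erase p, prr h r (-e) (X a r * h ^ (2 * e)) (mv h X r (a, e) f.1 f.2) =
      prr h r e (X a r) (X f.1 f.2) := fun f hf => by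
    rw [mv_row (snd_ne_of_mem_nb hr (mem_of_mem_erase hf)), prr_back hh he]
  have hw2 : (h ^ 2 - (h ^ 2)⁻¹) ^ 2 ≠ 0 := pow_ne_zero _ hw
  have e1 : ∏ b ∈ (cols r).erase a,
      ((vv h X r (a, e) - vv h X r (b, 1)) * (vv h X r (a, e) - vv h X r (b, -1))) =
      ((h ^ 2 - (h ^ 2)⁻¹) ^ 2) ^ (2 * #((cols r).erase a)) *
        (dd h X r (a, e) * dd h X r (a, e)) := by
    rw [pow_mul, dd, ← prod_mul_distrib, ← prod_const, ← prod_mul_distrib]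
    exact prod_congr rfl fun b hb => vv_sub_pair hh hw hX he (ne_of_mem_erase hb).symm
  have e2 : (∏ f ∈ (nb r).erase p, prr h r e (X a r) (X f.1 f.2)) *
      (∏ f ∈ (nb r).erase p, prr h r e (X a r) (X f.1 f.2)) =
      (∏ f ∈ (nb r).erase p, (yy (X f.1 f.2) - vv h X r (a, e))) /
        ((h ^ 2 - (h ^ 2)⁻¹) ^ 2) ^ #((nb r).erase p) := by
    rw [← prod_mul_distrib, ← prod_const, ← prod_div_distrib]
    refine prod_congr rfl fun f _ => ?_
    rw [prr_sq hh hw he (hX _ _) (hX _ _)]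
    simp [vv, ev, h0]
  have e3 : (e : ℂ) * e = 1 := by rcases he with rfl | rfl <;> norm_num
  have e4 : c a r ^ e * c a r ^ (-e) = 1 := by rw [← zpow_add₀ hc]; simp
  simp only [kk, h0, neg_eq_zero, if_false, mv_self, dd_back hh, prod_congr rfl hF]
  rw [e1, mul_div_right_comm _ (((h ^ 2 - (h ^ 2)⁻¹) ^ 2) ^ (2 * #((cols r).erase a))), ← e2]
  have hw3 : ((h ^ 2 - (h ^ 2)⁻¹) ^ 2) ^ (2 * #((cols r).erase a)) ≠ 0 := pow_ne_zero _ hw2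
  generalize ((h ^ 2 - (h ^ 2)⁻¹) ^ 2) ^ (2 * #((cols r).erase a)) = W at hw3
  generalize (∏ f ∈ (nb r).erase p, prr h r e (X a r) (X f.1 f.2)) = P
  have e5 : W * W⁻¹ = 1 := mul_inv_cancel₀ hw3
  push_cast
  simp only [div_eq_mul_inv, mul_inv]
  set D := (dd h X r (a, e))⁻¹
  set E1 := (den h r e (X a r))⁻¹
  set E2 := (den h r (-e) (X a r * h ^ (2 * e)))⁻¹
  linear_combination (-(c a r ^ e * c a r ^ (-e)) * P * P * D * D * E1 * E2) * e3
    - P * P * D * D * E1 * E2 * e4 + P * P * D * D * E1 * E2 * e5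

lemma prod_moves_erase (G : ℕ × ℤ → ℂ) {a : ℕ} {e : ℤ} (ha : a ∈ cols r)
    (he : e = 1 ∨ e = -1) :
    ∏ y ∈ (moves r).erase (a, e), G y = G (a, -e) * (if Even r then 1 else G (0, 0)) *
      ∏ b ∈ (cols r).erase a, (G (b, 1) * G (b, -1)) := by
  have h1 : (moves r).erase (a, e) = insert (a, -e) ((if Even r then ∅ else {(0, 0)}) ∪
      ((cols r).erase a) ×ˢ ({1, -1} : Finset ℤ)) := by
    ext ⟨b, d⟩
    rw [mem_erase, mem_moves, mem_insert, mem_union, mem_product, mem_erase]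
    have h0 : (0, 0) ≠ (a, e) := by
      intro h; have := (Prod.mk.inj h).2; omega
    simp only [ne_eq, Prod.mk.injEq, mem_insert, mem_singleton] at h0 ⊢
    rw [mem_Icc] at ha ⊢
    by_cases hr : Even r <;> simp [hr] <;> omega
  have h2 : (a, -e) ∉ ((if Even r then ∅ else {(0, 0)}) ∪
      ((cols r).erase a) ×ˢ ({1, -1} : Finset ℤ)) := by
    rw [mem_union, mem_product]
    rw [mem_Icc] at ha
    by_cases hr : Even r <;> simp [hr]
    omega
  have h3 : Disjoint (if Even r then (∅ : Finset (ℕ × ℤ)) else {(0, 0)})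
      (((cols r).erase a) ×ˢ ({1, -1} : Finset ℤ)) := by
    by_cases hr : Even r <;> simp [hr]
  rw [h1, prod_insert h2, prod_union h3, prod_product, mul_assoc]
  congr 2
  · by_cases hr : Even r <;> simp [hr]
  · refine prod_congr rfl fun b _ => ?_
    rw [prod_insert (by norm_num), prod_singleton]

lemma card_moves : #(moves r) = 2 * (r / 2) + if Even r then 0 else 1 := by
  rw [moves, card_union_of_disjoint, card_product, Nat.card_Icc]
  · rw [card_insert_of_notMem (by norm_num), card_singleton]
    by_cases hr : Even r <;> simp [hr] <;> omega
  · by_cases hr : Even r <;> simp [hr]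

lemma card_nb (hr : 1 ≤ r) : #(nb r) = (r + 1) / 2 + (r - 1) / 2 := by
  rw [nb, card_union_of_disjoint, card_product, card_product, Nat.card_Icc, Nat.card_Icc]
  · simp
  · rw [disjoint_left]
    rintro ⟨a, s⟩ h1 h2
    simp at h1 h2
    omega

end

section

variable {h : ℂ} {c : ℕ → ℕ → ℂ} {X : ℕ → ℕ → ℂ} {r r' : ℕ} {x y z : ℕ × ℤ} {A B : ℂ}
  {p : ℕ × ℕ}

lemma br_h_sq (hw : h ^ 2 - (h ^ 2)⁻¹ ≠ 0) : br h (h ^ 2) = 1 := div_self hw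

lemma vv_of_ne {a : ℕ} {e : ℤ} (he : e = 1 ∨ e = -1) : vv h X r (a, e) = yy (X a r ^ e * h) := by
  have : e ≠ 0 := by omega
  simp [vv, ev, this]

lemma vv_zero (hh : h ≠ 0) {a : ℕ} : vv h X r (a, 0) = yy 1 := by
  simp [vv, ev, hh]

lemma vv_sub_neg (hh : h ≠ 0) (hw : h ^ 2 - (h ^ 2)⁻¹ ≠ 0) (hX : ∀ a s, X a s ≠ 0)
    {a : ℕ} {e : ℤ} (he : e = 1 ∨ e = -1) :
    vv h X r (a, e) - vv h X r (a, -e) = (h ^ 2 - (h ^ 2)⁻¹) ^ 2 * (e * br h (X a r ^ 2)) := by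
  have hA := hX a r
  have hAe := zpow_ne_zero e hA
  rw [vv_of_ne he, vv_of_ne (by omega), zpow_neg,
    yy_sub hw (mul_ne_zero hAe hh) (mul_ne_zero (inv_ne_zero hAe) hh),
    show X a r ^ e * h * ((X a r ^ e)⁻¹ * h) = h ^ 2 by field_simp,
    show X a r ^ e * h * ((X a r ^ e)⁻¹ * h)⁻¹ = (X a r ^ 2) ^ e by
      rcases he with rfl | rfl
      · simp; field_simp
      · simp; field_simp,
    br_h_sq hw, br_zpow he, one_mul]

lemma vv_sub_zero (hh : h ≠ 0) (hw : h ^ 2 - (h ^ 2)⁻¹ ≠ 0) (hX : ∀ a s, X a s ≠ 0)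
    {a b : ℕ} {e : ℤ} (he : e = 1 ∨ e = -1) :
    vv h X r (a, e) - vv h X r (b, 0) = (h ^ 2 - (h ^ 2)⁻¹) ^ 2 *
      (br h (X a r * h ^ e) * br h (X a r * h ^ e)) := by
  have hA := hX a r
  have hAe := zpow_ne_zero e hA
  rw [vv_of_ne he, vv_zero hh, yy_sub hw (mul_ne_zero hAe hh) one_ne_zero]
  simp only [mul_one, inv_one]
  congr 1
  rcases he with rfl | rfl
  · simp
  · rw [show X a r ^ (-1 : ℤ) * h = (X a r * h ^ (-1 : ℤ))⁻¹ by simp [mul_comm], br_inv]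
    ring

lemma br_ev {a : ℕ} {e : ℤ} (he : e = 1 ∨ e = -1) :
    br h (ev h (a, e) A ^ 2 * h ^ 4) = e * br h ((A * h ^ (2 * e)) ^ 2) := by
  have h0 : e ≠ 0 := by omega
  rw [← br_zpow he]
  congr 1
  simp only [ev, h0, if_false]
  rcases he with rfl | rfl
  · rw [show h ^ (2 * (1 : ℤ)) = h ^ 2 by norm_cast]; simp; ring
  · rw [show h ^ (2 * (-1 : ℤ)) = (h ^ 2)⁻¹ by norm_num]
    simp only [zpow_neg, zpow_one]
    rw [mul_pow, mul_inv, inv_pow, inv_pow, inv_inv]; ring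

lemma card_cols_erase {a : ℕ} (ha : a ∈ cols r) : #((cols r).erase a) + 1 = r / 2 := by
  rw [card_erase_of_mem ha, Nat.card_Icc]
  rw [mem_Icc] at ha; omega

lemma card_nb_erase (hA : Adj r r') {a : ℕ} (ha : a ∈ cols r') :
    #((nb r).erase (a, r')) + 1 = (r + 1) / 2 + (r - 1) / 2 := by
  rw [card_erase_of_mem (hA.mem_nb.2 ha), card_nb hA.1]
  rw [mem_Icc] at ha
  obtain ⟨h1, h2, h3⟩ := hA
  omega

lemma ww_loop (hh : h ≠ 0) (hw : h ^ 2 - (h ^ 2)⁻¹ ≠ 0) (hX : ∀ a s, X a s ≠ 0) (hA : Adj r r')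
    (hx : x ∈ moves r) (hz : z ∈ moves r') (hz0 : z.2 ≠ 0) :
    ww h c X r r' z x (x.1, -x.2) = kk h c X r (z.1, r') x *
      kk h c (mv h X r x) r (z.1, r') (x.1, -x.2) * br h (ev h x (X x.1 r) ^ 2 * h ^ 4) *
      coef h c X r' z := by
  rw [ww_eq hA hz, tt_loop hh hw hX hA hx hz hz0, coef_eq_qq (z := z) hA]
  ring

/-- The numerator of the interpolation formula. -/
def nP (h : ℂ) (X : ℕ → ℕ → ℂ) (r : ℕ) (p : ℕ × ℕ) (x : ℕ × ℤ) : ℂ :=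
  ∏ f ∈ (nb r).erase p, (yy (X f.1 f.2) - vv h X r x)

/-- Every closed path contributes minus one summand of the interpolation formula times the
coefficient of `z`; the trivial move supplies the node `yy 1`. Since `z` lies in an even row it is
never trivial. `hden` guards the cancellation of a denominator that is evaluated after the move. -/
lemma loop_odd (hh : h ≠ 0) (hw : h ^ 2 - (h ^ 2)⁻¹ ≠ 0) (hX : ∀ a s, X a s ≠ 0) (hA : Adj r r')
    (hr : ¬ Even r) (hz : z ∈ moves r') (hc : ∀ a ∈ cols r, c a r ≠ 0)
    (hden : ∀ x ∈ moves r, x.2 ≠ 0 → br h ((X x.1 r * h ^ (2 * x.2)) ^ 2) ≠ 0 ∨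
      nP h X r (z.1, r') x = 0)
    (hL : ∑ x ∈ moves r, nP h X r (z.1, r') x /
      ∏ y ∈ (moves r).erase x, (vv h X r x - vv h X r y) = 1) :
    ∑ x ∈ moves r, ww h c X r r' z x (x.1, -x.2) = -coef h c X r' z := by
  have hr' : Even r' := hA.even.2 hr
  have hz0 : z.2 ≠ 0 := fun h0 => (eq_zero_of_mem hz h0).1 hr'
  have hw2 : (h ^ 2 - (h ^ 2)⁻¹) ^ 2 ≠ 0 := pow_ne_zero _ hw
  have hcard := card_nb_erase hA (col_of_mem hz hz0)
  suffices H : ∀ x ∈ moves r, ww h c X r r' z x (x.1, -x.2) =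
      -(nP h X r (z.1, r') x / ∏ y ∈ (moves r).erase x, (vv h X r x - vv h X r y)) *
        coef h c X r' z by
    rw [sum_congr rfl H, ← sum_mul, sum_neg_distrib, hL]; ring
  intro x hx
  rw [ww_loop hh hw hX hA hx hz hz0]
  congr 1
  by_cases hx0 : x.2 = 0
  · obtain ⟨-, rfl⟩ := eq_zero_of_mem hx hx0
    have e1 : (moves r).erase (0, 0) = cols r ×ˢ {1, -1} := by
      ext ⟨b, d⟩
      rw [mem_erase, mem_moves, mem_product]
      simp [hr]
      omega
    have e2 : ∏ y ∈ (moves r).erase (0, 0), (vv h X r (0, 0) - vv h X r y) =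
        (((h ^ 2 - (h ^ 2)⁻¹) ^ 2) ^ 2) ^ (r / 2) *
          ((∏ b ∈ cols r, (br h (X b r * h) * br h (X b r * h⁻¹))) *
          (∏ b ∈ cols r, (br h (X b r * h) * br h (X b r * h⁻¹)))) := by
      rw [e1, prod_product, ← prod_mul_distrib]
      have : r / 2 = #(cols r) := by rw [Nat.card_Icc]; omega
      rw [this, ← prod_const, ← prod_mul_distrib]
      refine prod_congr rfl fun b _ => ?_
      rw [prod_insert (by norm_num), prod_singleton]
      have e3 := vv_sub_zero (r := r) (a := b) (b := 0) (e := 1) hh hw hX (by simp)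
      have e4 := vv_sub_zero (r := r) (a := b) (b := 0) (e := -1) hh hw hX (by simp)
      rw [← neg_sub (vv h X r (b, 1)), e3, ← neg_sub (vv h X r (b, -1)), e4, zpow_neg, zpow_one]
      ring
    have e3 : nP h X r (z.1, r') (0, 0) = ((h ^ 2 - (h ^ 2)⁻¹) ^ 2) ^ #((nb r).erase (z.1, r')) *
        ((∏ f ∈ (nb r).erase (z.1, r'), br h (X f.1 f.2)) *
        (∏ f ∈ (nb r).erase (z.1, r'), br h (X f.1 f.2))) := by
      rw [nP, ← prod_const, ← prod_mul_distrib, ← prod_mul_distrib]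
      refine prod_congr rfl fun f _ => ?_
      rw [vv_zero hh, yy_sub hw (hX _ _) one_ne_zero]
      simp
    have hcd : #((nb r).erase (z.1, r')) = 2 * (r / 2) := by
      rw [Nat.not_even_iff] at hr; omega
    rw [e2, e3, hcd, pow_mul ((h ^ 2 - (h ^ 2)⁻¹) ^ 2) 2 (r / 2),
      mul_div_mul_left _ _ (pow_ne_zero _ (pow_ne_zero _ hw2))]
    have e4 : br h (ev h (0, 0) (X 0 r) ^ 2 * h ^ 4) = 1 := by
      rw [← br_h_sq hw]
      congr 1
      simp only [ev, if_true]
      field_simp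
    simp only [neg_zero, mv_zero, kk, if_true, e4, mul_one]
    set P := ∏ f ∈ (nb r).erase (z.1, r'), br h (X f.1 f.2)
    set Q := ∏ b ∈ cols r, (br h (X b r * h) * br h (X b r * h⁻¹))
    rw [div_mul_div_comm, ← neg_div]
    congr 1
    linear_combination P * P * Complex.I_mul_I
  · obtain ⟨a, e⟩ := x
    have he := sign_of_mem hx hx0
    have ha := col_of_mem hx hx0
    have hcd : #((nb r).erase (z.1, r')) = 2 * #((cols r).erase a) + 2 := by
      have := card_cols_erase (r := r) (a := a) ha
      rw [Nat.not_even_iff] at hr; omega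
    have hd := hden _ hx hx0
    simp only at ha he hd
    have e1 : den h r e (X a r) * den h r (-e) (X a r * h ^ (2 * e)) =
        (br h (X a r ^ 2) * br h (X a r * h ^ e)) *
          (br h ((X a r * h ^ (2 * e)) ^ 2) * br h (X a r * h ^ e)) := by
      simp only [den, hr, if_false]
      congr 3
      rw [mul_assoc, ← zpow_add₀ hh]; congr 2; ring
    rw [kk_mul_kk hh hw hX hA.1 he (hc a ha), br_ev he, prod_moves_erase _ ha he,
      vv_sub_neg hh hw hX he, vv_sub_zero hh hw hX he, if_neg hr, hcd, e1]
    change -(nP h X r (z.1, r') (a, e) * _ / _ / _ / _) * _ = _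
    generalize nP h X r (z.1, r') (a, e) = P at hd ⊢
    generalize br h ((X a r * h ^ (2 * e)) ^ 2) = b3 at hd ⊢
    generalize br h (X a r ^ 2) = b1
    generalize br h (X a r * h ^ e) = b2
    generalize (∏ b ∈ (cols r).erase a, ((vv h X r (a, e) - vv h X r (b, 1)) *
      (vv h X r (a, e) - vv h X r (b, -1)))) = D
    generalize (h ^ 2 - (h ^ 2)⁻¹) ^ 2 = W at hw2 ⊢
    generalize #((cols r).erase a) = m
    have k1 : W ^ (2 * m) * (W ^ (2 * m + 2))⁻¹ = W⁻¹ * W⁻¹ := by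
      field_simp; ring
    rcases hd with hd | rfl
    · have k2 : b3 * b3⁻¹ = 1 := mul_inv_cancel₀ hd
      have k3 : ((e : ℂ))⁻¹ = e := by rcases he with rfl | rfl <;> norm_num
      simp only [div_eq_mul_inv, mul_inv, k3]
      linear_combination (-e * P * D⁻¹ * b1⁻¹ * b2⁻¹ * b2⁻¹ * b3⁻¹ * b3) * k1
        - (e * P * D⁻¹ * b1⁻¹ * b2⁻¹ * b2⁻¹ * W⁻¹ * W⁻¹) * k2
    · simp

lemma den_even (hr : Even r) (e : ℤ) : den h r e A = A + A⁻¹ := by simp [den, hr]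

lemma br_sq (A : ℂ) (hA : A ≠ 0) : br h (A ^ 2) = br h A * (A + A⁻¹) := by
  simp only [br]
  rw [div_mul_eq_mul_div]
  congr 1
  field_simp
  ring

lemma add_inv_zpow {e : ℤ} (he : e = 1 ∨ e = -1) : A ^ e + (A ^ e)⁻¹ = A + A⁻¹ := by
  rcases he with rfl | rfl
  · simp
  · simp [add_comm]

/-- The weight of a closed path in a row of even number. -/
lemma kk_loop_even (hh : h ≠ 0) (hw : h ^ 2 - (h ^ 2)⁻¹ ≠ 0) (hX : ∀ a s, X a s ≠ 0) (hA : Adj r r')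
    (hr : Even r) (hz : z ∈ moves r') (hz0 : z.2 ≠ 0) (hc : ∀ a ∈ cols r, c a r ≠ 0)
    (hθ : ∀ x ∈ moves r, X x.1 r * h ^ (2 * x.2) + (X x.1 r * h ^ (2 * x.2))⁻¹ ≠ 0)
    {a : ℕ} {e : ℤ} (hx : (a, e) ∈ moves r) :
    kk h c X r (z.1, r') (a, e) * kk h c (mv h X r (a, e)) r (z.1, r') (a, -e) *
      br h (ev h (a, e) (X a r) ^ 2 * h ^ 4) =
      -(nP h X r (z.1, r') (a, e) / (∏ b ∈ (cols r).erase a,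
        ((vv h X r (a, e) - vv h X r (b, 1)) * (vv h X r (a, e) - vv h X r (b, -1))))) *
        (br h (X a r ^ e * h ^ 2) / (X a r + (X a r)⁻¹)) := by
  have hx0 : e ≠ 0 := fun h0 => (eq_zero_of_mem hx h0).1 hr
  have he := sign_of_mem hx hx0
  have ha := col_of_mem hx hx0
  have hw2 : (h ^ 2 - (h ^ 2)⁻¹) ^ 2 ≠ 0 := pow_ne_zero _ hw
  have hcard := card_nb_erase hA (col_of_mem hz hz0)
  have hcd : #((nb r).erase (z.1, r')) = 2 * #((cols r).erase a) := by
    have := card_cols_erase (r := r) (a := a) ha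
    rw [Nat.even_iff] at hr; omega
  have k0 := hθ _ hx
  simp only at ha he k0
  have hA0 := mul_ne_zero (hX a r) (zpow_ne_zero (2 * e) hh)
  rw [kk_mul_kk hh hw hX hA.1 he (hc a ha), br_ev he, den_even hr, den_even hr, hcd,
    br_sq _ hA0]
  change -(nP h X r (z.1, r') (a, e) * _ / _ / _ / _) * _ = _
  rw [mul_div_cancel_right₀ _ (pow_ne_zero _ hw2), ← zpow_shift he, br_zpow he]
  generalize X a r * h ^ (2 * e) + (X a r * h ^ (2 * e))⁻¹ = θ at k0 ⊢
  have k1 : θ * θ⁻¹ = 1 := mul_inv_cancel₀ k0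
  simp only [div_eq_mul_inv, mul_inv]
  generalize (∏ b ∈ (cols r).erase a, ((vv h X r (a, e) - vv h X r (b, 1)) *
      (vv h X r (a, e) - vv h X r (b, -1))))⁻¹ = D
  linear_combination (-nP h X r (z.1, r') (a, e) * D * (X a r + (X a r)⁻¹)⁻¹ * e *
    br h (X a r * h ^ (2 * e))) * k1

/-- In an even row there is no trivial move and the denominators are `A + A⁻¹`. Compared with
Lagrange's formula the closed path has the surplus factor `[A^e q][A]`, which is a difference of a
node and `yy h`. So the numerator gains the zero `yy h`, which restores the right degree and changes
the sign of the sum. -/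
lemma loop_even (hh : h ≠ 0) (hw : h ^ 2 - (h ^ 2)⁻¹ ≠ 0) (hX : ∀ a s, X a s ≠ 0) (hA : Adj r r')
    (hr : Even r) (hz : z ∈ moves r') (hz0 : z.2 ≠ 0) (hc : ∀ a ∈ cols r, c a r ≠ 0)
    (hθ : ∀ x ∈ moves r, X x.1 r * h ^ (2 * x.2) + (X x.1 r * h ^ (2 * x.2))⁻¹ ≠ 0)
    (hb : ∀ a ∈ cols r, br h (X a r) ≠ 0)
    (hL : ∑ x ∈ moves r, ((yy h - vv h X r x) * nP h X r (z.1, r') x) /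
      ∏ y ∈ (moves r).erase x, (vv h X r x - vv h X r y) = -1) :
    ∑ x ∈ moves r, ww h c X r r' z x (x.1, -x.2) = -coef h c X r' z := by
  have hw2 : (h ^ 2 - (h ^ 2)⁻¹) ^ 2 ≠ 0 := pow_ne_zero _ hw
  suffices H : ∀ x ∈ moves r, ww h c X r r' z x (x.1, -x.2) =
      ((yy h - vv h X r x) * nP h X r (z.1, r') x /
        ∏ y ∈ (moves r).erase x, (vv h X r x - vv h X r y)) * coef h c X r' z by
    rw [sum_congr rfl H, ← sum_mul, hL]; ring
  rintro ⟨a, e⟩ hx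
  rw [ww_loop hh hw hX hA hx hz hz0]
  congr 1
  have hx0 : e ≠ 0 := fun h0 => (eq_zero_of_mem hx h0).1 hr
  have he := sign_of_mem hx hx0
  have ha := col_of_mem hx hx0
  simp only at ha he
  have hAe := zpow_ne_zero e (hX a r)
  rw [kk_loop_even hh hw hX hA hr hz hz0 hc hθ hx, prod_moves_erase _ ha he, if_pos hr,
    vv_sub_neg hh hw hX he, br_sq _ (hX a r), ← neg_sub (vv h X r (a, e)),
    show vv h X r (a, e) - yy h = (h ^ 2 - (h ^ 2)⁻¹) ^ 2 *
      (br h (X a r ^ e * h ^ 2) * (e * br h (X a r))) by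
      rw [vv_of_ne he, yy_sub hw (mul_ne_zero hAe hh) hh, ← br_zpow he]
      congr 3 <;> field_simp]
  have k2 := mul_inv_cancel₀ (hb a ha)
  have k1 := mul_inv_cancel₀ hw2
  have k3 : ((e : ℂ))⁻¹ = e := by rcases he with rfl | rfl <;> norm_num
  have k4 : (e : ℂ) * e = 1 := by rcases he with rfl | rfl <;> norm_num
  simp only [div_eq_mul_inv, mul_inv, k3]
  generalize (∏ b ∈ (cols r).erase a, ((vv h X r (a, e) - vv h X r (b, 1)) *
      (vv h X r (a, e) - vv h X r (b, -1))))⁻¹ = D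
  generalize (h ^ 2 - (h ^ 2)⁻¹) ^ 2 = W at k1 ⊢
  set T := nP h X r (z.1, r') (a, e) * D * br h (X a r ^ e * h ^ 2) * (X a r + (X a r)⁻¹)⁻¹
  linear_combination (T * e * e * br h (X a r) * (br h (X a r))⁻¹) * k1 +
    T * e * e * k2 + T * k4

/-- If the coordinate of column `a₀` is `1`, both its nodes equal the extra zero `yy h`. Its two
moves have equal weights, each with a factor `1/2` from `A + A⁻¹ = 2`, so together they give one
Lagrange summand. Dropping one of the two nodes along with the extra zero leaves the formula for the
remaining nodes. -/
lemma loop_even_special (hh : h ≠ 0) (hw : h ^ 2 - (h ^ 2)⁻¹ ≠ 0) (hX : ∀ a s, X a s ≠ 0)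
    (hA : Adj r r') (hr : Even r) (hz : z ∈ moves r') (hz0 : z.2 ≠ 0)
    (hc : ∀ a ∈ cols r, c a r ≠ 0)
    (hθ : ∀ x ∈ moves r, X x.1 r * h ^ (2 * x.2) + (X x.1 r * h ^ (2 * x.2))⁻¹ ≠ 0)
    {a₀ : ℕ} (ha₀ : a₀ ∈ cols r) (h1 : X a₀ r = 1)
    (hb : ∀ a ∈ cols r, a ≠ a₀ → br h (X a r) ≠ 0)
    (hL : ∑ x ∈ (moves r).erase (a₀, -1), nP h X r (z.1, r') x /
      ∏ y ∈ ((moves r).erase (a₀, -1)).erase x, (vv h X r x - vv h X r y) = 1) :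
    ∑ x ∈ moves r, ww h c X r r' z x (x.1, -x.2) = -coef h c X r' z := by
  have hw2 : (h ^ 2 - (h ^ 2)⁻¹) ^ 2 ≠ 0 := pow_ne_zero _ hw
  have hm : ∀ e : ℤ, (e = 1 ∨ e = -1) → (a₀, e) ∈ moves r := fun e he =>
    mem_moves.2 (Or.inl ⟨ha₀, he⟩)
  have hv : ∀ e : ℤ, (e = 1 ∨ e = -1) → vv h X r (a₀, e) = yy h := fun e he => by
    rw [vv_of_ne he, h1, one_zpow, one_mul]
  have hnP : ∀ e : ℤ, (e = 1 ∨ e = -1) → nP h X r (z.1, r') (a₀, e) =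
      nP h X r (z.1, r') (a₀, 1) := fun e he => by
    rw [nP, nP, hv e he, hv 1 (by simp)]
  set D := ∏ b ∈ (cols r).erase a₀,
    ((vv h X r (a₀, 1) - vv h X r (b, 1)) * (vv h X r (a₀, 1) - vv h X r (b, -1))) with hD
  have hw0 : ∀ e : ℤ, (e = 1 ∨ e = -1) → ww h c X r r' z (a₀, e) (a₀, -e) =
      -(nP h X r (z.1, r') (a₀, 1) / D) * (1 / 2) * coef h c X r' z := by
    intro e he
    have := ww_loop (c := c) hh hw hX hA (hm e he) hz hz0
    simp only at this
    rw [this, kk_loop_even hh hw hX hA hr hz hz0 hc hθ (hm e he), hnP e he, hv e he,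
      ← hv 1 (by simp), ← hD, h1, one_zpow, one_mul, br_h_sq hw]
    norm_num
  have hD' : ∏ y ∈ ((moves r).erase (a₀, -1)).erase (a₀, 1),
      (vv h X r (a₀, 1) - vv h X r y) = D := by
    have h2 := prod_moves_erase (r := r) (fun y => if y = (a₀, -1) then 1 else
      vv h X r (a₀, 1) - vv h X r y) ha₀ (e := 1) (by simp)
    rw [if_pos hr, if_pos rfl, mul_one, one_mul,
      ← mul_prod_erase _ _ (mem_erase.2 ⟨by simp, hm (-1) (by simp)⟩ :
        (a₀, (-1 : ℤ)) ∈ (moves r).erase (a₀, 1)), if_pos rfl, one_mul] at h2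
    rw [erase_right_comm, hD]
    have e1 : ∀ y ∈ ((moves r).erase (a₀, 1)).erase (a₀, -1),
        (vv h X r (a₀, 1) - vv h X r y) = if y = (a₀, -1) then 1 else
          vv h X r (a₀, 1) - vv h X r y := fun y hy => by
      rw [if_neg (ne_of_mem_erase hy)]
    rw [prod_congr rfl e1, h2]
    refine prod_congr rfl fun b hb => ?_
    have := ne_of_mem_erase hb
    rw [if_neg (by simp [this]), if_neg (by simp [this])]
  rw [← add_sum_erase _ _ (hm (-1) (by simp)),
    ← add_sum_erase _ _ (mem_erase.2 ⟨by simp, hm 1 (by simp)⟩ :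
      (a₀, (1 : ℤ)) ∈ (moves r).erase (a₀, -1))]
  rw [← add_sum_erase _ _ (mem_erase.2 ⟨by simp, hm 1 (by simp)⟩ :
      (a₀, (1 : ℤ)) ∈ (moves r).erase (a₀, -1)), hD'] at hL
  have hrest : ∀ x ∈ ((moves r).erase (a₀, -1)).erase (a₀, 1), ww h c X r r' z x (x.1, -x.2) =
      -(nP h X r (z.1, r') x / ∏ y ∈ ((moves r).erase (a₀, -1)).erase x,
        (vv h X r x - vv h X r y)) * coef h c X r' z := by
    rintro ⟨a, e⟩ hx'
    have hx := mem_of_mem_erase (mem_of_mem_erase hx')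
    rw [ww_loop hh hw hX hA hx hz hz0]
    congr 1
    have hx0 : e ≠ 0 := fun h0 => (eq_zero_of_mem hx h0).1 hr
    have he := sign_of_mem hx hx0
    have ha := col_of_mem hx hx0
    simp only at ha he
    have haa : a ≠ a₀ := by
      rintro rfl
      have h3 := ne_of_mem_erase hx'
      have h4 := ne_of_mem_erase (mem_of_mem_erase hx')
      rcases he with rfl | rfl
      · exact h3 rfl
      · exact h4 rfl
    have hAe := zpow_ne_zero e (hX a r)
    have hmem : (a₀, (-1 : ℤ)) ∈ (moves r).erase (a, e) :=
      mem_erase.2 ⟨by simp [haa.symm], hm (-1) (by simp)⟩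
    have hPr : (vv h X r (a, e) - yy h) * ∏ y ∈ ((moves r).erase (a₀, -1)).erase (a, e),
        (vv h X r (a, e) - vv h X r y) = ∏ y ∈ (moves r).erase (a, e),
        (vv h X r (a, e) - vv h X r y) := by
      rw [erase_right_comm, ← hv (-1) (by simp), mul_prod_erase _ (fun y =>
        vv h X r (a, e) - vv h X r y) hmem]
    rw [prod_moves_erase _ ha he, if_pos hr, mul_one] at hPr
    have hv1 : vv h X r (a, e) - yy h = (h ^ 2 - (h ^ 2)⁻¹) ^ 2 *
        (br h (X a r ^ e * h ^ 2) * (e * br h (X a r))) := by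
      rw [vv_of_ne he, yy_sub hw (mul_ne_zero hAe hh) hh, ← br_zpow he]
      congr 3 <;> field_simp
    -- The double node of `a₀` contributes a square, so that both sides vanish when the node of `a`
    -- also equals `yy h`.
    have hva : (vv h X r (a, e) - yy h) * (vv h X r (a, e) - yy h) ∣
        ∏ b ∈ (cols r).erase a,
          ((vv h X r (a, e) - vv h X r (b, 1)) * (vv h X r (a, e) - vv h X r (b, -1))) := by
      have := dvd_prod_of_mem (fun b => (vv h X r (a, e) - vv h X r (b, 1)) *
        (vv h X r (a, e) - vv h X r (b, -1))) (mem_erase.2 ⟨haa.symm, ha₀⟩)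
      simpa only [hv 1 (by simp), hv (-1) (by simp)] using this
    obtain ⟨D', hD'⟩ := hva
    rw [kk_loop_even hh hw hX hA hr hz hz0 hc hθ hx]
    rw [vv_sub_neg hh hw hX he, br_sq _ (hX a r)] at hPr
    by_cases ht : vv h X r (a, e) - yy h = 0
    · have hz1 : ∏ y ∈ ((moves r).erase (a₀, -1)).erase (a, e),
          (vv h X r (a, e) - vv h X r y) = 0 := by
        refine prod_eq_zero (i := (a₀, 1)) ?_ (by rw [hv 1 (by simp), ht])
        exact mem_erase.2 ⟨by simp [haa.symm], mem_erase.2 ⟨by simp, hm 1 (by simp)⟩⟩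
      rw [hz1, hD', ht]; simp
    · have hPr' : ∏ y ∈ ((moves r).erase (a₀, -1)).erase (a, e),
          (vv h X r (a, e) - vv h X r y) = (vv h X r (a, e) - yy h)⁻¹ *
          ((h ^ 2 - (h ^ 2)⁻¹) ^ 2 * (e * (br h (X a r) * (X a r + (X a r)⁻¹))) *
          ∏ b ∈ (cols r).erase a,
          ((vv h X r (a, e) - vv h X r (b, 1)) * (vv h X r (a, e) - vv h X r (b, -1)))) := by
        rw [← hPr, inv_mul_cancel_left₀ ht]
      rw [hPr', hv1]
      have k2 := mul_inv_cancel₀ (hb a ha haa)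
      have k1 := mul_inv_cancel₀ hw2
      have k3 : ((e : ℂ))⁻¹ = e := by rcases he with rfl | rfl <;> norm_num
      have k4 : (e : ℂ) * e = 1 := by rcases he with rfl | rfl <;> norm_num
      simp only [div_eq_mul_inv, mul_inv, k3, inv_inv]
      generalize (∏ b ∈ (cols r).erase a, ((vv h X r (a, e) - vv h X r (b, 1)) *
          (vv h X r (a, e) - vv h X r (b, -1))))⁻¹ = D
      generalize (h ^ 2 - (h ^ 2)⁻¹) ^ 2 = W at k1 ⊢
      set T := nP h X r (z.1, r') (a, e) * D * br h (X a r ^ e * h ^ 2) * (X a r + (X a r)⁻¹)⁻¹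
      linear_combination (T * e * e * br h (X a r) * (br h (X a r))⁻¹) * k1 +
        T * e * e * k2 + T * k4
  have e0 := hw0 (-1) (by simp)
  rw [sum_congr rfl hrest, hw0 1 (by simp), e0, ← sum_mul, sum_neg_distrib]
  linear_combination (-coef h c X r' z) * hL

/-- The weight of a closed path in a row of even number, if the other move is trivial. -/
lemma ww_loop_zero (hh : h ≠ 0) (hw : h ^ 2 - (h ^ 2)⁻¹ ≠ 0) (hX : ∀ a s, X a s ≠ 0)
    (hA : Adj r r') (hr : Even r) (hz : z ∈ moves r') (hz0 : z.2 = 0)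
    (hc : ∀ a ∈ cols r, c a r ≠ 0)
    (hθ : ∀ x ∈ moves r, X x.1 r * h ^ (2 * x.2) + (X x.1 r * h ^ (2 * x.2))⁻¹ ≠ 0)
    {a : ℕ} {e : ℤ} (hx : (a, e) ∈ moves r) :
    ww h c X r r' z (a, e) (a, -e) =
      (nP h X r (z.1, r') (a, e) / (∏ b ∈ (cols r).erase a,
        ((vv h X r (a, e) - vv h X r (b, 1)) * (vv h X r (a, e) - vv h X r (b, -1))))) *
        (e / (X a r + (X a r)⁻¹)) / (h ^ 2 - (h ^ 2)⁻¹) ^ 2 *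
        (qq h c r r' z X * ∏ b ∈ (cols r).erase a, br h (X b r)) := by
  have hx0 : e ≠ 0 := fun h0 => (eq_zero_of_mem hx h0).1 hr
  have he := sign_of_mem hx hx0
  have ha := col_of_mem hx hx0
  have hw2 : (h ^ 2 - (h ^ 2)⁻¹) ^ 2 ≠ 0 := pow_ne_zero _ hw
  have hz1 := (eq_zero_of_mem hz hz0).2
  have hn : (z.1, r') ∉ nb r := by rw [hA.mem_nb, hz1]; simp
  have hcd : #((nb r).erase (z.1, r')) = 2 * #((cols r).erase a) + 1 := by
    have := card_cols_erase (r := r) (a := a) ha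
    rw [erase_eq_of_notMem hn, card_nb hA.1]
    rw [Nat.even_iff] at hr; omega
  have k0 := hθ _ hx
  simp only at ha he k0
  have h2 := tt_loop_zero (z := z) hh hw hX hA hx hx0 hz0
  simp only at h2
  rw [ww_eq hA hz, kk_mul_kk hh hw hX hA.1 he (hc a ha), h2, den_even hr, den_even hr, hcd,
    ← zpow_shift he, add_inv_zpow he]
  change -(nP h X r (z.1, r') (a, e) * _ / _ / _ / _) * _ * _ = _
  generalize X a r * h ^ (2 * e) + (X a r * h ^ (2 * e))⁻¹ = θ at k0 ⊢
  have k1 : θ * θ⁻¹ = 1 := mul_inv_cancel₀ k0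
  have hw3 : ((h ^ 2 - (h ^ 2)⁻¹) ^ 2) ^ (2 * #((cols r).erase a)) ≠ 0 := pow_ne_zero _ hw2
  rw [pow_succ ((h ^ 2 - (h ^ 2)⁻¹) ^ 2) (2 * #((cols r).erase a))]
  generalize ((h ^ 2 - (h ^ 2)⁻¹) ^ 2) ^ (2 * #((cols r).erase a)) = V at hw3
  have k2 : V * V⁻¹ = 1 := mul_inv_cancel₀ hw3
  simp only [div_eq_mul_inv, mul_inv]
  generalize (∏ b ∈ (cols r).erase a, ((vv h X r (a, e) - vv h X r (b, 1)) *
      (vv h X r (a, e) - vv h X r (b, -1))))⁻¹ = D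
  generalize (∏ b ∈ (cols r).erase a, br h (X b r)) = D2
  generalize ((h ^ 2 - (h ^ 2)⁻¹) ^ 2)⁻¹ = W
  set T := nP h X r (z.1, r') (a, e) * D * D2 * W * qq h c r r' z X * e * (X a r + (X a r)⁻¹)⁻¹
  linear_combination T * V * V⁻¹ * k1 + T * k2

/-- With `z` trivial no neighbour is removed from the numerator, so its degree is already right and
no extra zero enters. -/
lemma loop_zero (hh : h ≠ 0) (hw : h ^ 2 - (h ^ 2)⁻¹ ≠ 0) (hX : ∀ a s, X a s ≠ 0)
    (hA : Adj r r') (hr : Even r) (hz : z ∈ moves r') (hz0 : z.2 = 0)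
    (hc : ∀ a ∈ cols r, c a r ≠ 0)
    (hθ : ∀ x ∈ moves r, X x.1 r * h ^ (2 * x.2) + (X x.1 r * h ^ (2 * x.2))⁻¹ ≠ 0)
    (hb : ∀ a ∈ cols r, br h (X a r) ≠ 0)
    (hL : ∑ x ∈ moves r, nP h X r (z.1, r') x /
      ∏ y ∈ (moves r).erase x, (vv h X r x - vv h X r y) = -1) :
    ∑ x ∈ moves r, ww h c X r r' z x (x.1, -x.2) = -coef h c X r' z := by
  suffices H : ∀ x ∈ moves r, ww h c X r r' z x (x.1, -x.2) =
      (nP h X r (z.1, r') x /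
        ∏ y ∈ (moves r).erase x, (vv h X r x - vv h X r y)) * coef h c X r' z by
    rw [sum_congr rfl H, ← sum_mul, hL]; ring
  rintro ⟨a, e⟩ hx
  have hx0 : e ≠ 0 := fun h0 => (eq_zero_of_mem hx h0).1 hr
  have he := sign_of_mem hx hx0
  have ha := col_of_mem hx hx0
  simp only at ha he
  have h2 : ∏ b ∈ cols r, br h (X b r) = br h (X a r) * ∏ b ∈ (cols r).erase a, br h (X b r) :=
    (mul_prod_erase _ _ ha).symm
  rw [ww_loop_zero hh hw hX hA hr hz hz0 hc hθ hx, prod_moves_erase _ ha he, if_pos hr,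
    vv_sub_neg hh hw hX he, br_sq _ (hX a r), coef_eq_qq (z := z) hA, ff]
  simp only [hf, hz0, if_true]
  rw [h2]
  have k2 := mul_inv_cancel₀ (hb a ha)
  have k3 : ((e : ℂ))⁻¹ = e := by rcases he with rfl | rfl <;> norm_num
  simp only [div_eq_mul_inv, mul_inv, k3]
  generalize (∏ b ∈ (cols r).erase a, ((vv h X r (a, e) - vv h X r (b, 1)) *
      (vv h X r (a, e) - vv h X r (b, -1))))⁻¹ = D
  generalize (∏ b ∈ (cols r).erase a, br h (X b r)) = D2
  generalize ((h ^ 2 - (h ^ 2)⁻¹) ^ 2)⁻¹ = W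
  set T := nP h X r (z.1, r') (a, e) * D * D2 * W * qq h c r r' z X * e * (X a r + (X a r)⁻¹)⁻¹
  linear_combination -T * k2

/-- Both sides are zero. The diagonal coefficient contains `[X a₀ r] = 0`, as do the closed paths of
all other columns, and the two moves of `a₀` cancel by their signs. -/
lemma loop_zero_special (hh : h ≠ 0) (hw : h ^ 2 - (h ^ 2)⁻¹ ≠ 0) (hX : ∀ a s, X a s ≠ 0)
    (hA : Adj r r') (hr : Even r) (hz : z ∈ moves r') (hz0 : z.2 = 0)
    (hc : ∀ a ∈ cols r, c a r ≠ 0)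
    (hθ : ∀ x ∈ moves r, X x.1 r * h ^ (2 * x.2) + (X x.1 r * h ^ (2 * x.2))⁻¹ ≠ 0)
    {a₀ : ℕ} (ha₀ : a₀ ∈ cols r) (h1 : X a₀ r = 1) :
    ∑ x ∈ moves r, ww h c X r r' z x (x.1, -x.2) = -coef h c X r' z := by
  have hb : br h (X a₀ r) = 0 := by rw [h1, br_one]
  have hcf : coef h c X r' z = 0 := by
    rw [coef_eq_qq (z := z) hA, ff]
    simp only [hf, hz0, if_true]
    rw [prod_eq_zero ha₀ hb, mul_zero]
  have hm : ∀ e : ℤ, (e = 1 ∨ e = -1) → (a₀, e) ∈ moves r := fun e he =>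
    mem_moves.2 (Or.inl ⟨ha₀, he⟩)
  have hv : ∀ e : ℤ, (e = 1 ∨ e = -1) → vv h X r (a₀, e) = yy h := fun e he => by
    rw [vv_of_ne he, h1, one_zpow, one_mul]
  have h3 := ww_loop_zero hh hw hX hA hr hz hz0 hc hθ (hm (-1) (by simp))
  have h4 := ww_loop_zero hh hw hX hA hr hz hz0 hc hθ (hm 1 (by simp))
  have h5 : nP h X r (z.1, r') (a₀, -1) = nP h X r (z.1, r') (a₀, 1) := by
    rw [nP, nP, hv _ (by simp), hv _ (by simp)]
  rw [hcf, neg_zero, ← add_sum_erase _ _ (hm (-1) (by simp)),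
    ← add_sum_erase _ _ (mem_erase.2 ⟨by simp, hm 1 (by simp)⟩ :
      (a₀, (1 : ℤ)) ∈ (moves r).erase (a₀, -1)), ← add_assoc]
  simp only at h3 h4 ⊢
  rw [h3, h4, h5, hv (-1) (by simp), hv 1 (by simp), sum_eq_zero]
  · push_cast; ring
  · rintro ⟨a, e⟩ hx'
    have hx := mem_of_mem_erase (mem_of_mem_erase hx')
    have hx0 : e ≠ 0 := fun h0 => (eq_zero_of_mem hx h0).1 hr
    have he := sign_of_mem hx hx0
    have haa : a ≠ a₀ := by
      rintro rfl
      have h3 := ne_of_mem_erase hx'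
      have h4 := ne_of_mem_erase (mem_of_mem_erase hx')
      rcases he with he | he <;> simp only at he <;> subst he
      · exact h3 rfl
      · exact h4 rfl
    have hz2 : ∏ b ∈ (cols r).erase a, br h (X b r) = 0 :=
      prod_eq_zero (mem_erase.2 ⟨haa.symm, ha₀⟩) hb
    simp only
    rw [ww_loop_zero hh hw hX hA hr hz hz0 hc hθ hx, hz2]
    simp

end

namespace Omega

variable {P : Omega}

/-! ### Powers of `q` -/

variable (P) in
/-- The square root `q ^ (1 / 2)`. -/
def hq : ℂ := P.qp (1 / 2)

lemma qp_add (x y : ℂ) : P.qp (x + y) = P.qp x * P.qp y := by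
  rw [qp, qp, qp, ← Complex.exp_add]; congr 1; ring

lemma qp_neg (x : ℂ) : P.qp (-x) = (P.qp x)⁻¹ := by
  rw [qp, qp, ← Complex.exp_neg]; congr 1; ring

lemma qp_sub (x y : ℂ) : P.qp (x - y) = P.qp x * (P.qp y)⁻¹ := by
  rw [sub_eq_add_neg, qp_add, qp_neg]

lemma qp_ne_zero (x : ℂ) : P.qp x ≠ 0 := Complex.exp_ne_zero _

lemma hq_ne_zero : P.hq ≠ 0 := qp_ne_zero _

lemma hq_zpow (z : ℤ) : P.hq ^ z = P.qp (z / 2) := by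
  rw [hq, qp, qp, ← Complex.exp_int_mul]; congr 1; ring

lemma hq_sq : P.hq ^ 2 = P.qp 1 := by
  have := hq_zpow (P := P) 2
  norm_num at this
  exact_mod_cast this

lemma qn_eq (x : ℂ) : P.qn x = br P.hq (P.qp x) := by
  rw [qn, br, hq_sq, qp_neg, qp_neg]

lemma qp_eq_one_iff (hk : P.k ≠ 0) (x : ℂ) : P.qp x = 1 ↔ ∃ m : ℤ, P.ρ * x = P.k * m := by
  have h2 : (P.k : ℂ) ≠ 0 := Nat.cast_ne_zero.2 hk
  rw [qp, Complex.exp_eq_one_iff]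
  have h1 : (2 * Real.pi * Complex.I : ℂ) ≠ 0 := Complex.two_pi_I_ne_zero
  refine exists_congr fun m => ?_
  rw [div_eq_iff h2]
  constructor
  · intro h
    apply mul_left_cancel₀ h1
    linear_combination h
  · intro h
    linear_combination (2 * Real.pi * Complex.I) * h

lemma Admissible.k_ne_zero (hP : P.Admissible) : P.k ≠ 0 := by have := hP.k_ge; omega

lemma hq_zpow_sq_eq_one_iff (hP : P.Admissible) (z : ℤ) :
    P.hq ^ z * P.hq ^ z = 1 ↔ (P.k : ℤ) ∣ z := by
  rw [← zpow_add₀ hq_ne_zero, hq_zpow, qp_eq_one_iff hP.k_ne_zero]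
  have hc : IsCoprime (P.k : ℤ) P.ρ := by
    rw [Int.isCoprime_iff_gcd_eq_one, Int.gcd_comm]; exact hP.coprime
  constructor
  · rintro ⟨m, hm⟩
    refine hc.dvd_of_dvd_mul_left ⟨m, ?_⟩
    have : (P.ρ * z : ℂ) = P.k * m := by rw [← hm]; push_cast; ring
    exact_mod_cast this
  · rintro ⟨m, rfl⟩
    exact ⟨P.ρ * m, by push_cast; ring⟩

lemma hq_w (hP : P.Admissible) : P.hq ^ 2 - (P.hq ^ 2)⁻¹ ≠ 0 := by
  intro h
  have h1 := (hq_zpow_sq_eq_one_iff hP 2).1 (by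
    have h2 : P.hq ^ 2 ≠ 0 := pow_ne_zero _ hq_ne_zero
    rw [sub_eq_zero] at h
    rw [zpow_ofNat]
    nth_rewrite 2 [h]
    exact mul_inv_cancel₀ h2)
  have h3 := Int.le_of_dvd (by norm_num) h1
  have h4 := hP.k_ge
  omega

lemma br_eq_zero_iff (hP : P.Admissible) {x : ℂ} (hx : x ≠ 0) : br P.hq x = 0 ↔ x * x = 1 := by
  rw [br, div_eq_zero_iff, or_iff_left (hq_w hP), sub_eq_zero]
  constructor
  · intro h
    nth_rewrite 2 [h]
    exact mul_inv_cancel₀ hx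
  · exact fun h => eq_inv_of_mul_eq_one_left h

lemma br_zpow_eq_zero_iff (hP : P.Admissible) (z : ℤ) :
    br P.hq (P.hq ^ z) = 0 ↔ (P.k : ℤ) ∣ z := by
  rw [br_eq_zero_iff hP (zpow_ne_zero _ hq_ne_zero), hq_zpow_sq_eq_one_iff hP]

/-- No product of `A` with a power of `q ^ (1 / 2)` has a vanishing `q`-number. -/
def _root_.NonstdSo.IsGen (h A : ℂ) : Prop := ∀ z : ℤ, br h (A * h ^ z) ≠ 0

lemma _root_.NonstdSo.IsGen.inv {h A : ℂ} (hA : IsGen h A) : IsGen h A⁻¹ := fun z => by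
  have := hA (-z)
  rw [show A⁻¹ * h ^ z = (A * h ^ (-z))⁻¹ by rw [zpow_neg, mul_inv, inv_inv], br_inv]
  exact neg_ne_zero.2 this

lemma _root_.NonstdSo.IsGen.mul_zpow {h A : ℂ} (hh : h ≠ 0) (hA : IsGen h A) (z : ℤ) :
    IsGen h (A * h ^ z) := fun z' => by
  rw [mul_assoc, ← zpow_add₀ hh]; exact hA _

lemma _root_.NonstdSo.IsGen.ne {h A : ℂ} (hA : IsGen h A) : br h A ≠ 0 := by
  simpa using hA 0

lemma Generic.isGen (hP : P.Admissible) {x : ℂ} (hx : P.Generic x) : IsGen P.hq (P.qp x) := by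
  intro z h
  rw [br_eq_zero_iff hP (mul_ne_zero (qp_ne_zero _) (zpow_ne_zero _ hq_ne_zero)), hq_zpow,
    ← qp_add, ← qp_add, qp_eq_one_iff hP.k_ne_zero] at h
  obtain ⟨m, hm⟩ := h
  apply hx (P.k * m - P.ρ * z)
  push_cast
  linear_combination hm

/-! ### The coordinates of a tableau -/

variable (P) in
/-- The multiplicative coordinates `q ^ (m_{j,s} + s / 2 - j)`. -/
def xx (ξ : ℕ → ℕ → ℤ) (j s : ℕ) : ℂ := P.qp (P.entry ξ j s + s / 2 - j)

lemma xx_ne_zero (ξ : ℕ → ℕ → ℤ) (j s : ℕ) : P.xx ξ j s ≠ 0 := qp_ne_zero _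

variable (P) in
/-- The parameters `h_{j,s}` and `m_{j,n}`. -/
def base (j s : ℕ) : ℂ := if s = P.n then P.m j else P.h j s

lemma xx_base (ξ : ℕ → ℕ → ℤ) {j s : ℕ} (hj : j ≤ P.i) :
    ∃ z : ℤ, P.xx ξ j s = P.qp (P.base j s) * P.hq ^ z := by
  refine ⟨(if s = P.n then 0 else 2 * ξ j s) + s - 2 * j, ?_⟩
  rw [xx, entry, if_pos hj, base, hq_zpow, ← qp_add]
  congr 1
  split_ifs <;> push_cast <;> ring

/-- The position `(j, s)` of a cyclic entry, or one of the parameters `m_{j,n}`. -/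
def IsCyc (P : Omega) (j s : ℕ) : Prop := 1 ≤ j ∧ j ≤ P.i ∧ 2 * j ≤ s ∧ s ≤ P.n

lemma Generic.neg {x : ℂ} (hx : P.Generic x) : P.Generic (-x) := fun a h =>
  hx (-a) (by push_cast; linear_combination -h)

lemma generic_base (hP : P.Admissible) {j s : ℕ} (h : P.IsCyc j s) : P.Generic (P.base j s) := by
  obtain ⟨h1, h2, h3, h4⟩ := h
  rw [base]
  split_ifs with h5
  · exact hP.m_gen _ h1 h2
  · exact hP.h_gen _ _ h1 h2 h3 (by omega)

lemma generic_base_add (hP : P.Admissible) {a b s s' : ℕ} (h : P.IsCyc a s) (h' : P.IsCyc b s')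
    (hs : (s' = s ∧ s < P.n) ∨ s' = s + 1 ∨ s = s' + 1) : P.Generic (P.base a s + P.base b s') := by
  obtain ⟨h1, h2, h3, h4⟩ := h
  obtain ⟨h1', h2', h3', h4'⟩ := h'
  rcases hs with ⟨rfl, hs⟩ | rfl | rfl
  · rw [base, base, if_neg (by omega), if_neg (by omega)]
    exact hP.h_add _ _ _ h1 h2 h3 h1' h2' h3' hs
  · by_cases hn : s + 1 = P.n
    · rw [base, base, if_neg (by omega), if_pos hn]
      have := (hP.h_top a b h1 h2 (by omega) h1' h2').2
      rwa [show P.n - 1 = s by omega] at this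
    · rw [base, base, if_neg (by omega), if_neg hn]
      exact (hP.h_next _ _ _ h1 h2 h3 h1' h2' h3' (by omega)).2
  · rw [add_comm]
    by_cases hn : s' + 1 = P.n
    · rw [base, base, if_neg (by omega), if_pos hn]
      have := (hP.h_top b a h1' h2' (by omega) h1 h2).2
      rwa [show P.n - 1 = s' by omega] at this
    · rw [base, base, if_neg (by omega), if_neg hn]
      exact (hP.h_next _ _ _ h1' h2' h3' h1 h2 h3 (by omega)).2

lemma generic_base_sub (hP : P.Admissible) {a b s s' : ℕ} (h : P.IsCyc a s) (h' : P.IsCyc b s')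
    (hs : (s' = s ∧ a ≠ b ∧ s < P.n) ∨ s' = s + 1 ∨ s = s' + 1) :
    P.Generic (P.base a s - P.base b s') := by
  obtain ⟨h1, h2, h3, h4⟩ := h
  obtain ⟨h1', h2', h3', h4'⟩ := h'
  rcases hs with ⟨rfl, hab, hs⟩ | rfl | rfl
  · rw [base, base, if_neg (by omega), if_neg (by omega)]
    exact hP.h_sub _ _ _ h1 h2 h3 h1' h2' h3' hs hab
  · by_cases hn : s + 1 = P.n
    · rw [base, base, if_neg (by omega), if_pos hn]
      have := (hP.h_top a b h1 h2 (by omega) h1' h2').1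
      rwa [show P.n - 1 = s by omega] at this
    · rw [base, base, if_neg (by omega), if_neg hn]
      exact (hP.h_next _ _ _ h1 h2 h3 h1' h2' h3' (by omega)).1
  · rw [← neg_sub]
    apply Generic.neg
    by_cases hn : s' + 1 = P.n
    · rw [base, base, if_neg (by omega), if_pos hn]
      have := (hP.h_top b a h1' h2' (by omega) h1 h2).1
      rwa [show P.n - 1 = s' by omega] at this
    · rw [base, base, if_neg (by omega), if_neg hn]
      exact (hP.h_next _ _ _ h1' h2' h3' h1 h2 h3 (by omega)).1

/-! ### The integral coordinates -/

variable (P) in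
/-- The integer `2 m_{i+1,n}`. -/
def dM : ℤ := ⌊2 * P.M (P.i + 1)⌋

variable (P) in
/-- The integer `m_{j,n} - m_{i+1,n}`. -/
def tp (j : ℕ) : ℤ := ⌊P.M j - P.M (P.i + 1)⌋

lemma dM_eq (hP : P.Admissible) : (P.dM : ℚ) = 2 * P.M (P.i + 1) := by
  have h1 := hP.i_lt
  rw [dM]
  rcases hP.M_int with h | h <;> obtain ⟨a, ha⟩ := h (P.i + 1) (by omega) (by omega) <;> rw [ha]
  · rw [show (2 * a : ℚ) = ((2 * a : ℤ) : ℚ) by push_cast; ring, Int.floor_intCast]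
  · rw [show (2 * (a + 1 / 2) : ℚ) = ((2 * a + 1 : ℤ) : ℚ) by push_cast; ring, Int.floor_intCast]

lemma tp_eq (hP : P.Admissible) {j : ℕ} (hj : P.i < j) (hj' : j ≤ P.n / 2) :
    (P.tp j : ℚ) = P.M j - P.M (P.i + 1) := by
  have h1 := hP.i_lt
  rw [tp]
  rcases hP.M_int with h | h <;> obtain ⟨a, ha⟩ := h (P.i + 1) (by omega) (by omega) <;>
    obtain ⟨b, hb⟩ := h j hj hj' <;> rw [ha, hb]
  · rw [show (b - a : ℚ) = ((b - a : ℤ) : ℚ) by push_cast; ring, Int.floor_intCast]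
  · rw [show (b + 1 / 2 - (a + 1 / 2) : ℚ) = ((b - a : ℤ) : ℚ) by push_cast; ring,
      Int.floor_intCast]

variable (P) in
/-- The integer `2 (m_{j,s} + s / 2 - j)`, for `j > i`. -/
def tw (ξ : ℕ → ℕ → ℤ) (j s : ℕ) : ℤ :=
  P.dM + 2 * (if s = P.n then P.tp j else ξ j s) + s - 2 * j

lemma w_eq (hP : P.Admissible) (ξ : ℕ → ℕ → ℤ) {j s : ℕ} (hj : P.i < j) (hs : 2 * j ≤ s) :
    P.w ξ j s = (P.tw ξ j s - s) / 2 + j := by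
  rw [w, tw]
  split_ifs with h
  · push_cast
    rw [tp_eq hP hj (by omega), dM_eq hP]; ring
  · push_cast
    rw [dM_eq hP]; ring

lemma tw_parity (ξ : ℕ → ℕ → ℤ) (j s : ℕ) : 2 ∣ P.tw ξ j s - P.dM - s := by
  rw [tw]; omega

lemma xx_tw (hP : P.Admissible) (ξ : ℕ → ℕ → ℤ) {j s : ℕ} (hj : P.i < j) (hs : 2 * j ≤ s)
    (hn : s ≤ P.n) : P.xx ξ j s = P.hq ^ P.tw ξ j s := by
  rw [xx, entry, if_neg (by omega), w_eq hP ξ hj hs, hq_zpow]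
  congr 1
  push_cast; ring

/-! ### Generic pairs of coordinates -/

section

variable {ξ : ℕ → ℕ → ℤ} {a b s s' : ℕ}

lemma isGen_xx (hP : P.Admissible) (h : P.IsCyc a s) : IsGen P.hq (P.xx ξ a s) := by
  obtain ⟨z, hz⟩ := xx_base (P := P) ξ (s := s) h.2.1
  rw [hz]
  exact (Generic.isGen hP (generic_base hP h)).mul_zpow hq_ne_zero z

lemma isGen_mul (hP : P.Admissible) (h : P.IsCyc a s) (hb : 1 ≤ b) (hb' : 2 * b ≤ s')
    (hn : s' ≤ P.n) (hs : (s' = s ∧ s < P.n) ∨ s' = s + 1 ∨ s = s' + 1) :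
    IsGen P.hq (P.xx ξ a s * P.xx ξ b s') := by
  by_cases hbi : b ≤ P.i
  · obtain ⟨z, hz⟩ := xx_base (P := P) ξ (s := s) h.2.1
    obtain ⟨z', hz'⟩ := xx_base (P := P) ξ (s := s') hbi
    rw [hz, hz', show P.qp (P.base a s) * P.hq ^ z * (P.qp (P.base b s') * P.hq ^ z') =
      P.qp (P.base a s + P.base b s') * P.hq ^ (z + z') by
        rw [qp_add, zpow_add₀ hq_ne_zero]; ring]
    exact (Generic.isGen hP (generic_base_add hP h ⟨hb, hbi, hb', hn⟩ hs)).mul_zpow hq_ne_zero _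
  · rw [xx_tw (j := b) hP ξ (by omega) hb' hn]
    exact (isGen_xx hP h).mul_zpow hq_ne_zero _

lemma isGen_div (hP : P.Admissible) (h : P.IsCyc a s) (hb : 1 ≤ b) (hb' : 2 * b ≤ s')
    (hn : s' ≤ P.n) (hs : (s' = s ∧ a ≠ b ∧ s < P.n) ∨ s' = s + 1 ∨ s = s' + 1) :
    IsGen P.hq (P.xx ξ a s * (P.xx ξ b s')⁻¹) := by
  by_cases hbi : b ≤ P.i
  · obtain ⟨z, hz⟩ := xx_base (P := P) ξ (s := s) h.2.1
    obtain ⟨z', hz'⟩ := xx_base (P := P) ξ (s := s') hbi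
    rw [hz, hz', show P.qp (P.base a s) * P.hq ^ z * (P.qp (P.base b s') * P.hq ^ z')⁻¹ =
      P.qp (P.base a s - P.base b s') * P.hq ^ (z - z') by
        rw [qp_sub, zpow_sub₀ hq_ne_zero, mul_inv]; ring]
    exact (Generic.isGen hP (generic_base_sub hP h ⟨hb, hbi, hb', hn⟩ hs)).mul_zpow hq_ne_zero _
  · rw [xx_tw (j := b) hP ξ (by omega) hb' hn, ← zpow_neg]
    exact (isGen_xx hP h).mul_zpow hq_ne_zero _

end

lemma add_inv_ne_zero_of_cyc (hP : P.Admissible) {ξ : ℕ → ℕ → ℤ} {a s : ℕ} (h : P.IsCyc a s)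
    (hs : s < P.n) (z : ℤ) : P.xx ξ a s * P.hq ^ z + (P.xx ξ a s * P.hq ^ z)⁻¹ ≠ 0 := by
  intro h0
  have hA : P.xx ξ a s * P.hq ^ z ≠ 0 :=
    mul_ne_zero (xx_ne_zero _ _ _) (zpow_ne_zero _ hq_ne_zero)
  have h1 := isGen_mul (ξ := ξ) hP h h.1 h.2.2.1 h.2.2.2 (Or.inl ⟨rfl, hs⟩) (z + z)
  rw [zpow_add₀ hq_ne_zero, show P.xx ξ a s * P.xx ξ a s * (P.hq ^ z * P.hq ^ z) =
    (P.xx ξ a s * P.hq ^ z) ^ 2 by ring, br_sq _ hA, h0, mul_zero] at h1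
  exact h1 rfl

/-- Otherwise `q ^ z = -1`, and the `k`-th power would give `1 = (-1) ^ k`, contrary to the oddness
of `k`. This is why the even-row denominators never cause trouble. -/
lemma add_inv_hq_ne_zero (hP : P.Admissible) (z : ℤ) : P.hq ^ z + (P.hq ^ z)⁻¹ ≠ 0 := by
  intro h0
  have hA : P.hq ^ z ≠ 0 := zpow_ne_zero _ hq_ne_zero
  have h1 : P.hq ^ z * P.hq ^ z = -1 := by
    field_simp at h0
    linear_combination h0
  have h2 := (hq_zpow_sq_eq_one_iff hP (P.k * z)).2 (dvd_mul_right _ _)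
  rw [mul_comm (P.k : ℤ), zpow_mul, zpow_natCast, ← mul_pow, h1, hP.k_odd.neg_one_pow] at h2
  norm_num at h2

end Omega

namespace Omega

variable {P : Omega}

/-! ### Interlacing in terms of the integral coordinates -/

variable (P) in
/-- The interlacing conditions of the tableaux in terms of the integral coordinates. -/
structure Inter (ξ : ℕ → ℕ → ℤ) : Prop where
  up : ∀ j s, P.i < j → 2 * j ≤ s → s < P.n → P.tw ξ j s + 1 ≤ P.tw ξ j (s + 1)
  down : ∀ j s, P.i < j → 2 * j + 1 ≤ s → s < P.n → P.tw ξ (j + 1) (s + 1) + 1 ≤ P.tw ξ j s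
  even : ∀ r, P.i < r → 2 * r + 2 ≤ P.n → 1 ≤ P.tw ξ (r + 1) (2 * r + 2) + P.tw ξ r (2 * r + 1)
  odd : ∀ r, P.i < r → 2 * r + 1 ≤ P.n → 1 ≤ P.tw ξ r (2 * r) + P.tw ξ r (2 * r + 1)

variable (P) in
/-- The entries outside of the shape vanish. -/
def Supp (ξ : ℕ → ℕ → ℤ) : Prop := ∀ j s, ¬(1 ≤ j ∧ 2 * j ≤ s ∧ s < P.n) → ξ j s = 0

lemma le_iff_cast {a b : ℤ} {x y : ℚ} (h : 2 * (y - x) = b - a) : x ≤ y ↔ a ≤ b := by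
  rw [← Int.cast_le (R := ℚ)]
  constructor <;> intro <;> linarith

/-- Doubling and adding `s - 2j` turns each weak inequality between entries into one with a gap of
`1` between integers. The absolute value condition splits into `down` in the last column and `even`.
-/
lemma isTableau_iff (hP : P.Admissible) {ξ : ℕ → ℕ → ℤ} :
    P.IsTableau ξ ↔ P.Supp ξ ∧
      (∀ j s, 1 ≤ j → j ≤ P.i → 2 * j ≤ s → s < P.n → 0 ≤ ξ j s ∧ ξ j s < P.k) ∧ P.Inter ξ := by
  have hw := fun j s => w_eq (j := j) (s := s) hP ξ
  constructor
  · intro h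
    refine ⟨h.supp, h.cyc, ?_, ?_, ?_, ?_⟩
    · intro j s h1 h2 h3
      obtain ⟨r, rfl | rfl⟩ := Nat.even_or_odd' s
      · have := h.odd_ge r j (by omega) h1 (by omega)
        rw [hw _ _ h1 (by omega), hw _ _ h1 (by omega)] at this
        exact (le_iff_cast (by push_cast; ring_nf)).1 this
      · have := h.even_ge (r + 1) j (by omega) h1 (by omega)
        rw [show 2 * (r + 1) - 1 = 2 * r + 1 by omega] at this
        rw [hw _ _ h1 (by omega), hw _ _ h1 (by omega)] at this
        exact (le_iff_cast (by push_cast; ring_nf)).1 this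
    · intro j s h1 h2 h3
      obtain ⟨r, rfl | rfl⟩ := Nat.even_or_odd' s
      · have := h.odd_le r j (by omega) h1 (by omega)
        rw [hw _ _ (by omega) (by omega), hw _ _ h1 (by omega)] at this
        exact (le_iff_cast (by push_cast; ring_nf)).1 this
      · rcases eq_or_ne j r with rfl | hjr
        · have := (neg_abs_le _).trans (neg_le_neg (h.even_last (j + 1) (by omega) (by omega)))
          have := (le_abs_self _).trans (h.even_last (j + 1) (by omega) (by omega))
          rw [show 2 * (j + 1) - 1 = 2 * j + 1 by omega, show j + 1 - 1 = j by omega] at this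
          rw [hw _ _ (by omega) (by omega), hw _ _ h1 (by omega)] at this
          exact (le_iff_cast (by push_cast; ring_nf)).1 this
        · have := h.even_le (r + 1) j (by omega) h1 (by omega)
          rw [show 2 * (r + 1) - 1 = 2 * r + 1 by omega] at this
          rw [hw _ _ (by omega) (by omega), hw _ _ h1 (by omega)] at this
          exact (le_iff_cast (by push_cast; ring_nf)).1 this
    · intro r h1 h2
      have := (neg_le_abs _).trans (h.even_last (r + 1) (by omega) (by omega))
      rw [show 2 * (r + 1) - 1 = 2 * r + 1 by omega, show r + 1 - 1 = r by omega] at this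
      rw [hw _ _ (by omega) (by omega), hw _ _ h1 (by omega)] at this
      refine (le_iff_cast ?_).1 this
      rw [show 2 * (r + 1) = 2 * r + 2 by ring]; push_cast; ring_nf
    · intro r h1 h2
      have := h.odd_last r (by omega) h1
      rw [hw _ _ (by omega) (by omega), hw _ _ h1 (by omega)] at this
      exact (le_iff_cast (by push_cast; ring_nf)).1 this
  · rintro ⟨h0, hc, h⟩
    refine ⟨h0, hc, ?_, ?_, ?_, ?_, ?_, ?_⟩
    · intro r j h1 h2 h3
      rw [hw _ _ h2 (by omega), hw _ _ h2 (by omega)]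
      exact (le_iff_cast (by push_cast; ring_nf)).2 (h.up j (2 * r) h2 (by omega) (by omega))
    · intro r j h1 h2 h3
      rw [hw _ _ (by omega) (by omega), hw _ _ h2 (by omega)]
      exact (le_iff_cast (by push_cast; ring_nf)).2 (h.down j (2 * r) h2 (by omega) (by omega))
    · intro r h1 h2
      rw [hw _ _ (by omega) (by omega), hw _ _ h2 (by omega)]
      exact (le_iff_cast (by push_cast; ring_nf)).2 (h.odd r h2 (by omega))
    · intro r j h1 h2 h3
      obtain ⟨r, rfl⟩ : ∃ r', r = r' + 1 := ⟨r - 1, by omega⟩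
      rw [show 2 * (r + 1) - 1 = 2 * r + 1 by omega]
      rw [hw _ _ h2 (by omega), hw _ _ h2 (by omega)]
      exact (le_iff_cast (by push_cast; ring_nf)).2 (h.up j (2 * r + 1) h2 (by omega) (by omega))
    · intro r j h1 h2 h3
      obtain ⟨r, rfl⟩ : ∃ r', r = r' + 1 := ⟨r - 1, by omega⟩
      rw [show 2 * (r + 1) - 1 = 2 * r + 1 by omega]
      rw [hw _ _ (by omega) (by omega), hw _ _ h2 (by omega)]
      exact (le_iff_cast (by push_cast; ring_nf)).2 (h.down j (2 * r + 1) h2 (by omega) (by omega))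
    · intro r h1 h2
      obtain ⟨r, rfl⟩ : ∃ r', r = r' + 1 := ⟨r - 1, by omega⟩
      rw [show 2 * (r + 1) - 1 = 2 * r + 1 by omega, show r + 1 - 1 = r by omega]
      rw [abs_le', hw _ _ (by omega) (by omega), hw _ _ (by omega) (by omega)]
      constructor
      · exact (le_iff_cast (by push_cast; ring_nf)).2 (h.down r (2 * r + 1) (by omega) (by omega)
          (by omega))
      · refine (le_iff_cast ?_).2 (h.even r (by omega) (by omega))
        rw [show 2 * (r + 1) = 2 * r + 2 by ring]; push_cast; ring_nf

section

variable {ξ : ℕ → ℕ → ℤ}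

lemma Inter.col (h : P.Inter ξ) {a b s : ℕ} (ha : P.i < a) (hab : a ≤ b) (hb : 2 * b ≤ s)
    (hs : s < P.n) : P.tw ξ b s + 2 * (b - a) ≤ P.tw ξ a s := by
  induction b, hab using Nat.le_induction with
  | base => simp
  | succ b hab ih =>
    have h1 := ih (by omega)
    have h2 := h.down b s (by omega) (by omega) hs
    have h3 := h.up (b + 1) s (by omega) hb hs
    push_cast
    omega

lemma Inter.le_top (h : P.Inter ξ) {a s : ℕ} (ha : P.i < a) (hs : 2 * a ≤ s) (hn : s ≤ P.n) :
    P.tw ξ a s + (P.n - s) ≤ P.tw ξ a P.n := by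
  obtain ⟨d, hd⟩ := Nat.exists_eq_add_of_le hn
  induction d generalizing s with
  | zero => rw [add_zero] at hd; rw [hd]; simp
  | succ d ih =>
    have h1 := ih (s := s + 1) (by omega) (by omega) (by omega)
    have h2 := h.up a s ha hs (by omega)
    push_cast at h1
    omega

lemma tw_top (hP : P.Admissible) {a : ℕ} (ha : P.i < a) (han : a ≤ P.n / 2) :
    P.tw ξ a P.n + 2 * (a - (P.i + 1)) ≤ P.tw ξ (P.i + 1) P.n := by
  induction a, ha using Nat.le_induction with
  | base => simp
  | succ b hb ih =>
    have h1 := ih (by omega)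
    have h2 := hP.M_dom b hb (by omega)
    have h3 : P.tp (b + 1) ≤ P.tp b := by
      have e1 := tp_eq (j := b + 1) hP (by omega) (by omega)
      have e2 := tp_eq (j := b) hP (by omega) (by omega)
      rw [← Int.cast_le (R := ℚ), e1, e2]; linarith
    simp only [tw, if_true] at h1 ⊢
    push_cast at h1 ⊢
    omega

lemma Inter.pos_odd (h : P.Inter ξ) {a s : ℕ} (ha : P.i < a) (hs : 2 * a ≤ s) (hn : s < P.n)
    (ho : s % 2 = 1) : s - 2 * a ≤ P.tw ξ a s := by
  have h1 := h.col ha (by omega : a ≤ s / 2) (by omega) hn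
  have h2 := h.odd (s / 2) (by omega) (by omega)
  have h3 := h.up (s / 2) (2 * (s / 2)) (by omega) (by omega) (by omega)
  rw [show 2 * (s / 2) + 1 = s by omega] at h2 h3
  omega

/-- In an odd row all coordinates are positive. In an even row only the last can be negative, and
the odd row below bounds its modulus through `even`. -/
lemma Inter.add_pos (h : P.Inter ξ) {a b s : ℕ} (ha : P.i < a) (hab : a < b) (hs : 2 * b ≤ s)
    (hn : s < P.n) : 2 * ((b : ℤ) - a) ≤ P.tw ξ a s + P.tw ξ b s := by
  rcases Nat.mod_two_eq_zero_or_one s with h0 | h0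
  · have h1 := h.col (s := s) (by omega) (by omega : b ≤ s / 2) (by omega) hn
    have h2 := h.col (s := s) ha (by omega : a ≤ b) (by omega) hn
    have h2' := h.col (s := s) ha (by omega : a ≤ s / 2 - 1) (by omega) hn
    have h3 := h.even (s / 2 - 1) (by omega) (by omega)
    have h4 := h.up (s / 2 - 1) (s - 1) (by omega) (by omega) (by omega)
    rw [show s - 1 + 1 = s by omega] at h4
    rw [show 2 * (s / 2 - 1) + 2 = s by omega, show 2 * (s / 2 - 1) + 1 = s - 1 by omega,
      show s / 2 - 1 + 1 = s / 2 by omega] at h3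
    omega
  · have h1 := h.pos_odd (s := s) ha (by omega) hn h0
    have h2 := h.pos_odd (s := s) (by omega : P.i < b) (by omega) hn h0
    omega

variable (P) in
/-- The bound on the highest integral coordinate in the regular case. -/
def Low : Prop := P.tw (fun _ _ => 0) (P.i + 1) P.n + 1 ≤ P.k + (P.n % 2 : ℕ)

lemma tw_n (ξ : ℕ → ℕ → ℤ) (a : ℕ) : P.tw ξ a P.n = P.tw (fun _ _ => 0) a P.n := by
  simp [tw]

lemma Inter.le_bound (hP : P.Admissible) (hL : P.Low) (h : P.Inter ξ) {a s : ℕ} (ha : P.i < a)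
    (hs : 2 * a ≤ s) (hn : s ≤ P.n) :
    P.tw ξ a s + (P.n - s) + 2 * (a - (P.i + 1)) + 1 ≤ P.k + (P.n % 2 : ℕ) := by
  have h1 := h.le_top ha hs hn
  have h2 := tw_top (ξ := ξ) hP ha (by omega)
  rw [Low, ← tw_n ξ] at hL
  omega

/-- The top row bounds everything from above through interlacing, and the lower bound in even rows
comes from `odd`. All coordinates are thus less than `k` in modulus, and their sums and differences
less than `2k`. -/
lemma Inter.bounds (hP : P.Admissible) (hL : P.Low) (h : P.Inter ξ) {a s : ℕ} (ha : P.i < a)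
    (hs : 2 * a ≤ s) (hn : s < P.n) : P.tw ξ a s ≤ P.k - 1 - 2 * (a - (P.i + 1)) ∧
      -(P.k - 1 : ℤ) ≤ P.tw ξ a s ∧ (s % 2 = 1 → P.tw ξ a s ≤ P.k - 2 - 2 * (a - (P.i + 1))) := by
  have hk := hP.k_odd
  have h1 := h.le_bound hP hL ha hs hn.le
  refine ⟨by omega, ?_, ?_⟩
  · rcases Nat.mod_two_eq_zero_or_one s with h0 | h0
    · have h2 := h.col ha (by omega : a ≤ s / 2) (by omega) hn
      have h3 := h.odd (s / 2) (by omega) (by omega)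
      have h4 := h.le_bound hP hL (a := s / 2) (s := s + 1) (by omega) (by omega) (by omega)
      rw [show 2 * (s / 2) = s by omega] at h3
      omega
    · have := h.pos_odd ha hs hn h0
      have := hP.k_ge
      omega
  · intro ho
    omega

end

end Omega

/-! ### Moves of integral arrays and coefficients at the border -/

/-- The effect of a move on an array of integers. -/
def upd (ξ : ℕ → ℕ → ℤ) (r : ℕ) (x : ℕ × ℤ) : ℕ → ℕ → ℤ :=
  fun a s => if a = x.1 ∧ s = r then ξ a s + x.2 else ξ a s

lemma upd_comm (ξ : ℕ → ℕ → ℤ) (r r' : ℕ) (x y : ℕ × ℤ) :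
    upd (upd ξ r x) r' y = upd (upd ξ r' y) r x := by
  funext a s
  simp only [upd]
  split_ifs <;> ring

lemma upd_zero (ξ : ℕ → ℕ → ℤ) (r a : ℕ) : upd ξ r (a, 0) = ξ := by
  funext a s
  simp [upd]

lemma upd_neg (ξ : ℕ → ℕ → ℤ) (r : ℕ) (x : ℕ × ℤ) : upd (upd ξ r x) r (x.1, -x.2) = ξ := by
  funext a s
  simp only [upd]
  split_ifs <;> ring

namespace Omega

variable {P : Omega} {ξ : ℕ → ℕ → ℤ} {r r' : ℕ} {x y z : ℕ × ℤ}

lemma tw_upd (hr : r < P.n) (j s : ℕ) :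
    P.tw (upd ξ r x) j s = P.tw ξ j s + if j = x.1 ∧ s = r then 2 * x.2 else 0 := by
  simp only [tw, upd]
  split_ifs <;> omega

lemma tw_upd_of_ne {j s : ℕ} (h : ¬(j = x.1 ∧ s = r)) : P.tw (upd ξ r x) j s = P.tw ξ j s := by
  simp only [tw, upd, if_neg h]

lemma tw_upd_self (hr : r < P.n) : P.tw (upd ξ r x) x.1 r = P.tw ξ x.1 r + 2 * x.2 := by
  rw [tw_upd hr, if_pos ⟨rfl, rfl⟩]

lemma xx_upd (hr : r < P.n) : P.xx (upd ξ r x) = mv P.hq (P.xx ξ) r x := by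
  funext j s
  by_cases h : j = x.1 ∧ s = r
  · have h2 : s ≠ P.n := by omega
    simp only [mv, if_pos h, xx, entry, w, upd, if_neg h2]
    rw [hq_zpow, ← qp_add]
    congr 1
    split_ifs <;> push_cast <;> ring
  · simp only [mv, if_neg h, xx, entry, w, upd]

lemma vv_tw (hP : P.Admissible) {a : ℕ} {e : ℤ} (he : e = 1 ∨ e = -1) (ha : P.i < a)
    (har : 2 * a ≤ r) (hr : r < P.n) :
    vv P.hq (P.xx ξ) r (a, e) = yy (P.hq ^ (P.tw ξ a r + e)) := by
  rw [vv_of_ne he, xx_tw hP ξ ha har hr.le]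
  rcases he with rfl | rfl
  · rw [zpow_one, zpow_add_one₀ hq_ne_zero]
  · rw [← yy_inv]
    congr 1
    rw [zpow_add₀ hq_ne_zero]; simp [mul_comm]

lemma yy_neg (t : ℤ) : yy (P.hq ^ (-t)) = yy (P.hq ^ t) := by rw [zpow_neg, yy_inv]

lemma yy_eq_iff (hP : P.Admissible) (t u : ℤ) :
    yy (P.hq ^ t) = yy (P.hq ^ u) ↔ (P.k : ℤ) ∣ t + u ∨ (P.k : ℤ) ∣ t - u := by
  rw [← sub_eq_zero, yy_sub (hq_w hP) (zpow_ne_zero _ hq_ne_zero) (zpow_ne_zero _ hq_ne_zero),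
    mul_eq_zero, or_iff_right (pow_ne_zero _ (hq_w hP)), mul_eq_zero, ← zpow_add₀ hq_ne_zero,
    ← zpow_neg, ← zpow_add₀ hq_ne_zero, ← sub_eq_add_neg, br_zpow_eq_zero_iff hP, br_zpow_eq_zero_iff hP]

lemma coef_eq_zero_of {c : ℕ → ℕ → ℂ} (hP : P.Admissible) (hx : x ∈ moves r) (hx0 : x.2 ≠ 0)
    {f : ℕ × ℕ} (hf : f ∈ nb r) (h : yy (P.xx ξ f.1 f.2) = vv P.hq (P.xx ξ) r x) :
    coef P.hq c (P.xx ξ) r x = 0 := by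
  have he := sign_of_mem hx hx0
  have h1 := prr_sq (r := r) hq_ne_zero (hq_w hP) he (xx_ne_zero (P := P) ξ x.1 r)
    (xx_ne_zero (P := P) ξ f.1 f.2)
  rw [h, show vv P.hq (P.xx ξ) r x = yy (P.xx ξ x.1 r ^ x.2 * P.hq) from vv_of_ne (a := x.1) he,
    sub_self, zero_div, mul_self_eq_zero] at h1
  rw [coef, if_neg hx0, prod_eq_zero hf h1]
  simp

lemma col_iff {a : ℕ} : a ∈ cols r ↔ 1 ≤ a ∧ 2 * a ≤ r := by
  rw [mem_Icc]; omega

/-- Coefficients of moves that leave the set of tableaux vanish. -/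
lemma coef_border {c : ℕ → ℕ → ℂ} (hP : P.Admissible) (hr : 1 ≤ r) (hrn : r < P.n)
    (h : P.Inter ξ) (hx : x ∈ moves r) (h' : ¬ P.Inter (upd ξ r x)) :
    coef P.hq c (P.xx ξ) r x = 0 := by
  obtain ⟨a, e⟩ := x
  by_cases hx0 : e = 0
  · subst hx0
    rw [upd_zero] at h'
    exact absurd h h'
  have he := sign_of_mem hx hx0
  have ha := col_iff.1 (col_of_mem hx hx0)
  simp only at he ha
  by_cases hai : a ≤ P.i
  -- Moves of cyclic columns do not touch the interlacing conditions.
  · refine absurd ?_ h'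
    have e1 : ∀ j s, P.i < j → P.tw (upd ξ r (a, e)) j s = P.tw ξ j s := fun j s hj =>
      tw_upd_of_ne (by simp only; omega)
    refine ⟨fun j s h1 h2 h3 => ?_, fun j s h1 h2 h3 => ?_, fun j h1 h2 => ?_,
      fun j h1 h2 => ?_⟩
    · rw [e1 _ _ h1, e1 _ _ h1]; exact h.up j s h1 h2 h3
    · rw [e1 _ _ h1, e1 _ _ (by omega)]; exact h.down j s h1 h2 h3
    · rw [e1 _ _ h1, e1 _ _ (by omega)]; exact h.even j h1 h2
    · rw [e1 _ _ h1, e1 _ _ h1]; exact h.odd j h1 h2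
  by_contra hc
  apply h'
  -- A neighbour at the centre of the move, up to sign, would produce a zero factor. By parity an
  -- interlacing inequality can only be broken by a move whose centre is occupied by the neighbour
  -- concerned, so this excludes every violation.
  have key : ∀ f ∈ nb r, P.i < f.1 → P.tw ξ f.1 f.2 ≠ P.tw ξ a r + e ∧
      P.tw ξ f.1 f.2 ≠ -(P.tw ξ a r + e) := by
    intro f hf hfi
    rw [← not_or]
    intro hcon
    apply hc
    refine coef_eq_zero_of hP hx hx0 hf ?_
    have hf' := hf
    rw [mem_nb] at hf'
    rw [vv_tw hP he (by omega) ha.2 hrn, xx_tw hP ξ hfi (by omega) (by omega)]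
    rcases hcon with hcon | hcon <;> rw [hcon]
    rw [yy_neg]
  have hp := fun j s => tw_parity (P := P) ξ j s
  have e1 := fun j s => tw_upd (ξ := ξ) (x := (a, e)) hrn j s
  simp only at e1
  refine ⟨fun j s h1 h2 h3 => ?_, fun j s h1 h2 h3 => ?_, fun j h1 h2 => ?_, fun j h1 h2 => ?_⟩
  · have h0 := h.up j s h1 h2 h3
    have p1 := hp j s
    have p2 := hp j (s + 1)
    rw [e1, e1]
    by_cases c1 : j = a ∧ s = r
    · obtain ⟨rfl, rfl⟩ := c1
      have := key (j, s + 1) (mem_nb.2 (Or.inl ⟨by omega, by omega, rfl⟩)) h1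
      simp only at this
      rw [if_pos ⟨rfl, rfl⟩, if_neg (by omega)]
      omega
    · by_cases c2 : j = a ∧ s + 1 = r
      · obtain ⟨rfl, rfl⟩ := c2
        have := key (j, s) (mem_nb.2 (Or.inr ⟨by omega, by omega, rfl⟩)) h1
        simp only at this
        rw [if_neg c1, if_pos ⟨rfl, rfl⟩]
        omega
      · rw [if_neg c1, if_neg c2]; omega
  · have h0 := h.down j s h1 h2 h3
    have p1 := hp j s
    have p2 := hp (j + 1) (s + 1)
    rw [e1, e1]
    by_cases c1 : j = a ∧ s = r
    · obtain ⟨rfl, rfl⟩ := c1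
      have := key (j + 1, s + 1) (mem_nb.2 (Or.inl ⟨by omega, by omega, rfl⟩)) (by simp only; omega)
      simp only at this
      rw [if_neg (by omega), if_pos ⟨rfl, rfl⟩]
      omega
    · by_cases c2 : j + 1 = a ∧ s + 1 = r
      · obtain ⟨rfl, rfl⟩ := c2
        have := key (j, s) (mem_nb.2 (Or.inr ⟨by omega, by omega, rfl⟩)) h1
        simp only at this
        rw [if_pos ⟨rfl, rfl⟩, if_neg c1]
        omega
      · rw [if_neg c2, if_neg c1]; omega
  · have h0 := h.even j h1 h2
    have p1 := hp j (2 * j + 1)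
    have p2 := hp (j + 1) (2 * j + 2)
    rw [e1, e1]
    by_cases c1 : j = a ∧ 2 * j + 1 = r
    · obtain ⟨rfl, rfl⟩ := c1
      have := key (j + 1, 2 * j + 2) (mem_nb.2 (Or.inl ⟨by omega, by omega, rfl⟩)) (by simp only; omega)
      simp only at this
      rw [if_neg (by omega), if_pos ⟨rfl, rfl⟩]
      omega
    · by_cases c2 : j + 1 = a ∧ 2 * j + 2 = r
      · obtain ⟨rfl, rfl⟩ := c2
        have := key (j, 2 * j + 1) (mem_nb.2 (Or.inr ⟨by omega, by omega, rfl⟩)) h1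
        simp only at this
        rw [if_pos ⟨rfl, rfl⟩, if_neg c1]
        omega
      · rw [if_neg c2, if_neg c1]; omega
  · have h0 := h.odd j h1 h2
    have p1 := hp j (2 * j + 1)
    have p2 := hp j (2 * j)
    rw [e1, e1]
    by_cases c1 : j = a ∧ 2 * j = r
    · obtain ⟨rfl, rfl⟩ := c1
      have := key (j, 2 * j + 1) (mem_nb.2 (Or.inl ⟨by omega, by omega, rfl⟩)) h1
      simp only at this
      rw [if_pos ⟨rfl, rfl⟩, if_neg (by omega)]
      omega
    · by_cases c2 : j = a ∧ 2 * j + 1 = r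
      · obtain ⟨rfl, rfl⟩ := c2
        have := key (j, 2 * j) (mem_nb.2 (Or.inr ⟨by omega, by omega, rfl⟩)) h1
        simp only at this
        rw [if_neg c1, if_pos ⟨rfl, rfl⟩]
        omega
      · rw [if_neg c1, if_neg c2]; omega

/-! ### The minimal case -/

lemma tw_minimal_top (hP : P.Admissible) (hM : P.IsMinimal) {a : ℕ} (ha : P.i < a)
    (han : 2 * a ≤ P.n) : P.tw ξ a P.n = P.n - 2 * a := by
  have h1 := hM.1
  have hi := hP.i_lt
  have e1 := tp_eq (j := a) hP (by omega) (by omega)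
  have e2 := dM_eq hP
  rw [hM.2 a (by omega) (by omega), hM.2 (P.i + 1) (by omega) (by omega)] at e1
  rw [hM.2 (P.i + 1) (by omega) (by omega)] at e2
  have e1' : P.tp a = 0 := by exact_mod_cast e1.trans (sub_zero _)
  have e2' : P.dM = 0 := by exact_mod_cast e2.trans (mul_zero _)
  rw [tw, if_pos rfl, e1', e2']; ring

/-- In the case of minimal dimension the entries outside of the first column are fixed. -/
lemma Inter.tw_minimal (hP : P.Admissible) (hM : P.IsMinimal) (h : P.Inter ξ) {a s : ℕ}
    (ha : P.i < a) (has : 2 * a ≤ s) (hs : s ≤ P.n) : P.tw ξ a s = s - 2 * a := by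
  have hup : ∀ a s, P.i < a → 2 * a ≤ s → s ≤ P.n → P.tw ξ a s ≤ s - 2 * a := by
    intro a s ha has hs
    have h1 := h.le_top ha has hs
    rw [tw_minimal_top hP hM ha (by omega)] at h1
    omega
  rcases hs.eq_or_lt with rfl | hs
  · exact tw_minimal_top hP hM ha has
  · have h0 := hup a s ha has hs.le
    rcases Nat.mod_two_eq_zero_or_one s with ho | ho
    · have h1 := h.col ha (by omega : a ≤ s / 2) (by omega) hs
      have h2 := h.odd (s / 2) (by omega) (by omega)
      have h3 := hup (s / 2) (s + 1) (by omega) (by omega) (by omega)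
      rw [show 2 * (s / 2) = s by omega] at h2
      push_cast at h3
      omega
    · have := h.pos_odd ha has hs ho
      omega

end Omega

/-! ### Nonvanishing of the denominators between two tableaux -/

lemma nn_ne_zero {h : ℂ} {X : ℕ → ℕ → ℂ} {r a b : ℕ} (h1 : br h (X a r * X b r) ≠ 0)
    (h2 : br h (X a r * (X b r)⁻¹) ≠ 0) : nn h X r a b ≠ 0 := by
  intro h0
  have h3 := nn_sq (h := h) (X := X) (r := r) a b
  rw [h0, zero_mul] at h3
  rcases le_total a b with hab | hab
  · rw [min_eq_left hab, max_eq_right hab] at h3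
    exact mul_ne_zero h1 h2 h3.symm
  · rw [min_eq_right hab, max_eq_left hab,
      show X b r * (X a r)⁻¹ = (X a r * (X b r)⁻¹)⁻¹ by rw [mul_inv, inv_inv, mul_comm],
      br_inv] at h3
    exact mul_ne_zero h1 (neg_ne_zero.2 h2) h3.symm

namespace Omega

variable {P : Omega} {ξ η : ℕ → ℕ → ℤ} {r r' s : ℕ} {x y z : ℕ × ℤ}

/-- Coordinates of one row have equal parity, so their sums and differences differ by even numbers
from each other and the relevant exponents are even. An odd `k` divides an even number only if `2k`
does, which doubles the admissible range. -/
lemma not_dvd_of_lt (hP : P.Admissible) {t : ℤ} (h2 : 2 ∣ t) (h0 : t ≠ 0) (h1 : t < 2 * P.k)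
    (h1' : -(2 * P.k : ℤ) < t) : ¬ (P.k : ℤ) ∣ t := by
  intro h
  have hk := hP.k_odd
  have : IsCoprime (2 : ℤ) P.k := by
    obtain ⟨m, hm⟩ := hk
    exact ⟨-m, 1, by rw [hm]; push_cast; ring⟩
  obtain ⟨m, rfl⟩ := this.mul_dvd h2 h
  have hk3 := hP.k_ge
  have : m < 1 := by nlinarith
  have : -1 < m := by nlinarith
  have : m = 0 := by omega
  subst this
  simp at h0

lemma not_dvd_of_abs_lt {t : ℤ} {k : ℕ} (h0 : t ≠ 0) (h1 : t < k)
    (h1' : -(k : ℤ) < t) : ¬ (k : ℤ) ∣ t := by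
  intro h
  exact h0 (Int.eq_zero_of_abs_lt_dvd h (abs_lt.2 ⟨h1', h1⟩))

/-- Two columns do not collide on the way from a tableau to another one, if one of the adjacent
rows is not changed. -/
lemma Inter.pair (h : P.Inter ξ) (h' : P.Inter η) (hr : r < P.n) {a b : ℕ} {e : ℤ}
    (he : e = 1 ∨ e = -1) (ha : P.i < a) (hb : P.i < b) (har : 2 * a ≤ r) (hbr : 2 * b ≤ r)
    (hab : a ≠ b) (hη : P.tw η a r = P.tw ξ a r + 2 * e) (hs : s + 1 = r ∨ s = r + 1)
    (hu : ∀ j, P.tw η j s = P.tw ξ j s) :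
    P.tw ξ a r + 2 * e + P.tw ξ b r ≠ 0 ∧ P.tw ξ a r + 2 * e - P.tw ξ b r ≠ 0 := by
  have hpo := fun c (h1 : P.i < c) (h2 : 2 * c ≤ r) => h.pos_odd h1 h2 hr
  rcases lt_or_gt_of_ne hab with hl | hl
  -- Columns are at least `2` apart and the move has length `2`, so only adjacent columns can
  -- collide. The unchanged row `s` has an entry between them before and after the move, which
  -- excludes the collision.
  · have h1 := h.col ha hl.le hbr hr
    have h2 := h.add_pos ha hl hbr hr
    constructor
    · intro h0
      have hb1 : b = a + 1 := by omega
      have hodd := hpo b hb hbr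
      have hev : r = 2 * b := by
        by_contra hne
        rcases Nat.mod_two_eq_zero_or_one r with h3 | h3
        · have h4 := h.add_pos (s := r) ha (by omega : a < b + 1) (by omega) hr
          have h5 := h.col (s := r) hb (by omega : b ≤ b + 1) (by omega) hr
          push_cast at h4 h5
          omega
        · have := hodd h3
          have := hpo a ha har h3
          omega
      subst hb1
      rcases hs with rfl | rfl
      · have h3 := h'.up a s ha (by omega) (by omega)
        have h4 := h.even a ha (by omega)
        have e1 : s = 2 * a + 1 := by omega
        subst e1
        rw [hu] at h3
        simp only [show 2 * a + 1 + 1 = 2 * a + 2 by ring] at *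
        omega
      · have h3 := h'.down a r ha (by omega) (by omega)
        have h4 := h.odd (a + 1) hb (by omega)
        rw [hu] at h3
        subst hev
        omega
    · intro h0
      have hb1 : b = a + 1 := by omega
      subst hb1
      rcases hs with rfl | rfl
      · have h3 := h'.up a s ha (by omega) (by omega)
        have h4 := h.down a s ha (by omega) (by omega)
        rw [hu] at h3
        omega
      · have h3 := h'.down a r ha (by omega) (by omega)
        have h4 := h.up (a + 1) r hb (by omega) (by omega)
        rw [hu] at h3
        omega
  · have h1 := h.col hb hl.le har hr
    have h2 := h.add_pos hb hl har hr
    constructor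
    · intro h0
      have hb1 : a = b + 1 := by omega
      have hodd := hpo a ha har
      have hev : r = 2 * a := by
        by_contra hne
        rcases Nat.mod_two_eq_zero_or_one r with h3 | h3
        · have h4 := h.add_pos (s := r) hb (by omega : b < a + 1) (by omega) hr
          have h5 := h.col (s := r) ha (by omega : a ≤ a + 1) (by omega) hr
          push_cast at h4 h5
          omega
        · have := hodd h3
          have := hpo b hb hbr h3
          omega
      subst hb1
      rcases hs with rfl | rfl
      · have h3 := h'.even b hb (by omega)
        have h4 := h.up b s hb (by omega) (by omega)
        have e1 : s = 2 * b + 1 := by omega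
        subst e1
        rw [hu] at h3
        simp only [show 2 * b + 1 + 1 = 2 * b + 2 by ring] at *
        omega
      · have h3 := h'.odd (b + 1) ha (by omega)
        have h4 := h.down b r hb (by omega) (by omega)
        subst hev
        rw [hu] at h3
        omega
    · intro h0
      have hb1 : a = b + 1 := by omega
      subst hb1
      rcases hs with rfl | rfl
      · have h3 := h'.down b s hb (by omega) (by omega)
        have h4 := h.up b s hb (by omega) (by omega)
        rw [hu] at h3
        omega
      · have h3 := h'.up (b + 1) r ha (by omega) (by omega)
        have h4 := h.down b r hb (by omega) (by omega)
        rw [hu] at h3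
        omega

section

variable (hP : P.Admissible) (hLM : P.Low ∨ P.IsMinimal) (hr : 1 ≤ r) (hrn : r < P.n)
  (h : P.Inter ξ) (h' : P.Inter η) (hx : x ∈ moves r) (hx0 : x.2 ≠ 0)
  (hη : P.tw η x.1 r = P.tw ξ x.1 r + 2 * x.2) (hs : s + 1 = r ∨ s = r + 1)
  (hu : ∀ j, P.tw η j s = P.tw ξ j s)

include hP hLM hrn h h' hx hx0 hη hs hu

/-- Nondegeneracy of the denominators on the way between two tableaux. -/
lemma nn_mv_ne_zero (hy : y ∈ moves r) (hy0 : y.2 ≠ 0) (hxy : x.1 ≠ y.1) :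
    nn P.hq (mv P.hq (P.xx ξ) r x) r x.1 y.1 ≠ 0 := by
  have he := sign_of_mem hx hx0
  have ha := col_iff.1 (col_of_mem hx hx0)
  have hb := col_iff.1 (col_of_mem hy hy0)
  have e1 : P.xx ξ x.1 r * P.hq ^ (2 * x.2) * P.xx ξ y.1 r =
    P.xx ξ x.1 r * P.xx ξ y.1 r * P.hq ^ (2 * x.2) := by ring
  have e2 : P.xx ξ x.1 r * P.hq ^ (2 * x.2) * (P.xx ξ y.1 r)⁻¹ =
    P.xx ξ x.1 r * (P.xx ξ y.1 r)⁻¹ * P.hq ^ (2 * x.2) := by ring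
  have hcy : ∀ {a}, 1 ≤ a → 2 * a ≤ r → a ≤ P.i → P.IsCyc a r := fun h1 h2 h3 =>
    ⟨h1, h3, h2, hrn.le⟩
  apply nn_ne_zero
  · rw [mv_self', mv_col hxy.symm]
    by_cases hxi : x.1 ≤ P.i
    · rw [e1]
      exact isGen_mul hP (hcy ha.1 ha.2 hxi) hb.1 hb.2 hrn.le (Or.inl ⟨rfl, hrn⟩) _
    by_cases hyi : y.1 ≤ P.i
    · rw [e1, mul_comm (P.xx ξ x.1 r)]
      exact isGen_mul hP (hcy hb.1 hb.2 hyi) ha.1 ha.2 hrn.le (Or.inl ⟨rfl, hrn⟩) _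
    rw [xx_tw hP ξ (by omega) ha.2 hrn.le, xx_tw hP ξ (by omega) hb.2 hrn.le,
      ← zpow_add₀ hq_ne_zero, ← zpow_add₀ hq_ne_zero, Ne, br_zpow_eq_zero_iff hP]
    rcases hLM with hL | hM
    · have p1 := tw_parity (P := P) ξ x.1 r
      have p2 := tw_parity (P := P) ξ y.1 r
      have b1 := h.bounds hP hL (by omega) ha.2 hrn
      have b2 := h.bounds hP hL (by omega) hb.2 hrn
      have q := (h.pair h' hrn he (by omega) (by omega) ha.2 hb.2 hxy hη hs hu).1
      refine not_dvd_of_lt hP (by omega) q (by omega) ?_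
      rcases lt_or_gt_of_ne hxy with hl | hl
      · have := h.add_pos (by omega) hl hb.2 hrn
        omega
      · have := h.add_pos (by omega) hl ha.2 hrn
        omega
    · have m1 := h.tw_minimal hP hM (by omega : P.i < x.1) ha.2 hrn.le
      have m2 := h'.tw_minimal hP hM (by omega : P.i < x.1) ha.2 hrn.le
      omega
  · rw [mv_self', mv_col hxy.symm]
    by_cases hxi : x.1 ≤ P.i
    · rw [e2]
      exact isGen_div hP (hcy ha.1 ha.2 hxi) hb.1 hb.2 hrn.le (Or.inl ⟨rfl, hxy, hrn⟩) _
    by_cases hyi : y.1 ≤ P.i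
    · rw [e2, show P.xx ξ x.1 r * (P.xx ξ y.1 r)⁻¹ = (P.xx ξ y.1 r * (P.xx ξ x.1 r)⁻¹)⁻¹ by
        rw [mul_inv, inv_inv, mul_comm]]
      exact (isGen_div hP (hcy hb.1 hb.2 hyi) ha.1 ha.2 hrn.le
        (Or.inl ⟨rfl, hxy.symm, hrn⟩)).inv _
    rw [xx_tw hP ξ (by omega) ha.2 hrn.le, xx_tw hP ξ (by omega) hb.2 hrn.le, ← zpow_neg,
      ← zpow_add₀ hq_ne_zero, ← zpow_add₀ hq_ne_zero, Ne, br_zpow_eq_zero_iff hP]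
    rcases hLM with hL | hM
    · have p1 := tw_parity (P := P) ξ x.1 r
      have p2 := tw_parity (P := P) ξ y.1 r
      have b1 := h.bounds hP hL (by omega) ha.2 hrn
      have b2 := h.bounds hP hL (by omega) hb.2 hrn
      have q := (h.pair h' hrn he (by omega) (by omega) ha.2 hb.2 hxy hη hs hu).2
      rcases lt_or_gt_of_ne hxy with hl | hl
      · have := h.add_pos (by omega) hl hb.2 hrn
        exact not_dvd_of_lt hP (by omega) q (by omega) (by omega)
      · have := h.add_pos (by omega) hl ha.2 hrn
        exact not_dvd_of_lt hP (by omega) q (by omega) (by omega)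
    · have m1 := h.tw_minimal hP hM (by omega : P.i < x.1) ha.2 hrn.le
      have m2 := h'.tw_minimal hP hM (by omega : P.i < x.1) ha.2 hrn.le
      omega

/-- The exceptional cases are the moves between the coordinates `1` and `3` in the last column.
Interlacing at the end with coordinate `1` squeezes the neighbour in the unchanged row `s` to `0`,
so the numerator of the diagonal coefficient vanishes; `hp` ensures that this factor has not been
removed. -/
lemma zero_cond (hod : r % 2 = 1) {p : ℕ × ℕ} (hp : p.2 ≠ s) :
    (br P.hq (P.xx ξ x.1 r ^ x.2 * P.hq⁻¹) ≠ 0 ∧ br P.hq (P.xx ξ x.1 r ^ x.2 * P.hq ^ 3) ≠ 0) ∨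
      ∏ f ∈ (nb r).erase p, br P.hq (P.xx ξ f.1 f.2) = 0 := by
  obtain ⟨a, e⟩ := x
  have he := sign_of_mem hx hx0
  have ha := col_iff.1 (col_of_mem hx hx0)
  simp only at *
  by_cases hxi : a ≤ P.i
  · left
    have g : IsGen P.hq (P.xx ξ a r ^ e) := by
      have := isGen_xx (ξ := ξ) hP ⟨ha.1, hxi, ha.2, hrn.le⟩
      rcases he with rfl | rfl
      · simpa using this
      · simpa using this.inv
    exact ⟨by simpa using g (-1), g 3⟩
  rcases hLM with hL | hM
  swap
  · have m1 := h.tw_minimal hP hM (by omega : P.i < a) ha.2 hrn.le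
    have m2 := h'.tw_minimal hP hM (by omega : P.i < a) ha.2 hrn.le
    omega
  have b1 := h.bounds hP hL (by omega) ha.2 hrn
  have b2 := h'.bounds hP hL (by omega) ha.2 hrn
  have o1 := h.pos_odd (by omega) ha.2 hrn hod
  have o2 := h'.pos_odd (by omega) ha.2 hrn hod
  by_cases hz : e * P.tw ξ a r = 1 ∨ e * P.tw ξ a r = -3
  · right
    have hpos : 2 * a + 1 = r := by
      rcases he with rfl | rfl <;> omega
    subst hpos
    have hf : ∃ b, (b, s) ∈ nb (2 * a + 1) ∧ P.i < b ∧ P.tw ξ b s = 0 := by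
      rcases hs with hs | rfl
      · obtain rfl : s = 2 * a := by omega
        refine ⟨a, mem_nb.2 (Or.inr ⟨ha.1, by omega, rfl⟩), by omega, ?_⟩
        have h1 := h.up a (2 * a) (by omega) (by omega) (by omega)
        have h2 := h.odd a (by omega) (by omega)
        have h1' := h'.up a (2 * a) (by omega) (by omega) (by omega)
        have h2' := h'.odd a (by omega) (by omega)
        rw [hu] at h1' h2'
        rcases he with rfl | rfl <;> omega
      · refine ⟨a + 1, mem_nb.2 (Or.inl ⟨by omega, by simp only; omega, rfl⟩), by omega, ?_⟩
        have h1 := h.down a (2 * a + 1) (by omega) (by omega) (by omega)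
        have h2 := h.even a (by omega) (by omega)
        have h1' := h'.down a (2 * a + 1) (by omega) (by omega) (by omega)
        have h2' := h'.even a (by omega) (by omega)
        simp only [show 2 * a + 1 + 1 = 2 * a + 2 by ring] at *
        rw [hu] at h1' h2'
        rcases he with rfl | rfl <;> omega
    obtain ⟨b, hb1, hb2, hb3⟩ := hf
    refine prod_eq_zero (i := (b, s)) (mem_erase.2 ⟨?_, hb1⟩) ?_
    · rintro rfl
      exact hp rfl
    · have hb1' := mem_nb.1 hb1
      simp only at hb1'
      simp only
      rw [xx_tw hP ξ hb2 (by omega) (by omega), hb3]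
      simp
  · left
    rw [xx_tw hP ξ (by omega) ha.2 hrn.le, ← zpow_mul, ← zpow_sub_one₀ hq_ne_zero,
      show P.hq ^ 3 = P.hq ^ (3 : ℤ) by norm_cast, ← zpow_add₀ hq_ne_zero, Ne,
      br_zpow_eq_zero_iff hP, Ne, br_zpow_eq_zero_iff hP]
    constructor <;> apply not_dvd_of_abs_lt <;> rcases he with rfl | rfl <;> omega

end

/-- The two orders of moves of different columns. -/
lemma ww_add_swap {c : ℕ → ℕ → ℂ} (hP : P.Admissible) (hLM : P.Low ∨ P.IsMinimal)
    (hA : Adj r r') (hrn : r < P.n) (h : P.Inter ξ) (hx : x ∈ moves r)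
    (hy : y ∈ moves r) (hxy : x.1 ≠ y.1) (hz : z ∈ moves r')
    (h' : P.Inter (upd (upd (upd ξ r' z) r x) r y)) :
    ww P.hq c (P.xx ξ) r r' z x y + ww P.hq c (P.xx ξ) r r' z y x = 0 := by
  apply ww_ne hq_ne_zero (hq_w hP) (xx_ne_zero ξ) hA hx hy hxy hz
  -- `s` is the neighbour row of `r` other than `r'`; none of the three moves changes it.
  obtain ⟨s, hs, hsr'⟩ : ∃ s, (s + 1 = r ∨ s = r + 1) ∧ r' ≠ s := by
    obtain ⟨h1, h2, h3 | h3⟩ := hA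
    · exact ⟨r - 1, by omega, by omega⟩
    · exact ⟨r + 1, by omega, by omega⟩
  have hsr : s ≠ r := by omega
  have hu : ∀ j, P.tw (upd (upd (upd ξ r' z) r x) r y) j s = P.tw ξ j s := fun j => by
    rw [tw_upd_of_ne (by tauto), tw_upd_of_ne (by tauto), tw_upd_of_ne]
    rintro ⟨-, h1⟩
    exact hsr' h1.symm
  have hηx : P.tw (upd (upd (upd ξ r' z) r x) r y) x.1 r = P.tw ξ x.1 r + 2 * x.2 := by
    rw [tw_upd_of_ne (by tauto), tw_upd_self hrn, tw_upd_of_ne]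
    rintro ⟨-, h1⟩
    exact hA.ne h1
  have hηy : P.tw (upd (upd (upd ξ r' z) r x) r y) y.1 r = P.tw ξ y.1 r + 2 * y.2 := by
    rw [tw_upd_self hrn, tw_upd_of_ne (by simp only; tauto), tw_upd_of_ne]
    rintro ⟨-, h1⟩
    exact hA.ne h1
  by_cases hx0 : x.2 = 0
  · obtain ⟨hod, rfl⟩ := eq_zero_of_mem hx hx0
    have hy0 : y.2 ≠ 0 := fun h0 => hxy (by rw [(eq_zero_of_mem hy h0).2])
    exact kk_comm_zero hq_ne_zero (xx_ne_zero ξ) hA.1 hy hy0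
      (zero_cond hP hLM hrn h h' hy hy0 hηy hs hu (Nat.not_even_iff.1 hod) hsr')
  · by_cases hy0 : y.2 = 0
    · obtain ⟨hod, rfl⟩ := eq_zero_of_mem hy hy0
      rw [add_comm]
      exact kk_comm_zero hq_ne_zero (xx_ne_zero ξ) hA.1 hx hx0
        (zero_cond hP hLM hrn h h' hx hx0 hηx hs hu (Nat.not_even_iff.1 hod) hsr')
    · refine kk_comm hq_ne_zero (xx_ne_zero ξ) hA.1 hx hx0 hy hy0 hxy
        (nn_mv_ne_zero hP hLM hrn h h' hx hx0 hηx hs hu hy hy0 hxy) ?_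
      rw [nn_comm]
      exact nn_mv_ne_zero hP hLM hrn h h' hy hy0 hηy hs hu hx hx0 hxy.symm

end Omega

/-! ### Coinciding interpolation nodes -/

/-- The neighbour that coincides with the centre of a move, if this centre is not unique. -/
def phi (r : ℕ) (x : ℕ × ℤ) : ℕ × ℕ :=
  if x.2 = 0 then ((r + 1) / 2, r + 1)
  else if x.2 = 1 ∨ (r % 2 = 0 ∧ x.1 = r / 2) then (x.1, r + 1) else (x.1, r - 1)

lemma phi_inj {r : ℕ} {x y : ℕ × ℤ} (hx : x ∈ moves r) (hy : y ∈ moves r)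
    (h : phi r x = phi r y) (hxy : x ≠ y) : x.1 = y.1 := by
  by_contra hne
  simp only [phi] at h
  have hc : ∀ {x}, x ∈ moves r → x.2 ≠ 0 → 2 * x.1 ≤ r := fun h1 h2 =>
    (Omega.col_iff.1 (col_of_mem h1 h2)).2
  by_cases hx0 : x.2 = 0
  · by_cases hy0 : y.2 = 0
    · exact hxy ((eq_zero_of_mem hx hx0).2.trans (eq_zero_of_mem hy hy0).2.symm)
    · have := hc hy hy0
      have h3 := Nat.not_even_iff.1 (eq_zero_of_mem hx hx0).1
      rw [if_pos hx0, if_neg hy0] at h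
      split_ifs at h <;> rw [Prod.mk.injEq] at h <;> omega
  · by_cases hy0 : y.2 = 0
    · have := hc hx hx0
      have h3 := Nat.not_even_iff.1 (eq_zero_of_mem hy hy0).1
      rw [if_neg hx0, if_pos hy0] at h
      split_ifs at h <;> rw [Prod.mk.injEq] at h <;> omega
    · rw [if_neg hx0, if_neg hy0] at h
      split_ifs at h <;> rw [Prod.mk.injEq] at h <;> omega

/-- The interpolation formula, if coinciding nodes are zeros of the numerator. -/
lemma lagrange {ι κ : Type*} [DecidableEq ι] [DecidableEq κ] {s : Finset ι}
    {F : Finset κ} {v : ι → ℂ} {u : κ → ℂ} (φ : ι → κ)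
    (h : ∀ x ∈ s, ∀ y ∈ s, x ≠ y → v x = v y → φ x ∈ F ∧ u (φ x) = v x)
    (hi : ∀ x ∈ s, ∀ y ∈ s, φ x = φ y → v x = v y → x = y) (hc : #s = #F + 1) :
    ∑ i ∈ s, (∏ f ∈ F, (u f - v i)) / ∏ j ∈ s.erase i, (v i - v j) = (-1) ^ #F := by
  classical
  refine sum_prod_div_prod (S := s.filter fun x => φ x ∈ F ∧ u (φ x) = v x) (φ := φ)
    (filter_subset _ _) (fun x hx => (mem_filter.1 hx).2) ?_ ?_ ?_ hc
  · intro x hx y hy hxy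
    obtain ⟨h1, h2, h3⟩ := mem_filter.1 hx
    obtain ⟨h4, h5, h6⟩ := mem_filter.1 hy
    exact hi x h1 y h4 hxy (by rw [← h3, ← h6, hxy])
  · intro x hx y hy hxy
    by_contra hne
    obtain ⟨h1, h2⟩ := mem_sdiff.1 hx
    exact h2 (mem_filter.2 ⟨h1, h x h1 y (mem_sdiff.1 hy).1 hne hxy⟩)
  · intro x hx y hy hxy
    obtain ⟨h1, h2⟩ := mem_sdiff.1 hx
    refine h2 (mem_filter.2 ⟨h1, h x h1 y (mem_filter.1 hy).1 ?_ hxy⟩)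
    rintro rfl
    exact h2 hy

namespace Omega

variable {P : Omega} {ξ η : ℕ → ℕ → ℤ} {r r' s : ℕ} {x y z : ℕ × ℤ}

/-- Centres of moves of cyclic columns are unique. -/
lemma vv_ne_of_cyc (hP : P.Admissible) (hrn : r < P.n) (hx : x ∈ moves r) (hx0 : x.2 ≠ 0)
    (hxi : x.1 ≤ P.i) (hy : y ∈ moves r) (hxy : x ≠ y) :
    vv P.hq (P.xx ξ) r x ≠ vv P.hq (P.xx ξ) r y := by
  obtain ⟨a, e⟩ := x
  have he := sign_of_mem hx hx0
  have ha := col_iff.1 (col_of_mem hx hx0)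
  simp only at he ha hxi hx0
  have hcy : P.IsCyc a r := ⟨ha.1, hxi, ha.2, hrn.le⟩
  have key : ∀ {A : ℂ}, IsGen P.hq A → ∀ z : ℤ, ∀ B, B = A * P.hq ^ z ∨ B = A⁻¹ * P.hq ^ z →
      br P.hq B ≠ 0 := by
    rintro A hA z B (rfl | rfl)
    · exact hA z
    · exact hA.inv z
  have hX := xx_ne_zero (P := P) ξ a r
  rw [Ne, ← sub_eq_zero, vv, vv, yy_sub (hq_w hP)
    (mul_ne_zero (ev_ne_zero hq_ne_zero (xx_ne_zero _ _ _)) hq_ne_zero)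
    (mul_ne_zero (ev_ne_zero hq_ne_zero (xx_ne_zero _ _ _)) hq_ne_zero), mul_eq_zero,
    or_iff_right (pow_ne_zero _ (hq_w hP)), mul_eq_zero, not_or]
  by_cases hy0 : y.2 = 0
  · have g := isGen_xx (ξ := ξ) hP hcy
    simp only [ev, hx0, hy0, if_true, if_false]
    rcases he with rfl | rfl
    · exact ⟨key g 1 _ (Or.inl (by have := hq_ne_zero (P := P); simp [this])),
        key g 1 _ (Or.inl (by have := hq_ne_zero (P := P); simp [this]))⟩
    · exact ⟨key g 1 _ (Or.inr (by have := hq_ne_zero (P := P); simp [this])),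
        key g 1 _ (Or.inr (by have := hq_ne_zero (P := P); simp [this]))⟩
  · obtain ⟨b, d⟩ := y
    have hd := sign_of_mem hy hy0
    have hb := col_iff.1 (col_of_mem hy hy0)
    simp only at hd hb hy0
    have hY := xx_ne_zero (P := P) ξ b r
    have hq := hq_ne_zero (P := P)
    have g1 := isGen_mul (ξ := ξ) hP hcy hb.1 hb.2 hrn.le (Or.inl ⟨rfl, hrn⟩)
    simp only [ev, hx0, hy0, if_false]
    by_cases hab : a = b
    · subst hab
      have hde : d = -e := by
        rcases he with rfl | rfl <;> rcases hd with rfl | rfl <;> simp_all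
      subst hde
      constructor
      · rw [show P.xx ξ a r ^ e * P.hq * (P.xx ξ a r ^ (-e) * P.hq) = P.hq ^ (2 : ℤ) by
          rw [zpow_neg]; field_simp, br_zpow_eq_zero_iff hP]
        have := hP.k_ge
        exact not_dvd_of_abs_lt (by norm_num) (by omega) (by omega)
      · apply key g1 0
        rcases he with rfl | rfl
        · left; simp; field_simp
        · right; simp; field_simp
    · have g2 := isGen_div (ξ := ξ) hP hcy hb.1 hb.2 hrn.le (Or.inl ⟨rfl, hab, hrn⟩)
      have e2 : P.hq ^ (2 : ℤ) = P.hq * P.hq := by norm_cast; ring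
      rcases he with rfl | rfl <;> rcases hd with rfl | rfl
      · exact ⟨key g1 2 _ (Or.inl (by rw [e2]; simp; ring)),
          key g2 0 _ (Or.inl (by simp; field_simp))⟩
      · exact ⟨key g2 2 _ (Or.inl (by rw [e2]; simp; ring)),
          key g1 0 _ (Or.inl (by simp; field_simp))⟩
      · exact ⟨key g2 2 _ (Or.inr (by rw [e2]; simp; ring)),
          key g1 0 _ (Or.inr (by simp; field_simp))⟩
      · exact ⟨key g1 2 _ (Or.inr (by rw [e2]; simp; ring)),
          key g2 0 _ (Or.inr (by simp; field_simp))⟩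

variable (P) in
/-- The integral coordinate of the centre of a move. -/
def tau (ξ : ℕ → ℕ → ℤ) (r : ℕ) (x : ℕ × ℤ) : ℤ := if x.2 = 0 then 0 else P.tw ξ x.1 r + x.2

lemma vv_tau (hP : P.Admissible) (hrn : r < P.n) (hx : x ∈ moves r)
    (hxi : x.2 = 0 ∨ P.i < x.1) : vv P.hq (P.xx ξ) r x = yy (P.hq ^ P.tau ξ r x) := by
  rw [tau]
  split_ifs with h0
  · obtain ⟨-, rfl⟩ := eq_zero_of_mem hx h0
    rw [vv_zero hq_ne_zero, zpow_zero]
  · exact vv_tw hP (sign_of_mem hx h0) (by tauto) (col_iff.1 (col_of_mem hx h0)).2 hrn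

/-- A coordinate in an odd row is at least its distance from the end of the row, so `1` occurs only
in the last column; the inequalities on both sides then pin the neighbours to `0`. -/
lemma tw_eq_of_inter (hod : r % 2 = 1) {a : ℕ} (hrn : r < P.n) (h : P.Inter ξ) (ha : P.i < a)
    (har : 2 * a ≤ r) (h1 : P.tw ξ a r = 1) : 2 * a + 1 = r ∧ P.tw ξ a (r - 1) = 0 ∧
      P.tw ξ (a + 1) (r + 1) = 0 := by
  have h2 := h.pos_odd ha har hrn hod
  obtain rfl : 2 * a + 1 = r := by omega
  have h3 := h.up a (2 * a) ha (by omega) (by omega)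
  have h4 := h.odd a ha (by omega)
  have h5 : P.tw ξ (a + 1) (2 * a + 2) + 1 ≤ P.tw ξ a (2 * a + 1) :=
    h.down a (2 * a + 1) ha (by omega) (by omega)
  have h6 := h.even a ha (by omega)
  change _ ∧ P.tw ξ a (2 * a) = 0 ∧ P.tw ξ (a + 1) (2 * a + 2) = 0
  omega

/-- Coinciding centres of noncyclic columns in the regular case. -/
lemma collide (hP : P.Admissible) (hL : P.Low) (hrn : r < P.n) (h : P.Inter ξ)
    (hx : x ∈ moves r) (hy : y ∈ moves r) (hxi : P.i < x.1) (hyi : P.i < y.1)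
    (hx0 : x.2 ≠ 0) (hy0 : y.2 ≠ 0) (hxy : x.1 < y.1)
    (hv : (P.k : ℤ) ∣ P.tau ξ r x + P.tau ξ r y ∨ (P.k : ℤ) ∣ P.tau ξ r x - P.tau ξ r y) :
    y.1 = x.1 + 1 ∧ x.2 = -1 ∧ P.tw ξ x.1 (r - 1) = P.tau ξ r x ∧
      P.tw ξ y.1 (r + 1) = P.tau ξ r x ∧
      (y.2 = 1 ∧ P.tau ξ r y = P.tau ξ r x ∨ r = 2 * y.1 ∧ P.tau ξ r y = -P.tau ξ r x) := by
  obtain ⟨a, e⟩ := x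
  obtain ⟨b, d⟩ := y
  have he := sign_of_mem hx hx0
  have ha := col_iff.1 (col_of_mem hx hx0)
  have hd := sign_of_mem hy hy0
  have hb := col_iff.1 (col_of_mem hy hy0)
  simp only at *
  rw [show P.tau ξ r (a, e) = P.tw ξ a r + e from if_neg hx0,
    show P.tau ξ r (b, d) = P.tw ξ b r + d from if_neg hy0] at *
  have p1 := tw_parity (P := P) ξ a r
  have p2 := tw_parity (P := P) ξ b r
  have b1 := h.bounds hP hL (by omega) ha.2 hrn
  have b2 := h.bounds hP hL (by omega) hb.2 hrn
  have h1 := h.col hxi hxy.le hb.2 hrn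
  have h2 := h.add_pos hxi hxy hb.2 hrn
  rcases hv with hv | hv
  · have hs : P.tw ξ a r + e + (P.tw ξ b r + d) = 0 := by
      by_contra hne
      exact not_dvd_of_lt hP (by omega) hne (by omega) (by omega) hv
    obtain rfl : b = a + 1 := by omega
    obtain rfl : e = -1 := by omega
    obtain rfl : d = -1 := by omega
    have hr : r = 2 * a + 2 := by
      by_contra hne
      rcases Nat.mod_two_eq_zero_or_one r with h3 | h3
      · have h4 := h.add_pos (s := r) hxi (by omega : a < a + 2) (by omega) hrn
        have h5 := h.col (s := r) hyi (by omega : a + 1 ≤ a + 2) (by omega) hrn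
        push_cast at h4 h5
        omega
      · have := h.pos_odd hxi ha.2 hrn h3
        have := h.pos_odd hyi hb.2 hrn h3
        omega
    subst hr
    have h3 : P.tw ξ a (2 * a + 1) + 1 ≤ P.tw ξ a (2 * a + 2) :=
      h.up a (2 * a + 1) hxi (by omega) (by omega)
    have h4 := h.even a hxi (by omega)
    have h5 : P.tw ξ (a + 1) (2 * a + 3) + 1 ≤ P.tw ξ a (2 * a + 2) :=
      h.down a (2 * a + 2) hxi (by omega) (by omega)
    have h6 : 1 ≤ P.tw ξ (a + 1) (2 * a + 2) + P.tw ξ (a + 1) (2 * a + 3) :=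
      h.odd (a + 1) hyi (by omega)
    change _ ∧ _ ∧ P.tw ξ a (2 * a + 1) = _ ∧ P.tw ξ (a + 1) (2 * a + 3) = _ ∧ _
    refine ⟨rfl, rfl, by omega, by omega, Or.inr ⟨by omega, by omega⟩⟩
  · have hs : P.tw ξ a r + e - (P.tw ξ b r + d) = 0 := by
      by_contra hne
      exact not_dvd_of_lt hP (by omega) hne (by omega) (by omega) hv
    obtain rfl : b = a + 1 := by omega
    obtain rfl : e = -1 := by omega
    obtain rfl : d = 1 := by omega
    obtain ⟨s, rfl⟩ : ∃ s, r = s + 1 := ⟨r - 1, by omega⟩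
    have h3 := h.up a s hxi (by omega) (by omega)
    have h4 := h.down a s hxi (by omega) (by omega)
    have h5 := h.down a (s + 1) hxi (by omega) (by omega)
    have h6 := h.up (a + 1) (s + 1) hyi (by omega) (by omega)
    change _ ∧ _ ∧ P.tw ξ a s = _ ∧ _ ∧ _
    refine ⟨rfl, rfl, by omega, by omega, Or.inl ⟨rfl, by omega⟩⟩

/-- In a row of even number only the last noncyclic entry can have a vanishing coordinate. -/
lemma br_xx_even (hP : P.Admissible) (hLM : P.Low ∨ P.IsMinimal) (hev : Even r) (hrn : r < P.n)
    (h : P.Inter ξ) {a : ℕ} (ha : a ∈ cols r) (h0 : br P.hq (P.xx ξ a r) = 0) :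
    P.i < a ∧ a = r / 2 ∧ P.tw ξ a r = 0 := by
  rw [Nat.even_iff] at hev
  have ha := col_iff.1 ha
  have hai : P.i < a := by
    by_contra hcon
    exact (isGen_xx (ξ := ξ) hP ⟨ha.1, not_lt.1 hcon, ha.2, hrn.le⟩).ne h0
  rw [xx_tw hP ξ hai ha.2 hrn.le, br_zpow_eq_zero_iff hP] at h0
  rcases hLM with hL | hM
  · have b := h.bounds hP hL hai ha.2 hrn
    have ht : P.tw ξ a r = 0 := by
      by_contra hne
      exact not_dvd_of_abs_lt hne (by omega) (by omega) h0
    refine ⟨hai, ?_, ht⟩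
    by_contra hne
    have h1 := h.add_pos hai (by omega : a < r / 2) (by omega) hrn
    have h2 := h.col hai (by omega : a ≤ r / 2) (by omega) hrn
    omega
  · have ht := h.tw_minimal hP hM hai ha.2 hrn.le
    have hi := hM.1
    have hi2 := hP.i_lt
    -- In the minimal case `Low` may fail. The bound `2k` from `bound_add` is enough, as the frozen
    -- coordinates of an even row are even.
    have hb : P.tw ξ (P.i + 1) P.n < 2 * P.k := by
      have h1 := hP.bound_add
      rw [tw_minimal_top hP hM (by omega) (by omega)]
      rw [topL, topL, hM.2 _ (by omega) (by omega), hM.2 _ (by omega) (by omega)] at h1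
      have h2 : (((P.n + 1) / 2 : ℕ) : ℚ) - (P.i + 1 : ℕ) + (((P.n + 1) / 2 : ℕ) - (P.n / 2 : ℕ))
        < P.k := by linarith
      have h3 : (((P.n + 1) / 2 : ℕ) : ℤ) - (P.i + 1 : ℕ) +
        (((P.n + 1) / 2 : ℕ) - (P.n / 2 : ℕ)) < P.k := by exact_mod_cast h2
      omega
    rw [tw_minimal_top hP hM (by omega) (by omega)] at hb
    have ht0 : P.tw ξ a r = 0 := by
      by_contra hne
      exact not_dvd_of_lt hP (by omega) hne (by omega) (by omega) h0
    exact ⟨hai, by omega, ht0⟩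

/-- The centres of the two moves of a column. -/
lemma eq_of_vv_eq (hP : P.Admissible) (hLM : P.Low ∨ (P.IsMinimal ∧ Even r)) (hrn : r < P.n)
    (h : P.Inter ξ) (hx : x ∈ moves r) (hy : y ∈ moves r) (hxy : x.1 = y.1)
    (hv : vv P.hq (P.xx ξ) r x = vv P.hq (P.xx ξ) r y) :
    x = y ∨ (Even r ∧ P.i < x.1 ∧ x.1 = r / 2 ∧ P.tw ξ x.1 r = 0) := by
  by_cases hne : x = y
  · exact Or.inl hne
  right
  by_cases hx0 : x.2 = 0
  · have := (eq_zero_of_mem hx hx0).2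
    by_cases hy0 : y.2 = 0
    · exact absurd (this.trans (eq_zero_of_mem hy hy0).2.symm) hne
    · have ha := col_iff.1 (col_of_mem hy hy0)
      rw [← hxy, this] at ha
      simp at ha
  by_cases hy0 : y.2 = 0
  · have ha := col_iff.1 (col_of_mem hx hx0)
    rw [hxy, (eq_zero_of_mem hy hy0).2] at ha
    simp at ha
  obtain ⟨a, e⟩ := x
  obtain ⟨b, d⟩ := y
  simp only at hxy
  subst hxy
  have he := sign_of_mem hx hx0
  have hd := sign_of_mem hy hy0
  simp only at he hd hx0 hy0
  have hde : d = -e := by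
    have : e ≠ d := fun h0 => hne (by rw [h0])
    omega
  subst hde
  have ha' := col_of_mem hx hx0
  have ha := col_iff.1 ha'
  have hk := vv_sub_neg (r := r) (a := a) hq_ne_zero (hq_w hP) (xx_ne_zero (P := P) ξ) he
  have he0 : (e : ℂ) ≠ 0 := Int.cast_ne_zero.2 hx0
  rw [hv, sub_self, zero_eq_mul, or_iff_right (pow_ne_zero _ (hq_w hP)), mul_eq_zero,
    or_iff_right he0] at hk
  have hai : P.i < a := by
    by_contra hcon
    have := isGen_mul (ξ := ξ) hP ⟨ha.1, not_lt.1 hcon, ha.2, hrn.le⟩ ha.1 ha.2 hrn.le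
      (Or.inl ⟨rfl, hrn⟩)
    exact this.ne (by rw [← sq]; exact hk)
  by_cases hev : Even r
  · have h0 : br P.hq (P.xx ξ a r) = 0 := by
      rw [br_sq _ (xx_ne_zero _ _ _), mul_eq_zero] at hk
      refine hk.resolve_right ?_
      rw [xx_tw hP ξ hai ha.2 hrn.le]
      exact add_inv_hq_ne_zero hP _
    exact ⟨hev, br_xx_even hP (hLM.imp_right And.left) hev hrn h ha' h0⟩
  · exfalso
    have hL := hLM.resolve_right fun h0 => hev h0.2
    rw [Nat.not_even_iff] at hev
    rw [xx_tw hP ξ hai ha.2 hrn.le, sq, ← zpow_add₀ hq_ne_zero, br_zpow_eq_zero_iff hP] at hk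
    have hp := h.pos_odd hai ha.2 hrn hev
    have b := h.bounds hP hL hai ha.2 hrn
    exact not_dvd_of_lt hP (by omega) (by omega) (by omega) (by omega) hk

/-- A coinciding centre is a zero of the numerator of the interpolation formula. -/
lemma phi_of_vv_eq (hP : P.Admissible) (hLM : P.Low ∨ P.IsMinimal) (hA : Adj r r')
    (hrn : r < P.n) (hrn' : r' < P.n) (h : P.Inter ξ) (hz : z ∈ moves r')
    (h' : P.Inter (upd ξ r' z)) (hx : x ∈ moves r) (hy : y ∈ moves r) (hne : x ≠ y)
    (hs : Even r → x.1 ≠ y.1) (hv : vv P.hq (P.xx ξ) r x = vv P.hq (P.xx ξ) r y) :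
    phi r x ∈ (nb r).erase (z.1, r') ∧
      yy (P.xx ξ (phi r x).1 (phi r x).2) = vv P.hq (P.xx ξ) r x := by
  have hxi : x.2 = 0 ∨ P.i < x.1 := by
    by_contra hcon
    rw [not_or, not_lt] at hcon
    exact vv_ne_of_cyc hP hrn hx hcon.1 hcon.2 hy hne hv
  have hyi : y.2 = 0 ∨ P.i < y.1 := by
    by_contra hcon
    rw [not_or, not_lt] at hcon
    exact vv_ne_of_cyc hP hrn hy hcon.1 hcon.2 hx hne.symm hv.symm
  have hv' := hv
  rw [vv_tau hP hrn hx hxi, vv_tau hP hrn hy hyi, yy_eq_iff hP] at hv'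
  -- it suffices to find the integral coordinate of the neighbour
  suffices H : phi r x ∈ nb r ∧ P.i < (phi r x).1 ∧
      (P.tw ξ (phi r x).1 (phi r x).2 = P.tau ξ r x ∨
        P.tw ξ (phi r x).1 (phi r x).2 = -P.tau ξ r x) ∧ phi r x ≠ (z.1, r') by
    obtain ⟨h1, h2, h3, h4⟩ := H
    refine ⟨mem_erase.2 ⟨h4, h1⟩, ?_⟩
    have h5 := mem_nb.1 h1
    rw [vv_tau hP hrn hx hxi, xx_tw hP ξ h2 (by omega) (by omega)]
    rcases h3 with h3 | h3 <;> rw [h3]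
    rw [yy_neg]
  -- If the coinciding neighbour were the entry moved by `z`, it would change by `2`. In each case
  -- below, interlacing after the move is incompatible with that change.
  have hzz : ∀ f : ℕ × ℕ, 1 ≤ f.1 → f = (z.1, r') → (z.2 = 1 ∨ z.2 = -1) ∧
      P.tw (upd ξ r' z) f.1 f.2 = P.tw ξ f.1 f.2 + 2 * z.2 := by
    rintro f hf rfl
    refine ⟨sign_of_mem hz fun h0 => ?_, tw_upd_self hrn'⟩
    rw [(eq_zero_of_mem hz h0).2] at hf
    simp at hf
  have hzz' : ∀ f : ℕ × ℕ, f.2 = r → P.tw (upd ξ r' z) f.1 f.2 = P.tw ξ f.1 f.2 := by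
    rintro f rfl
    exact tw_upd_of_ne fun h0 => hA.ne h0.2
  rcases hLM with hL | hM
  · have hxy : x.1 ≠ y.1 := fun h0 => by
      rcases eq_of_vv_eq hP (Or.inl hL) hrn h hx hy h0 hv with h1 | ⟨h1, -⟩
      · exact hne h1
      · exact hs h1 h0
    by_cases hx0 : x.2 = 0
    · by_cases hy0 : y.2 = 0
      · exact absurd ((eq_zero_of_mem hx hx0).2.trans (eq_zero_of_mem hy hy0).2.symm) hne
      obtain ⟨hod, rfl⟩ := eq_zero_of_mem hx hx0
      rw [Nat.not_even_iff] at hod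
      obtain ⟨b, d⟩ := y
      have hd := sign_of_mem hy hy0
      have hb := col_iff.1 (col_of_mem hy hy0)
      simp only at hd hb hy0
      replace hyi : P.i < b := hyi.resolve_left hy0
      have b2 := h.bounds hP hL hyi hb.2 hrn
      have o2 := h.pos_odd hyi hb.2 hrn hod
      have hτ : P.tw ξ b r + d = 0 := by
        by_contra hne
        simp only [tau, hy0, if_true, if_false, zero_add, zero_sub, dvd_neg, or_self] at hv'
        exact not_dvd_of_abs_lt hne (by omega) (by omega) hv'
      obtain ⟨k1, k2, k3⟩ := tw_eq_of_inter hod hrn h hyi hb.2 (by omega)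
      have e1 : phi r (0, 0) = (b + 1, r + 1) := by
        simp only [phi, if_true, Prod.mk.injEq, and_true]; omega
      rw [e1]
      refine ⟨mem_nb.2 (Or.inl ⟨by omega, by omega, rfl⟩), by simp only; omega,
        Or.inl (by simp [tau, k3]), fun h0 => ?_⟩
      obtain ⟨q1, q2⟩ := hzz _ (by simp only; omega) h0
      have q3 := hzz' (b, r) rfl
      simp only at q2 q3
      have q4 := (tw_eq_of_inter hod hrn h' hyi hb.2 (by omega)).2.2
      omega
    · by_cases hy0 : y.2 = 0
      · obtain ⟨hod, rfl⟩ := eq_zero_of_mem hy hy0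
        rw [Nat.not_even_iff] at hod
        obtain ⟨b, d⟩ := x
        have hd := sign_of_mem hx hx0
        have hb := col_iff.1 (col_of_mem hx hx0)
        simp only at hd hb hx0
        replace hxi : P.i < b := hxi.resolve_left hx0
        have b2 := h.bounds hP hL hxi hb.2 hrn
        have o2 := h.pos_odd hxi hb.2 hrn hod
        have hτ : P.tw ξ b r + d = 0 := by
          by_contra hne
          simp only [tau, hx0, if_true, if_false, add_zero, sub_zero, or_self] at hv'
          exact not_dvd_of_abs_lt hne (by omega) (by omega) hv'
        obtain ⟨k1, k2, k3⟩ := tw_eq_of_inter hod hrn h hxi hb.2 (by omega)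
        have e1 : phi r (b, d) = (b, r - 1) := by
          simp only [phi]
          rw [if_neg hx0, if_neg (by omega)]
        rw [e1]
        refine ⟨mem_nb.2 (Or.inr ⟨by omega, by omega, rfl⟩), by simp only; omega,
          Or.inl (by simp only [tau, if_neg hx0, k2]; omega), fun h0 => ?_⟩
        obtain ⟨q1, q2⟩ := hzz _ (by simp only; omega) h0
        have q3 := hzz' (b, r) rfl
        simp only at q2 q3
        have q4 := (tw_eq_of_inter hod hrn h' hxi hb.2 (by omega)).2.1
        omega
      · have hxi' : P.i < x.1 := by tauto
        have hyi' : P.i < y.1 := by tauto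
        have ha := col_iff.1 (col_of_mem hx hx0)
        have hb := col_iff.1 (col_of_mem hy hy0)
        rcases lt_or_gt_of_ne hxy with hl | hl
        · obtain ⟨k1, k2, k3, k4, k5⟩ := collide hP hL hrn h hx hy hxi' hyi' hx0 hy0 hl hv'
          have e1 : phi r x = (x.1, r - 1) := by
            simp only [phi]
            rw [if_neg hx0, if_neg (by omega)]
          rw [e1]
          refine ⟨mem_nb.2 (Or.inr ⟨by simp only; omega, by simp only; omega, rfl⟩), hxi',
            Or.inl k3, fun h0 => ?_⟩
          obtain ⟨q1, q2⟩ := hzz _ (by simp only; omega) h0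
          have q3 := hzz' (x.1, r) rfl
          have q3' := hzz' (y.1, r) rfl
          obtain ⟨s, rfl⟩ : ∃ s, r = s + 1 := ⟨r - 1, by omega⟩
          have h3 := h'.up x.1 s hxi' (by omega) (by omega)
          have h4 := h'.down x.1 s hxi' (by omega) (by omega)
          simp only [tau, if_neg hx0, if_neg hy0, show s + 1 - 1 = s by omega, k1] at *
          rcases k5 with ⟨k5, k6⟩ | ⟨k5, k6⟩
          · omega
          · have h6 := h'.even x.1 hxi' (by omega)
            obtain rfl : s = 2 * x.1 + 1 := by omega
            simp only [show 2 * x.1 + 1 + 1 = 2 * x.1 + 2 by ring] at *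
            have hd := sign_of_mem hy hy0
            omega
        · obtain ⟨k1, k2, k3, k4, k5⟩ := collide hP hL hrn h hy hx hyi' hxi' hy0 hx0 hl
            (by rw [add_comm, ← dvd_neg (a := (P.k : ℤ)) (b := P.tau ξ r y - _), neg_sub]
                exact hv')
          have e1 : phi r x = (x.1, r + 1) := by
            simp only [phi]
            rw [if_neg hx0, if_pos (by omega)]
          rw [e1]
          refine ⟨mem_nb.2 (Or.inl ⟨by simp only; omega, by simp only; omega, rfl⟩), hxi',
            by simp only; omega, fun h0 => ?_⟩
          obtain ⟨q1, q2⟩ := hzz _ (by simp only; omega) h0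
          have q3 := hzz' (x.1, r) rfl
          have q3' := hzz' (y.1, r) rfl
          have h3 := h'.up x.1 r hxi' (by omega) (by omega)
          have h4 := h'.down y.1 r hyi' (by omega) (by omega)
          simp only [tau, if_neg hx0, if_neg hy0, ← k1] at *
          rcases k5 with ⟨k5, k6⟩ | ⟨k5, k6⟩
          · omega
          · have h6 := h'.odd x.1 hxi' (by omega)
            rw [← k5] at h6
            have hd := sign_of_mem hx hx0
            omega
  · have hi := hM.1
    have htw : ∀ a s, P.i < a → 2 * a ≤ s → s ≤ P.n → P.tw ξ a s = s - 2 * a := fun a s =>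
      h.tw_minimal hP hM
    have hno : ∀ f : ℕ × ℕ, P.i < f.1 → 2 * f.1 ≤ f.2 → f.2 ≤ P.n → f ≠ (z.1, r') := by
      intro f h1 h2 h3 h0
      obtain ⟨q1, q2⟩ := hzz _ (by omega) h0
      rw [h.tw_minimal hP hM h1 h2 h3, h'.tw_minimal hP hM h1 h2 h3] at q2
      omega
    by_cases hx0 : x.2 = 0
    · by_cases hy0 : y.2 = 0
      · exact absurd ((eq_zero_of_mem hx hx0).2.trans (eq_zero_of_mem hy hy0).2.symm) hne
      have hb := col_iff.1 (col_of_mem hy hy0)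
      have hyi' : P.i < y.1 := by tauto
      have hod := Nat.not_even_iff.1 (eq_zero_of_mem hx hx0).1
      have e1 : phi r x = ((r + 1) / 2, r + 1) := by rw [phi, if_pos hx0]
      rw [e1]
      refine ⟨mem_nb.2 (Or.inl ⟨by simp only; omega, by simp only; omega, rfl⟩), by
        simp only; omega, Or.inl ?_, hno _ (by simp only; omega) (by simp only; omega)
          (by simp only; omega)⟩
      rw [htw _ _ (by simp only; omega) (by simp only; omega) (by simp only; omega), tau,
        if_pos hx0]
      simp only
      omega
    · have hxi' : P.i < x.1 := by tauto
      have ha := col_iff.1 (col_of_mem hx hx0)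
      have he := sign_of_mem hx hx0
      simp only [phi]
      rw [if_neg hx0, tau, if_neg hx0, htw _ _ hxi' ha.2 hrn.le]
      split_ifs with hc
      · refine ⟨mem_nb.2 (Or.inl ⟨by simp only; omega, by simp only; omega, rfl⟩), hxi', ?_,
          hno _ hxi' (by simp only; omega) (by simp only; omega)⟩
        rw [htw _ _ hxi' (by simp only; omega) (by simp only; omega)]
        simp only
        omega
      · refine ⟨mem_nb.2 (Or.inr ⟨by simp only; omega, by simp only; omega, rfl⟩), hxi', ?_,
          hno _ hxi' (by simp only; omega) (by simp only; omega)⟩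
        rw [htw _ _ hxi' (by simp only; omega) (by simp only; omega)]
        simp only
        omega

end Omega

/-! ### The sum over closed paths -/

namespace Omega

variable {P : Omega} {ξ η : ℕ → ℕ → ℤ} {r r' s : ℕ} {x y z : ℕ × ℤ}

lemma add_inv_ne_zero (hP : P.Admissible) (hrn : r < P.n) (hx : x ∈ moves r) (hx0 : x.2 ≠ 0) :
    P.xx ξ x.1 r * P.hq ^ (2 * x.2) + (P.xx ξ x.1 r * P.hq ^ (2 * x.2))⁻¹ ≠ 0 := by
  have ha := col_iff.1 (col_of_mem hx hx0)
  by_cases hxi : x.1 ≤ P.i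
  · exact add_inv_ne_zero_of_cyc hP ⟨ha.1, hxi, ha.2, hrn.le⟩ hrn _
  · rw [xx_tw hP ξ (by omega) ha.2 hrn.le, ← zpow_add₀ hq_ne_zero]
    exact add_inv_hq_ne_zero hP _


lemma phi_inj' (hx : x ∈ moves r) (hy : y ∈ moves r) (h : phi r x = phi r y)
    (hs : Even r → x.1 = y.1 → x = y) : x = y := by
  by_contra hne
  have h1 := phi_inj hx hy h hne
  have hod : ¬ Even r := fun h0 => hne (hs h0 h1)
  have hod' := Nat.not_even_iff.1 hod
  have hr : (r + 1 : ℕ) ≠ r - 1 := by omega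
  simp only [phi, h1, hod'] at h
  have h2 : x.2 ≠ y.2 := fun h0 => hne (Prod.ext h1 h0)
  have hc : ∀ {x}, x ∈ moves r → x.2 ≠ 0 → 1 ≤ x.1 := fun h1 h2 =>
    (col_iff.1 (col_of_mem h1 h2)).1
  by_cases hx0 : x.2 = 0
  · have := hc hy (fun h0 => h2 (hx0.trans h0.symm))
    rw [← h1, (eq_zero_of_mem hx hx0).2] at this
    simp at this
  by_cases hy0 : y.2 = 0
  · have := hc hx hx0
    rw [h1, (eq_zero_of_mem hy hy0).2] at this
    simp at this
  have he := sign_of_mem hx hx0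
  have hd := sign_of_mem hy hy0
  rcases he with he | he <;> rcases hd with hd | hd <;>
    (simp [he, hd] at h h2; try omega)

section

variable {c : ℕ → ℕ → ℂ} (hP : P.Admissible) (hLM : P.Low ∨ P.IsMinimal) (hA : Adj r r')
  (hrn : r < P.n) (hrn' : r' < P.n) (h : P.Inter ξ) (hz : z ∈ moves r')
  (h' : P.Inter (upd ξ r' z))

include hP hLM hA hrn hrn' h hz h'

/-- The denominator vanishes only if the coordinate after the move is a multiple of `k`. In the
regular case that means `0` or `k`. At `0` neighbours in both adjacent rows lie at the centre up to
sign, and at least one is not moved by `z`; at `k` the bound `Low` puts the neighbour above at the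
centre. -/
lemma hden_odd (hod : ¬ Even r) (hx : x ∈ moves r) (hx0 : x.2 ≠ 0) :
    br P.hq ((P.xx ξ x.1 r * P.hq ^ (2 * x.2)) ^ 2) ≠ 0 ∨ nP P.hq (P.xx ξ) r (z.1, r') x = 0 := by
  obtain ⟨a, e⟩ := x
  have he := sign_of_mem hx hx0
  have ha := col_iff.1 (col_of_mem hx hx0)
  simp only at he ha hx0 ⊢
  rw [Nat.not_even_iff] at hod
  by_cases hai : a ≤ P.i
  · left
    rw [mul_pow, sq, ← zpow_natCast, ← zpow_mul]
    exact isGen_mul (ξ := ξ) hP ⟨ha.1, hai, ha.2, hrn.le⟩ ha.1 ha.2 hrn.le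
      (Or.inl ⟨rfl, hrn⟩) _
  rw [not_le] at hai
  by_cases hk : (P.k : ℤ) ∣ P.tw ξ a r + 2 * e
  swap
  · left
    rw [xx_tw hP ξ hai ha.2 hrn.le, ← zpow_add₀ hq_ne_zero, sq, ← zpow_add₀ hq_ne_zero, Ne,
      br_zpow_eq_zero_iff hP]
    intro hd
    have h2 : IsCoprime (P.k : ℤ) 2 := by
      obtain ⟨m, hm⟩ := hP.k_odd
      exact ⟨1, -m, by rw [hm]; push_cast; ring⟩
    exact hk (h2.dvd_of_dvd_mul_left (by rwa [two_mul]))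
  right
  suffices H : ∃ f ∈ nb r, P.i < f.1 ∧ (P.tw ξ f.1 f.2 = P.tw ξ a r + e ∨
      P.tw ξ f.1 f.2 = -(P.tw ξ a r + e)) ∧ f ≠ (z.1, r') by
    obtain ⟨f, h1, h2, h3, h4⟩ := H
    refine prod_eq_zero (mem_erase.2 ⟨h4, h1⟩) ?_
    have h5 := mem_nb.1 h1
    rw [sub_eq_zero, vv_tw hP he hai ha.2 hrn, xx_tw hP ξ h2 (by omega) (by omega)]
    rcases h3 with h3 | h3 <;> rw [h3]
    rw [yy_neg]
  have hzz : ∀ f : ℕ × ℕ, 1 ≤ f.1 → f = (z.1, r') → (z.2 = 1 ∨ z.2 = -1) ∧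
      P.tw (upd ξ r' z) f.1 f.2 = P.tw ξ f.1 f.2 + 2 * z.2 := by
    rintro f hf rfl
    refine ⟨sign_of_mem hz fun h0 => ?_, tw_upd_self hrn'⟩
    rw [(eq_zero_of_mem hz h0).2] at hf
    simp at hf
  have hzz' : ∀ f : ℕ × ℕ, f.2 ≠ r' → P.tw (upd ξ r' z) f.1 f.2 = P.tw ξ f.1 f.2 :=
    fun f h1 => tw_upd_of_ne fun h0 => h1 h0.2
  have hp := h.pos_odd hai ha.2 hrn hod
  rcases hLM with hL | hM
  · have b := h.bounds hP hL hai ha.2 hrn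
    by_cases h0 : P.tw ξ a r + 2 * e = 0
    · have h2a : 2 * a + 1 = r := by omega
      subst h2a
      have h3 := h.up a (2 * a) hai (by omega) (by omega)
      have h4 := h.odd a hai (by omega)
      have h5 : P.tw ξ (a + 1) (2 * a + 2) + 1 ≤ P.tw ξ a (2 * a + 1) :=
        h.down a (2 * a + 1) hai (by omega) (by omega)
      have h6 := h.even a hai (by omega)
      have p1 := tw_parity (P := P) ξ a (2 * a)
      have p2 := tw_parity (P := P) ξ (a + 1) (2 * a + 2)
      have p3 := tw_parity (P := P) ξ a (2 * a + 1)
      by_cases hr' : r' = 2 * a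
      · refine ⟨(a + 1, 2 * a + 2), mem_nb.2 (Or.inl ⟨by simp only; omega, by simp only; omega,
          rfl⟩), by simp only; omega, by simp only; omega, ?_⟩
        rw [hr']
        simp
      · refine ⟨(a, 2 * a), mem_nb.2 (Or.inr ⟨by simp only; omega, by simp only; omega,
          rfl⟩), hai, by simp only; omega, fun hc => hr' ?_⟩
        rw [Prod.mk.injEq] at hc
        exact hc.2.symm
    · have hk0 : P.tw ξ a r + 2 * e = P.k := by
        by_contra hne
        have hk3 := hP.k_ge
        obtain ⟨m, hm⟩ := hk
        have : m ≠ 0 := by rintro rfl; simp at hm; omega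
        have : m ≠ 1 := by rintro rfl; simp at hm; omega
        have l1 : (P.k : ℤ) * m ≤ P.k := by omega
        have l2 : -1 ≤ (P.k : ℤ) * m := by omega
        have h1 : m < 2 := by nlinarith
        have h2 : -1 < m := by nlinarith
        omega
      have htop := h.le_bound hP hL hai (s := r + 1) (by omega) (by omega)
      have h1 := h.up a r hai ha.2 hrn
      have p1 := tw_parity (P := P) ξ a (r + 1)
      have p2 := tw_parity (P := P) ξ a r
      refine ⟨(a, r + 1), mem_nb.2 (Or.inl ⟨by simp only; omega, by simp only; omega, rfl⟩), hai,
        by simp only; omega, fun hc => ?_⟩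
      obtain ⟨q1, q2⟩ := hzz _ (by simp only; omega) hc
      rw [Prod.mk.injEq] at hc
      have q3 := hzz' (a, r) (by simp only; omega)
      have q4 := h'.up a r hai ha.2 hrn
      have q5 := h'.le_bound hP hL hai (s := r + 1) (by omega) (by omega)
      simp only at q2 q3
      have := hP.k_odd
      omega
  · have htw : ∀ a s, P.i < a → 2 * a ≤ s → s ≤ P.n → P.tw ξ a s = s - 2 * a := fun a s =>
      h.tw_minimal hP hM
    have hno : ∀ f : ℕ × ℕ, P.i < f.1 → 2 * f.1 ≤ f.2 → f.2 ≤ P.n → f ≠ (z.1, r') := by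
      intro f h1 h2 h3 h0
      obtain ⟨q1, q2⟩ := hzz _ (by omega) h0
      rw [h.tw_minimal hP hM h1 h2 h3, h'.tw_minimal hP hM h1 h2 h3] at q2
      omega
    rw [htw a r hai ha.2 hrn.le]
    rcases he with rfl | rfl
    · refine ⟨(a, r + 1), mem_nb.2 (Or.inl ⟨by simp only; omega, by simp only; omega, rfl⟩), hai,
        ?_, hno _ hai (by simp only; omega) (by simp only; omega)⟩
      rw [htw _ _ hai (by simp only; omega) (by simp only; omega)]
      simp only
      omega
    · refine ⟨(a, r - 1), mem_nb.2 (Or.inr ⟨by simp only; omega, by simp only; omega, rfl⟩), hai,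
        ?_, hno _ hai (by simp only; omega) (by simp only; omega)⟩
      rw [htw _ _ hai (by simp only; omega) (by simp only; omega)]
      simp only
      omega

/-- The sum over the closed paths. -/
lemma sum_loops (hc : ∀ a ∈ cols r, c a r ≠ 0) :
    ∑ x ∈ moves r, ww P.hq c (P.xx ξ) r r' z x (x.1, -x.2) = -coef P.hq c (P.xx ξ) r' z := by
  have hX := xx_ne_zero (P := P) ξ
  -- Interpolation over a subset `s` of the moves, with freedom to enlarge the set `F` of zeros.
  -- `phi` matches coinciding nodes with neighbours, provided that no column of an even row has both
  -- its nodes equal.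
  have hcol : ∀ s ⊆ moves r, (∀ x ∈ s, ∀ y ∈ s, Even r → x.1 = y.1 →
      vv P.hq (P.xx ξ) r x = vv P.hq (P.xx ξ) r y → x = y) → ∀ F : Finset (ℕ × ℕ),
      (nb r).erase (z.1, r') ⊆ F → ∀ u : ℕ × ℕ → ℂ,
      (∀ f ∈ nb r, u f = yy (P.xx ξ f.1 f.2)) → #s = #F + 1 →
      ∑ x ∈ s, (∏ f ∈ F, (u f - vv P.hq (P.xx ξ) r x)) /
        ∏ y ∈ s.erase x, (vv P.hq (P.xx ξ) r x - vv P.hq (P.xx ξ) r y) = (-1) ^ #F := by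
    intro s hs hev F hF u hu hcard
    refine lagrange (phi r) (fun x hx y hy hne hv => ?_) (fun x hx y hy hp hv => ?_) hcard
    · obtain ⟨h1, h2⟩ := phi_of_vv_eq hP hLM hA hrn hrn' h hz h' (hs hx) (hs hy) hne
        (fun h3 h4 => hne (hev x hx y hy h3 h4 hv)) hv
      exact ⟨hF h1, by rw [hu _ (mem_of_mem_erase h1), h2]⟩
    · exact phi_inj' (hs hx) (hs hy) hp fun h3 h4 => hev x hx y hy h3 h4 hv
  have hr1 := hA.1
  have hAr := hA
  obtain ⟨-, hr1', hA1⟩ := hA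
  by_cases hod : ¬ Even r
  · have hz0 : z.2 ≠ 0 := fun h0 => (eq_zero_of_mem hz h0).1 (hAr.even.2 hod)
    have hF := card_nb_erase hAr (col_of_mem hz hz0)
    have hs := card_moves (r := r)
    rw [if_neg hod] at hs
    have hod' := Nat.not_even_iff.1 hod
    have hFe : Even #((nb r).erase (z.1, r')) := by rw [Nat.even_iff]; omega
    refine loop_odd hq_ne_zero (hq_w hP) hX hAr hod hz hc
      (fun x hx hx0 => hden_odd hP hLM hAr hrn hrn' h hz h' hod hx hx0) ?_
    have := hcol (moves r) (Subset.refl _) (fun x hx y hy h0 => absurd h0 hod) _ (Subset.refl _)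
      (fun f => yy (P.xx ξ f.1 f.2)) (fun f _ => rfl) (by omega)
    rw [hFe.neg_one_pow] at this
    exact this
  rw [not_not] at hod
  have hod' := Nat.even_iff.1 hod
  have hθ : ∀ x ∈ moves r, P.xx ξ x.1 r * P.hq ^ (2 * x.2) +
      (P.xx ξ x.1 r * P.hq ^ (2 * x.2))⁻¹ ≠ 0 := fun x hx =>
    add_inv_ne_zero hP hrn hx fun h0 => (eq_zero_of_mem hx h0).1 hod
  have hs := card_moves (r := r)
  rw [if_pos hod] at hs
  -- The only column of an even row whose two nodes can coincide is the last one, when its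
  -- coordinate is `0`.
  by_cases hsp : P.i < r / 2 ∧ P.tw ξ (r / 2) r = 0
  · have hX1 : P.xx ξ (r / 2) r = 1 := by
      rw [xx_tw hP ξ hsp.1 (by omega) hrn.le, hsp.2, zpow_zero]
    have ha₀ : r / 2 ∈ cols r := col_iff.2 ⟨by omega, by omega⟩
    by_cases hz0 : z.2 = 0
    · exact loop_zero_special hq_ne_zero (hq_w hP) hX hAr hod hz hz0 hc hθ ha₀ hX1
    · have hF := card_nb_erase hAr (col_of_mem hz hz0)
      have hFe : Even #((nb r).erase (z.1, r')) := by rw [Nat.even_iff]; omega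
      refine loop_even_special hq_ne_zero (hq_w hP) hX hAr hod hz hz0 hc hθ ha₀ hX1
        (fun a ha hne h0 => hne (br_xx_even hP hLM hod hrn h ha h0).2.1) ?_
      have hmem : (r / 2, (-1 : ℤ)) ∈ moves r := mem_moves.2 (Or.inl ⟨ha₀, by simp⟩)
      have := hcol ((moves r).erase (r / 2, -1)) (erase_subset _ _)
        (fun x hx y hy _ hxy hv => by
          rcases eq_of_vv_eq hP (hLM.imp_right fun h0 => ⟨h0, hod⟩) hrn h (mem_of_mem_erase hx)
            (mem_of_mem_erase hy) hxy hv with h1 | ⟨-, -, h1, -⟩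
          · exact h1
          · have e1 : ∀ {x : ℕ × ℤ}, x ∈ (moves r).erase (r / 2, -1) → x.1 = r / 2 →
                x = (r / 2, 1) := by
              rintro ⟨a, e⟩ hx rfl
              have h2 := mem_of_mem_erase hx
              rcases sign_of_mem h2 fun h0 => (eq_zero_of_mem h2 h0).1 hod with h3 | h3
              · simp only at h3; rw [h3]
              · simp only at h3; subst h3; exact absurd rfl (ne_of_mem_erase hx)
            rw [e1 hx h1, e1 hy (hxy ▸ h1)]) _ (Subset.refl _)
        (fun f => yy (P.xx ξ f.1 f.2)) (fun f _ => rfl)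
        (by rw [card_erase_of_mem hmem]; omega)
      rw [hFe.neg_one_pow] at this
      exact this
  · have hev : ∀ x ∈ moves r, ∀ y ∈ moves r, Even r → x.1 = y.1 →
      vv P.hq (P.xx ξ) r x = vv P.hq (P.xx ξ) r y → x = y := fun x hx y hy _ hxy hv => by
      rcases eq_of_vv_eq hP (hLM.imp_right fun h0 => ⟨h0, hod⟩) hrn h hx hy hxy hv with
        h1 | ⟨-, h1, h2, h3⟩
      · exact h1
      · exact absurd ⟨h2 ▸ h1, h2 ▸ h3⟩ hsp
    have hb : ∀ a ∈ cols r, br P.hq (P.xx ξ a r) ≠ 0 := fun a ha h0 => by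
      obtain ⟨h1, rfl, h3⟩ := br_xx_even hP hLM hod hrn h ha h0
      exact hsp ⟨h1, h3⟩
    by_cases hz0 : z.2 = 0
    · have hn : (z.1, r') ∉ nb r := by
        rw [hAr.mem_nb, (eq_zero_of_mem hz hz0).2]; simp
      have hF := card_nb hr1
      rw [← erase_eq_of_notMem hn] at hF
      have hFo : Odd #((nb r).erase (z.1, r')) := by
        rw [Nat.odd_iff, hF]
        omega
      refine loop_zero hq_ne_zero (hq_w hP) hX hAr hod hz hz0 hc hθ hb ?_
      have := hcol (moves r) (Subset.refl _) hev _ (Subset.refl _)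
        (fun f => yy (P.xx ξ f.1 f.2)) (fun f _ => rfl) (by omega)
      rw [hFo.neg_one_pow] at this
      exact this
    · have hF := card_nb_erase hAr (col_of_mem hz hz0)
      refine loop_even hq_ne_zero (hq_w hP) hX hAr hod hz hz0 hc hθ hb ?_
      -- The unused position `(0, 0)` serves as the index of the extra zero `yy h`.
      have hn : ((0, 0) : ℕ × ℕ) ∉ nb r := by
        rw [mem_nb]; simp
      have hne : ∀ f ∈ nb r, f ≠ (0, 0) := by
        rintro f hf rfl
        exact hn hf
      have hn' : ((0, 0) : ℕ × ℕ) ∉ (nb r).erase (z.1, r') := fun h0 => hn (mem_of_mem_erase h0)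
      have hcd := card_insert_of_notMem hn'
      have hFo : Odd #(insert (0, 0) ((nb r).erase (z.1, r'))) := by
        rw [Nat.odd_iff, hcd]; omega
      have := hcol (moves r) (Subset.refl _) hev (insert (0, 0) ((nb r).erase (z.1, r')))
        (subset_insert _ _) (fun f => if f = (0, 0) then yy P.hq else yy (P.xx ξ f.1 f.2))
        (fun f hf => if_neg (hne f hf)) (by omega)
      rw [hFo.neg_one_pow] at this
      rw [← this]
      refine sum_congr rfl fun x hx => ?_
      rw [prod_insert hn', if_pos rfl]
      congr 2
      exact prod_congr rfl fun f hf => by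
        rw [if_neg (hne f (mem_of_mem_erase hf))]

end

end Omega

/-! ### Comparison with the operators of the representation -/

lemma sum_moves {M : Type*} [AddCommMonoid M] (r : ℕ) (F : ℕ × ℤ → M) :
    ∑ x ∈ moves r, F x = ∑ j ∈ cols r, (F (j, 1) + F (j, -1)) + if Even r then 0 else F (0, 0) := by
  rw [moves, sum_union, sum_product]
  · congr 1
    · refine sum_congr rfl fun j _ => ?_
      rw [sum_insert (by norm_num), sum_singleton]
    · split_ifs <;> simp
  · by_cases hr : Even r <;> simp [hr]

lemma prod_nb (r : ℕ) (hr : 1 ≤ r) (F : ℕ × ℕ → ℂ) :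
    ∏ f ∈ nb r, F f = (∏ a ∈ cols (r + 1), F (a, r + 1)) * ∏ a ∈ cols (r - 1), F (a, r - 1) := by
  rw [nb, prod_union, prod_product, prod_product]
  · simp only [prod_singleton]
  · rw [disjoint_left]
    rintro ⟨a, s⟩ h1 h2
    simp at h1 h2
    omega

lemma nn_mul_sq {h : ℂ} {X : ℕ → ℕ → ℂ} {r j b : ℕ} (hjb : b ≠ j) :
    nn h X r j b * nn h (mv h X r (j, 1)) r j b * (nn h X r j b * nn h (mv h X r (j, 1)) r j b) =
      br h (X b r * X j r) * br h (X b r * (X j r)⁻¹) * br h (X b r * X j r * h ^ 2) *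
        br h (X b r * (X j r)⁻¹ * (h ^ 2)⁻¹) := by
  have e2 : h ^ (2 * (1 : ℤ)) = h ^ 2 := by norm_cast
  have hi : ∀ A B : ℂ, br h (A * B⁻¹) = -br h (B * A⁻¹) := fun A B => by
    rw [← br_inv, mul_inv, inv_inv, mul_comm]
  rw [mul_mul_mul_comm, nn_sq, nn_sq]
  rcases lt_or_gt_of_ne hjb with hl | hl
  · rw [min_eq_right hl.le, max_eq_left hl.le, mv_self, mv_col (x := (j, 1)) hjb, e2, mul_inv,
      ← mul_assoc (X b r), mul_comm (X j r) (X b r), show X j r * h ^ 2 * X b r =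
        X b r * X j r * h ^ 2 by ring]
    ring
  · rw [min_eq_left hl.le, max_eq_right hl.le, mv_self, mv_col (x := (j, 1)) hjb, e2, hi (X j r),
      hi (X j r * h ^ 2), mul_comm (X j r) (X b r), show X j r * h ^ 2 * X b r =
        X b r * X j r * h ^ 2 by ring, mul_inv, ← mul_assoc (X b r)]
    ring

namespace Omega

variable {P : Omega} {ξ η : ℕ → ℕ → ℤ} {r r' s : ℕ} {x y z : ℕ × ℤ}

lemma qp_l_even (hs : Even s) (ξ : ℕ → ℕ → ℤ) (j : ℕ) : P.qp (P.l ξ j s) = P.xx ξ j s := by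
  rw [l, xx]
  congr 2
  obtain ⟨p, rfl⟩ := hs
  rw [show (p + p + 1) / 2 = p by omega]
  push_cast; ring

lemma qp_l_odd (hs : ¬ Even s) (ξ : ℕ → ℕ → ℤ) (j : ℕ) :
    P.qp (P.l ξ j s) = P.xx ξ j s * P.hq := by
  rw [l, xx, hq, ← qp_add]
  congr 1
  obtain ⟨p, rfl⟩ := Nat.not_even_iff_odd.1 hs
  rw [show (2 * p + 1 + 1) / 2 = p + 1 by omega]
  push_cast; ring

variable (P) in
/-- A choice of the roots. -/
def root (ξ : ℕ → ℕ → ℤ) (j s : ℕ) : ℂ :=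
  (∏ f ∈ nb s, prr P.hq s 1 (P.xx ξ j s) (P.xx ξ f.1 f.2)) / dd P.hq (P.xx ξ) s (j, 1)

variable (P) in
/-- The expression under the root. -/
def rad (ξ : ℕ → ℕ → ℤ) (j s : ℕ) : ℂ :=
  if Even s then P.radA ξ (s / 2) j else P.radB ξ ((s + 1) / 2) j

/-- In an odd row `l` is the coordinate shifted by `1/2`. After this shift the radicands of `A` and
`B` become the same expression in the coordinates. -/
lemma rad_eq (hs : 1 ≤ s) (j : ℕ) :
    P.rad ξ j s = (∏ f ∈ nb s, (br P.hq (P.xx ξ f.1 f.2 * (P.xx ξ j s * P.hq)) *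
      br P.hq (P.xx ξ f.1 f.2 * (P.xx ξ j s * P.hq)⁻¹))) /
      ∏ b ∈ (cols s).erase j, (br P.hq (P.xx ξ b s * P.xx ξ j s) *
        br P.hq (P.xx ξ b s * (P.xx ξ j s)⁻¹) * br P.hq (P.xx ξ b s * P.xx ξ j s * P.hq ^ 2) *
        br P.hq (P.xx ξ b s * (P.xx ξ j s)⁻¹ * (P.hq ^ 2)⁻¹)) := by
  have hh := hq_ne_zero (P := P)
  rw [prod_nb s hs, rad]
  split_ifs with he
  · obtain ⟨p, rfl⟩ := he.two_dvd
    have h1 : ¬ Even (2 * p + 1) := by simp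
    have h2 : ¬ Even (2 * p - 1) := by rw [Nat.not_even_iff]; omega
    rw [radA, cols, cols, cols, show (2 * p + 1) / 2 = p by omega,
      show (2 * p - 1) / 2 = p - 1 by omega, show 2 * p / 2 = p by omega]
    simp only [qn_eq, qp_add, qp_sub, qp_l_even he, qp_l_odd h1, qp_l_odd h2, ← hq_sq]
    congr 2
    · refine prod_congr rfl fun a _ => ?_
      congr 2
      · ring
      · field_simp
    · refine prod_congr rfl fun a _ => ?_
      congr 2
      · ring
      · field_simp
  · obtain ⟨p, rfl⟩ : ∃ p, s = 2 * p + 1 := Nat.not_even_iff_odd.1 he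
    have h1 : Even (2 * p + 2) := ⟨p + 1, by ring⟩
    have h2 : Even (2 * p) := even_two_mul p
    rw [show (2 * p + 1 + 1) / 2 = p + 1 by omega, radB, cols, cols, cols,
      show (2 * p + 1 + 1) / 2 = p + 1 by omega, show (2 * p + 1 - 1) / 2 = p by omega,
      show (2 * p + 1) / 2 = p by omega, show 2 * (p + 1) - 1 = 2 * p + 1 by omega,
      show 2 * (p + 1) - 2 = 2 * p by omega, show p + 1 - 1 = p by omega,
      show 2 * (p + 1) = 2 * p + 2 by ring, show 2 * p + 1 - 1 = 2 * p by omega]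
    simp only [qn_eq, qp_add, qp_sub, qp_l_even h1, qp_l_even h2, qp_l_odd he, ← hq_sq]
    congr 1
    refine prod_congr rfl fun b _ => ?_
    rw [show P.xx ξ b (2 * p + 1) * P.hq * (P.xx ξ j (2 * p + 1) * P.hq) =
        P.xx ξ b (2 * p + 1) * P.xx ξ j (2 * p + 1) * P.hq ^ 2 by ring,
      show P.xx ξ b (2 * p + 1) * P.hq * (P.xx ξ j (2 * p + 1) * P.hq)⁻¹ =
        P.xx ξ b (2 * p + 1) * (P.xx ξ j (2 * p + 1))⁻¹ by field_simp,
      show P.xx ξ b (2 * p + 1) * P.xx ξ j (2 * p + 1) * P.hq ^ 2 * (P.hq ^ 2)⁻¹ =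
        P.xx ξ b (2 * p + 1) * P.xx ξ j (2 * p + 1) by field_simp]
    ring

lemma root_sq (hP : P.Admissible) (hs : 1 ≤ s) (j : ℕ) : P.root ξ j s ^ 2 = P.rad ξ j s := by
  have hX := xx_ne_zero (P := P) ξ
  rw [rad_eq hs, root, div_pow, ← prod_pow, dd, ← prod_pow]
  congr 1
  · refine prod_congr rfl fun f _ => ?_
    rw [sq, prr_sq hq_ne_zero (hq_w hP) (by simp) (hX _ _) (hX _ _), zpow_one,
      yy_sub (hq_w hP) (hX _ _) (mul_ne_zero (hX _ _) hq_ne_zero),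
      mul_div_cancel_left₀ _ (pow_ne_zero _ (hq_w hP))]
  · refine prod_congr rfl fun b hb => ?_
    rw [sq]
    exact nn_mul_sq (ne_of_mem_erase hb)

lemma denUp_eq (ξ : ℕ → ℕ → ℤ) (j s : ℕ) : P.denUp ξ j s = den P.hq s 1 (P.xx ξ j s) := by
  have hh := hq_ne_zero (P := P)
  rw [denUp, den]
  split_ifs with hs
  · rw [qp_neg, qp_l_even hs]
  · rw [qn_eq, qn_eq, qp_sub, two_mul, qp_add, qp_l_odd hs, ← hq_sq, zpow_one]
    congr 2
    field_simp

lemma denDown_eq (ξ : ℕ → ℕ → ℤ) (j s : ℕ) : P.denDown ξ j s = den P.hq s (-1) (P.xx ξ j s) := by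
  have hh := hq_ne_zero (P := P)
  rw [denDown, den]
  split_ifs with hs
  · rw [qp_neg, qp_l_even hs]
  · rw [qn_eq, qn_eq, qp_sub, qp_sub, two_mul, qp_add, qp_l_odd hs, ← hq_sq, zpow_neg, zpow_one]
    congr 2 <;> field_simp

lemma C_eq (hs : ¬ Even s) (ξ : ℕ → ℕ → ℤ) : P.C ξ ((s + 1) / 2) =
    (∏ f ∈ nb s, br P.hq (P.xx ξ f.1 f.2)) /
      ∏ b ∈ cols s, (br P.hq (P.xx ξ b s * P.hq) * br P.hq (P.xx ξ b s * P.hq⁻¹)) := by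
  have hh := hq_ne_zero (P := P)
  obtain ⟨p, rfl⟩ : ∃ p, s = 2 * p + 1 := Nat.not_even_iff_odd.1 hs
  have h1 : Even (2 * p + 2) := ⟨p + 1, by ring⟩
  have h2 : Even (2 * p) := even_two_mul p
  rw [prod_nb _ (by omega), C, cols, cols, cols,
    show (2 * p + 1 + 1) / 2 = p + 1 by omega, show (2 * p + 1 - 1) / 2 = p by omega,
    show (2 * p + 1) / 2 = p by omega, show 2 * (p + 1) - 1 = 2 * p + 1 by omega,
    show 2 * (p + 1) - 2 = 2 * p by omega, show p + 1 - 1 = p by omega,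
    show 2 * (p + 1) = 2 * p + 2 by ring, show 2 * p + 1 - 1 = 2 * p by omega]
  simp only [qn_eq, qp_sub, qp_l_even h1, qp_l_even h2, qp_l_odd hs, ← hq_sq]
  congr 1
  refine prod_congr rfl fun b _ => ?_
  congr 2
  field_simp

/-! ### Reduction of the cyclic entries -/

variable (P) in
/-- The representatives modulo `k` of the cyclic entries. -/
def red (ξ : ℕ → ℕ → ℤ) : ℕ → ℕ → ℤ := fun j s => if j ≤ P.i then ξ j s % (P.k : ℤ) else ξ j s

lemma tw_red {j : ℕ} (hj : P.i < j) : P.tw (P.red ξ) j s = P.tw ξ j s := by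
  simp only [tw, red, if_neg (not_le.2 hj)]

lemma inter_red : P.Inter (P.red ξ) ↔ P.Inter ξ := by
  constructor <;> rintro ⟨h1, h2, h3, h4⟩
  · refine ⟨fun j s hj => ?_, fun j s hj => ?_, fun j hj => ?_, fun j hj => ?_⟩
    · have := h1 j s hj; rwa [tw_red hj, tw_red hj] at this
    · have := h2 j s hj; rwa [tw_red hj, tw_red (by omega)] at this
    · have := h3 j hj; rwa [tw_red hj, tw_red (by omega)] at this
    · have := h4 j hj; rwa [tw_red hj, tw_red hj] at this
  · refine ⟨fun j s hj => ?_, fun j s hj => ?_, fun j hj => ?_, fun j hj => ?_⟩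
    · rw [tw_red hj, tw_red hj]; exact h1 j s hj
    · rw [tw_red hj, tw_red (by omega)]; exact h2 j s hj
    · rw [tw_red hj, tw_red (by omega)]; exact h3 j hj
    · rw [tw_red hj, tw_red hj]; exact h4 j hj

lemma isTableau_red (hP : P.Admissible) (hξ : P.Supp ξ) : P.IsTableau (P.red ξ) ↔ P.Inter ξ := by
  have hk : (0 : ℤ) < P.k := by have := hP.k_ge; omega
  rw [isTableau_iff hP, inter_red]
  refine ⟨fun h => h.2.2, fun h => ⟨fun j s hjs => ?_, fun j s _ hj _ _ => ?_, h⟩⟩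
  · simp only [red, hξ j s hjs]; simp
  · simp only [red, if_pos hj]
    exact ⟨Int.emod_nonneg _ hk.ne', Int.emod_lt_of_pos _ hk⟩

lemma IsTableau.red_eq (h : P.IsTableau ξ) : P.red ξ = ξ := by
  funext j s
  simp only [red]
  split_ifs with hj
  · by_cases hp : 1 ≤ j ∧ 2 * j ≤ s ∧ s < P.n
    · have := h.cyc j s hp.1 hj hp.2.1 hp.2.2
      exact Int.emod_eq_of_lt this.1 this.2
    · rw [h.supp j s hp]; simp
  · rfl

/-- Reduction modulo `k` is invisible to the coordinates because `q ^ k = 1`. Together with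
`shift_red` it allows all computations to be done with unreduced arrays. -/
lemma xx_red (hP : P.Admissible) : P.xx (P.red ξ) = P.xx ξ := by
  funext j s
  by_cases hj : j ≤ P.i
  · simp only [xx, entry, red, if_pos hj]
    split_ifs with hs
    · rfl
    · have h1 : ((ξ j s : ℤ) : ℂ) = (ξ j s % (P.k : ℤ) : ℤ) + (P.k : ℤ) * (ξ j s / P.k : ℤ) := by
        have := Int.emod_add_mul_ediv (ξ j s) P.k
        exact_mod_cast this.symm
      rw [h1, show P.h j s + (((ξ j s % (P.k : ℤ) : ℤ) : ℂ) + (P.k : ℤ) * (ξ j s / P.k : ℤ)) +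
        (s : ℂ) / 2 - j = P.h j s + ((ξ j s % (P.k : ℤ) : ℤ) : ℂ) + (s : ℂ) / 2 - j +
          (P.k : ℤ) * (ξ j s / P.k : ℤ) by ring,
        qp_add _ (((P.k : ℤ) : ℂ) * ((ξ j s / P.k : ℤ) : ℂ)),
        (qp_eq_one_iff hP.k_ne_zero (((P.k : ℤ) : ℂ) * ((ξ j s / P.k : ℤ) : ℂ))).2 ⟨P.ρ * (ξ j s / P.k), by push_cast; ring⟩, mul_one]
  · simp only [xx, entry, w, red, if_neg hj]

lemma shift_red (j : ℕ) (e : ℤ) :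
    P.shift (P.red ξ) j s e = P.red (upd ξ s (j, e)) := by
  funext j' s'
  simp only [shift, red, upd]
  by_cases h : j' = j ∧ s' = s
  · obtain ⟨rfl, rfl⟩ := h
    simp only [and_self, if_true]
    split_ifs
    · rw [Int.emod_add_emod]
    · rfl
  · simp only [if_neg h]

lemma supp_upd (hr : r < P.n) (hξ : P.Supp ξ) (hx : x ∈ moves r) : P.Supp (upd ξ r x) := by
  intro j s hjs
  simp only [upd]
  split_ifs with h
  · by_cases hx0 : x.2 = 0
    · rw [hx0, hξ j s hjs, add_zero]
    · have := col_iff.1 (col_of_mem hx hx0)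
      obtain ⟨rfl, rfl⟩ := h
      exact absurd ⟨this.1, this.2, hr⟩ hjs
  · exact hξ j s hjs

/-- The tableau given by an array. -/
def tab (ξ : ℕ → ℕ → ℤ) (h : P.IsTableau ξ) : P.Tab := ⟨ξ, h⟩

/-- The array of a tableau. -/
def arr (ξ : P.Tab) : ℕ → ℕ → ℤ := ξ.1

lemma arr_tab (h : P.IsTableau ξ) : arr (tab ξ h) = ξ := rfl

lemma isTableau_arr (ξ : P.Tab) : P.IsTableau (arr ξ) := ξ.2

lemma ket_pos (f : P.Tab → ℂ) (hξ : P.IsTableau ξ) :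
    P.ket ξ f = Finsupp.single (tab ξ hξ) (f (tab ξ hξ)) := dif_pos hξ

lemma ket_neg (f : P.Tab → ℂ) (hξ : ¬ P.IsTableau ξ) : P.ket ξ f = 0 := dif_neg hξ

lemma act_apply (R : P.Tab → ℕ → ℕ → ℂ) (s : ℕ) (ξ : P.Tab) : P.act R s ξ =
    ∑ j ∈ cols s,
      (P.ket (P.shift (arr ξ) j s 1) (fun _ => P.cc j s * R ξ j s / P.denUp (arr ξ) j s) -
        P.ket (P.shift (arr ξ) j s (-1)) (fun η => (P.cc j s)⁻¹ * R η j s / P.denDown (arr ξ) j s))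
      + (if Even s then 0 else Finsupp.single ξ (Complex.I * P.C (arr ξ) ((s + 1) / 2))) := rfl

variable (P) in
/-- The choice of the roots as a function of tableaux. -/
def rootR (ξ : P.Tab) (j s : ℕ) : ℂ := P.root (arr ξ) j s

variable (P) in
/-- The basis vector of a tableau with cyclic entries that need not be reduced. -/
def kv (ξ : ℕ → ℕ → ℤ) : P.V := P.ket (P.red ξ) fun _ => 1

lemma ket_eq {η : ℕ → ℕ → ℤ} {f : P.Tab → ℂ} {a : ℂ} (h : ∀ hη, f (tab η hη) = a) :
    P.ket η f = a • P.ket η fun _ => 1 := by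
  by_cases hη : P.IsTableau η
  · rw [ket_pos _ hη, ket_pos _ hη, h hη, Finsupp.smul_single, smul_eq_mul, mul_one]
  · rw [ket_neg _ hη, ket_neg _ hη, smul_zero]

lemma kv_eq (hξ : P.IsTableau ξ) : P.kv ξ = Finsupp.single (tab ξ hξ) 1 := by
  rw [kv, hξ.red_eq, ket_pos _ hξ]

lemma kv_eq_zero (hP : P.Admissible) (hξ : P.Supp ξ) (h : ¬ P.Inter ξ) : P.kv ξ = 0 :=
  ket_neg _ fun h0 => h ((isTableau_red hP hξ).1 h0)

/-- The operators of the representation in terms of moves, for an arbitrary choice of the roots. -/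
lemma act_eq (hP : P.Admissible) (hr : 1 ≤ r) (hrn : r < P.n) (hξ : P.IsTableau ξ) :
    P.act P.rootR r (tab ξ hξ) =
      ∑ x ∈ moves r, coef P.hq P.cc (P.xx ξ) r x • P.kv (upd ξ r x) := by
  have hre := hξ.red_eq
  rw [sum_moves, act_apply, arr_tab]
  congr 1
  · refine sum_congr rfl fun j hj => ?_
    rw [sub_eq_add_neg]
    congr 1
    · rw [ket_eq (a := P.cc j r * P.root ξ j r / P.denUp ξ j r) (fun _ => rfl), kv, ← shift_red, hre]
      congr 1
      simp only [coef, root, one_ne_zero, if_false, denUp_eq, Int.cast_one, one_mul, zpow_one]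
      rw [mul_div_assoc', div_div]
    · have hs := shift_red (P := P) (ξ := ξ) (s := r) j (-1)
      rw [hre] at hs
      rw [ket_eq (a := (P.cc j r)⁻¹ * P.root (upd ξ r (j, -1)) j r / P.denDown ξ j r)
        (fun hη => ?_), kv, ← shift_red, hre, ← neg_smul]
      swap
      · simp only [rootR, arr_tab, root, hs, xx_red hP]
      congr 1
      -- The downward term carries the root of the lower tableau; `prr_back` and `dd_back` rewrite
      -- it in the coordinates of the tableau one starts from.
      have e1 : P.root (upd ξ r (j, -1)) j r =
          (∏ f ∈ nb r, prr P.hq r (-1) (P.xx ξ j r) (P.xx ξ f.1 f.2)) /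
            dd P.hq (P.xx ξ) r (j, -1) := by
        have k := dd_back (X := P.xx ξ) (r := r) (a := j) (e := -1) (hq_ne_zero (P := P))
        rw [neg_neg] at k
        rw [root, xx_upd hrn, k, mv_self]
        congr 1
        refine prod_congr rfl fun f hf => ?_
        have k2 := prr_back (r := r) (A := P.xx ξ j r) (B := P.xx ξ f.1 f.2) (e := -1)
          (hq_ne_zero (P := P)) (by simp)
        rw [neg_neg] at k2
        rw [mv_row (snd_ne_of_mem_nb hr hf), k2]
      rw [e1]
      have hne : (-1 : ℤ) ≠ 0 := by norm_num
      simp only [coef, if_neg hne, denDown_eq, Int.cast_neg, Int.cast_one, zpow_neg, zpow_one]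
      rw [mul_div_assoc', div_div]
      ring
  · split_ifs with he
    · rfl
    · rw [upd_zero, kv_eq hξ, Finsupp.smul_single, smul_eq_mul, mul_one, C_eq he]
      simp only [coef, if_true]
      rw [mul_div_assoc]

lemma op_kv (hP : P.Admissible) (hr : 1 ≤ r) (hrn : r < P.n) (hξ : P.Supp ξ) (h : P.Inter ξ) :
    P.op P.rootR r (P.kv ξ) =
      ∑ x ∈ moves r, coef P.hq P.cc (P.xx ξ) r x • P.kv (upd ξ r x) := by
  have ht := (isTableau_red hP hξ).2 h
  rw [kv, ket_pos _ ht, op, Finsupp.linearCombination_single, one_smul, act_eq hP hr hrn,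
    xx_red hP]
  refine sum_congr rfl fun x _ => ?_
  congr 1
  rw [kv, kv, ← shift_red, ← shift_red, ht.red_eq]

end Omega

/-! ### The defining relations -/

/-- A sum over pairs of moves that is antisymmetric outside of the closed paths. -/
lemma sum_sum_moves {M : Type*} [AddCommGroup M] [Module ℂ M] {r : ℕ} (F : ℕ × ℤ → ℕ × ℤ → M)
    (h1 : ∀ x ∈ moves r, ∀ y ∈ moves r, x.1 ≠ y.1 → F x y + F y x = 0)
    (h2 : ∀ x ∈ moves r, x.2 ≠ 0 → F x x = 0) :
    ∑ x ∈ moves r, ∑ y ∈ moves r, F x y = ∑ x ∈ moves r, F x (x.1, -x.2) := by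
  -- Interchanging the summation variables shows that this part is its own negative.
  have e1 : ∑ x ∈ moves r, ∑ y ∈ moves r, (if x.1 = y.1 then 0 else F x y) = 0 := by
    have h3 : (2 : ℂ) • ∑ x ∈ moves r, ∑ y ∈ moves r, (if x.1 = y.1 then 0 else F x y) = 0 := by
      rw [two_smul]
      nth_rewrite 2 [sum_comm]
      rw [← sum_add_distrib]
      refine sum_eq_zero fun x hx => ?_
      rw [← sum_add_distrib]
      refine sum_eq_zero fun y hy => ?_
      by_cases hxy : x.1 = y.1
      · simp [hxy]
      · rw [if_neg hxy, if_neg (fun h0 => hxy h0.symm), h1 x hx y hy hxy]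
    exact (smul_eq_zero.1 h3).resolve_left two_ne_zero
  rw [← add_zero (∑ x ∈ moves r, F x (x.1, -x.2)), ← e1, ← sum_add_distrib]
  refine sum_congr rfl fun x hx => ?_
  have hm : (x.1, -x.2) ∈ moves r := by
    by_cases hx0 : x.2 = 0
    · obtain ⟨h3, rfl⟩ := eq_zero_of_mem hx hx0
      exact hx
    · have hcx := col_of_mem hx hx0
      exact mem_moves.2 (Or.inl ⟨hcx, by have := sign_of_mem hx hx0; simp; omega⟩)
  rw [← sub_eq_iff_eq_add, ← sum_sub_distrib, sum_eq_single_of_mem _ hm]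
  · simp
  · intro y hy hne
    by_cases hxy : x.1 = y.1
    · rw [if_pos hxy, sub_zero]
      have hx0 : x.2 ≠ 0 := by
        intro hx0
        apply hne
        obtain ⟨h3, rfl⟩ := eq_zero_of_mem hx hx0
        by_cases hy0 : y.2 = 0
        · rw [(eq_zero_of_mem hy hy0).2]; rfl
        · have := (Omega.col_iff.1 (col_of_mem hy hy0)).1
          rw [← hxy] at this
          simp at this
      have hy0 : y.2 ≠ 0 := by
        intro hy0
        have := (Omega.col_iff.1 (col_of_mem hx hx0)).1
        rw [hxy, (eq_zero_of_mem hy hy0).2] at this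
        simp at this
      have hy1 := sign_of_mem hy hy0
      have hx1 := sign_of_mem hx hx0
      have : y.2 ≠ -x.2 := fun h0 => hne (Prod.ext hxy.symm h0)
      rw [show y = x from Prod.ext hxy.symm (by omega), h2 x hx hx0]
    · rw [if_neg hxy, sub_self]

lemma coef_mv_far {h : ℂ} {c X : ℕ → ℕ → ℂ} {r r' : ℕ} {x z : ℕ × ℤ}
    (h1 : r + 1 < r' ∨ r' + 1 < r) :
    coef h c (mv h X r' z) r x = coef h c X r x := by
  have e1 : ∀ a, mv h X r' z a r = X a r := fun a => mv_row (by omega)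
  have e2 : ∀ f ∈ nb r, mv h X r' z f.1 f.2 = X f.1 f.2 := fun f hf => by
    rw [mem_nb] at hf
    exact mv_row (by omega)
  simp only [coef, e1, dd_congr e1]
  split_ifs
  · rw [prod_congr rfl fun f hf => by rw [e2 f hf]]
  · rw [prod_congr rfl fun f hf => by rw [e2 f hf]]

namespace Omega

variable {P : Omega} {ξ : ℕ → ℕ → ℤ} {r r' r₁ r₂ r₃ : ℕ} {x y z : ℕ × ℤ}

lemma cc_ne_zero (hP : P.Admissible) (hrn : r < P.n) {a : ℕ} (ha : a ∈ cols r) : P.cc a r ≠ 0 := by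
  have := col_iff.1 ha
  rw [cc]
  split_ifs with h
  · exact hP.c_ne a r this.1 h this.2 hrn
  · exact one_ne_zero

section

variable (hP : P.Admissible) (hr : 1 ≤ r) (hrn : r < P.n)

include hP hr hrn

/-- A path has weight zero from the first step that leaves the interlacing arrays. Compositions of
operators may therefore be expanded over all paths without restriction, even though the operators
act only on genuine tableaux. -/
lemma step_zero {c₀ : ℂ} (h0 : ¬ P.Inter ξ → c₀ = 0) (hx : x ∈ moves r)
    (h1 : ¬ P.Inter (upd ξ r x)) : c₀ * coef P.hq P.cc (P.xx ξ) r x = 0 := by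
  by_cases h : P.Inter ξ
  · rw [coef_border hP hr hrn h hx h1, mul_zero]
  · rw [h0 h, zero_mul]

lemma step {c₀ : ℂ} (hξ : P.Supp ξ) (h0 : ¬ P.Inter ξ → c₀ = 0) :
    c₀ • P.op P.rootR r (P.kv ξ) =
      ∑ x ∈ moves r, (c₀ * coef P.hq P.cc (P.xx ξ) r x) • P.kv (upd ξ r x) := by
  by_cases h : P.Inter ξ
  · rw [op_kv hP hr hrn hξ h, smul_sum]
    exact sum_congr rfl fun x _ => by rw [smul_smul]
  · simp [h0 h]

end

lemma op_op (hP : P.Admissible) (h1 : 1 ≤ r₁) (h1' : r₁ < P.n) (h2 : 1 ≤ r₂) (h2' : r₂ < P.n)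
    (hξ : P.Supp ξ) (h : P.Inter ξ) :
    P.op P.rootR r₂ (P.op P.rootR r₁ (P.kv ξ)) = ∑ x ∈ moves r₁, ∑ y ∈ moves r₂,
      (coef P.hq P.cc (P.xx ξ) r₁ x * coef P.hq P.cc (P.xx (upd ξ r₁ x)) r₂ y) •
        P.kv (upd (upd ξ r₁ x) r₂ y) := by
  rw [op_kv hP h1 h1' hξ h, map_sum]
  refine sum_congr rfl fun x hx => ?_
  rw [map_smul, step hP h2 h2' (supp_upd h1' hξ hx)]
  intro h3
  have := step_zero (c₀ := 1) hP h1 h1' (fun h0 => absurd h h0) hx h3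
  rwa [one_mul] at this

lemma op_op_op (hP : P.Admissible) (h1 : 1 ≤ r₁) (h1' : r₁ < P.n) (h2 : 1 ≤ r₂) (h2' : r₂ < P.n)
    (h3 : 1 ≤ r₃) (h3' : r₃ < P.n) (hξ : P.Supp ξ) (h : P.Inter ξ) :
    P.op P.rootR r₃ (P.op P.rootR r₂ (P.op P.rootR r₁ (P.kv ξ))) =
      ∑ x ∈ moves r₁, ∑ y ∈ moves r₂, ∑ z ∈ moves r₃,
      (coef P.hq P.cc (P.xx ξ) r₁ x * coef P.hq P.cc (P.xx (upd ξ r₁ x)) r₂ y *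
        coef P.hq P.cc (P.xx (upd (upd ξ r₁ x) r₂ y)) r₃ z) •
        P.kv (upd (upd (upd ξ r₁ x) r₂ y) r₃ z) := by
  rw [op_op hP h1 h1' h2 h2' hξ h, map_sum]
  refine sum_congr rfl fun x hx => ?_
  rw [map_sum]
  refine sum_congr rfl fun y hy => ?_
  rw [map_smul, step hP h3 h3' (supp_upd h2' (supp_upd h1' hξ hx) hy)]
  refine step_zero hP h2 h2' (fun h4 => ?_) hy
  have := step_zero (c₀ := 1) hP h1 h1' (fun h0 => absurd h h0) hx h4
  rwa [one_mul] at this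

/-- After the triple sums are arranged by the final array, the pairs `(x, y)` and `(y, x)` cancel,
repeated moves vanish, and the closed paths give minus the coefficient of `z`. -/
lemma op_trilinear_kv (hP : P.Admissible) (hLM : P.Low ∨ P.IsMinimal) (hA : Adj r r')
    (hrn : r < P.n) (hrn' : r' < P.n) (hξ : P.Supp ξ) (h : P.Inter ξ) :
    P.op P.rootR r (P.op P.rootR r (P.op P.rootR r' (P.kv ξ))) -
      (P.hq ^ 2 + (P.hq ^ 2)⁻¹) • P.op P.rootR r (P.op P.rootR r' (P.op P.rootR r (P.kv ξ))) +
      P.op P.rootR r' (P.op P.rootR r (P.op P.rootR r (P.kv ξ))) =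
      -P.op P.rootR r' (P.kv ξ) := by
  have hr := hA.1
  have hr' := hA.2.1
  rw [op_op_op hP hr' hrn' hr hrn hr hrn hξ h, op_op_op hP hr hrn hr' hrn' hr hrn hξ h,
    op_op_op hP hr hrn hr hrn hr' hrn' hξ h, op_kv hP hr' hrn' hξ h]
  rw [sum_comm (s := moves r) (t := moves r')]
  have e3 : ∀ F : ℕ × ℤ → ℕ × ℤ → ℕ × ℤ → P.V, ∑ x ∈ moves r, ∑ y ∈ moves r, ∑ z ∈ moves r',
      F x y z = ∑ z ∈ moves r', ∑ x ∈ moves r, ∑ y ∈ moves r, F x y z := fun F => by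
    rw [sum_congr rfl fun x _ => sum_comm, sum_comm]
  rw [e3, smul_sum, ← sum_sub_distrib, ← sum_add_distrib, ← sum_neg_distrib]
  refine sum_congr rfl fun z hz => ?_
  have hsz := supp_upd hrn' hξ hz
  have hs3 : ∀ x ∈ moves r, ∀ y ∈ moves r, P.Supp (upd (upd (upd ξ r' z) r x) r y) :=
    fun x hx y hy => supp_upd hrn (supp_upd hrn hsz hx) hy
  have key : ∀ x y, (coef P.hq P.cc (P.xx ξ) r' z * coef P.hq P.cc (P.xx (upd ξ r' z)) r x *
        coef P.hq P.cc (P.xx (upd (upd ξ r' z) r x)) r y) •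
        P.kv (upd (upd (upd ξ r' z) r x) r y) -
      (P.hq ^ 2 + (P.hq ^ 2)⁻¹) • (coef P.hq P.cc (P.xx ξ) r x *
        coef P.hq P.cc (P.xx (upd ξ r x)) r' z *
        coef P.hq P.cc (P.xx (upd (upd ξ r x) r' z)) r y) •
        P.kv (upd (upd (upd ξ r x) r' z) r y) +
      (coef P.hq P.cc (P.xx ξ) r x * coef P.hq P.cc (P.xx (upd ξ r x)) r y *
        coef P.hq P.cc (P.xx (upd (upd ξ r x) r y)) r' z) •
        P.kv (upd (upd (upd ξ r x) r y) r' z) =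
      ww P.hq P.cc (P.xx ξ) r r' z x y • P.kv (upd (upd (upd ξ r' z) r x) r y) := by
    intro x y
    rw [upd_comm (upd ξ r x) r r' y z, upd_comm ξ r r' x z]
    simp only [xx_upd hrn, xx_upd hrn', ww]
    rw [smul_smul, ← sub_smul, ← add_smul]
    rw [mv_comm r' r z x]
  rw [smul_sum, ← sum_sub_distrib, ← sum_add_distrib]
  rw [sum_congr rfl fun x _ => by rw [smul_sum, ← sum_sub_distrib, ← sum_add_distrib]]
  simp only [key]
  rw [sum_sum_moves]
  · rw [sum_congr rfl fun x _ => by rw [upd_neg], ← sum_smul, ← neg_smul]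
    -- A closed path ends at the array moved by `z`. The sum over loops is known only if that array
    -- interlaces; otherwise its basis vector is zero.
    by_cases hz1 : P.Inter (upd ξ r' z)
    · rw [sum_loops hP hLM hA hrn hrn' h hz hz1 fun a ha => cc_ne_zero hP hrn ha]
    · rw [kv_eq_zero hP hsz hz1, smul_zero, smul_zero]
  · intro x hx y hy hxy
    rw [upd_comm (upd ξ r' z) r r y x, ← add_smul]
    by_cases hi : P.Inter (upd (upd (upd ξ r' z) r x) r y)
    · rw [ww_add_swap hP hLM hA hrn h hx hy hxy hz hi, zero_smul]
    · rw [kv_eq_zero hP (hs3 x hx y hy) hi, smul_zero]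
  · intro x hx hx0
    rw [ww_eq hA hz, tt_self hq_ne_zero (xx_ne_zero ξ) hA hx hx0 hz, mul_zero, zero_smul]

lemma hom_ext_kv (hP : P.Admissible) {A B : Module.End ℂ P.V}
    (hAB : ∀ ξ, P.Supp ξ → P.Inter ξ → A (P.kv ξ) = B (P.kv ξ)) : A = B := by
  refine Finsupp.lhom_ext' fun ξ => LinearMap.ext_ring ?_
  have h := (isTableau_iff hP).1 (isTableau_arr ξ)
  have h1 := hAB (arr ξ) h.1 h.2.2
  rw [kv_eq (isTableau_arr ξ)] at h1
  exact h1

lemma op_trilinear (hP : P.Admissible) (hLM : P.Low ∨ P.IsMinimal) (hA : Adj r r')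
    (hrn : r < P.n) (hrn' : r' < P.n) :
    P.op P.rootR r ^ 2 * P.op P.rootR r' - (P.q + P.q⁻¹) • (P.op P.rootR r * P.op P.rootR r' *
      P.op P.rootR r) + P.op P.rootR r' * P.op P.rootR r ^ 2 = -P.op P.rootR r' := by
  refine hom_ext_kv hP fun ξ h1 h2 => ?_
  have h3 := op_trilinear_kv hP hLM hA hrn hrn' h1 h2
  rw [hq_sq] at h3
  rw [sq]
  exact h3

lemma op_comm (hP : P.Admissible) (h1 : 1 ≤ r) (h2 : r + 1 < r') (hrn' : r' < P.n) :
    P.op P.rootR r * P.op P.rootR r' = P.op P.rootR r' * P.op P.rootR r := by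
  refine hom_ext_kv hP fun ξ h3 h4 => ?_
  rw [Module.End.mul_apply, Module.End.mul_apply, op_op hP (by omega) hrn' h1 (by omega) h3 h4,
    op_op hP h1 (by omega) (by omega) hrn' h3 h4, sum_comm]
  refine sum_congr rfl fun x _ => sum_congr rfl fun z _ => ?_
  rw [upd_comm ξ r' r z x, xx_upd hrn', xx_upd (by omega : r < P.n), coef_mv_far (Or.inl h2),
    coef_mv_far (Or.inr h2), mul_comm]

theorem exists_rep (hP : P.Admissible) (hLM : P.Low ∨ P.IsMinimal) :
    ∃ R, P.IsRootChoice R ∧ ∃ T, P.IsRep R T := by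
  refine ⟨P.rootR, ?_, ?_⟩
  · intro ξ j s h1 h2 h3 _
    exact root_sq hP (by omega) j
  · let f : FreeAlgebra ℂ (Fin (P.n - 1)) →ₐ[ℂ] Module.End ℂ P.V :=
      FreeAlgebra.lift ℂ fun t => P.op P.rootR (t + 1)
    have hf : ∀ t, f (FreeAlgebra.ι ℂ t) = P.op P.rootR (t + 1) := fun t => by
      simp only [f, FreeAlgebra.lift_ι_apply]
    have hrel : ∀ ⦃x y⦄, Rel P.q P.n x y → f x = f y := by
      intro x y hxy
      cases hxy with
      | left a b hab =>
        simp only [map_add, map_sub, map_mul, map_pow, map_smul, map_neg, hf]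
        exact op_trilinear hP hLM ⟨by omega, by omega, by omega⟩ (by omega) (by omega)
      | right a b hab =>
        simp only [map_add, map_sub, map_mul, map_pow, map_smul, map_neg, hf]
        -- The second relation is the first one with the two rows interchanged.
        rw [← op_trilinear hP hLM (r := b + 1) (r' := a + 1) ⟨by omega, by omega, by omega⟩
          (by omega) (by omega)]
        abel
      | comm a b hab =>
        simp only [map_mul, hf]
        exact op_comm hP (by omega) (by omega) (by omega)
    refine ⟨RingQuot.liftAlgHom ℂ ⟨f, hrel⟩, fun t => ?_⟩
    rw [gen, RingQuot.liftAlgHom_mkAlgHom_apply, hf]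

/-! ### Finiteness -/

lemma finite_tab (hP : P.Admissible) : Finite P.Tab := by
  classical
  -- the entries are bounded
  let N : ℤ := P.k + 2 * |P.tw (fun _ _ => 0) (P.i + 1) P.n| + |P.dM| + 10 * P.n
  -- Truncation to `[-N, N]` only serves to land in a finite type; it changes no entry in the
  -- support.
  let f : P.Tab → (Fin P.n → Fin P.n → Set.Icc (-N) N) := fun ξ j s =>
    ⟨max (-N) (min N (arr ξ j s)), by
      have : 0 ≤ N := by positivity
      exact ⟨le_max_left _ _, max_le (by omega) (min_le_left _ _)⟩⟩
  refine Finite.of_injective f fun ξ η hξη => ?_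
  suffices H : arr ξ = arr η from Subtype.ext H
  have hb : ∀ ξ : P.Tab, ∀ j s, 1 ≤ j → 2 * j ≤ s → s < P.n →
      -N ≤ arr ξ j s ∧ arr ξ j s ≤ N := by
    intro ξ j s h1 h2 h3
    obtain ⟨-, hc, h⟩ := (isTableau_iff hP).1 (isTableau_arr ξ)
    have hN : N = P.k + 2 * |P.tw (fun _ _ => 0) (P.i + 1) P.n| + |P.dM| + 10 * P.n := rfl
    have a1 := abs_nonneg (P.tw (fun _ _ => 0) (P.i + 1) P.n)
    have a2 := abs_nonneg P.dM
    by_cases hj : j ≤ P.i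
    · have := hc j s h1 hj h2 h3
      omega
    · have b0 : ∀ j s, P.i < j → 2 * j ≤ s → s ≤ P.n → P.tw (arr ξ) j s ≤
          P.tw (fun _ _ => 0) (P.i + 1) P.n := fun j s h1 h2 h3 => by
        have b1 := h.le_top h1 h2 h3
        have b2 := tw_top (ξ := arr ξ) hP h1 (by omega)
        rw [tw_n _ (P.i + 1)] at b2
        omega
      have b1 := b0 j s (by omega) h2 h3.le
      have b2 : -P.tw (fun _ _ => 0) (P.i + 1) P.n ≤ P.tw (arr ξ) j s := by
        rcases Nat.mod_two_eq_zero_or_one s with h0 | h0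
        · have c1 := h.col (s := s) (by omega) (by omega : j ≤ s / 2) (by omega) h3
          have c2 := h.odd (s / 2) (by omega) (by omega)
          have c3 := b0 (s / 2) (s + 1) (by omega) (by omega) (by omega)
          rw [show 2 * (s / 2) = s by omega] at c2
          omega
        · have c1 := h.pos_odd (by omega) h2 h3 h0
          omega
      have a3 := le_abs_self (P.tw (fun _ _ => 0) (P.i + 1) P.n)
      have a4 := le_abs_self P.dM
      have a5 := neg_le_abs P.dM
      have e1 : P.tw (arr ξ) j s = P.dM + 2 * arr ξ j s + s - 2 * j := by
        rw [tw, if_neg (by omega)]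
      omega
  funext j s
  by_cases hjs : 1 ≤ j ∧ 2 * j ≤ s ∧ s < P.n
  · have h1 := congrArg Subtype.val (congrFun (congrFun hξη ⟨j, by omega⟩) ⟨s, hjs.2.2⟩)
    have h2 := hb ξ j s hjs.1 hjs.2.1 hjs.2.2
    have h3 := hb η j s hjs.1 hjs.2.1 hjs.2.2
    simp only [f] at h1
    rwa [min_eq_right h2.2, max_eq_right h2.1, min_eq_right h3.2, max_eq_right h3.1] at h1
  · rw [(isTableau_arr ξ).supp j s hjs, (isTableau_arr η).supp j s hjs]

end Omega

namespace Omega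

variable {P : Omega} {ξ : ℕ → ℕ → ℤ} {j s : ℕ}

/-! ### The range of the parameters -/

lemma denUp_odd (hs : ¬ Even s) :
    P.denUp ξ j s = br P.hq (P.xx ξ j s * P.xx ξ j s) * br P.hq (P.xx ξ j s * P.hq) := by
  rw [denUp_eq, den, if_neg hs, zpow_one, sq]

lemma denDown_odd (hs : ¬ Even s) :
    P.denDown ξ j s = br P.hq (P.xx ξ j s * P.xx ξ j s) * br P.hq (P.xx ξ j s * P.hq⁻¹) := by
  rw [denDown_eq, den, if_neg hs, zpow_neg, zpow_one, sq]

lemma dvd_add_self_iff (hP : P.Admissible) (t : ℤ) : (P.k : ℤ) ∣ t + t ↔ (P.k : ℤ) ∣ t := by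
  have h : IsCoprime (P.k : ℤ) 2 := by
    obtain ⟨m, hm⟩ := hP.k_odd
    exact ⟨1, -m, by rw [hm]; push_cast; ring⟩
  rw [← two_mul]
  exact ⟨h.dvd_of_dvd_mul_left, fun h => h.mul_left 2⟩

lemma denUp_eq_zero_iff (hP : P.Admissible) (hs : ¬ Even s) (hj : P.i < j) (hjs : 2 * j ≤ s)
    (hn : s ≤ P.n) :
    P.denUp ξ j s = 0 ↔ (P.k : ℤ) ∣ P.tw ξ j s ∨ (P.k : ℤ) ∣ P.tw ξ j s + 1 := by
  have hh := hq_ne_zero (P := P)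
  rw [denUp_odd hs, mul_eq_zero, xx_tw hP ξ hj hjs hn, ← zpow_add₀ hh, ← zpow_add_one₀ hh,
    br_zpow_eq_zero_iff hP, br_zpow_eq_zero_iff hP, dvd_add_self_iff hP]

lemma tw_n_eq (hP : P.Admissible) (hj : P.i < j) (hjn : j ≤ P.n / 2) :
    (P.tw ξ j P.n : ℚ) = 2 * P.M j + P.n - 2 * j := by
  rw [tw, if_pos rfl]
  push_cast
  rw [tp_eq hP hj hjn, dM_eq hP]
  ring

lemma two_mul_topL (hP : P.Admissible) (hj : P.i < j) (hjn : j ≤ P.n / 2) :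
    2 * P.topL j = (P.tw ξ j P.n + (P.n % 2 : ℕ) : ℤ) := by
  have h : (2 * ((P.n + 1) / 2 : ℕ) : ℚ) = P.n + (P.n % 2 : ℕ) := by
    have : 2 * ((P.n + 1) / 2) = P.n + P.n % 2 := by omega
    exact_mod_cast this
  rw [topL, Int.cast_add, Int.cast_natCast]
  rw [tw_n_eq hP hj hjn]
  linear_combination h

lemma tw_add_tw_lt (hP : P.Admissible) :
    P.tw ξ (P.i + 1) P.n + P.tw ξ (P.n / 2) P.n + 2 * (P.n % 2 : ℕ) < 2 * P.k := by
  have hi := hP.i_lt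
  have h := hP.bound_add
  have e1 := two_mul_topL (ξ := ξ) hP (Nat.lt_succ_self P.i) (by omega)
  have e2 := two_mul_topL (ξ := ξ) hP hi le_rfl
  rw [← Int.cast_lt (R := ℚ)]
  push_cast at e1 e2 ⊢
  linarith

lemma tw_sub_tw_lt (hP : P.Admissible) :
    P.tw ξ (P.i + 1) P.n - P.tw ξ (P.n / 2) P.n < 2 * P.k := by
  have hi := hP.i_lt
  have h := hP.bound_sub
  have e1 := two_mul_topL (ξ := ξ) hP (Nat.lt_succ_self P.i) (by omega)
  have e2 := two_mul_topL (ξ := ξ) hP hi le_rfl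
  rw [← Int.cast_lt (R := ℚ)]
  push_cast at e1 e2 ⊢
  linarith

/-- Both sides are the same inequality for the doubled coordinate of the first noncyclic top entry.
If that entry is also the last one, `bound_add` already implies it, so no condition is left. -/
lemma low_iff (hP : P.Admissible) : P.Low ↔
    (P.i + 2 ≤ P.n / 2 → 2 * (P.M (P.i + 1) + (P.n / 2 : ℕ) - P.i - 1) < (P.k : ℚ)) := by
  have hi := hP.i_lt
  have h : 2 * (P.M (P.i + 1) + (P.n / 2 : ℕ) - P.i - 1) =
      ((P.tw (fun _ _ => 0) (P.i + 1) P.n - (P.n % 2 : ℕ) : ℤ) : ℚ) := by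
    have h2 : (2 * (P.n / 2 : ℕ) : ℚ) = P.n - (P.n % 2 : ℕ) := by
      have : 2 * (P.n / 2) + P.n % 2 = P.n := by omega
      rw [eq_sub_iff_add_eq]
      exact_mod_cast this
    rw [Int.cast_sub, Int.cast_natCast, tw_n_eq hP (j := P.i + 1) (by omega) (by omega),
      Nat.cast_add, Nat.cast_one]
    linear_combination h2
  rw [h, show ((P.k : ℕ) : ℚ) = ((P.k : ℤ) : ℚ) by push_cast; rfl, Int.cast_lt, Low]
  have h3 := tw_add_tw_lt (ξ := fun _ _ => 0) hP
  constructor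
  · intro h1 _
    omega
  · intro h1
    by_cases h4 : P.i + 2 ≤ P.n / 2
    · have := h1 h4
      omega
    · rw [show P.n / 2 = P.i + 1 by omega] at h3
      omega

lemma denUp_ne_zero_of_cyc (hP : P.Admissible) (hs : ¬ Even s) (hj : P.IsCyc j s) (hn : s < P.n) :
    P.denUp ξ j s ≠ 0 := by
  rw [denUp_odd hs]
  have h := isGen_xx (ξ := ξ) hP hj 1
  rw [zpow_one] at h
  exact mul_ne_zero (isGen_mul hP hj hj.1 hj.2.2.1 hj.2.2.2 (Or.inl ⟨rfl, hn⟩)).ne h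

lemma denDown_ne_zero_of_cyc (hP : P.Admissible) (hs : ¬ Even s) (hj : P.IsCyc j s)
    (hn : s < P.n) : P.denDown ξ j s ≠ 0 := by
  rw [denDown_odd hs]
  have h := isGen_xx (ξ := ξ) hP hj (-1)
  rw [zpow_neg_one] at h
  exact mul_ne_zero (isGen_mul hP hj hj.1 hj.2.2.1 hj.2.2.2 (Or.inl ⟨rfl, hn⟩)).ne h

lemma Low.regular (hP : P.Admissible) (hL : P.Low) : P.Regular := by
  intro ξ j s h1 h2 h3 h4
  have hs : ¬ Even s := Nat.not_even_iff_odd.2 h4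
  by_cases hj : j ≤ P.i
  · exact denUp_ne_zero_of_cyc hP hs ⟨h1, hj, h2, h3.le⟩ h3
  · have h := ((isTableau_iff hP).1 (isTableau_arr ξ)).2.2
    have ho : s % 2 = 1 := Nat.odd_iff.1 h4
    have b1 := h.pos_odd (not_le.1 hj) h2 h3 ho
    have b2 := (h.bounds hP hL (not_le.1 hj) h2 h3).2.2 ho
    rw [Ne, denUp_eq_zero_iff hP hs (not_le.1 hj) h2 h3.le]
    rintro (h0 | h0)
    · exact not_dvd_of_abs_lt (by unfold arr at *; omega) (by unfold arr at *; omega)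
        (by unfold arr at *; omega) h0
    · exact not_dvd_of_abs_lt (by unfold arr at *; omega) (by unfold arr at *; omega)
        (by unfold arr at *; omega) h0

/-! ### Tableaux with constant columns -/

lemma tp_anti (hP : P.Admissible) {a : ℕ} (ha : P.i < a) (han : a + 1 ≤ P.n / 2) :
    P.tp (a + 1) ≤ P.tp a := by
  have h2 := hP.M_dom a ha han
  have e1 := tp_eq (j := a + 1) hP (by omega) (by omega)
  have e2 := tp_eq (j := a) hP (by omega) (by omega)
  rw [← Int.cast_le (R := ℚ), e1, e2]; linarith

lemma dM_add_tp (hP : P.Admissible) (h : P.i + 1 < P.n / 2) :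
    0 ≤ P.dM + P.tp (P.n / 2) + P.tp (P.n / 2 - 1) := by
  have e1 := tp_eq (j := P.n / 2) hP (by omega) (by omega)
  have e2 := tp_eq (j := P.n / 2 - 1) hP (by omega) (by omega)
  have e3 := dM_eq hP
  have : (0 : ℚ) ≤ P.dM + P.tp (P.n / 2) + P.tp (P.n / 2 - 1) := by
    rw [e1, e2, e3]
    rcases Nat.even_or_odd P.n with hn | hn
    · have := (neg_abs_le _).trans' (neg_le_neg (hP.M_even hn h))
      linarith
    · have h1 := hP.M_odd hn
      have h2 := hP.M_dom (P.n / 2 - 1) (by omega) (by omega)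
      rw [show P.n / 2 - 1 + 1 = P.n / 2 by omega] at h2
      linarith
  exact_mod_cast this

variable (P) in
/-- The tableau with the columns `μ` below the highest even row. -/
def colTab (μ : ℕ → ℤ) : ℕ → ℕ → ℤ := fun j s =>
  if P.i < j ∧ 2 * j ≤ s ∧ s < P.n then (if s < 2 * (P.n / 2) then μ j else P.tp j) else 0

lemma tw_colTab {μ : ℕ → ℤ} (hj : P.i < j) (hjs : 2 * j ≤ s) (hn : s ≤ P.n) :
    P.tw (P.colTab μ) j s =
      P.dM + 2 * (if s < 2 * (P.n / 2) then μ j else P.tp j) + s - 2 * j := by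
  simp only [tw, colTab]
  split_ifs <;> first | rfl | omega

/-- Constant columns interlace by themselves below row `2⌊n/2⌋`. The hypotheses express interlacing
with the row above, where the columns take the top values. -/
lemma isTableau_colTab (hP : P.Admissible) {μ : ℕ → ℤ}
    (h1 : ∀ a, P.i < a → a < P.n / 2 → P.tp (a + 1) ≤ μ a ∧ μ a ≤ P.tp a)
    (h2 : P.i + 1 < P.n / 2 → 0 ≤ P.dM + P.tp (P.n / 2) + μ (P.n / 2 - 1)) :
    P.IsTableau (P.colTab μ) := by
  have hi := hP.i_lt
  have hk := hP.k_ge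
  have hμ : ∀ a, P.i < a → a < P.n / 2 → μ (P.n / 2 - 1) ≤ μ a := by
    intro a ha han
    obtain ⟨d, hd⟩ := Nat.exists_eq_add_of_lt han
    induction d generalizing a with
    | zero => rw [hd]; simp
    | succ d ih =>
      have := ih (a + 1) (by omega) (by omega) (by omega)
      have := (h1 a ha han).1
      have := (h1 (a + 1) (by omega) (by omega)).2
      omega
  have h3 : P.i + 1 < P.n / 2 → P.tp (P.n / 2) ≤ μ (P.n / 2 - 1) := fun h => by
    have := (h1 (P.n / 2 - 1) (by omega) (by omega)).1
    rwa [show P.n / 2 - 1 + 1 = P.n / 2 by omega] at this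
  have h4 : Odd P.n → 0 ≤ P.dM + 2 * P.tp (P.n / 2) := fun h => by
    have e1 := tp_eq (j := P.n / 2) hP (by omega) (by omega)
    have e3 := dM_eq hP
    have : (0 : ℚ) ≤ P.dM + 2 * P.tp (P.n / 2) := by
      rw [e1, e3]
      have h1 := hP.M_odd h
      linarith
    exact_mod_cast this
  refine (isTableau_iff hP).2 ⟨fun j s h => ?_, fun j s _ hj _ _ => ?_, ?_, ?_, ?_, ?_⟩
  · rw [colTab, if_neg fun h0 => h ⟨by omega, h0.2⟩]
  · rw [colTab, if_neg fun h0 => absurd h0.1 (not_lt.2 hj)]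
    omega
  · intro j s hj hjs hn
    rw [tw_colTab hj hjs hn.le, tw_colTab hj (by omega) hn]
    have h5 := h1 j hj
    push_cast
    split_ifs <;> omega
  · intro j s hj hjs hn
    rw [tw_colTab hj (by omega) hn.le, tw_colTab (by omega) (by omega) hn]
    have h5 := h1 j hj
    have h6 := h1 (j + 1) (by omega)
    have h7 := tp_anti hP hj
    push_cast
    split_ifs <;> omega
  · intro r hr hrn
    rw [tw_colTab hr (by omega) (by omega), tw_colTab (by omega) (by omega) hrn]
    have h5 := hμ r hr
    have h6 := hμ (r + 1) (by omega)
    rcases eq_or_ne (r + 1) (P.n / 2) with h7 | h7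
    · rw [← h7] at h2
      simp only [show r + 1 - 1 = r by omega] at h2
      push_cast
      split_ifs <;> omega
    · push_cast
      split_ifs <;> omega
  · intro r hr hrn
    rw [tw_colTab hr (by omega) (by omega), tw_colTab (by omega) (by omega) hrn]
    have h5 := hμ r hr
    rcases eq_or_ne r (P.n / 2) with rfl | h7
    · have := h4 (Nat.odd_iff.2 (by omega))
      push_cast
      split_ifs <;> omega
    · push_cast
      split_ifs <;> omega

lemma nonempty_tab (hP : P.Admissible) : Nonempty P.Tab :=
  ⟨tab _ (isTableau_colTab hP (μ := P.tp) (fun _ ha han => ⟨tp_anti hP ha han, le_rfl⟩)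
    (dM_add_tp hP))⟩

/-- If the bound fails, the coordinates that can occur in row `2⌊n/2⌋ - 1` include a value at which
the denominator vanishes. It is realised by lowering one column of the tableau whose columns equal
the top entries. -/
lemma Regular.low (hP : P.Admissible) (hR : P.Regular) : P.Low := by
  by_contra hL
  have hi := hP.i_lt
  have h1 := tw_add_tw_lt (ξ := fun _ _ => 0) hP
  have h2 := tw_sub_tw_lt (ξ := fun _ _ => 0) hP
  rw [Low] at hL
  have hN : P.i + 1 < P.n / 2 := by
    by_contra hc
    rw [show P.n / 2 = P.i + 1 by omega] at h1
    omega
  simp only [tw, if_true] at h1 h2 hL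
  -- `E a` is the coordinate of column `a` in row `2⌊n/2⌋ - 1` when this column is constantly equal
  -- to its top entry.
  obtain ⟨E, hE⟩ : ∃ E : ℕ → ℤ, ∀ a, E a = P.dM + 2 * P.tp a + 2 * (P.n / 2 : ℕ) - 1 - 2 * a :=
    ⟨_, fun _ => rfl⟩
  -- The denominator vanishes at the coordinates `k` and `k - 1`; exactly one of them has the parity
  -- of the row.
  obtain ⟨t, ht, ht1, ht2⟩ : ∃ t : ℤ, (t = P.k ∨ t = P.k - 1) ∧ (t - E (P.i + 1)) % 2 = 0 ∧
      t ≤ E (P.i + 1) := by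
    have := hE (P.i + 1)
    by_cases hp : ((P.k : ℤ) - E (P.i + 1)) % 2 = 0
    · exact ⟨P.k, Or.inl rfl, hp, by push_cast at *; omega⟩
    · exact ⟨P.k - 1, Or.inr rfl, by omega, by push_cast at *; omega⟩
  -- `j` is the last column whose coordinate still reaches `t`. Lowering it to `t` keeps it above
  -- the next top entry.
  obtain ⟨j, hj1, hj2, hj3, hj4⟩ : ∃ j, P.i < j ∧ j < P.n / 2 ∧ t ≤ E j ∧
      (j + 1 < P.n / 2 → E (j + 1) < t) := by
    by_contra! hcon
    have hall : ∀ j, P.i + 1 ≤ j → j < P.n / 2 → t ≤ E j := by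
      intro j hj
      induction j, hj using Nat.le_induction with
      | base => exact fun _ => ht2
      | succ j hj ih => exact fun h => (hcon j hj (by omega) (ih (by omega))).2
    have := (hcon (P.n / 2 - 1) (by omega) (by omega) (hall _ (by omega) (by omega))).1
    omega
  have e1 := hE (P.i + 1)
  have e2 := hE j
  have hd : 2 * ((E j - t) / 2) = E j - t := by omega
  obtain ⟨ν, hν⟩ : ∃ ν, ν = P.tp j - (E j - t) / 2 := ⟨_, rfl⟩
  have hT : P.IsTableau (P.colTab (Function.update P.tp j ν)) := by
    refine isTableau_colTab hP (fun a ha han => ?_) fun _ => ?_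
    · rcases eq_or_ne a j with rfl | hne
      · rw [Function.update_self]
        refine ⟨?_, by omega⟩
        rcases eq_or_ne (a + 1) (P.n / 2) with h3 | h3
        · rw [h3]
          push_cast at *
          omega
        · have h4 := hj4 (by omega)
          have e3 := hE (a + 1)
          push_cast at *
          omega
      · rw [Function.update_of_ne hne]
        exact ⟨tp_anti hP ha han, le_rfl⟩
    · rcases eq_or_ne (P.n / 2 - 1) j with rfl | hne
      · rw [Function.update_self]
        push_cast at *
        omega
      · rw [Function.update_of_ne hne]
        exact dM_add_tp hP hN
  have ho : ¬ Even (2 * (P.n / 2) - 1) := by rw [Nat.not_even_iff]; omega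
  suffices h0 : P.denUp (P.colTab (Function.update P.tp j ν)) j (2 * (P.n / 2) - 1) = 0 from
    hR (tab _ hT) j (2 * (P.n / 2) - 1) (by omega) (by omega) (by omega)
      (Nat.not_even_iff_odd.1 ho) h0
  refine (denUp_eq_zero_iff hP ho hj1 (by omega) (by omega)).2 ?_
  rw [tw_colTab hj1 (by omega) (by omega), if_pos (by omega), Function.update_self]
  have : P.dM + 2 * ν + (2 * (P.n / 2) - 1 : ℕ) - 2 * j = t := by
    omega
  rw [this]
  rcases ht with rfl | rfl
  · left; exact dvd_rfl
  · right; simp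

end Omega

section diagonal

variable {X β : Type*} {W : Submodule ℂ (X →₀ ℂ)} {T : Module.End ℂ (X →₀ ℂ)} {x x' y z : X}

/-! ### Diagonal operators that preserve a subspace -/

/-- The diagonal operator with the eigenvalues `g`. -/
def diagOp (g : X → ℂ) : Module.End ℂ (X →₀ ℂ) :=
  Finsupp.linearCombination ℂ fun x => Finsupp.single x (g x)

/-- The diagonal operator preserves the subspace. -/
def DiagInv (W : Submodule ℂ (X →₀ ℂ)) (g : X → ℂ) : Prop := ∀ w ∈ W, diagOp g w ∈ W

/-- Points that are not separated by the diagonal operators that preserve the subspace. -/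
def Twin (W : Submodule ℂ (X →₀ ℂ)) (x y : X) : Prop := ∀ g, DiagInv W g → g x = g y

lemma Twin.refl (x : X) : Twin W x x := fun _ _ => rfl

lemma Twin.symm (h : Twin W x y) : Twin W y x := fun g hg => (h g hg).symm

lemma Twin.trans (h : Twin W x y) (h' : Twin W y z) : Twin W x z :=
  fun g hg => (h g hg).trans (h' g hg)

open Classical in
/-- The characteristic function of a class. -/
def twinChar (W : Submodule ℂ (X →₀ ℂ)) (x : X) : X → ℂ := fun y => if Twin W x y then 1 else 0

lemma twinChar_ne_zero (h : twinChar W x y ≠ 0) : Twin W x y := by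
  by_contra h0
  exact h (if_neg h0)

lemma twinChar_self (h : Twin W x y) : twinChar W x y = 1 := if_pos h

variable [Fintype X]

lemma end_apply (T : Module.End ℂ (X →₀ ℂ)) (w : X →₀ ℂ) (y : X) :
    T w y = ∑ x, w x * T (Finsupp.single x 1) y := by
  have h : w = ∑ x, w x • Finsupp.single x 1 := by
    conv_lhs => rw [← Finsupp.univ_sum_single w]
    simp
  conv_lhs => rw [h]
  rw [map_sum, Finsupp.finsetSum_apply]
  simp only [map_smul, Finsupp.smul_apply, smul_eq_mul]

lemma diagOp_apply (g : X → ℂ) (w : X →₀ ℂ) (y : X) : diagOp g w y = g y * w y := by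
  classical
  rw [end_apply, sum_eq_single y]
  · simp [diagOp, mul_comm]
  · intro x _ h
    simp [diagOp, h]
  · simp

lemma DiagInv.mul {f g : X → ℂ} (hf : DiagInv W f) (hg : DiagInv W g) :
    DiagInv W (f * g) := fun w hw => by
  have : diagOp (f * g) w = diagOp f (diagOp g w) := by
    ext y; simp only [diagOp_apply, Pi.mul_apply, mul_assoc]
  rw [this]
  exact hf _ (hg w hw)

lemma DiagInv.affine {f : X → ℂ} (hf : DiagInv W f) (a b : ℂ) :
    DiagInv W fun x => b * (f x - a) := fun w hw => by
  have : diagOp (fun x => b * (f x - a)) w = b • (diagOp f w - a • w) := by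
    ext y
    simp only [diagOp_apply, Finsupp.smul_apply, Finsupp.sub_apply, smul_eq_mul]
    ring
  rw [this]
  exact W.smul_mem _ (W.sub_mem (hf w hw) (W.smul_mem _ hw))

lemma diagInv_one : DiagInv W (1 : X → ℂ) := fun w hw => by
  have : diagOp (1 : X → ℂ) w = w := by ext y; simp [diagOp_apply]
  rwa [this]

/-- For each `y` that is not a twin of `x`, an affine function of a separating `g` is `1` at `x` and
`0` at `y`. The product over all `y` stays in the algebra, equals `1` on the class of `x`, and
vanishes off it. -/
lemma diagInv_twinChar (x : X) : DiagInv W (twinChar W x) := by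
  classical
  have h : ∀ y, ∃ f, DiagInv W f ∧ f x = 1 ∧ (¬ Twin W x y → f y = 0) := by
    intro y
    by_cases hy : Twin W x y
    · exact ⟨1, diagInv_one, rfl, fun h => absurd hy h⟩
    · rw [Twin] at hy
      push Not at hy
      obtain ⟨g, hg, hne⟩ := hy
      exact ⟨_, hg.affine (g y) (g x - g y)⁻¹, inv_mul_cancel₀ (sub_ne_zero.2 hne), by simp⟩
  choose f hf hfx hfy using h
  have hprod : DiagInv W (∏ y, f y) :=
    prod_induction f (DiagInv W) (fun _ _ => DiagInv.mul) diagInv_one fun y _ => hf y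
  convert hprod using 1
  funext z
  rw [twinChar, Finset.prod_apply]
  split_ifs with hz
  · refine (prod_eq_one fun y _ => ?_).symm
    rw [← hz (f y) (hf y), hfx]
  · exact (prod_eq_zero (f := fun c => f c z) (mem_univ z) (hfy z hz)).symm

section

variable {σ : X → β}

/-- With `P_x`, `P_y` the projections onto the classes, `P_x T P_y T P_x` preserves `W`. Since `σ`
is constant along `T` and injective on classes, this operator is diagonal and its eigenvalues are
the products along two-step loops; twins share them. -/
lemma Twin.loop (hT : ∀ w ∈ W, T w ∈ W) (hσ : ∀ y y', Twin W y y' → σ y = σ y' → y = y')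
    (ht : ∀ x y, T (Finsupp.single x 1) y ≠ 0 → σ x = σ y) (hx : Twin W x x')
    (h0 : T (Finsupp.single x 1) y * T (Finsupp.single y 1) x ≠ 0) :
    ∃ y', Twin W y y' ∧ T (Finsupp.single x' 1) y' * T (Finsupp.single y' 1) x' =
      T (Finsupp.single x 1) y * T (Finsupp.single y 1) x := by
  obtain ⟨t, htt⟩ : ∃ t : X → X → ℂ, ∀ x y, T (Finsupp.single x 1) y = t x y :=
    ⟨_, fun _ _ => rfl⟩
  simp only [htt] at h0 ht ⊢
  have hg : DiagInv W fun z => twinChar W x z * ∑ y', twinChar W y y' * (t z y' * t y' z) := by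
    intro w hw
    have : diagOp (fun z => twinChar W x z * ∑ y', twinChar W y y' * (t z y' * t y' z)) w =
        diagOp (twinChar W x) (T (diagOp (twinChar W y) (T (diagOp (twinChar W x) w)))) := by
      ext z
      simp only [diagOp_apply]
      rw [end_apply T]
      simp only [diagOp_apply]
      rw [mul_assoc]
      by_cases hz : twinChar W x z = 0
      · rw [hz, zero_mul, zero_mul]
      have hz' := twinChar_ne_zero hz
      congr 1
      rw [sum_mul]
      refine sum_congr rfl fun y' _ => ?_
      by_cases h3 : t y' z = 0
      · rw [htt, h3]; ring
      rw [end_apply T, sum_eq_single z]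
      · rw [diagOp_apply, twinChar_self hz', htt, htt]
        ring
      · intro z' _ hzz
        rw [diagOp_apply, htt]
        by_contra hne
        exact hzz (hσ _ _ ((twinChar_ne_zero (left_ne_zero_of_mul (left_ne_zero_of_mul hne))).symm.trans
          hz') ((ht _ _ (right_ne_zero_of_mul hne)).trans (ht _ _ h3)))
      · simp
    rw [this]
    exact diagInv_twinChar x _ (hT _ (diagInv_twinChar y _ (hT _ (diagInv_twinChar x _ hw))))
  have h1 := hx _ hg
  have huniq : ∀ z y₁ y₂, Twin W y y₁ → Twin W y y₂ → t z y₁ ≠ 0 → t z y₂ ≠ 0 → y₁ = y₂ :=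
    fun z y₁ y₂ h1 h2 h3 h4 => hσ _ _ (h1.symm.trans h2) ((ht _ _ h3).symm.trans (ht _ _ h4))
  have hsum : ∀ z y₁, Twin W y y₁ → t z y₁ ≠ 0 →
      ∑ y', twinChar W y y' * (t z y' * t y' z) = t z y₁ * t y₁ z := by
    intro z y₁ h1 h3
    rw [sum_eq_single y₁]
    · rw [twinChar_self h1, one_mul]
    · intro y₂ _ hne
      by_contra h4
      exact hne (huniq z y₂ y₁ (twinChar_ne_zero (left_ne_zero_of_mul h4)) h1
        (left_ne_zero_of_mul (right_ne_zero_of_mul h4)) h3)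
    · simp
  simp only [twinChar_self hx, twinChar_self (Twin.refl x), one_mul] at h1
  rw [hsum x y (Twin.refl y) (left_ne_zero_of_mul h0)] at h1
  obtain ⟨y', -, hy'⟩ := exists_ne_zero_of_sum_ne_zero (h1 ▸ h0)
  have hy1 := twinChar_ne_zero (left_ne_zero_of_mul hy')
  exact ⟨y', hy1, by rw [h1, hsum x' y' hy1 (left_ne_zero_of_mul (right_ne_zero_of_mul hy'))]⟩

/-- The same argument with `P_x T P_x`, whose eigenvalues on the class are the diagonal entries of
`T`. -/
lemma Twin.diag (hT : ∀ w ∈ W, T w ∈ W) (hσ : ∀ y y', Twin W y y' → σ y = σ y' → y = y')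
    (ht : ∀ x y, T (Finsupp.single x 1) y ≠ 0 → σ x = σ y) (hx : Twin W x x') :
    T (Finsupp.single x 1) x = T (Finsupp.single x' 1) x' := by
  have hg : DiagInv W fun z => twinChar W x z * T (Finsupp.single z 1) z := by
    intro w hw
    have : diagOp (fun z => twinChar W x z * T (Finsupp.single z 1) z) w =
        diagOp (twinChar W x) (T (diagOp (twinChar W x) w)) := by
      ext z
      simp only [diagOp_apply]
      rw [mul_assoc]
      by_cases hz : twinChar W x z = 0
      · rw [hz, zero_mul, zero_mul]
      have hz' := twinChar_ne_zero hz
      congr 1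
      rw [end_apply T (diagOp _ w), sum_eq_single z]
      · rw [diagOp_apply, twinChar_self hz']
        ring
      · intro z' _ hzz
        rw [diagOp_apply]
        by_contra hne
        exact hzz (hσ _ _ ((twinChar_ne_zero (left_ne_zero_of_mul (left_ne_zero_of_mul hne))).symm.trans
          hz') (ht _ _ (right_ne_zero_of_mul hne)))
      · simp
    rw [this]
    exact diagInv_twinChar x _ (hT _ (diagInv_twinChar x _ hw))
  have h1 := hx _ hg
  simpa only [twinChar_self hx, twinChar_self (Twin.refl x), one_mul] using h1

end

lemma single_mem_of_ne (hW : ∀ x y, Twin W x y → x = y) {w : X →₀ ℂ} (hw : w ∈ W)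
    (hx : w x ≠ 0) : Finsupp.single x 1 ∈ W := by
  classical
  have h : diagOp (twinChar W x) w = w x • Finsupp.single x 1 := by
    ext y
    rw [diagOp_apply, Finsupp.smul_apply, smul_eq_mul, Finsupp.single_apply]
    by_cases hxy : x = y
    · subst hxy
      rw [twinChar_self (Twin.refl x), if_pos rfl, one_mul, mul_one]
    · rw [if_neg hxy, mul_zero, twinChar, if_neg fun h => hxy (hW _ _ h), zero_mul]
  have := W.smul_mem (w x)⁻¹ (diagInv_twinChar x w hw)
  rwa [h, smul_smul, inv_mul_cancel₀ hx, one_smul] at this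

end diagonal

namespace Omega

variable {P : Omega} {ξ η : ℕ → ℕ → ℤ} {j j' s : ℕ} {e e' : ℤ}

/-! ### Matrix entries of the operators -/

lemma shift_ne_aux (hP : P.Admissible) (he : e = 1 ∨ e = -1) (he' : e' = 1 ∨ e' = -1 ∨ e' = 0)
    (hne : e ≠ e') (a : ℤ) : (a + e) % (P.k : ℤ) ≠ (a + e') % (P.k : ℤ) := by
  intro h
  have hk := hP.k_ge
  have h2 := Int.ModEq.dvd (show a + e ≡ a + e' [ZMOD P.k] from h)
  exact not_dvd_of_abs_lt (by omega) (by omega) (by omega) h2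

lemma shift_self_ne (hP : P.Admissible) (he : e = 1 ∨ e = -1) (hξ : P.IsTableau ξ) :
    P.shift ξ j s e j s ≠ ξ j s := by
  have h2 := congr_fun (congr_fun hξ.red_eq j) s
  simp only [red, shift, and_self, if_true] at h2 ⊢
  split_ifs at h2 ⊢
  · rw [← h2, Int.emod_add_emod]
    simpa using shift_ne_aux hP (e' := 0) he (by simp) (by omega) (ξ j s)
  · omega

lemma shift_ne_self (hP : P.Admissible) (he : e = 1 ∨ e = -1) (hξ : P.IsTableau ξ) :
    P.shift ξ j s e ≠ ξ := fun h => shift_self_ne hP he hξ (congr_fun (congr_fun h j) s)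

lemma shift_inj (hP : P.Admissible) (he : e = 1 ∨ e = -1) (he' : e' = 1 ∨ e' = -1)
    (hξ : P.IsTableau ξ) (h : P.shift ξ j s e = P.shift ξ j' s e') : j = j' ∧ e = e' := by
  have h1 := congr_fun (congr_fun h j) s
  by_cases hj : j = j'
  · subst hj
    refine ⟨rfl, ?_⟩
    by_contra hne
    simp only [shift, and_self, if_true] at h1
    split_ifs at h1
    · exact shift_ne_aux hP he (by tauto) hne _ h1
    · omega
  · have h2 : P.shift ξ j' s e' j s = ξ j s := by simp [shift, hj]
    exact absurd (h1.trans h2) (shift_self_ne hP he hξ)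

lemma shift_of_ne {a r : ℕ} (h : ¬(a = j ∧ r = s)) : P.shift ξ j s e a r = ξ a r := by
  simp only [shift, if_neg h]

lemma shift_shift_neg (hξ : P.IsTableau ξ) : P.shift (P.shift ξ j s e) j s (-e) = ξ := by
  have h1 : P.shift ξ j s e = P.red (upd ξ s (j, e)) := by rw [← shift_red, hξ.red_eq]
  rw [h1, shift_red, upd_neg ξ s (j, e), hξ.red_eq]

lemma arr_injective : Function.Injective (arr (P := P)) := Subtype.val_injective

lemma ket_apply_of_ne {f : P.Tab → ℂ} {ζ : P.Tab} (h : arr ζ ≠ η) : P.ket η f ζ = 0 := by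
  classical
  by_cases hη : P.IsTableau η
  · rw [ket_pos f hη, Finsupp.single_apply, if_neg]
    rintro rfl
    exact h rfl
  · rw [ket_neg f hη]; rfl

lemma ket_arr (f : P.Tab → ℂ) (ζ : P.Tab) : P.ket (arr ζ) f = Finsupp.single ζ (f ζ) :=
  ket_pos f (isTableau_arr ζ)

variable {R : P.Tab → ℕ → ℕ → ℂ} {x y : P.Tab}

lemma op_single (R : P.Tab → ℕ → ℕ → ℂ) (s : ℕ) (x : P.Tab) (a : ℂ) :
    P.op R s (Finsupp.single x a) = a • P.act R s x := by
  rw [op, Finsupp.linearCombination_single]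

lemma op_apply_row (h : P.op R s (Finsupp.single x 1) y ≠ 0) {r : ℕ} (hr : r ≠ s) (j : ℕ) :
    arr x j r = arr y j r := by
  classical
  by_contra hne
  apply h
  rw [op_single, one_smul, act_apply, Finsupp.add_apply, Finsupp.finsetSum_apply, sum_eq_zero,
    zero_add]
  · split_ifs
    · rfl
    · rw [Finsupp.single_apply, if_neg]
      rintro rfl
      exact hne rfl
  · intro a _
    rw [Finsupp.sub_apply, ket_apply_of_ne, ket_apply_of_ne, sub_zero]
    · intro h0
      exact hne (by rw [h0, shift_of_ne (by tauto)])
    · intro h0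
      exact hne (by rw [h0, shift_of_ne (by tauto)])

lemma op_apply_self (hP : P.Admissible) : P.op R s (Finsupp.single x 1) x =
    if Even s then 0 else Complex.I * P.C (arr x) ((s + 1) / 2) := by
  rw [op_single, one_smul, act_apply, Finsupp.add_apply, Finsupp.finsetSum_apply, sum_eq_zero,
    zero_add]
  · split_ifs
    · rfl
    · exact Finsupp.single_eq_same
  · intro a _
    have := isTableau_arr x
    rw [Finsupp.sub_apply, ket_apply_of_ne (shift_ne_self hP (by simp) this).symm,
      ket_apply_of_ne (shift_ne_self hP (by simp) this).symm, sub_zero]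

lemma op_apply_up (hP : P.Admissible) (hj : j ∈ cols s) (hy : arr y = P.shift (arr x) j s 1) :
    P.op R s (Finsupp.single x 1) y = P.cc j s * R x j s / P.denUp (arr x) j s := by
  classical
  have hx := isTableau_arr x
  have hne : x ≠ y := by
    rintro rfl
    exact shift_ne_self hP (by simp) hx hy.symm
  rw [op_single, one_smul, act_apply, Finsupp.add_apply, Finsupp.finsetSum_apply,
    sum_eq_single_of_mem j hj]
  · rw [Finsupp.sub_apply, ← hy, ket_arr, Finsupp.single_eq_same, ket_apply_of_ne, sub_zero]
    · split_ifs
      · simp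
      · rw [Finsupp.single_apply, if_neg hne, add_zero]
    · rw [hy]
      intro h
      have := (shift_inj hP (by simp) (by simp) hx h).2
      omega
  · intro a _ ha
    rw [Finsupp.sub_apply, ket_apply_of_ne, ket_apply_of_ne, sub_zero]
    · rw [hy]
      intro h
      have := (shift_inj hP (by simp) (by simp) hx h).2
      omega
    · rw [hy]
      intro h
      exact ha (shift_inj hP (by simp) (by simp) hx h).1.symm

lemma op_apply_down (hP : P.Admissible) (hj : j ∈ cols s) (hy : arr y = P.shift (arr x) j s 1) :
    P.op R s (Finsupp.single y 1) x = -((P.cc j s)⁻¹ * R x j s / P.denDown (arr y) j s) := by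
  classical
  have hx := isTableau_arr x
  have hyt := isTableau_arr y
  have hxy : arr x = P.shift (arr y) j s (-1) := by rw [hy, shift_shift_neg hx]
  have hne : y ≠ x := by
    rintro rfl
    exact shift_ne_self hP (by simp) hx hy.symm
  rw [op_single, one_smul, act_apply, Finsupp.add_apply, Finsupp.finsetSum_apply,
    sum_eq_single_of_mem j hj]
  · rw [Finsupp.sub_apply, ← hxy, ket_arr, Finsupp.single_eq_same, ket_apply_of_ne, zero_sub]
    · split_ifs
      · simp
      · rw [Finsupp.single_apply, if_neg hne, add_zero]
    · rw [hxy]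
      intro h
      have := (shift_inj hP (by simp) (by simp) hyt h).2
      omega
  · intro a _ ha
    rw [Finsupp.sub_apply, ket_apply_of_ne, ket_apply_of_ne, sub_zero]
    · rw [hxy]
      intro h
      exact ha (shift_inj hP (by simp) (by simp) hyt h).1.symm
    · rw [hxy]
      intro h
      have := (shift_inj hP (by simp) (by simp) hyt h).2
      omega

/-! ### Non-vanishing of the matrix entries -/

lemma Inter.adj_add_pos (h : P.Inter ξ) {a b : ℕ} (ha : P.i < a) (has : 2 * a ≤ s) (hb : P.i < b)
    (hbs : 2 * b ≤ s + 1) (hn : s < P.n) : 1 ≤ P.tw ξ a s + P.tw ξ b (s + 1) := by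
  rcases Nat.mod_two_eq_zero_or_one s with h0 | h0
  · have h1 := h.up b s hb (by omega) hn
    have h2 := h.odd (s / 2) (by omega) (by omega)
    rw [show 2 * (s / 2) = s by omega] at h2
    rcases lt_trichotomy a b with hab | rfl | hab
    · have := h.add_pos ha hab (by omega) hn
      omega
    · rcases eq_or_ne a (s / 2) with rfl | hne
      · exact h2
      · have h3 := h.add_pos ha (by omega : a < s / 2) (by omega) hn
        have h4 := h.col ha (by omega : a ≤ s / 2) (by omega) hn
        omega
    · have := h.add_pos hb hab (by omega) hn
      omega
  · have h1 := h.pos_odd ha has hn h0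
    by_cases hb2 : 2 * b ≤ s
    · have h2 := h.pos_odd hb hb2 hn h0
      have h3 := h.up b s hb hb2 hn
      omega
    · have h2 := h.even (s / 2) (by omega) (by omega)
      rw [show s / 2 + 1 = b by omega, show 2 * (s / 2) + 2 = s + 1 by omega,
        show 2 * (s / 2) + 1 = s by omega] at h2
      have h3 := h.col ha (by omega : a ≤ s / 2) (by omega) hn
      omega

lemma br_ne_zero_of_lt (hP : P.Admissible) {t : ℤ} (h2 : 2 ∣ t) (h0 : t ≠ 0) (h1 : t < 2 * P.k)
    (h1' : -(2 * P.k : ℤ) < t) : br P.hq (P.hq ^ t) ≠ 0 := by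
  rw [Ne, br_zpow_eq_zero_iff hP]
  exact not_dvd_of_lt hP h2 h0 h1 h1'

section

variable (hP : P.Admissible) (hL : P.Low) (h : P.Inter ξ) (hj : P.i < j) (hjs : 2 * j ≤ s)
  (hn : s < P.n) (h' : P.Inter (upd ξ s (j, 1)))

include hP hL h hj hjs hn h'

lemma br_nb_ne_zero {a r : ℕ} (ha : P.i < a) (har : 2 * a ≤ r) (hr : r ≤ P.n)
    (hrs : r = s + 1 ∨ s = r + 1) :
    br P.hq (P.xx ξ a r * (P.xx ξ j s * P.hq)) ≠ 0 ∧
      br P.hq (P.xx ξ a r * (P.xx ξ j s * P.hq)⁻¹) ≠ 0 := by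
  have hh := hq_ne_zero (P := P)
  have p1 := tw_parity (P := P) ξ a r
  have p2 := tw_parity (P := P) ξ j s
  have b1 := h'.bounds hP hL hj hjs hn
  have b2 := h.bounds hP hL hj hjs hn
  have b3 := h.le_bound hP hL ha har hr
  have e1 : P.tw (upd ξ s (j, 1)) j s = P.tw ξ j s + 2 * 1 := tw_upd_self (x := (j, 1)) hn
  have e2 : P.tw (upd ξ s (j, 1)) a r = P.tw ξ a r := tw_upd_of_ne (by omega)
  rw [e1] at b1
  have key : P.tw ξ a r ≠ P.tw ξ j s + 1 ∧ 1 ≤ P.tw ξ a r + P.tw ξ j s := by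
    rcases hrs with rfl | rfl
    · refine ⟨?_, ?_⟩
      · rcases le_or_gt a j with haj | haj
        · have h1 := h'.up j s hj hjs hn
          have h2 := h'.up a s ha (by omega) hn
          have h3 := h'.col ha haj hjs hn
          rw [e1] at h3
          rw [e2] at h2
          omega
        · have h2 := h.down (a - 1) s (by omega) (by omega) hn
          have h3 := h.col hj (by omega : j ≤ a - 1) (by omega) hn
          rw [show a - 1 + 1 = a by omega] at h2
          omega
      · have := h.adj_add_pos hj hjs ha har hn
        omega
    · refine ⟨?_, h.adj_add_pos ha har hj hjs (by omega)⟩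
      rcases le_or_gt j a with haj | haj
      · have h2 := h.up a r ha har (by omega)
        have h3 := h.col hj haj (by omega) hn
        omega
      · have h2 := h'.down a r ha (by omega) (by omega)
        have h3 := h'.col (by omega) (by omega : a + 1 ≤ j) (by omega) hn
        rw [e1] at h3
        rw [e2] at h2
        omega
  rw [xx_tw hP ξ ha har hr, xx_tw hP ξ hj hjs hn.le, ← zpow_add_one₀ hh, ← zpow_add₀ hh,
    ← zpow_neg, ← zpow_add₀ hh]
  constructor <;> refine br_ne_zero_of_lt hP ?_ ?_ ?_ ?_ <;> omega

lemma br_row_ne_zero {b : ℕ} (hb : P.i < b) (hbs : 2 * b ≤ s) (hbj : b ≠ j) :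
    br P.hq (P.xx ξ b s * P.xx ξ j s) * br P.hq (P.xx ξ b s * (P.xx ξ j s)⁻¹) *
      br P.hq (P.xx ξ b s * P.xx ξ j s * P.hq ^ 2) *
      br P.hq (P.xx ξ b s * (P.xx ξ j s)⁻¹ * (P.hq ^ 2)⁻¹) ≠ 0 := by
  have hh := hq_ne_zero (P := P)
  have p1 := tw_parity (P := P) ξ b s
  have p2 := tw_parity (P := P) ξ j s
  have b1 := h'.bounds hP hL hj hjs hn
  have b2 := h.bounds hP hL hj hjs hn
  have b3 := h.bounds hP hL hb hbs hn
  have e1 : P.tw (upd ξ s (j, 1)) j s = P.tw ξ j s + 2 * 1 := tw_upd_self (x := (j, 1)) hn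
  have e2 : P.tw (upd ξ s (j, 1)) b s = P.tw ξ b s :=
    tw_upd_of_ne (x := (j, 1)) fun h0 => hbj h0.1
  rw [e1] at b1
  have key : 2 ≤ P.tw ξ b s + P.tw ξ j s ∧ P.tw ξ b s ≠ P.tw ξ j s ∧
      P.tw ξ b s ≠ P.tw ξ j s + 2 := by
    rcases lt_or_gt_of_ne hbj with hl | hl
    · have h1 := h.add_pos hb hl hjs hn
      have h2 := h.col hb hl.le hjs hn
      have h3 := h'.col hb hl.le hjs hn
      rw [e1, e2] at h3
      omega
    · have h1 := h.add_pos hj hl hbs hn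
      have h2 := h.col hj hl.le hbs hn
      omega
  have e3 : P.hq ^ 2 = P.hq ^ (2 : ℤ) := by norm_cast
  rw [xx_tw hP ξ hb hbs hn.le, xx_tw hP ξ hj hjs hn.le, e3, ← zpow_neg, ← zpow_neg,
    ← zpow_add₀ hh, ← zpow_add₀ hh, ← zpow_add₀ hh, ← zpow_add₀ hh]
  refine mul_ne_zero (mul_ne_zero (mul_ne_zero ?_ ?_) ?_) ?_ <;>
    refine br_ne_zero_of_lt hP ?_ ?_ ?_ ?_ <;> omega

end

/-- In the minimal case noncyclic entries are frozen, so the existence of such a move already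
excludes it. -/
lemma low_of_move (hP : P.Admissible) (hLM : P.Low ∨ P.IsMinimal) (h : P.Inter ξ) (hj : P.i < j)
    (hjs : 2 * j ≤ s) (hn : s < P.n) (h' : P.Inter (upd ξ s (j, 1))) : P.Low := by
  refine hLM.resolve_right fun hM => ?_
  have h1 := h.tw_minimal hP hM hj hjs hn.le
  have h2 := h'.tw_minimal hP hM hj hjs hn.le
  rw [show P.tw (upd ξ s (j, 1)) j s = P.tw ξ j s + 2 * 1 from tw_upd_self (x := (j, 1)) hn] at h2
  omega

lemma rad_ne_zero (hP : P.Admissible) (hLM : P.Low ∨ P.IsMinimal) (h : P.Inter ξ) (hj : j ∈ cols s)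
    (hn : s < P.n) (h' : P.Inter (upd ξ s (j, 1))) : P.rad ξ j s ≠ 0 := by
  have hj := col_iff.1 hj
  have hh := hq_ne_zero (P := P)
  have e3 : P.hq ^ 2 = P.hq ^ (2 : ℤ) := by norm_cast
  rw [rad_eq (by omega)]
  refine div_ne_zero (prod_ne_zero_iff.2 fun f hf => ?_) (prod_ne_zero_iff.2 fun b hb => ?_)
  · rw [mem_nb] at hf
    have key : ∀ A B : ℂ, IsGen P.hq (A * B) → IsGen P.hq (A * B⁻¹) →
        br P.hq (A * (B * P.hq)) * br P.hq (A * (B * P.hq)⁻¹) ≠ 0 := by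
      intro A B h1 h2
      rw [← mul_assoc, mul_inv, ← mul_assoc]
      refine mul_ne_zero ?_ ?_
      · simpa using h1 1
      · simpa using h2 (-1)
    by_cases hji : j ≤ P.i
    · have hc : P.IsCyc j s := ⟨hj.1, hji, hj.2, hn.le⟩
      refine key _ _ ?_ ?_
      · rw [mul_comm]
        exact isGen_mul hP hc (by omega) (by omega) (by omega) (by omega)
      · have := (isGen_div (ξ := ξ) hP hc (b := f.1) (s' := f.2) (by omega) (by omega) (by omega)
          (by omega)).inv
        rwa [mul_inv, inv_inv, mul_comm] at this
    · by_cases hfi : f.1 ≤ P.i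
      · have hc : P.IsCyc f.1 f.2 := ⟨by omega, hfi, by omega, by omega⟩
        exact key _ _ (isGen_mul hP hc hj.1 hj.2 hn.le (by omega))
          (isGen_div hP hc hj.1 hj.2 hn.le (by omega))
      · have hL := low_of_move hP hLM h (not_le.1 hji) hj.2 hn h'
        have := br_nb_ne_zero hP hL h (not_le.1 hji) hj.2 hn h' (not_le.1 hfi)
          (r := f.2) (by omega) (by omega) (by omega)
        exact mul_ne_zero this.1 this.2
  · obtain ⟨hbj, hb⟩ := mem_erase.1 hb
    have hb := col_iff.1 hb
    have key : ∀ A B : ℂ, IsGen P.hq (A * B) → IsGen P.hq (A * B⁻¹) →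
        br P.hq (A * B) * br P.hq (A * B⁻¹) * br P.hq (A * B * P.hq ^ 2) *
          br P.hq (A * B⁻¹ * (P.hq ^ 2)⁻¹) ≠ 0 := by
      intro A B h1 h2
      rw [e3, ← zpow_neg]
      exact mul_ne_zero (mul_ne_zero (mul_ne_zero h1.ne h2.ne) (h1 _)) (h2 _)
    by_cases hji : j ≤ P.i
    · have hc : P.IsCyc j s := ⟨hj.1, hji, hj.2, hn.le⟩
      refine key _ _ ?_ ?_
      · rw [mul_comm]
        exact isGen_mul hP hc hb.1 hb.2 hn.le (by omega)
      · have := (isGen_div (ξ := ξ) hP hc hb.1 hb.2 hn.le (Or.inl ⟨rfl, hbj.symm, hn⟩)).inv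
        rwa [mul_inv, inv_inv, mul_comm] at this
    · by_cases hbi : b ≤ P.i
      · have hc : P.IsCyc b s := ⟨hb.1, hbi, hb.2, hn.le⟩
        exact key _ _ (isGen_mul hP hc hj.1 hj.2 hn.le (by omega))
          (isGen_div hP hc hj.1 hj.2 hn.le (by omega))
      · have hL := low_of_move hP hLM h (not_le.1 hji) hj.2 hn h'
        exact br_row_ne_zero hP hL h (not_le.1 hji) hj.2 hn h' (not_le.1 hbi) hb.2 hbj

lemma denUp_ne_zero (hP : P.Admissible) (hLM : P.Low ∨ P.IsMinimal) (h : P.Inter ξ)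
    (hj : j ∈ cols s) (hn : s < P.n) (h' : P.Inter (upd ξ s (j, 1))) : P.denUp ξ j s ≠ 0 := by
  have hj := col_iff.1 hj
  by_cases hs : Even s
  · rw [denUp_eq, den, if_pos hs]
    by_cases hji : j ≤ P.i
    · simpa using add_inv_ne_zero_of_cyc hP ⟨hj.1, hji, hj.2, hn.le⟩ hn 0
    · rw [xx_tw hP ξ (not_le.1 hji) hj.2 hn.le]
      exact add_inv_hq_ne_zero hP _
  · by_cases hji : j ≤ P.i
    · exact denUp_ne_zero_of_cyc hP hs ⟨hj.1, hji, hj.2, hn.le⟩ hn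
    · have hL := low_of_move hP hLM h (not_le.1 hji) hj.2 hn h'
      have ho : s % 2 = 1 := Nat.not_even_iff.1 hs
      have b1 := h.pos_odd (not_le.1 hji) hj.2 hn ho
      have b2 := (h.bounds hP hL (not_le.1 hji) hj.2 hn).2.2 ho
      rw [Ne, denUp_eq_zero_iff hP hs (not_le.1 hji) hj.2 hn.le]
      rintro (h0 | h0)
      · exact not_dvd_of_abs_lt (by omega) (by omega) (by omega) h0
      · exact not_dvd_of_abs_lt (by omega) (by omega) (by omega) h0

lemma denDown_ne_zero (hP : P.Admissible) (hLM : P.Low ∨ P.IsMinimal) (h : P.Inter ξ)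
    (hj : j ∈ cols s) (hn : s < P.n) (h' : P.Inter (upd ξ s (j, 1))) :
    P.denDown (upd ξ s (j, 1)) j s ≠ 0 := by
  have hj := col_iff.1 hj
  have hh := hq_ne_zero (P := P)
  by_cases hs : Even s
  · rw [denDown_eq, den, if_pos hs]
    by_cases hji : j ≤ P.i
    · simpa using add_inv_ne_zero_of_cyc hP ⟨hj.1, hji, hj.2, hn.le⟩ hn 0
    · rw [xx_tw hP _ (not_le.1 hji) hj.2 hn.le]
      exact add_inv_hq_ne_zero hP _
  · by_cases hji : j ≤ P.i
    · exact denDown_ne_zero_of_cyc hP hs ⟨hj.1, hji, hj.2, hn.le⟩ hn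
    · have hL := low_of_move hP hLM h (not_le.1 hji) hj.2 hn h'
      have ho : s % 2 = 1 := Nat.not_even_iff.1 hs
      have b1 := h.pos_odd (not_le.1 hji) hj.2 hn ho
      have b2 := (h'.bounds hP hL (not_le.1 hji) hj.2 hn).2.2 ho
      have e1 : P.tw (upd ξ s (j, 1)) j s = P.tw ξ j s + 2 * 1 := tw_upd_self (x := (j, 1)) hn
      rw [denDown_odd hs, xx_tw hP _ (not_le.1 hji) hj.2 hn.le, ← zpow_add₀ hh,
        ← zpow_sub_one₀ hh]
      refine mul_ne_zero ?_ ?_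
      · rw [Ne, br_zpow_eq_zero_iff hP, dvd_add_self_iff hP]
        exact not_dvd_of_abs_lt (by omega) (by omega) (by omega)
      · rw [Ne, br_zpow_eq_zero_iff hP]
        exact not_dvd_of_abs_lt (by omega) (by omega) (by omega)

end Omega

/-! ### Products that agree at many points -/

/-- As functions of `v` the two products are, up to one common sign, monic polynomials of degree
`#s`. Their difference has smaller degree and vanishes on `V`, so they have the same roots. -/
lemma exists_eq_of_prod_sub_eq {ι : Type*} {s : Finset ι} {f g : ι → ℂ} {V : Finset ℂ}
    (hV : #s ≤ #V) (h : ∀ v ∈ V, ∏ a ∈ s, (f a - v) = ∏ a ∈ s, (g a - v)) {a : ι} (ha : a ∈ s) :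
    ∃ b ∈ s, f a = g b := by
  have hm : ∀ f : ι → ℂ, (∏ a ∈ s, (Polynomial.X - Polynomial.C (f a))).Monic := fun f =>
    Polynomial.monic_prod_of_monic _ _ fun a _ => Polynomial.monic_X_sub_C _
  have hd : ∀ f : ι → ℂ, (∏ a ∈ s, (Polynomial.X - Polynomial.C (f a))).degree = ((#s : ℕ) : WithBot ℕ) :=
    fun f => by
      rw [Polynomial.degree_prod]
      simp
  have hlt := Polynomial.degree_sub_lt_left ((hd f).trans (hd g).symm) (hm f).ne_zero
    ((hm f).leadingCoeff.trans (hm g).leadingCoeff.symm)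
  rw [hd] at hlt
  have hneg : ∀ (f : ι → ℂ) v, ∏ a ∈ s, (v - f a) = (∏ a ∈ s, (-1)) * ∏ a ∈ s, (f a - v) := by
    intro f v
    rw [← prod_mul_distrib]
    exact prod_congr rfl fun a _ => by ring
  have heq : ∏ a ∈ s, (Polynomial.X - Polynomial.C (f a)) =
      ∏ a ∈ s, (Polynomial.X - Polynomial.C (g a)) := by
    refine Polynomial.eq_of_degree_sub_lt_of_eval_finset_eq V
      (hlt.trans_le (by exact_mod_cast hV)) fun v hv => ?_
    simp only [Polynomial.eval_prod, Polynomial.eval_sub, Polynomial.eval_X, Polynomial.eval_C]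
    rw [hneg, hneg, h v hv]
  have h0 := congr_arg (Polynomial.eval (f a)) heq
  simp only [Polynomial.eval_prod, Polynomial.eval_sub, Polynomial.eval_X, Polynomial.eval_C] at h0
  rw [prod_eq_zero ha (sub_self _)] at h0
  obtain ⟨b, hb, hab⟩ := prod_eq_zero_iff.1 h0.symm
  exact ⟨b, hb, sub_eq_zero.1 hab⟩

namespace Omega

variable {P : Omega} {ξ η : ℕ → ℕ → ℤ} {j s : ℕ}

lemma xx_congr {r : ℕ} (h : ξ j r = η j r) : P.xx ξ j r = P.xx η j r := by
  simp only [xx, entry, w, h]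

variable (P) in
/-- The part of the expression under the root that does not depend on the next row. -/
def radLow (ξ : ℕ → ℕ → ℤ) (j s : ℕ) : ℂ :=
  (∏ _a ∈ cols (s + 1), ((P.hq ^ 2 - (P.hq ^ 2)⁻¹) ^ 2)⁻¹) *
    (∏ a ∈ cols (s - 1), br P.hq (P.xx ξ a (s - 1) * (P.xx ξ j s * P.hq)) *
      br P.hq (P.xx ξ a (s - 1) * (P.xx ξ j s * P.hq)⁻¹)) /
      ∏ b ∈ (cols s).erase j, (br P.hq (P.xx ξ b s * P.xx ξ j s) *
        br P.hq (P.xx ξ b s * (P.xx ξ j s)⁻¹) * br P.hq (P.xx ξ b s * P.xx ξ j s * P.hq ^ 2) *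
        br P.hq (P.xx ξ b s * (P.xx ξ j s)⁻¹ * (P.hq ^ 2)⁻¹))

/-- The next row enters the radicand only as the value at one node of the polynomial whose roots are
its `yy`. Once the rows up to `s` are known, the radicand therefore yields that value. -/
lemma rad_eq_radLow (hP : P.Admissible) (hs : 1 ≤ s) : P.rad ξ j s =
    (∏ a ∈ cols (s + 1), (yy (P.xx ξ a (s + 1)) - yy (P.xx ξ j s * P.hq))) * P.radLow ξ j s := by
  have hX := xx_ne_zero (P := P) ξ
  rw [rad_eq hs, prod_nb s hs, radLow, ← mul_div_assoc, ← mul_assoc, ← prod_mul_distrib]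
  congr 2
  refine prod_congr rfl fun a _ => ?_
  rw [yy_sub (hq_w hP) (hX _ _) (mul_ne_zero (hX _ _) hq_ne_zero), mul_right_comm,
    mul_inv_cancel₀ (pow_ne_zero _ (hq_w hP)), one_mul]

lemma radLow_congr (h : ∀ a r, r ≤ s → ξ a r = η a r) : P.radLow ξ j s = P.radLow η j s := by
  simp only [radLow, xx_congr (P := P) (h _ s le_rfl), xx_congr (P := P) (h _ (s - 1) (by omega))]

variable {R : P.Tab → ℕ → ℕ → ℂ} {x x' y y' : P.Tab}

lemma arr_eq_red (hy : arr y = P.shift (arr x) j s 1) :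
    arr y = P.red (upd (arr x) s (j, 1)) := by
  rw [hy, ← shift_red, (isTableau_arr x).red_eq]

lemma inter_arr (hP : P.Admissible) (x : P.Tab) : P.Inter (arr x) :=
  ((isTableau_iff hP).1 (isTableau_arr x)).2.2

lemma supp_arr (x : P.Tab) : P.Supp (arr x) := fun j s h => (isTableau_arr x).supp j s h

lemma inter_of_shift (hP : P.Admissible) (hy : arr y = P.shift (arr x) j s 1) :
    P.Inter (upd (arr x) s (j, 1)) := by
  rw [← inter_red, ← arr_eq_red hy]
  exact inter_arr hP y

lemma exists_shift (hP : P.Admissible) (hj : j ∈ cols s) (hn : s < P.n)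
    (h : P.Inter (upd (arr x) s (j, 1))) : ∃ y : P.Tab, arr y = P.shift (arr x) j s 1 := by
  have hx : (j, (1 : ℤ)) ∈ moves s := mem_moves.2 (Or.inl ⟨hj, by simp⟩)
  refine ⟨tab _ ((isTableau_red hP (supp_upd hn (supp_arr x) hx)).2 h), ?_⟩
  rw [arr_tab, ← shift_red, (isTableau_arr x).red_eq]

lemma denDown_red (hP : P.Admissible) : P.denDown (P.red ξ) j s = P.denDown ξ j s := by
  rw [denDown_eq, denDown_eq, xx_red hP]

section

variable (hP : P.Admissible) (hLM : P.Low ∨ P.IsMinimal) (hR : P.IsRootChoice R) (hj : j ∈ cols s)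
  (hn : s < P.n) (hy : arr y = P.shift (arr x) j s 1)

include hP hLM hj hn hy

lemma denDown_arr_ne_zero : P.denDown (arr y) j s ≠ 0 := by
  rw [arr_eq_red hy, denDown_red hP]
  exact denDown_ne_zero hP hLM (inter_arr hP x) hj hn (inter_of_shift hP hy)

include hR

lemma root_choice_ne_zero : R x j s ^ 2 = P.rad (arr x) j s ∧ R x j s ≠ 0 := by
  have hj' := col_iff.1 hj
  have h : R x j s ^ 2 = P.rad (arr x) j s := by
    refine hR x j s hj'.1 hj'.2 hn ?_
    have := isTableau_arr y
    rw [hy] at this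
    exact this
  refine ⟨h, fun h0 => ?_⟩
  rw [h0] at h
  exact rad_ne_zero hP hLM (inter_arr hP x) hj hn (inter_of_shift hP hy) (by rw [← h]; simp)

lemma op_up_ne_zero : P.op R s (Finsupp.single x 1) y ≠ 0 := by
  rw [op_apply_up hP hj hy]
  exact div_ne_zero (mul_ne_zero (cc_ne_zero hP hn hj) (root_choice_ne_zero hP hLM hR hj hn hy).2)
    (denUp_ne_zero hP hLM (inter_arr hP x) hj hn (inter_of_shift hP hy))

lemma op_down_ne_zero : P.op R s (Finsupp.single y 1) x ≠ 0 := by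
  rw [op_apply_down hP hj hy]
  exact neg_ne_zero.2 (div_ne_zero (mul_ne_zero (inv_ne_zero (cc_ne_zero hP hn hj))
    (root_choice_ne_zero hP hLM hR hj hn hy).2) (denDown_arr_ne_zero hP hLM hj hn hy))

/-- In the product of two opposite matrix entries the root is squared and `c` cancels. This makes
the irreducibility argument independent of the choice of square roots. -/
lemma rad_eq_loop : P.rad (arr x) j s = -(P.denUp (arr x) j s * P.denDown (arr y) j s) *
    (P.op R s (Finsupp.single x 1) y * P.op R s (Finsupp.single y 1) x) := by
  have h1 := cc_ne_zero hP hn hj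
  have h2 := denUp_ne_zero hP hLM (inter_arr hP x) hj hn (inter_of_shift hP hy)
  have h3 := denDown_arr_ne_zero hP hLM hj hn hy
  rw [op_apply_up hP hj hy, op_apply_down hP hj hy,
    ← (root_choice_ne_zero hP hLM hR hj hn hy).1]
  field_simp

end

/-! ### Twins -/

variable (P) in
/-- A subspace that is invariant with respect to the operators. -/
def Invariant (R : P.Tab → ℕ → ℕ → ℂ) (W : Submodule ℂ P.V) : Prop :=
  ∀ s, 1 ≤ s → s < P.n → ∀ w ∈ W, P.op R s w ∈ W

variable {W : Submodule ℂ P.V}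

/-- Twins agree in the rows up to the row `s`. -/
def Settled (W : Submodule ℂ P.V) (s : ℕ) : Prop :=
  ∀ x y : P.Tab, Twin W x y → ∀ j r, r ≤ s → arr x j r = arr y j r

/-- The part of a tableau outside of the row `s`. -/
def offRow (s : ℕ) (x : P.Tab) (p : {p : ℕ × ℕ // p.2 ≠ s}) : ℤ := arr x p.1.1 p.1.2

lemma Settled.offRow_inj (hS : Settled W s) (x y : P.Tab) (h : Twin W x y)
    (h' : offRow s x = offRow s y) : x = y := by
  refine arr_injective ?_
  funext j r
  by_cases hr : r = s
  · exact hS x y h j r hr.le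
  · exact congr_fun h' ⟨(j, r), hr⟩

lemma offRow_eq (x y : P.Tab) (h : P.op R s (Finsupp.single x 1) y ≠ 0) :
    offRow s x = offRow s y := by
  funext p
  exact op_apply_row h p.2 p.1.1

section

variable [Fintype P.Tab] (hP : P.Admissible) (hLM : P.Low ∨ P.IsMinimal) (hR : P.IsRootChoice R)
  (hW : P.Invariant R W) (hS : Settled W s)

include hP hLM hR hW hS

/-- The operator of row `s` changes nothing outside that row, and twins agree in it, so `offRow`
meets the requirements on `σ` in `Twin.loop`. The loop at `x` thus has a counterpart at `x'`, with
the same product and hence the same radicand. -/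
lemma Settled.transfer (hj : j ∈ cols s) (hn : s < P.n) (hx : Twin W x x')
    (hy : arr y = P.shift (arr x) j s 1) : ∃ y', arr y' = P.shift (arr x') j s 1 ∧ Twin W y y' ∧
      P.rad (arr x) j s = P.rad (arr x') j s := by
  have hj' := col_iff.1 hj
  obtain ⟨y', h1, h2⟩ := Twin.loop (T := P.op R s) (σ := offRow s) (hW s (by omega) hn)
    hS.offRow_inj offRow_eq hx (mul_ne_zero (op_up_ne_zero hP hLM hR hj hn hy)
      (op_down_ne_zero hP hLM hR hj hn hy))
  have hy' : arr y' = P.shift (arr x') j s 1 := by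
    have h3 : P.op R s (Finsupp.single x' 1) y' ≠ 0 := by
      intro h0
      rw [h0, zero_mul] at h2
      exact mul_ne_zero (op_up_ne_zero hP hLM hR hj hn hy)
        (op_down_ne_zero hP hLM hR hj hn hy) h2.symm
    funext a r
    by_cases hr : r = s
    · subst hr
      rw [← hS y y' h1 a r le_rfl, hy]
      simp only [shift, hS x x' hx _ r le_rfl]
    · rw [shift_of_ne (by tauto), op_apply_row h3 hr a]
  refine ⟨y', hy', h1, ?_⟩
  rw [rad_eq_loop hP hLM hR hj hn hy, rad_eq_loop hP hLM hR hj hn hy', h2, denUp_eq, denUp_eq,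
    denDown_eq, denDown_eq, xx_congr (hS x x' hx j s le_rfl), xx_congr (hS y y' h1 j s le_rfl)]

lemma Settled.prod_eq (hj : j ∈ cols s) (hn : s < P.n) (hx : Twin W x x')
    (hy : arr y = P.shift (arr x) j s 1) :
    (∏ a ∈ cols (s + 1), (yy (P.xx (arr x) a (s + 1)) - yy (P.xx (arr x) j s * P.hq)) ≠ 0) ∧
    ∏ a ∈ cols (s + 1), (yy (P.xx (arr x) a (s + 1)) - yy (P.xx (arr x) j s * P.hq)) =
      ∏ a ∈ cols (s + 1), (yy (P.xx (arr x') a (s + 1)) - yy (P.xx (arr x) j s * P.hq)) := by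
  have hj' := col_iff.1 hj
  obtain ⟨y', -, -, h⟩ := hS.transfer hP hLM hR hW hj hn hx hy
  have h0 := rad_ne_zero hP hLM (inter_arr hP x) hj hn (inter_of_shift hP hy)
  rw [rad_eq_radLow hP (by omega)] at h h0
  rw [rad_eq_radLow hP (by omega), ← radLow_congr (hS x x' hx),
    ← xx_congr (hS x x' hx j s le_rfl)] at h
  exact ⟨left_ne_zero_of_mul h0, mul_right_cancel₀ (right_ne_zero_of_mul h0) h⟩

end

/-! ### Rotations of the cyclic entries -/

lemma upd_upd (ξ : ℕ → ℕ → ℤ) (s j : ℕ) (a b : ℤ) :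
    upd (upd ξ s (j, a)) s (j, b) = upd ξ s (j, a + b) := by
  funext c r
  simp only [upd]
  split_ifs <;> ring

lemma inter_upd_of_le (hj : j ≤ P.i) (e : ℤ) : P.Inter (upd ξ s (j, e)) ↔ P.Inter ξ := by
  have h : ∀ a r, P.i < a → P.tw (upd ξ s (j, e)) a r = P.tw ξ a r := fun a r ha =>
    tw_upd_of_ne (x := (j, e)) fun h0 => by simp at h0; omega
  constructor <;> rintro ⟨h1, h2, h3, h4⟩
  · refine ⟨fun a r ha => ?_, fun a r ha => ?_, fun r hr => ?_, fun r hr => ?_⟩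
    · have := h1 a r ha; rwa [h _ _ ha, h _ _ ha] at this
    · have := h2 a r ha; rwa [h _ _ ha, h _ _ (by omega)] at this
    · have := h3 r hr; rwa [h _ _ hr, h _ _ (by omega)] at this
    · have := h4 r hr; rwa [h _ _ hr, h _ _ hr] at this
  · refine ⟨fun a r ha => ?_, fun a r ha => ?_, fun r hr => ?_, fun r hr => ?_⟩
    · rw [h _ _ ha, h _ _ ha]; exact h1 a r ha
    · rw [h _ _ ha, h _ _ (by omega)]; exact h2 a r ha
    · rw [h _ _ hr, h _ _ (by omega)]; exact h3 r hr
    · rw [h _ _ hr, h _ _ hr]; exact h4 r hr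

lemma exists_rotate (hP : P.Admissible) (hj : j ∈ cols s) (hn : s < P.n) (hi : j ≤ P.i)
    (x : P.Tab) (e : ℤ) : ∃ y : P.Tab, arr y = P.red (upd (arr x) s (j, e)) := by
  have hj' := col_iff.1 hj
  refine ⟨tab _ ((isTableau_red hP fun a r h => ?_).2
    ((inter_upd_of_le hi e).2 (inter_arr hP x))), arr_tab _⟩
  simp only [upd]
  rw [if_neg, supp_arr x a r h]
  rintro ⟨rfl, rfl⟩
  exact h ⟨hj'.1, hj'.2, hn⟩

lemma rotate_succ {e : ℤ} (hx : arr x = P.red (upd ξ s (j, e)))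
    (hy : arr y = P.red (upd ξ s (j, e + 1))) : arr y = P.shift (arr x) j s 1 := by
  rw [hx, hy, shift_red, upd_upd]

/-- A cyclic entry can be raised any number of times and never meets a border; twins follow at every
step. The next row stays fixed meanwhile, so each cyclic column provides `k` nodes. -/
lemma Settled.rotate [Fintype P.Tab] (hP : P.Admissible) (hLM : P.Low ∨ P.IsMinimal)
    (hR : P.IsRootChoice R) (hW : P.Invariant R W) (hS : Settled W s) (hj : j ∈ cols s)
    (hn : s < P.n) (hi : j ≤ P.i) (hx : Twin W x x') (e : ℕ) : ∃ y y' : P.Tab,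
      arr y = P.red (upd (arr x) s (j, e)) ∧ arr y' = P.red (upd (arr x') s (j, e)) ∧
        Twin W y y' := by
  induction e with
  | zero =>
    refine ⟨x, x', ?_, ?_, hx⟩
    · rw [Nat.cast_zero, upd_zero, (isTableau_arr x).red_eq]
    · rw [Nat.cast_zero, upd_zero, (isTableau_arr x').red_eq]
  | succ e ih =>
    obtain ⟨y, y', h1, h2, h3⟩ := ih
    obtain ⟨z, hz⟩ := exists_rotate hP hj hn hi x (e + 1)
    obtain ⟨z', hz', h4, -⟩ := hS.transfer hP hLM hR hW hj hn h3 (rotate_succ h1 hz)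
    refine ⟨z, z', by exact_mod_cast hz, ?_, h4⟩
    rw [hz', h2, shift_red, upd_upd]
    push_cast
    rfl

lemma Settled.prod_eq_rotate [Fintype P.Tab] (hP : P.Admissible) (hLM : P.Low ∨ P.IsMinimal)
    (hR : P.IsRootChoice R) (hW : P.Invariant R W) (hS : Settled W s) (hj : j ∈ cols s)
    (hn : s < P.n) (hi : j ≤ P.i) (hx : Twin W x x') (e : ℕ) :
    (∏ a ∈ cols (s + 1),
      (yy (P.xx (arr x) a (s + 1)) - yy (P.xx (arr x) j s * P.hq ^ (2 * (e : ℤ) + 1))) ≠ 0) ∧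
    ∏ a ∈ cols (s + 1),
      (yy (P.xx (arr x) a (s + 1)) - yy (P.xx (arr x) j s * P.hq ^ (2 * (e : ℤ) + 1))) =
    ∏ a ∈ cols (s + 1),
      (yy (P.xx (arr x') a (s + 1)) - yy (P.xx (arr x) j s * P.hq ^ (2 * (e : ℤ) + 1))) := by
  obtain ⟨y, y', h1, h2, h3⟩ := hS.rotate hP hLM hR hW hj hn hi hx e
  obtain ⟨z, hz⟩ := exists_rotate hP hj hn hi x (e + 1)
  have h4 := hS.prod_eq hP hLM hR hW hj hn h3 (rotate_succ h1 hz)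
  have e1 : ∀ ξ : ℕ → ℕ → ℤ, ∀ a, P.xx (P.red (upd ξ s (j, (e : ℤ)))) a (s + 1) =
      P.xx ξ a (s + 1) := fun ξ a => by
    rw [xx_red hP]
    exact xx_congr (by simp [upd])
  have e2 : P.xx (P.red (upd (arr x) s (j, (e : ℤ)))) j s * P.hq =
      P.xx (arr x) j s * P.hq ^ (2 * (e : ℤ) + 1) := by
    rw [xx_red hP, xx_upd hn, zpow_add_one₀ hq_ne_zero, ← mul_assoc]
    simp [mv]
  rw [h1, h2] at h4
  simp only [e1, e2] at h4
  exact h4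

end Omega

lemma eq_of_strictAnti_image {f g : ℕ → ℤ} {m p : ℕ}
    (hf : ∀ a b, m < a → a < b → b ≤ p → f b < f a) (hg : ∀ a b, m < a → a < b → b ≤ p → g b < g a)
    (h1 : ∀ a, m < a → a ≤ p → ∃ b, m < b ∧ b ≤ p ∧ f a = g b)
    (h2 : ∀ a, m < a → a ≤ p → ∃ b, m < b ∧ b ≤ p ∧ g a = f b) (a : ℕ) (ha : m < a)
    (hap : a ≤ p) : f a = g a := by
  induction a using Nat.strong_induction_on with
  | _ a ih =>
    obtain ⟨b, hb, hbp, hab⟩ := h1 a ha hap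
    obtain ⟨c, hc, hcp, hac⟩ := h2 a ha hap
    have hb' : ¬ b < a := fun h => by
      have := ih b h hb hbp
      have := hf b a hb h hap
      omega
    have hc' : ¬ c < a := fun h => by
      have := ih c h hc hcp
      have := hg c a hc h hap
      omega
    rcases eq_or_ne b a with rfl | hba
    · exact hab
    · rcases eq_or_ne c a with rfl | hca
      · exact hac.symm
      · have := hg a b ha (by omega) hbp
        have := hf a c ha (by omega) hcp
        omega

namespace Omega

variable {P : Omega} {ξ η : ℕ → ℕ → ℤ} {a b j s : ℕ}

lemma xx_sub (hs : s < P.n) (ξ η : ℕ → ℕ → ℤ) (a : ℕ) :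
    P.xx η a s = P.xx ξ a s * P.hq ^ (2 * (η a s - ξ a s)) := by
  rw [xx, xx, hq_zpow, ← qp_add]
  congr 1
  have : s ≠ P.n := hs.ne
  simp only [entry, w, if_neg this]
  split_ifs <;> push_cast <;> ring

lemma dvd_of_br_zpow (hP : P.Admissible) {d : ℤ} (h : br P.hq (P.hq ^ (2 * d)) = 0) :
    (P.k : ℤ) ∣ d := by
  rw [br_zpow_eq_zero_iff hP, two_mul, dvd_add_self_iff hP] at h
  exact h

lemma IsTableau.eq_of_dvd (hξ : P.IsTableau ξ) (hη : P.IsTableau η) (ha : 1 ≤ a) (hai : a ≤ P.i)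
    (has : 2 * a ≤ s) (hs : s < P.n) (h : (P.k : ℤ) ∣ η a s - ξ a s) : ξ a s = η a s := by
  have h1 := hξ.cyc a s ha hai has hs
  have h2 := hη.cyc a s ha hai has hs
  have := Int.eq_zero_of_abs_lt_dvd h (abs_lt.2 ⟨by omega, by omega⟩)
  omega

lemma yy_ne_of_cyc (hP : P.Admissible) (ha : P.IsCyc a s) (hs : s < P.n) (hb : 1 ≤ b)
    (hbs : 2 * b ≤ s) (hab : a ≠ b) : yy (P.xx ξ a s) ≠ yy (P.xx η b s) := by
  intro h
  have hX := xx_ne_zero (P := P)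
  rw [← sub_eq_zero, yy_sub (hq_w hP) (hX _ _ _) (hX _ _ _), mul_eq_zero,
    or_iff_right (pow_ne_zero _ (hq_w hP)), xx_sub hs ξ η b, mul_inv, ← mul_assoc, ← mul_assoc,
    ← zpow_neg, mul_eq_zero] at h
  rcases h with h | h
  · exact isGen_mul hP ha hb hbs hs.le (Or.inl ⟨rfl, hs⟩) _ h
  · exact isGen_div hP ha hb hbs hs.le (Or.inl ⟨rfl, hab, hs⟩) _ h

lemma eq_of_yy_cyc (hP : P.Admissible) (hξ : P.IsTableau ξ) (hη : P.IsTableau η)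
    (ha : P.IsCyc a s) (hs : s < P.n) (h : yy (P.xx ξ a s) = yy (P.xx η a s)) :
    ξ a s = η a s := by
  have hX := xx_ne_zero (P := P)
  rw [eq_comm, ← sub_eq_zero, yy_sub (hq_w hP) (hX _ _ _) (hX _ _ _), mul_eq_zero,
    or_iff_right (pow_ne_zero _ (hq_w hP)), xx_sub hs ξ η a, mul_right_comm, mul_eq_zero] at h
  rcases h with h | h
  · exact absurd h (isGen_mul hP ha ha.1 ha.2.2.1 hs.le (Or.inl ⟨rfl, hs⟩) _)
  · rw [mul_right_comm, mul_inv_cancel₀ (hX _ _ _), one_mul] at h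
    exact hξ.eq_of_dvd hη ha.1 ha.2.1 ha.2.2.1 hs (dvd_of_br_zpow hP h)

lemma eq_of_tw_eq (hs : s < P.n) (h : P.tw ξ a s = P.tw η a s) : ξ a s = η a s := by
  have : s ≠ P.n := hs.ne
  simp only [tw, if_neg this] at h
  omega

lemma abs_tw_eq (hP : P.Admissible) (hL : P.Low) (hξ : P.Inter ξ) (hη : P.Inter η)
    (ha : P.i < a) (has : 2 * a ≤ s) (hb : P.i < b) (hbs : 2 * b ≤ s) (hs : s < P.n)
    (h : yy (P.xx ξ a s) = yy (P.xx η b s)) : |P.tw ξ a s| = |P.tw η b s| := by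
  rw [xx_tw hP ξ ha has hs.le, xx_tw hP η hb hbs hs.le, yy_eq_iff hP] at h
  have b1 := hξ.bounds hP hL ha has hs
  have b2 := hη.bounds hP hL hb hbs hs
  have p1 := tw_parity (P := P) ξ a s
  have p2 := tw_parity (P := P) η b s
  rw [abs_eq_abs]
  by_contra! hne
  rcases h with h | h
  · exact not_dvd_of_lt hP (by omega) (by omega) (by omega) (by omega) h
  · exact not_dvd_of_lt hP (by omega) (by omega) (by omega) (by omega) h

lemma Inter.abs_tw_lt (h : P.Inter ξ) (ha : P.i < a) (hab : a < b) (hbs : 2 * b ≤ s)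
    (hs : s < P.n) : |P.tw ξ b s| < |P.tw ξ a s| := by
  have h1 := h.add_pos ha hab hbs hs
  have h2 := h.col ha hab.le hbs hs
  rw [abs_of_pos (a := P.tw ξ a s) (by omega), abs_lt]
  omega

/-! ### The next row of twins -/

variable {R : P.Tab → ℕ → ℕ → ℂ} {x x' y y' : P.Tab} {W : Submodule ℂ P.V}

lemma settled_one : Settled W 1 := fun x y _ j r hr => by
  rw [supp_arr x j r (by omega), supp_arr y j r (by omega)]

/-- The operator of row `1` is diagonal with eigenvalues proportional to `[m_{1,2}]`. With `A` the
coordinate and `A z` that of a twin, equality of brackets forces `z = 1` or `A²z = -1`, and the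
second is excluded by genericity of twice the parameter. -/
lemma settled_two [Fintype P.Tab] (hP : P.Admissible) (hW : P.Invariant R W) : Settled W 2 := by
  have hi := hP.i_lt
  have hi' := hP.i_pos
  have hX := xx_ne_zero (P := P)
  intro x x' hx j r hr
  by_cases h2 : r = 2 ∧ j = 1
  swap
  · rw [supp_arr x j r (by omega), supp_arr x' j r (by omega)]
  obtain ⟨rfl, rfl⟩ := h2
  have h := Twin.diag (hW 1 le_rfl (by omega)) settled_one.offRow_inj offRow_eq hx
  have hC : ∀ z : P.Tab, P.op R 1 (Finsupp.single z 1) z =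
      Complex.I * br P.hq (P.xx (arr z) 1 2) := fun z => by
    rw [op_apply_self hP, if_neg (by decide), C_eq (by decide), prod_nb 1 le_rfl]
    simp [cols]
  rw [hC, hC] at h
  have h1 := mul_left_cancel₀ Complex.I_ne_zero h
  have hc : P.IsCyc 1 2 := ⟨le_rfl, hi', le_rfl, by omega⟩
  have hs : 2 < P.n := by omega
  obtain ⟨d, hd⟩ : ∃ d, d = arr x' 1 2 - arr x 1 2 := ⟨_, rfl⟩
  have e := xx_sub hs (arr x) (arr x') 1
  rw [← hd] at e
  rw [e] at h1
  refine (isTableau_arr x).eq_of_dvd (isTableau_arr x') le_rfl hi' le_rfl hs ?_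
  rw [← hd, ← hq_zpow_sq_eq_one_iff hP]
  have hA := hX (arr x) 1 2
  have hz := zpow_ne_zero (2 * d) (hq_ne_zero (P := P))
  have hgen := isGen_mul (ξ := arr x) hP hc le_rfl le_rfl hs.le (Or.inl ⟨rfl, hs⟩) (2 * d)
  rw [Ne, br_eq_zero_iff hP (mul_ne_zero (mul_ne_zero hA hA) hz)] at hgen
  generalize P.xx (arr x) 1 2 = A at *
  rw [← zpow_add₀ hq_ne_zero, ← two_mul]
  generalize P.hq ^ (2 * d) = z at *
  have h3 : (A * A * z + 1) * (z - 1) = 0 := by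
    rw [br, br, div_left_inj' (hq_w hP)] at h1
    field_simp at h1
    linear_combination -h1
  rcases mul_eq_zero.1 h3 with h4 | h4
  · exact absurd (by linear_combination (A * A * z - 1) * h4) hgen
  · exact sub_eq_zero.1 h4

/-- There are at least as many nodes, `k` for every cyclic column of row `s`, as unknown roots in
row `s + 1`. In an odd row `r` the first noncyclic coordinate is at least `r - 2(i+1)` and at most
`k - 2`, which bounds the number of noncyclic columns by about `k/2`. -/
lemma card_le_of_low (hP : P.Admissible) (hL : P.Low) (x : P.Tab) (hs : 2 ≤ s) (hn : s + 1 < P.n) :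
    (s + 1) / 2 ≤ min P.i (s / 2) * P.k := by
  have hk := hP.k_ge
  have hi := hP.i_pos
  have h := inter_arr hP x
  rcases le_total P.i (s / 2) with h1 | h1
  · rw [min_eq_left h1]
    have key : ∀ r, r = s ∨ r = s + 1 → r % 2 = 1 → r ≤ P.k + 2 * P.i := by
      intro r hr ho
      by_contra hcon
      have b1 := h.pos_odd (a := P.i + 1) (s := r) (by omega) (by omega) (by omega) ho
      have b2 := (h.bounds hP hL (a := P.i + 1) (s := r) (by omega) (by omega) (by omega)).2.2 ho
      push_cast at b1 b2
      omega
    have h2 : (s + 1) / 2 ≤ P.i + (P.k + 1) / 2 := by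
      rcases Nat.mod_two_eq_zero_or_one s with h0 | h0
      · have := key (s + 1) (Or.inr rfl) (by omega)
        omega
      · have := key s (Or.inl rfl) h0
        omega
    obtain ⟨m, hm⟩ : ∃ m, P.i = m + 1 := ⟨P.i - 1, by omega⟩
    rw [hm] at h2 ⊢
    have h3 : m * 3 ≤ m * P.k := Nat.mul_le_mul_left _ hk
    rw [add_mul, one_mul]
    omega
  · rw [min_eq_right h1]
    have h3 : s / 2 * 3 ≤ s / 2 * P.k := Nat.mul_le_mul_left _ hk
    omega

lemma nodes_injective (hP : P.Admissible) (hs : s < P.n) {a b t u : ℕ}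
    (ha : P.IsCyc a s) (hb : P.IsCyc b s) (ht : t < P.k) (hu : u < P.k)
    (h : yy (P.xx ξ a s * P.hq ^ (2 * (t : ℤ) + 1)) = yy (P.xx ξ b s * P.hq ^ (2 * (u : ℤ) + 1))) :
    a = b ∧ t = u := by
  have hX := xx_ne_zero (P := P) ξ
  have hh := hq_ne_zero (P := P)
  have hz := fun z : ℤ => zpow_ne_zero z hh
  rw [← sub_eq_zero, yy_sub (hq_w hP) (mul_ne_zero (hX _ _) (hz _)) (mul_ne_zero (hX _ _) (hz _)),
    mul_eq_zero, or_iff_right (pow_ne_zero _ (hq_w hP)), mul_eq_zero, mul_mul_mul_comm,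
    ← zpow_add₀ hh, mul_inv, mul_mul_mul_comm, ← zpow_neg, ← zpow_add₀ hh] at h
  rcases h with h | h
  · exact absurd h (isGen_mul hP ha hb.1 hb.2.2.1 hs.le (Or.inl ⟨rfl, hs⟩) _)
  · have hab : a = b := by
      by_contra hab
      exact isGen_div hP ha hb.1 hb.2.2.1 hs.le (Or.inl ⟨rfl, hab, hs⟩) _ h
    subst hab
    refine ⟨rfl, ?_⟩
    rw [mul_inv_cancel₀ (hX _ _), one_mul,
      show 2 * (t : ℤ) + 1 + -(2 * (u : ℤ) + 1) = 2 * ((t : ℤ) - u) by ring] at h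
    have := Int.eq_zero_of_abs_lt_dvd (dvd_of_br_zpow hP h) (abs_lt.2 ⟨by omega, by omega⟩)
    omega

section

variable [Fintype P.Tab] (hP : P.Admissible) (hLM : P.Low ∨ P.IsMinimal) (hR : P.IsRootChoice R)
  (hW : P.Invariant R W) (hS : Settled W s) (hs : 2 ≤ s) (hn : s + 1 < P.n) (hx : Twin W x x')

include hP hLM hR hW hS hs hn hx

lemma Settled.exists_yy_eq (ha : a ∈ cols (s + 1)) :
    ∃ b ∈ cols (s + 1), yy (P.xx (arr x) a (s + 1)) = yy (P.xx (arr x') b (s + 1)) := by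
  classical
  have hcol : ∀ j, j ∈ Icc 1 (min P.i (s / 2)) → j ∈ cols s ∧ P.IsCyc j s := fun j hj => by
    rw [mem_Icc, le_min_iff] at hj
    exact ⟨col_iff.2 ⟨hj.1, by omega⟩, hj.1, hj.2.1, by omega, by omega⟩
  rcases hLM with hL | hM
  · refine exists_eq_of_prod_sub_eq (f := fun a => yy (P.xx (arr x) a (s + 1)))
      (g := fun a => yy (P.xx (arr x') a (s + 1))) (V := (Icc 1 (min P.i (s / 2)) ×ˢ range P.k).image fun p =>
      yy (P.xx (arr x) p.1 s * P.hq ^ (2 * (p.2 : ℤ) + 1))) ?_ ?_ ha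
    · have hcard : #(cols (s + 1)) = (s + 1) / 2 := by rw [cols, Nat.card_Icc]; rfl
      rw [hcard, card_image_of_injOn, card_product, Nat.card_Icc, card_range, Nat.add_sub_cancel]
      · exact card_le_of_low hP hL x hs hn
      · rintro ⟨j, t⟩ h1 ⟨j', t'⟩ h2 h3
        rw [mem_coe, mem_product] at h1 h2
        have := nodes_injective hP (by omega) (hcol _ h1.1).2 (hcol _ h2.1).2
          (mem_range.1 h1.2) (mem_range.1 h2.2) h3
        exact Prod.ext this.1 this.2
    · intro v hv
      obtain ⟨⟨j, t⟩, h1, rfl⟩ := mem_image.1 hv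
      rw [mem_product] at h1
      have h2 := hcol _ h1.1
      exact (hS.prod_eq_rotate hP (Or.inl hL) hR hW h2.1 (by omega) h2.2.2.1 hx t).2
  -- In the minimal case only the first column is unknown. All other factors agree and are nonzero
  -- at the node, so a single value suffices.
  · refine ⟨a, ha, ?_⟩
    have h1 := hM.1
    have ha' := col_iff.1 ha
    have htw : ∀ b, 1 < b → 2 * b ≤ s + 1 → P.xx (arr x) b (s + 1) = P.xx (arr x') b (s + 1) := by
      intro b hb hbs
      rw [xx_tw hP _ (by omega) hbs hn.le, xx_tw hP _ (by omega) hbs hn.le,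
        (inter_arr hP x).tw_minimal hP hM (by omega) hbs hn.le,
        (inter_arr hP x').tw_minimal hP hM (by omega) hbs hn.le]
    by_cases ha1 : a = 1
    · subst ha1
      have h2 := hcol 1 (by rw [mem_Icc, le_min_iff]; omega)
      obtain ⟨h3, h4⟩ := hS.prod_eq_rotate hP (Or.inr hM) hR hW h2.1 (by omega) h2.2.2.1 hx 0
      rw [← mul_prod_erase _ _ ha] at h3
      rw [← mul_prod_erase _ _ ha, ← mul_prod_erase _ _ ha] at h4
      have h5 : ∀ v, ∏ b ∈ (cols (s + 1)).erase 1, (yy (P.xx (arr x) b (s + 1)) - v) =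
          ∏ b ∈ (cols (s + 1)).erase 1, (yy (P.xx (arr x') b (s + 1)) - v) := fun v =>
        prod_congr rfl fun b hb => by
          obtain ⟨hb1, hb2⟩ := mem_erase.1 hb
          have := col_iff.1 hb2
          rw [htw b (by omega) this.2]
      rw [← h5] at h4
      exact sub_left_injective (mul_right_cancel₀ (right_ne_zero_of_mul h3) h4)
    · rw [htw a (by omega) ha'.2]

lemma Settled.eq_of_cyc (ha : 1 ≤ a) (has : 2 * a ≤ s + 1) (hai : a ≤ P.i) :
    arr x a (s + 1) = arr x' a (s + 1) := by
  have hc : P.IsCyc a (s + 1) := ⟨ha, hai, has, hn.le⟩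
  obtain ⟨b, hb, h⟩ := hS.exists_yy_eq hP hLM hR hW hs hn hx (col_iff.2 ⟨ha, has⟩)
  have hb := col_iff.1 hb
  by_cases hab : a = b
  · subst hab
    exact eq_of_yy_cyc hP (isTableau_arr x) (isTableau_arr x') hc hn h
  · exact absurd h (yy_ne_of_cyc hP hc hn hb.1 hb.2 hab)

lemma Settled.exists_abs_eq (hL : P.Low) (ha : P.i < a) (has : a ≤ (s + 1) / 2) :
    ∃ b, P.i < b ∧ b ≤ (s + 1) / 2 ∧ |P.tw (arr x) a (s + 1)| = |P.tw (arr x') b (s + 1)| := by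
  obtain ⟨b, hb, h⟩ := hS.exists_yy_eq hP hLM hR hW hs hn hx (col_iff.2 ⟨by omega, by omega⟩ :
    a ∈ cols (s + 1))
  have hb := col_iff.1 hb
  have hbi : P.i < b := by
    by_contra hbi
    exact yy_ne_of_cyc hP ⟨hb.1, not_lt.1 hbi, hb.2, hn.le⟩ hn (by omega) (by omega) (by omega)
      h.symm
  exact ⟨b, hbi, by omega, abs_tw_eq hP hL (inter_arr hP x) (inter_arr hP x') ha (by omega) hbi
    hb.2 hn h⟩

lemma Settled.abs_tw_eq (ha : P.i < a) (has : 2 * a ≤ s + 1) :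
    |P.tw (arr x) a (s + 1)| = |P.tw (arr x') a (s + 1)| := by
  by_cases hM : P.IsMinimal
  · rw [(inter_arr hP x).tw_minimal hP hM ha has hn.le,
      (inter_arr hP x').tw_minimal hP hM ha has hn.le]
  · have hL := hLM.resolve_right hM
    refine eq_of_strictAnti_image (f := fun a => |P.tw (arr x) a (s + 1)|)
      (g := fun a => |P.tw (arr x') a (s + 1)|) (m := P.i) (p := (s + 1) / 2) ?_ ?_ ?_ ?_ a ha
      (by omega)
    · exact fun a b h1 h2 h3 => (inter_arr hP x).abs_tw_lt h1 h2 (by omega) hn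
    · exact fun a b h1 h2 h3 => (inter_arr hP x').abs_tw_lt h1 h2 (by omega) hn
    · exact fun a h1 h2 => hS.exists_abs_eq hP hLM hR hW hs hn hx hL h1 h2
    · exact fun a h1 h2 => hS.exists_abs_eq hP hLM hR hW hs hn hx.symm hL h1 h2

end

end Omega

namespace Omega

variable {P : Omega} {ξ η : ℕ → ℕ → ℤ} {a b j s r m : ℕ}
  {R : P.Tab → ℕ → ℕ → ℂ} {x x' y y' z : P.Tab} {W : Submodule ℂ P.V}

/-! ### Raising the entries below a row -/

/-- A noncyclic entry below the row `m` is raised. -/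
def UpStep (m : ℕ) (x y : P.Tab) : Prop :=
  ∃ j r, P.i < j ∧ 2 * j ≤ r ∧ r < m ∧ arr y = P.shift (arr x) j r 1

lemma shift_of_lt (hj : P.i < j) : P.shift ξ j r 1 = upd ξ r (j, 1) := by
  funext a s
  simp only [shift, upd, if_neg (not_le.2 hj)]
  by_cases h : a = j ∧ s = r
  · rw [if_pos h, if_pos h, h.1, h.2]
  · rw [if_neg h, if_neg h]

lemma exists_max (x : P.Tab) [Finite P.Tab] (m : ℕ) :
    ∃ y, Relation.ReflTransGen (UpStep m) x y ∧ ∀ z, ¬ UpStep m y z := by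
  obtain ⟨y, hy, hmax⟩ := Set.exists_max_image {y | Relation.ReflTransGen (UpStep m) x y}
    -- The sum of the entries grows by one with each step, so a tableau maximising it cannot be
    -- raised further.
    (fun y => ∑ p ∈ range m ×ˢ range m, arr y p.1 p.2) (Set.toFinite _)
    ⟨x, Relation.ReflTransGen.refl⟩
  refine ⟨y, hy, fun z hz => ?_⟩
  have h1 := hmax z (hy.tail hz)
  obtain ⟨j, r, h2, h3, h4, h5⟩ := hz
  rw [shift_of_lt h2] at h5
  refine absurd h1 (not_le.2 (sum_lt_sum (fun p _ => ?_) ⟨(j, r), ?_, ?_⟩))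
  · rw [h5, upd]
    split_ifs <;> simp
  · rw [mem_product, mem_range, mem_range]
    omega
  · rw [h5]
    simp [upd]

lemma row_eq_of_upStep (h : Relation.ReflTransGen (UpStep m) x y) (a : ℕ) (hr : m ≤ r) :
    arr y a r = arr x a r := by
  induction h with
  | refl => rfl
  | tail _ h ih =>
    obtain ⟨j, r', _, _, h4, h5⟩ := h
    rw [← ih, h5, shift_of_ne (by omega)]

lemma tw_succ (hP : P.Admissible) (h : P.Inter ξ) (ha : P.i < a) (har : 2 * (a + 1) ≤ r)
    (hr : r ≤ P.n) : P.tw ξ (a + 1) r + 2 ≤ P.tw ξ a r := by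
  rcases hr.lt_or_eq with hr | rfl
  · have := h.col ha (by omega : a ≤ a + 1) har hr
    push_cast at this
    omega
  · have := tp_anti hP ha (by omega)
    simp only [tw, if_true]
    push_cast
    omega

lemma Inter.raise (h : P.Inter ξ) (hr : r < P.n) (h1 : P.tw ξ a r + 3 ≤ P.tw ξ a (r + 1))
    (h2 : ∀ b s, P.i < b → b + 1 = a → s + 1 = r → P.tw ξ a r + 3 ≤ P.tw ξ b s) :
    P.Inter (upd ξ r (a, 1)) := by
  refine ⟨fun j s hj hjs hs => ?_, fun j s hj hjs hs => ?_, fun p hp hpn => ?_,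
    fun p hp hpn => ?_⟩
  · have h3 := h.up j s hj hjs hs
    rw [tw_upd hr, tw_upd hr]
    by_cases h4 : j = a ∧ s = r
    · obtain ⟨rfl, rfl⟩ := h4
      simp
      omega
    · simp only [h4, if_false]
      split_ifs <;> omega
  · have h3 := h.down j s hj hjs hs
    rw [tw_upd hr, tw_upd hr]
    by_cases h4 : j + 1 = a ∧ s + 1 = r
    · have h5 := h2 j s hj h4.1 h4.2
      obtain ⟨rfl, rfl⟩ := h4
      simp
      omega
    · simp only [h4, if_false]
      split_ifs <;> omega
  · have h3 := h.even p hp hpn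
    rw [tw_upd hr, tw_upd hr]
    split_ifs <;> omega
  · have h3 := h.odd p hp hpn
    rw [tw_upd hr, tw_upd hr]
    split_ifs <;> omega

/-- If an entry did not touch the one above it, it could be raised: the only other obstruction is
the entry of the preceding column one row below, which by induction is already as high as possible.
-/
lemma tw_of_max (hP : P.Admissible) (hm : m ≤ P.n) (hy : ∀ z, ¬ UpStep m y z) (ha : P.i < a)
    (har : 2 * a ≤ r) (hr : r < m) : P.tw (arr y) a r + 1 = P.tw (arr y) a (r + 1) := by
  have h := inter_arr hP y
  induction a using Nat.strong_induction_on generalizing r with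
  | _ a ih =>
    by_contra hne
    have h1 := h.up a r ha har (by omega)
    have p1 := tw_parity (P := P) (arr y) a r
    have p2 := tw_parity (P := P) (arr y) a (r + 1)
    have hI : P.Inter (upd (arr y) r (a, 1)) := by
      refine h.raise (by omega) (by omega) ?_
      rintro b s hb rfl rfl
      have h2 := ih b (by omega) hb (r := s) (by omega) (by omega)
      have h3 := ih b (by omega) hb (r := s + 1) (by omega) hr
      have h4 := tw_succ hP h hb (r := s + 1 + 1) (by omega) (by omega)
      omega
    obtain ⟨z, hz⟩ := exists_shift hP (col_iff.2 ⟨by omega, har⟩) (by omega) hI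
    exact hy z ⟨a, r, ha, har, hr, hz⟩

/-! ### Separation of the basis vectors -/

lemma Settled.mono {t : ℕ} (hS : Settled W s) (h : t ≤ s) : Settled W t :=
  fun x y hx j r hr => hS x y hx j r (hr.trans h)

lemma br_zpow_ne_zero (hP : P.Admissible) {t : ℤ} (h0 : t ≠ 0) (h1 : t < P.k)
    (h2 : -(P.k : ℤ) < t) : br P.hq (P.hq ^ t) ≠ 0 := by
  rw [Ne, br_zpow_eq_zero_iff hP]
  exact not_dvd_of_abs_lt h0 h1 h2

lemma br_xx_ne_zero (hP : P.Admissible) (hL : P.Low) (h : P.Inter ξ) (ha : 1 ≤ a)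
    (har : 2 * a ≤ r) (hr : r < P.n) (h0 : P.i < a → P.tw ξ a r ≠ 0) :
    br P.hq (P.xx ξ a r) ≠ 0 := by
  by_cases hi : a ≤ P.i
  · exact (isGen_xx hP ⟨ha, hi, har, hr.le⟩).ne
  · rw [xx_tw hP ξ (not_le.1 hi) har hr.le]
    have := h.bounds hP hL (not_le.1 hi) har hr
    exact br_zpow_ne_zero hP (h0 (not_le.1 hi)) (by omega) (by omega)

section

variable [Fintype P.Tab] (hP : P.Admissible) (hLM : P.Low ∨ P.IsMinimal) (hR : P.IsRootChoice R)
  (hW : P.Invariant R W) (hS : Settled W s)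

include hP hLM hR hW hS

lemma Settled.transfer_path (hs : s ≤ P.n) (hx : Twin W x x')
    (hy : Relation.ReflTransGen (UpStep s) x y) :
    ∃ y', Relation.ReflTransGen (UpStep s) x' y' ∧ Twin W y y' := by
  induction hy with
  | refl => exact ⟨x', Relation.ReflTransGen.refl, hx⟩
  | tail _ h ih =>
    obtain ⟨y', h1, h2⟩ := ih
    obtain ⟨j, r, h3, h4, h5, h6⟩ := h
    obtain ⟨z', h7, h8, -⟩ := (hS.mono h5.le).transfer hP hLM hR hW
      (col_iff.2 ⟨by omega, h4⟩) (by omega) h2 h6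
    exact ⟨z', h1.tail ⟨j, r, h3, h4, h5, h7⟩, h8⟩

variable (hs : 2 ≤ s) (hn : s + 1 < P.n)

include hs hn

/-- Apart from the last noncyclic entry of an even row, all noncyclic coordinates are positive and
hence determined by their modulus. -/
lemma Settled.eq_of_ne_last (hx : Twin W x x') (ha : 1 ≤ a) (has : 2 * a ≤ s + 1)
    (hl : a ≤ P.i ∨ 2 * a ≠ s + 1) : arr x a (s + 1) = arr x' a (s + 1) := by
  by_cases hi : a ≤ P.i
  · exact hS.eq_of_cyc hP hLM hR hW hs hn hx ha has hi
  · have hpos : ∀ z : P.Tab, 0 < P.tw (arr z) a (s + 1) := by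
      intro z
      have h := inter_arr hP z
      rcases Nat.mod_two_eq_zero_or_one (s + 1) with h0 | h0
      · have h1 := h.add_pos (s := s + 1) (not_le.1 hi) (by omega : a < a + 1) (by omega) hn
        have h2 := h.col (s := s + 1) (not_le.1 hi) (by omega : a ≤ a + 1) (by omega) hn
        push_cast at h1 h2
        omega
      · have := h.pos_odd (not_le.1 hi) has hn h0
        push_cast at this
        omega
    have h := hS.abs_tw_eq hP hLM hR hW hs hn hx (not_le.1 hi) has
    rw [abs_of_pos (hpos x), abs_of_pos (hpos x')] at h
    exact eq_of_tw_eq hn h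

/-- A change of sign of the last coordinate changes the sign of the diagonal coefficient of row `s`,
whereas twins have equal diagonal coefficients. The contradiction requires this coefficient to be
nonzero, which can be arranged by raising the rows below. -/
lemma Settled.eq_of_last (hx : Twin W x x') (hi : P.i < a) (has : 2 * a = s + 1) :
    P.tw (arr x) a (s + 1) = P.tw (arr x') a (s + 1) := by
  by_cases hM : P.IsMinimal
  · rw [(inter_arr hP x).tw_minimal hP hM hi has.le hn.le,
      (inter_arr hP x').tw_minimal hP hM hi has.le hn.le]
  have hL := hLM.resolve_right hM
  by_contra hne
  have habs := hS.abs_tw_eq hP hLM hR hW hs hn hx hi has.le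
  have hneg : P.tw (arr x') a (s + 1) = -P.tw (arr x) a (s + 1) := by
    rcases abs_eq_abs.1 habs with h | h
    · exact absurd h hne
    · omega
  -- Raising all noncyclic entries below row `s` removes possible zeros in row `s - 1`; rows `s` and
  -- above, and the twin relation, are preserved.
  obtain ⟨y, hxy, hmax⟩ := exists_max x s
  obtain ⟨y', hxy', hy⟩ := hS.transfer_path hP hLM hR hW (by omega) hx hxy
  have h := inter_arr hP y
  have e1 : P.tw (arr y) a (s + 1) = P.tw (arr x) a (s + 1) := by
    simp only [tw, row_eq_of_upStep hxy a (by omega : s ≤ s + 1)]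
  have e2 : P.tw (arr y') a (s + 1) = -P.tw (arr y) a (s + 1) := by
    rw [e1, ← hneg]
    simp only [tw, row_eq_of_upStep hxy' a (by omega : s ≤ s + 1)]
  have ht : P.tw (arr y) a (s + 1) ≠ 0 := by omega
  have hs' : ¬ Even s := by rw [Nat.not_even_iff]; omega
  have ha : a ∈ cols (s + 1) := col_iff.2 ⟨by omega, has.le⟩
  have hCC := Twin.diag (hW s (by omega) (by omega)) hS.offRow_inj offRow_eq hy
  rw [op_apply_self hP, op_apply_self hP, if_neg hs', if_neg hs'] at hCC
  have hC := mul_left_cancel₀ Complex.I_ne_zero hCC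
  have hC' : P.C (arr y') ((s + 1) / 2) = -P.C (arr y) ((s + 1) / 2) := by
    rw [C_eq hs', C_eq hs', prod_nb s (by omega), prod_nb s (by omega), ← mul_prod_erase _ _ ha,
      ← mul_prod_erase _ _ ha]
    have f1 : ∀ b, P.xx (arr y') b s = P.xx (arr y) b s := fun b =>
      xx_congr (hS y y' hy b s le_rfl).symm
    have f2 : ∀ b, P.xx (arr y') b (s - 1) = P.xx (arr y) b (s - 1) := fun b =>
      xx_congr (hS y y' hy b (s - 1) (by omega)).symm
    have f3 : ∏ b ∈ (cols (s + 1)).erase a, br P.hq (P.xx (arr y') b (s + 1)) =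
        ∏ b ∈ (cols (s + 1)).erase a, br P.hq (P.xx (arr y) b (s + 1)) :=
      prod_congr rfl fun b hb => by
        obtain ⟨hba, hb⟩ := mem_erase.1 hb
        have hb := col_iff.1 hb
        rw [xx_congr (hS.eq_of_ne_last hP hLM hR hW hs hn hy hb.1 hb.2 (by omega)).symm]
    have f4 : br P.hq (P.xx (arr y') a (s + 1)) = -br P.hq (P.xx (arr y) a (s + 1)) := by
      rw [xx_tw hP _ hi has.le hn.le, xx_tw hP _ hi has.le hn.le, e2, zpow_neg, br_inv]
    simp only [f1, f2, f3, f4]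
    ring
  have h0 : P.C (arr y) ((s + 1) / 2) = 0 := by
    have := hC.trans hC'
    exact CharZero.eq_neg_self_iff.1 this
  -- The last coordinate of row `s + 1` is a nonzero `t`, and interlacing forces those of row `s` to
  -- be at least `1 + |t|`.
  have hrow : ∀ b, P.i < b → 2 * b ≤ s → 2 ≤ P.tw (arr y) b s := by
    intro b hb hbs
    have h1 := h.down (a - 1) s (by omega) (by omega) (by omega)
    have h2 := h.even (a - 1) (by omega) (by omega)
    have h3 := h.col hb (by omega : b ≤ a - 1) (by omega) (by omega : s < P.n)
    rw [show a - 1 + 1 = a by omega] at h1 h2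
    rw [show 2 * (a - 1) + 2 = s + 1 by omega, show 2 * (a - 1) + 1 = s by omega] at h2
    omega
  refine absurd h0 ?_
  rw [C_eq hs', prod_nb s (by omega)]
  refine div_ne_zero (mul_ne_zero (prod_ne_zero_iff.2 fun b hb => ?_)
    (prod_ne_zero_iff.2 fun b hb => ?_)) (prod_ne_zero_iff.2 fun b hb => ?_)
  · have hb := col_iff.1 hb
    refine br_xx_ne_zero hP hL h hb.1 hb.2 hn fun hbi => ?_
    change P.tw (arr y) b (s + 1) ≠ 0
    rcases eq_or_ne b a with rfl | hba
    · exact ht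
    · have := h.up b s hbi (by omega) (by omega)
      have := hrow b hbi (by omega)
      omega
  · have hb := col_iff.1 hb
    refine br_xx_ne_zero hP hL h hb.1 hb.2 (by omega) fun hbi => ?_
    change P.tw (arr y) b (s - 1) ≠ 0
    have h1 := tw_of_max (a := b) (r := s - 1) hP (by omega) hmax hbi hb.2 (by omega)
    rw [show s - 1 + 1 = s by omega] at h1
    have := hrow b hbi (by omega)
    omega
  · have hb := col_iff.1 hb
    have hh := hq_ne_zero (P := P)
    by_cases hbi : b ≤ P.i
    · have hc := isGen_xx (ξ := arr y) hP (⟨hb.1, hbi, hb.2, by omega⟩ : P.IsCyc b s)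
      have h1 := hc 1
      have h2 := hc (-1)
      rw [zpow_one] at h1
      rw [zpow_neg_one] at h2
      exact mul_ne_zero h1 h2
    · have h1 := hrow b (not_le.1 hbi) hb.2
      have h2 := (h.bounds hP hL (not_le.1 hbi) hb.2 (by omega)).2.2 (by omega)
      rw [xx_tw hP _ (not_le.1 hbi) hb.2 (by omega), ← zpow_add_one₀ hh, ← zpow_sub_one₀ hh]
      exact mul_ne_zero (br_zpow_ne_zero hP (by omega) (by omega) (by omega))
        (br_zpow_ne_zero hP (by omega) (by omega) (by omega))

lemma Settled.succ : Settled W (s + 1) := by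
  intro x x' hx j r hr
  by_cases hrs : r ≤ s
  · exact hS x x' hx j r hrs
  obtain rfl : r = s + 1 := by omega
  by_cases hj : 1 ≤ j ∧ 2 * j ≤ s + 1
  · by_cases hl : j ≤ P.i ∨ 2 * j ≠ s + 1
    · exact hS.eq_of_ne_last hP hLM hR hW hs hn hx hj.1 hj.2 hl
    · exact eq_of_tw_eq hn (hS.eq_of_last hP hLM hR hW hs hn hx (by omega) (by omega))
  · rw [supp_arr x j _ (by omega), supp_arr x' j _ (by omega)]

end

lemma twin_eq [Fintype P.Tab] (hP : P.Admissible) (hLM : P.Low ∨ P.IsMinimal)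
    (hR : P.IsRootChoice R) (hW : P.Invariant R W) (x y : P.Tab) (h : Twin W x y) : x = y := by
  have hall : ∀ s, 2 ≤ s → s < P.n → Settled W s := by
    intro s hs
    induction s, hs using Nat.le_induction with
    | base => exact fun _ => settled_two hP hW
    | succ s hs ih => exact fun hn => (ih (by omega)).succ hP hLM hR hW hs hn
  refine arr_injective ?_
  funext j s
  by_cases hs : s < P.n
  · have := hP.i_lt
    have := hP.i_pos
    exact hall (max s 2) (le_max_right _ _) (by omega) x y h j s (le_max_left _ _)
  · rw [supp_arr x j s (by omega), supp_arr y j s (by omega)]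

/-! ### Irreducibility -/

section

variable (hP : P.Admissible) (hLM : P.Low ∨ P.IsMinimal) (hR : P.IsRootChoice R)
  (hW : P.Invariant R W) (hT : ∀ x y : P.Tab, Twin W x y → x = y)

include hP hLM hR hW hT

lemma single_mem_iff [Fintype P.Tab] (hj : j ∈ cols s) (hn : s < P.n)
    (hy : arr y = P.shift (arr x) j s 1) :
    Finsupp.single x 1 ∈ W ↔ Finsupp.single y 1 ∈ W := by
  have hj' := col_iff.1 hj
  constructor
  · intro h
    exact single_mem_of_ne hT (hW s (by omega) hn _ h) (op_up_ne_zero hP hLM hR hj hn hy)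
  · intro h
    exact single_mem_of_ne hT (hW s (by omega) hn _ h) (op_down_ne_zero hP hLM hR hj hn hy)

lemma single_mem_iff_of_path [Fintype P.Tab] (h : Relation.ReflTransGen (UpStep P.n) x y) :
    Finsupp.single x 1 ∈ W ↔ Finsupp.single y 1 ∈ W := by
  induction h with
  | refl => rfl
  | tail _ h ih =>
    obtain ⟨j, r, h3, h4, h5, h6⟩ := h
    rw [ih]
    exact single_mem_iff hP hLM hR hW hT (col_iff.2 ⟨by omega, h4⟩) h5 h6

lemma single_mem_rotate [Fintype P.Tab] (hj : j ∈ cols s) (hn : s < P.n) (hi : j ≤ P.i)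
    (hx : Finsupp.single x 1 ∈ W) (e : ℕ) (hy : arr y = P.red (upd (arr x) s (j, e))) :
    Finsupp.single y 1 ∈ W := by
  induction e generalizing y with
  | zero =>
    rw [Nat.cast_zero, upd_zero, (isTableau_arr x).red_eq] at hy
    rwa [arr_injective hy]
  | succ e ih =>
    obtain ⟨z, hz⟩ := exists_rotate hP hj hn hi x e
    push_cast at hy
    exact (single_mem_iff hP hLM hR hW hT hj hn (rotate_succ hz hy)).1 (ih hz)

lemma single_mem_of_cyc [Fintype P.Tab] (F : Finset (ℕ × ℕ)) (hx : Finsupp.single x 1 ∈ W)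
    (hF : ∀ p ∈ F, p.1 ≤ P.i ∧ p.1 ∈ cols p.2 ∧ p.2 < P.n)
    (hy : ∀ p ∉ F, arr x p.1 p.2 = arr y p.1 p.2) : Finsupp.single y 1 ∈ W := by
  induction F using Finset.induction_on generalizing x with
  | empty =>
    have : x = y := arr_injective (by
      funext j s
      exact hy (j, s) (notMem_empty _))
    rwa [← this]
  | insert p F hp ih =>
    obtain ⟨h1, h2, h3⟩ := hF p (mem_insert_self _ _)
    have h2' := col_iff.1 h2
    have hk : (0 : ℤ) < P.k := by have := hP.k_ge; omega
    obtain ⟨e, he⟩ : ∃ e : ℕ, (e : ℤ) = (arr y p.1 p.2 - arr x p.1 p.2) % P.k :=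
      ⟨_, Int.toNat_of_nonneg (Int.emod_nonneg _ hk.ne')⟩
    obtain ⟨z, hz⟩ := exists_rotate hP h2 h3 h1 x e
    refine ih (single_mem_rotate hP hLM hR hW hT h2 h3 h1 hx e hz)
      (fun q hq => hF q (mem_insert_of_mem hq)) fun q hq => ?_
    by_cases hqp : q = p
    · subst hqp
      rw [hz]
      simp only [red, upd, and_self, if_true, if_pos h1, he]
      rw [Int.add_emod_emod, add_sub_cancel]
      have := (isTableau_arr y).cyc q.1 q.2 h2'.1 h1 h2'.2 h3
      exact Int.emod_eq_of_lt this.1 this.2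
    · rw [← hy q (fun h => (mem_insert.1 h).elim hqp hq), hz]
      have hne : ¬(q.1 = p.1 ∧ q.2 = p.2) := fun h => hqp (Prod.ext h.1 h.2)
      have h4 := congr_fun (congr_fun (isTableau_arr x).red_eq q.1) q.2
      simp only [red, upd, if_neg hne] at h4 ⊢
      exact h4

/-- Any two tableaux are connected by moves with nonzero matrix entries in both directions: raise
the noncyclic entries of both to the unique maximal configuration, then rotate the cyclic entries
into each other. -/
lemma single_mem [Fintype P.Tab] (hx : Finsupp.single x 1 ∈ W) (y : P.Tab) :
    Finsupp.single y 1 ∈ W := by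
  obtain ⟨x₁, hx₁, hm⟩ := exists_max x P.n
  obtain ⟨y₁, hy₁, hm'⟩ := exists_max y P.n
  rw [single_mem_iff_of_path hP hLM hR hW hT hy₁]
  rw [single_mem_iff_of_path hP hLM hR hW hT hx₁] at hx
  refine single_mem_of_cyc hP hLM hR hW hT ((range (P.n + 1) ×ˢ range (P.n + 1)).filter fun p =>
    p.1 ≤ P.i ∧ p.1 ∈ cols p.2 ∧ p.2 < P.n) hx (fun p hp => (mem_filter.1 hp).2) fun p hp => ?_
  by_cases hs : 1 ≤ p.1 ∧ 2 * p.1 ≤ p.2 ∧ p.2 < P.n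
  swap
  · rw [supp_arr x₁ _ _ hs, supp_arr y₁ _ _ hs]
  by_cases hi : p.1 ≤ P.i
  · refine absurd (mem_filter.2 ⟨?_, hi, col_iff.2 ⟨hs.1, hs.2.1⟩, hs.2.2⟩) hp
    rw [mem_product, mem_range, mem_range]
    omega
  · have key : ∀ (u : P.Tab), (∀ z, ¬ UpStep P.n u z) → ∀ d r, 2 * p.1 ≤ r → r + d = P.n →
        P.tw (arr u) p.1 r + d = P.tw (fun _ _ => 0) p.1 P.n := by
      intro u hu d
      induction d with
      | zero =>
        intro r _ h2
        obtain rfl : r = P.n := by omega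
        rw [tw_n]; simp
      | succ d ih =>
        intro r h1 h2
        have h3 := ih (r + 1) (by omega) (by omega)
        have h4 := tw_of_max hP le_rfl hu (not_le.1 hi) h1 (by omega)
        push_cast
        omega
    have h1 := key x₁ hm (P.n - p.2) p.2 hs.2.1 (by omega)
    have h2 := key y₁ hm' (P.n - p.2) p.2 hs.2.1 (by omega)
    exact eq_of_tw_eq hs.2.2 (by omega)

end

theorem isIrreducibleRep (hP : P.Admissible) (hLM : P.Low ∨ P.IsMinimal) (hR : P.IsRootChoice R)
    {T : Uq P.q P.n →ₐ[ℂ] Module.End ℂ P.V} (hT : P.IsRep R T) : IsIrreducibleRep T := by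
  have := finite_tab hP
  have := Fintype.ofFinite P.Tab
  have := nonempty_tab hP
  refine ⟨inferInstance, fun W hW => ?_⟩
  have hI : P.Invariant R W := by
    intro s h1 h2 w hw
    have := hW (gen P.q P.n ⟨s - 1, by omega⟩) w hw
    rw [hT] at this
    simpa only [Nat.sub_add_cancel h1] using this
  have htw := twin_eq hP hLM hR hI
  rcases eq_or_ne W ⊥ with h | h
  · exact Or.inl h
  · right
    obtain ⟨w, hw, hw0⟩ := W.ne_bot_iff.1 h
    obtain ⟨x, hx⟩ := Finsupp.ne_iff.1 hw0
    have hx1 := single_mem_of_ne htw hw hx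
    refine eq_top_iff.2 fun v _ => ?_
    rw [← Finsupp.sum_single v]
    refine W.sum_mem fun y _ => ?_
    have := W.smul_mem (v y) (single_mem hP hLM hR hI htw hx1 y)
    rwa [Finsupp.smul_single, smul_eq_mul, mul_one] at this

end Omega

namespace Omega

variable {P : Omega} {ξ η : ℕ → ℕ → ℤ} {a b j s r : ℕ} {R : P.Tab → ℕ → ℕ → ℂ} {x y z : P.Tab}

/-! ### Representations of minimal dimension -/

lemma numParams_of_minimal (hP : P.Admissible) (hM : P.IsMinimal) : P.numParams = 2 * P.n - 3 := by
  have hi := hP.i_lt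
  have h1 := hM.1
  have h : ∀ s ∈ Icc 2 (P.n - 1), #(Icc 1 (min P.i (s / 2))) = 1 := fun s hs => by
    rw [mem_Icc] at hs
    rw [h1, Nat.card_Icc, min_eq_left (by omega)]
  rw [numParams, card_sigma, sum_congr rfl h, sum_const, Nat.card_Icc, h1, smul_eq_mul]
  omega

lemma Inter.congr (h : ∀ a r, P.i < a → P.tw ξ a r = P.tw η a r) (hξ : P.Inter ξ) : P.Inter η := by
  obtain ⟨h1, h2, h3, h4⟩ := hξ
  refine ⟨fun a r ha => ?_, fun a r ha => ?_, fun r hr => ?_, fun r hr => ?_⟩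
  · rw [← h _ _ ha, ← h _ _ ha]; exact h1 a r ha
  · rw [← h _ _ ha, ← h _ _ (by omega)]; exact h2 a r ha
  · rw [← h _ _ hr, ← h _ _ (by omega)]; exact h3 r hr
  · rw [← h _ _ hr, ← h _ _ hr]; exact h4 r hr

/-- The noncyclic entries are frozen, which leaves one entry with `k` values in each of the rows `2,
…, n - 1`. -/
lemma finrank_of_minimal (hP : P.Admissible) (hM : P.IsMinimal) :
    Module.finrank ℂ P.V = P.k ^ (P.n - 2) := by
  have hi := hP.i_lt
  have h1 := hM.1
  have hb : ∀ (x : P.Tab) (t : Fin (P.n - 2)),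
      0 ≤ arr x 1 (t + 2) ∧ arr x 1 (t + 2) < P.k := fun x t =>
    (isTableau_arr x).cyc 1 (t + 2) le_rfl h1.ge (by omega) (by omega)
  let F : P.Tab → Fin (P.n - 2) → Fin P.k := fun x t =>
    ⟨(arr x 1 (t + 2)).toNat, by have := hb x t; omega⟩
  have hF : Function.Bijective F := by
    constructor
    · intro x y hxy
      refine arr_injective ?_
      funext j s
      by_cases hs : 1 ≤ j ∧ 2 * j ≤ s ∧ s < P.n
      swap
      · rw [supp_arr x j s hs, supp_arr y j s hs]
      rcases eq_or_ne j 1 with rfl | hj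
      · have h2 := congr_arg Fin.val (congr_fun hxy ⟨s - 2, by omega⟩)
        have h3 := hb x ⟨s - 2, by omega⟩
        have h4 := hb y ⟨s - 2, by omega⟩
        simp only [F, Nat.sub_add_cancel hs.2.1] at h2 h3 h4
        omega
      · refine eq_of_tw_eq hs.2.2 ?_
        rw [(inter_arr hP x).tw_minimal hP hM (by omega) hs.2.1 hs.2.2.le,
          (inter_arr hP y).tw_minimal hP hM (by omega) hs.2.1 hs.2.2.le]
    · intro f
      obtain ⟨x⟩ := nonempty_tab hP
      obtain ⟨ξ, hξ⟩ : ∃ ξ : ℕ → ℕ → ℤ, ξ = fun j s =>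
          if h : j = 1 ∧ 2 ≤ s ∧ s < P.n then ((f ⟨s - 2, by omega⟩ : ℕ) : ℤ) else arr x j s :=
        ⟨_, rfl⟩
      have hT : P.IsTableau ξ := by
        refine (isTableau_iff hP).2 ⟨fun j s hs => ?_, fun j s h2 h3 h4 h5 => ?_, ?_⟩
        · rw [hξ]
          simp only
          rw [dif_neg (by omega), supp_arr x j s hs]
        · rw [hξ]
          simp only
          rw [dif_pos (by omega)]
          have := (f ⟨s - 2, by omega⟩).2
          omega
        · refine (inter_arr hP x).congr fun a r ha => ?_
          have : ¬(a = 1 ∧ 2 ≤ r ∧ r < P.n) := by omega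
          simp only [tw, hξ, dif_neg this]
      refine ⟨tab ξ hT, ?_⟩
      funext t
      ext
      simp only [F, arr_tab, hξ]
      rw [dif_pos ⟨trivial, by omega⟩, Int.toNat_natCast]
      rfl
  have := finite_tab hP
  rw [Module.finrank_eq_nat_card_basis (Finsupp.basisSingleOne (R := ℂ) (ι := P.Tab)),
    Nat.card_congr (Equiv.ofBijective F hF), Nat.card_fun]
  simp

section

variable (hP : P.Admissible) (hM : P.IsMinimal)

include hP hM

lemma ket_eq_zero_of_minimal {e : ℤ} (he : e = 1 ∨ e = -1) (hj : 2 ≤ j) (hjs : 2 * j ≤ s)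
    (hn : s < P.n) (f : P.Tab → ℂ) : P.ket (P.shift (arr x) j s e) f = 0 := by
  have h1 := hM.1
  refine ket_neg _ fun h => ?_
  have h2 := (((isTableau_iff hP).1 h).2.2).tw_minimal hP hM (by omega : P.i < j) hjs hn.le
  have h3 := (inter_arr hP x).tw_minimal hP hM (by omega : P.i < j) hjs hn.le
  have hne : s ≠ P.n := hn.ne
  simp only [tw, if_neg hne, shift, and_self, if_true, if_neg (by omega : ¬ j ≤ P.i)] at h2 h3
  omega

lemma C_of_minimal (hs : 3 ≤ s) (hn : s < P.n) (ho : ¬ Even s) :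
    P.C (arr x) ((s + 1) / 2) = 0 := by
  have h1 := hM.1
  have ho' := Nat.not_even_iff.1 ho
  rw [C_eq ho, prod_nb s (by omega),
    prod_eq_zero (i := (s + 1) / 2) (col_iff.2 ⟨by omega, by omega⟩), zero_mul, zero_div]
  change br P.hq (P.xx (arr x) ((s + 1) / 2) (s + 1)) = 0
  rw [xx_tw hP _ (by omega) (by omega) (by omega),
    (inter_arr hP x).tw_minimal hP hM (by omega) (by omega) (by omega),
    show ((s + 1 : ℕ) : ℤ) - 2 * ((s + 1) / 2 : ℕ) = 0 by omega, zpow_zero, br_one]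

lemma act_of_minimal (hs : 2 ≤ s) (hn : s < P.n) : P.act R s x =
    P.ket (P.shift (arr x) 1 s 1) (fun _ => P.c 1 s * R x 1 s / P.denUp (arr x) 1 s) -
      P.ket (P.shift (arr x) 1 s (-1)) (fun η => (P.c 1 s)⁻¹ * R η 1 s / P.denDown (arr x) 1 s) := by
  have h1 := hM.1
  rw [act_apply, sum_eq_single_of_mem 1 (col_iff.2 ⟨le_rfl, by omega⟩)]
  · simp only [cc, if_pos h1.ge]
    split_ifs with he
    · rw [add_zero]
    · rw [C_of_minimal hP hM (by have := Nat.not_even_iff.1 he; omega) hn he, mul_zero,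
        Finsupp.single_zero, add_zero]
  · intro j hj hj1
    have hj := col_iff.1 hj
    rw [ket_eq_zero_of_minimal hP hM (by simp) (by omega) hj.2 hn,
      ket_eq_zero_of_minimal hP hM (by simp) (by omega) hj.2 hn, sub_zero]

end

lemma act_one :
    P.act R 1 x = Finsupp.single x (Complex.I * P.qn (P.mm (arr x) 2)) := by
  have e : P.C (arr x) ((1 + 1) / 2) = P.qn (P.mm (arr x) 2) := by
    rw [C_eq (by decide), prod_nb 1 le_rfl, qn_eq, mm, if_neg (by decide)]
    simp only [cols, Nat.reduceAdd, Nat.reduceDiv, Icc_self, prod_singleton, Nat.sub_self,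
      Nat.zero_div, Icc_eq_empty_of_lt Nat.zero_lt_one, prod_empty, mul_one, div_one, xx]
    congr 2
    norm_num
  rw [act_apply, e, if_neg (by decide), cols, Icc_eq_empty_of_lt (by decide), sum_empty, zero_add]

variable (P) in
/-- The factor of a product of brackets over the columns of a row. -/
def fac (A : ℂ) (t : ℤ) : ℂ := br P.hq (P.hq ^ t * A) * br P.hq (P.hq ^ t * A⁻¹)

/-- The frozen columns of the rows `s ± 1` cancel against the denominators of row `s` column by
column. For even `s` row `s - 1` has one column too few, for odd `s` row `s + 1` has one too many,
and this leaves the boundary factor. -/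
lemma prod_cancel {F : ℤ → ℂ} (hF : ∀ t, F t ≠ 0) (s : ℕ) (hs : 3 ≤ s) :
    (∏ a ∈ (cols (s + 1)).erase 1, F ((s + 1 : ℕ) - 2 * a)) *
      (∏ a ∈ (cols (s - 1)).erase 1, F ((s - 1 : ℕ) - 2 * a)) /
        ∏ b ∈ (cols s).erase 1, F (s - 2 * b + 1) * F (s - 2 * b - 1) =
      if Even s then (F (-1))⁻¹ else F 0 := by
  have he : ∀ r, (cols r).erase 1 = Icc 2 (r / 2) := fun r => by
    ext a
    simp only [cols, mem_erase, mem_Icc]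
    omega
  rw [he, he, he, prod_mul_distrib]
  have h1 : ∀ m : ℕ, ∏ a ∈ Icc 2 m, F ((s + 1 : ℕ) - 2 * a) = ∏ a ∈ Icc 2 m, F (s - 2 * a + 1) :=
    fun m => prod_congr rfl fun a _ => by
      congr 1; push_cast; ring
  have h2 : ∀ m : ℕ, ∏ a ∈ Icc 2 m, F ((s - 1 : ℕ) - 2 * a) = ∏ a ∈ Icc 2 m, F (s - 2 * a - 1) :=
    fun m => prod_congr rfl fun a _ => by
      rw [Nat.cast_sub (by omega)]
      congr 1; push_cast; ring
  have hne : ∀ (m : ℕ) (e : ℤ), ∏ a ∈ Icc 2 m, F (s - 2 * a + e) ≠ 0 := fun m e =>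
    prod_ne_zero_iff.2 fun a _ => hF _
  have hne' : ∀ m : ℕ, ∏ a ∈ Icc 2 m, F (s - 2 * a - 1) ≠ 0 := fun m =>
    prod_ne_zero_iff.2 fun a _ => hF _
  rw [h1, h2]
  split_ifs with hs2
  · obtain ⟨p, rfl⟩ : ∃ p, s = 2 * (p + 1) := ⟨s / 2 - 1, by
      obtain ⟨m, rfl⟩ := hs2
      omega⟩
    rw [show (2 * (p + 1) + 1) / 2 = p + 1 by omega, show (2 * (p + 1) - 1) / 2 = p by omega,
      show 2 * (p + 1) / 2 = p + 1 by omega]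
    rw [prod_Icc_succ_top (by omega) fun a : ℕ => F (((2 * (p + 1) : ℕ) : ℤ) - 2 * a - 1)]
    have h3 : F (((2 * (p + 1) : ℕ) : ℤ) - 2 * ((p + 1 : ℕ) : ℤ) - 1) = F (-1) := by
      congr 1; push_cast; ring
    have := hne (p + 1) 1
    have := hne' p
    have := hF (-1)
    rw [h3]
    field_simp
  · obtain ⟨p, rfl⟩ := Nat.not_even_iff_odd.1 hs2
    rw [show (2 * p + 1 + 1) / 2 = p + 1 by omega, show (2 * p + 1 - 1) / 2 = p by omega,
      show (2 * p + 1) / 2 = p by omega]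
    rw [prod_Icc_succ_top (by omega) fun a : ℕ => F (((2 * p + 1 : ℕ) : ℤ) - 2 * a + 1)]
    have h3 : F (((2 * p + 1 : ℕ) : ℤ) - 2 * ((p + 1 : ℕ) : ℤ) + 1) = F 0 := by
      congr 1; push_cast; ring
    have := hne p 1
    have := hne' p
    rw [h3]
    field_simp

end Omega

namespace Omega

variable {P : Omega} {ξ η : ℕ → ℕ → ℤ} {a b j s r : ℕ} {R : P.Tab → ℕ → ℕ → ℂ} {x y z : P.Tab}

lemma br_mul_add {h A : ℂ} (hA : A ≠ 0) : br h (A * A) = br h A * (A + A⁻¹) := by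
  rw [br, br, div_mul_eq_mul_div]
  congr 1
  field_simp
  ring

lemma rad_of_minimal (hP : P.Admissible) (hM : P.IsMinimal) (hs : 2 ≤ s) (hn : s < P.n)
    (x : P.Tab) : P.rad (arr x) 1 s =
      br P.hq (P.xx (arr x) 1 (s + 1) * (P.xx (arr x) 1 s * P.hq)) *
        br P.hq (P.xx (arr x) 1 (s + 1) * (P.xx (arr x) 1 s * P.hq)⁻¹) *
      if s = 2 then 1 else
        br P.hq (P.xx (arr x) 1 (s - 1) * (P.xx (arr x) 1 s * P.hq)) *
          br P.hq (P.xx (arr x) 1 (s - 1) * (P.xx (arr x) 1 s * P.hq)⁻¹) *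
        if Even s then (P.fac (P.xx (arr x) 1 s * P.hq) (-1))⁻¹
        else P.fac (P.xx (arr x) 1 s * P.hq) 0 := by
  have h1 := hM.1
  have hh := hq_ne_zero (P := P)
  rw [rad_eq (by omega), prod_nb s (by omega)]
  by_cases h2 : s = 2
  · subst h2
    simp [cols]
  · rw [if_neg h2]
    simp only
    have hA := xx_ne_zero (P := P) (arr x) 1 s
    have hgen := isGen_xx (ξ := arr x) hP (⟨le_rfl, h1.ge, hs, hn.le⟩ : P.IsCyc 1 s)
    have htw : ∀ a r, 2 ≤ a → 2 * a ≤ r → r ≤ P.n → P.xx (arr x) a r = P.hq ^ ((r : ℤ) - 2 * a) := by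
      intro a r ha har hr
      rw [xx_tw hP _ (by omega) har hr, (inter_arr hP x).tw_minimal hP hM (by omega) har hr]
    generalize P.xx (arr x) 1 s = A at *
    have hF : ∀ t, P.fac (A * P.hq) t ≠ 0 := by
      intro t
      rw [fac, show P.hq ^ t * (A * P.hq) = A * P.hq ^ (t + 1) by rw [zpow_add_one₀ hh]; ring,
        show P.hq ^ t * (A * P.hq)⁻¹ = A⁻¹ * P.hq ^ (t - 1) by
          rw [zpow_sub_one₀ hh, mul_inv]; ring]
      exact mul_ne_zero (hgen _) (hgen.inv _)
    rw [← prod_cancel hF s (by omega), ← mul_prod_erase _ _ (col_iff.2 (by omega) : 1 ∈ cols (s + 1)),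
      ← mul_prod_erase _ _ (col_iff.2 (by omega) : 1 ∈ cols (s - 1))]
    have e1 : ∀ r, r ≤ P.n → ∏ a ∈ (cols r).erase 1, (br P.hq (P.xx (arr x) a r * (A * P.hq)) *
        br P.hq (P.xx (arr x) a r * (A * P.hq)⁻¹)) =
          ∏ a ∈ (cols r).erase 1, P.fac (A * P.hq) (r - 2 * a) := fun r hr =>
      prod_congr rfl fun a ha => by
        obtain ⟨ha1, ha2⟩ := mem_erase.1 ha
        have ha2 := col_iff.1 ha2
        rw [htw a r (by omega) ha2.2 hr, fac]
    have e2 : ∏ b ∈ (cols s).erase 1, (br P.hq (P.xx (arr x) b s * A) *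
        br P.hq (P.xx (arr x) b s * A⁻¹) * br P.hq (P.xx (arr x) b s * A * P.hq ^ 2) *
        br P.hq (P.xx (arr x) b s * A⁻¹ * (P.hq ^ 2)⁻¹)) =
        ∏ b ∈ (cols s).erase 1, P.fac (A * P.hq) (s - 2 * b + 1) *
          P.fac (A * P.hq) (s - 2 * b - 1) := prod_congr rfl fun b hb => by
      obtain ⟨hb1, hb2⟩ := mem_erase.1 hb
      have hb2 := col_iff.1 hb2
      rw [htw b s (by omega) hb2.2 hn.le, fac, fac, zpow_add_one₀ hh, zpow_sub_one₀ hh]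
      generalize P.hq ^ ((s : ℤ) - 2 * b) = t
      rw [show t * P.hq * (A * P.hq) = t * A * P.hq ^ 2 by ring,
        show t * P.hq * (A * P.hq)⁻¹ = t * A⁻¹ by field_simp,
        show t * P.hq⁻¹ * (A * P.hq) = t * A by field_simp,
        show t * P.hq⁻¹ * (A * P.hq)⁻¹ = t * A⁻¹ * (P.hq ^ 2)⁻¹ by field_simp]
      ring
    rw [e1 _ (by omega), e1 _ (by omega), e2]
    ring

lemma radMin_eq (hs : 2 ≤ s) : P.radMin ξ s =
    br P.hq (P.xx ξ 1 (s + 1) * (P.xx ξ 1 s * P.hq)) *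
      br P.hq (P.xx ξ 1 (s + 1) * (P.xx ξ 1 s * P.hq)⁻¹) *
      (if s = 2 then br P.hq (P.xx ξ 1 s) * br P.hq (P.xx ξ 1 s * P.hq ^ 2) else
        -(br P.hq (P.xx ξ 1 (s - 1) * (P.xx ξ 1 s * P.hq)) *
          br P.hq (P.xx ξ 1 (s - 1) * (P.xx ξ 1 s * P.hq)⁻¹))) /
      (br P.hq (P.xx ξ 1 s * P.hq ^ 2 * (P.xx ξ 1 s * P.hq ^ 2)) *
        br P.hq (P.xx ξ 1 s * P.xx ξ 1 s)) := by
  have m1 : P.mm ξ s = P.entry ξ 1 s := if_neg (by omega)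
  have m2 : P.mm ξ (s + 1) = P.entry ξ 1 (s + 1) := if_neg (by omega)
  rw [radMin, m1, m2]
  simp only [qn_eq]
  have e1 : P.qp (P.entry ξ 1 (s + 1) + P.entry ξ 1 s + s - 1) =
      P.xx ξ 1 (s + 1) * (P.xx ξ 1 s * P.hq) := by
    rw [xx, xx, hq, ← qp_add, ← qp_add]; congr 1; push_cast; ring
  have e2 : P.qp (P.entry ξ 1 (s + 1) - P.entry ξ 1 s) =
      P.xx ξ 1 (s + 1) * (P.xx ξ 1 s * P.hq)⁻¹ := by
    rw [xx, xx, hq, ← qp_add, ← qp_sub]; congr 1; push_cast; ring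
  have e3 : P.qp (2 * P.entry ξ 1 s + s) =
      P.xx ξ 1 s * P.hq ^ 2 * (P.xx ξ 1 s * P.hq ^ 2) := by
    rw [xx, hq_sq, ← qp_add, ← qp_add]; congr 1; push_cast; ring
  have e4 : P.qp (2 * P.entry ξ 1 s + s - 2) = P.xx ξ 1 s * P.xx ξ 1 s := by
    rw [xx, ← qp_add]; congr 1; push_cast; ring
  rw [e1, e2, e3, e4]
  congr 1
  rw [mul_assoc (_ * _)]
  congr 1
  split_ifs with h2
  · subst h2
    have m3 : P.mm ξ (2 - 1) = 0 := if_pos rfl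
    rw [m3]
    congr 2
    · rw [xx]; congr 1; push_cast; ring
    · rw [xx, hq_sq, ← qp_add]; congr 1; push_cast; ring
  · have m3 : P.mm ξ (s - 1) = P.entry ξ 1 (s - 1) := if_neg (by omega)
    have hc : ((s - 1 : ℕ) : ℂ) = s - 1 := by rw [Nat.cast_sub (by omega)]; simp
    rw [m3, ← mul_neg, ← br_inv]
    congr 2
    · rw [xx, xx, hq, ← qp_add, ← qp_add]; congr 1; rw [hc]; push_cast; ring
    · rw [xx, xx, hq, ← qp_add, ← qp_sub, ← qp_neg]; congr 1; rw [hc]; push_cast; ring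

variable (P) in
/-- The factor of the norm of a basis vector that comes from the row `s`. -/
def gg (ξ : ℕ → ℕ → ℤ) (s : ℕ) : ℂ :=
  if Even s then P.xx ξ 1 s + (P.xx ξ 1 s)⁻¹ else br P.hq (P.xx ξ 1 s * P.xx ξ 1 s)

variable (P) in
/-- The scaling factors of the basis vectors. -/
def scale (ξ : ℕ → ℕ → ℤ) : ℂ := (∏ s ∈ Icc 2 (P.n - 1), P.gg ξ s) ^ ((1 : ℂ) / 2)

lemma scale_sq (ξ : ℕ → ℕ → ℤ) : P.scale ξ ^ 2 = ∏ s ∈ Icc 2 (P.n - 1), P.gg ξ s := by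
  have := Complex.cpow_nat_inv_pow (∏ s ∈ Icc 2 (P.n - 1), P.gg ξ s) (n := 2) (by norm_num)
  rw [scale]
  convert this using 2
  norm_num

section

variable (hP : P.Admissible) (hM : P.IsMinimal)

include hP hM

lemma gg_ne_zero (hs : 2 ≤ s) (hn : s < P.n) : P.gg ξ s ≠ 0 := by
  have h1 := hM.1
  have hc : P.IsCyc 1 s := ⟨le_rfl, h1.ge, hs, hn.le⟩
  rw [gg]
  split_ifs with he
  · simpa using add_inv_ne_zero_of_cyc (ξ := ξ) hP hc hn 0
  · exact (isGen_mul hP hc le_rfl hs hn.le (Or.inl ⟨rfl, hn⟩)).ne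

lemma scale_ne_zero (ξ : ℕ → ℕ → ℤ) : P.scale ξ ≠ 0 := by
  intro h0
  have h := scale_sq (P := P) ξ
  rw [h0, zero_pow two_ne_zero] at h
  refine prod_ne_zero_iff.2 (fun s hs => ?_) h.symm
  rw [mem_Icc] at hs
  exact gg_ne_zero hP hM hs.1 (by omega)

variable (hs : 2 ≤ s) (hn : s < P.n) (hy : arr y = P.shift (arr x) 1 s 1)

include hs hn hy

omit hP hM in
lemma scale_sq_mul :
    P.scale (arr y) ^ 2 * P.gg (arr x) s = P.scale (arr x) ^ 2 * P.gg (arr y) s := by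
  have hmem : s ∈ Icc 2 (P.n - 1) := mem_Icc.2 ⟨hs, by omega⟩
  rw [scale_sq, scale_sq, ← mul_prod_erase _ _ hmem, ← mul_prod_erase _ (P.gg (arr x)) hmem]
  have h : ∏ r ∈ (Icc 2 (P.n - 1)).erase s, P.gg (arr y) r =
      ∏ r ∈ (Icc 2 (P.n - 1)).erase s, P.gg (arr x) r := prod_congr rfl fun r hr => by
    have hrs := (mem_erase.1 hr).1
    have : P.xx (arr y) 1 r = P.xx (arr x) 1 r :=
      xx_congr (by rw [hy, shift_of_ne (fun h => hrs h.2)])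
    rw [gg, gg, this]
  rw [h]
  ring

omit hM hs in
lemma xx_shift : P.xx (arr y) 1 s = P.xx (arr x) 1 s * P.hq ^ 2 := by
  have e2 : P.hq ^ (2 * (1 : ℤ)) = P.hq ^ 2 := by norm_cast
  rw [arr_eq_red hy, xx_red hP, xx_upd hn, ← e2]
  exact if_pos ⟨rfl, rfl⟩

omit hM hs in
lemma gg_mul_denUp :
    P.gg (arr y) s * P.denUp (arr x) 1 s = P.gg (arr x) s * P.denDown (arr y) 1 s := by
  have hh := hq_ne_zero (P := P)
  by_cases he : Even s
  · rw [denUp_eq, denDown_eq, den, den, if_pos he, if_pos he, gg, gg, if_pos he, if_pos he]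
    ring
  · rw [denUp_odd he, denDown_odd he, gg, gg, if_neg he, if_neg he, xx_shift hP hn hy,
      show P.xx (arr x) 1 s * P.hq ^ 2 * P.hq⁻¹ = P.xx (arr x) 1 s * P.hq by field_simp]
    ring

/-- The ratio of the `gg` replaces one of two equal denominator factors by its value at the other
end of the move, which makes the denominator symmetric. The remaining factors cancel against what
`prod_cancel` leaves over. -/
lemma rad_div_eq : P.rad (arr x) 1 s / P.denUp (arr x) 1 s ^ 2 *
    (P.gg (arr x) s / P.gg (arr y) s) = P.radMin (arr x) s := by
  have h1 := hM.1
  have hh := hq_ne_zero (P := P)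
  have hc : P.IsCyc 1 s := ⟨le_rfl, h1.ge, hs, hn.le⟩
  have hA := xx_ne_zero (P := P) (arr x) 1 s
  have hgen := isGen_xx (ξ := arr x) hP hc
  have e2 : P.hq ^ (2 : ℤ) = P.hq ^ 2 := by norm_cast
  have g0 := hgen.ne
  have g1 := hgen 1
  have g2 := hgen 2
  rw [zpow_one] at g1
  rw [e2] at g2
  have n1 := gg_ne_zero (ξ := arr x) hP hM hs hn
  have n2 := gg_ne_zero (ξ := arr y) hP hM hs hn
  rw [rad_of_minimal hP hM hs hn, radMin_eq hs]
  by_cases he : Even s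
  · rw [denUp_eq, den, if_pos he]
    rw [gg, if_pos he] at n1 n2 ⊢
    rw [gg, if_pos he]
    rw [xx_shift hP hn hy] at n2 ⊢
    have hf : P.fac (P.xx (arr x) 1 s * P.hq) (-1) =
        -(br P.hq (P.xx (arr x) 1 s) * br P.hq (P.xx (arr x) 1 s * P.hq ^ 2)) := by
      rw [fac, ← mul_neg, ← br_inv, zpow_neg_one]
      congr 2 <;> field_simp
    rw [br_mul_add hA, br_mul_add (mul_ne_zero hA (pow_ne_zero 2 hh)), if_pos he, hf]
    generalize P.xx (arr x) 1 s + (P.xx (arr x) 1 s)⁻¹ = p at *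
    generalize P.xx (arr x) 1 s * P.hq ^ 2 + (P.xx (arr x) 1 s * P.hq ^ 2)⁻¹ = p' at *
    generalize br P.hq (P.xx (arr x) 1 s) = u at *
    generalize br P.hq (P.xx (arr x) 1 s * P.hq ^ 2) = u' at *
    split_ifs
    · field_simp
    · field_simp
  · have hs2 : s ≠ 2 := by
      rintro rfl
      exact he even_two
    rw [denUp_odd he, if_neg he, if_neg hs2, if_neg hs2]
    rw [gg, if_neg he] at n1 n2 ⊢
    rw [gg, if_neg he]
    rw [xx_shift hP hn hy] at n2 ⊢
    have hf : P.fac (P.xx (arr x) 1 s * P.hq) 0 = -br P.hq (P.xx (arr x) 1 s * P.hq) ^ 2 := by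
      rw [fac, zpow_zero, one_mul, one_mul, br_inv]
      ring
    rw [hf]
    field_simp

end

theorem minimal_form (hP : P.Admissible) (hM : P.IsMinimal) (hR : P.IsRootChoice R) :
    ∃ (d : P.Tab → ℂ) (S : P.Tab → ℕ → ℂ),
      (∀ ξ, d ξ ≠ 0) ∧
      (∀ (ξ : P.Tab) (s : ℕ), 2 ≤ s → s < P.n → S ξ s ^ 2 = P.radMin (arr ξ) s) ∧
      (∀ ξ : P.Tab, P.op R 1 (Finsupp.single ξ (d ξ)) =
        Finsupp.single ξ (Complex.I * P.qn (P.mm (arr ξ) 2) * d ξ)) ∧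
      ∀ (ξ : P.Tab) (s : ℕ), 2 ≤ s → s < P.n →
        P.op R s (Finsupp.single ξ (d ξ)) =
          P.ket (P.shift (arr ξ) 1 s 1) (fun η => P.c 1 s * S ξ s * d η) -
          P.ket (P.shift (arr ξ) 1 s (-1)) (fun η => (P.c 1 s)⁻¹ * S η s * d η) := by
  have h1 := hM.1
  have hcol : ∀ s, 2 ≤ s → 1 ∈ cols s := fun s hs => col_iff.2 ⟨le_rfl, hs⟩
  have hup : ∀ (x : P.Tab) s, 2 ≤ s → s < P.n → ∃ y : P.Tab, arr y = P.shift (arr x) 1 s 1 :=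
    fun x s hs hn => by
      obtain ⟨y, hy⟩ := exists_rotate hP (hcol s hs) hn h1.ge x 1
      exact ⟨y, by rw [hy, ← shift_red, (isTableau_arr x).red_eq]⟩
  have hdown : ∀ (x : P.Tab) s, 2 ≤ s → s < P.n → ∃ y : P.Tab, arr y = P.shift (arr x) 1 s (-1) :=
    fun x s hs hn => by
      obtain ⟨y, hy⟩ := exists_rotate hP (hcol s hs) hn h1.ge x (-1)
      exact ⟨y, by rw [hy, ← shift_red, (isTableau_arr x).red_eq]⟩
  have hsc := scale_ne_zero hP hM
  -- With basis vectors rescaled by `scale`, the upward coefficient forces this `S`; the point is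
  -- that the downward coefficient then agrees with it.
  refine ⟨fun x => P.scale (arr x), fun x s => R x 1 s / P.denUp (arr x) 1 s *
    (P.scale (arr x) / P.scale (P.shift (arr x) 1 s 1)), fun x => hsc _, fun x s hs hn => ?_,
    fun x => ?_, fun x s hs hn => ?_⟩
  · obtain ⟨y, hy⟩ := hup x s hs hn
    rw [← rad_div_eq hP hM hs hn hy, mul_pow, div_pow, div_pow, ← hy,
      (root_choice_ne_zero hP (Or.inr hM) hR (hcol s hs) hn hy).1]
    congr 1
    rw [div_eq_div_iff (pow_ne_zero 2 (hsc _)) (gg_ne_zero hP hM hs hn),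
      ← scale_sq_mul hs hn hy]
    ring
  · rw [op_single, act_one, Finsupp.smul_single, smul_eq_mul, mul_comm]
  · obtain ⟨y, hy⟩ := hup x s hs hn
    obtain ⟨z, hz⟩ := hdown x s hs hn
    have hzx : arr x = P.shift (arr z) 1 s 1 := by
      have := shift_shift_neg (isTableau_arr x) (j := 1) (s := s) (e := -1)
      rw [neg_neg] at this
      rw [hz, this]
    rw [op_single, act_of_minimal hP hM hs hn, ← hy, ← hz, ket_arr, ket_arr, ket_arr, ket_arr,
      smul_sub, Finsupp.smul_single, Finsupp.smul_single, smul_eq_mul, smul_eq_mul]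
    simp only
    rw [← hy, ← hzx]
    congr 2
    · have := hsc (arr y)
      field_simp
    · have e1 := scale_sq_mul hs hn hzx
      have e2 := gg_mul_denUp hP hn hzx
      have n1 := hsc (arr x)
      have n2 := gg_ne_zero (ξ := arr x) hP hM hs hn
      have n3 := gg_ne_zero (ξ := arr z) hP hM hs hn
      have n4 := denUp_ne_zero hP (Or.inr hM) (inter_arr hP z) (hcol s hs) hn (inter_of_shift hP hzx)
      have n5 := denDown_arr_ne_zero hP (Or.inr hM) (hcol s hs) hn hzx
      -- Equality of the two coefficients amounts to this identity: the squared scales at the two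
      -- ends are in the ratio of the `gg`, which compensates the different denominators up and
      -- down.
      have key : P.scale (arr x) ^ 2 * P.denUp (arr z) 1 s =
          P.scale (arr z) ^ 2 * P.denDown (arr x) 1 s := by
        refine mul_right_cancel₀ (mul_ne_zero n2 n3) ?_
        linear_combination P.denUp (arr z) 1 s * P.gg (arr x) s * e1 +
          P.scale (arr z) ^ 2 * P.gg (arr x) s * e2
      generalize (P.c 1 s)⁻¹ = t
      field_simp
      linear_combination R z 1 s * t * key

end Omega

end NonstdSo

end

theorem mainTheorem7 (P : NonstdSo.Omega) (hP : P.Admissible) :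
    -- the formulas make sense exactly in the following range of the parameters
    (P.Regular ↔
      (P.i + 2 ≤ P.n / 2 → 2 * (P.M (P.i + 1) + (P.n / 2 : ℕ) - P.i - 1) < (P.k : ℚ))) ∧
    -- whenever they do, and in the case of minimal dimension, they give an irreducible
    -- finite dimensional representation
    (P.Regular ∨ P.IsMinimal →
      FiniteDimensional ℂ P.V ∧
      (∃ R, P.IsRootChoice R ∧ ∃ T, P.IsRep R T) ∧
      ∀ R, P.IsRootChoice R → ∀ T, P.IsRep R T → NonstdSo.IsIrreducibleRep T) ∧
    -- the representations of minimal dimension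
    (P.IsMinimal →
      P.numParams = 2 * P.n - 3 ∧
      Module.finrank ℂ P.V = P.k ^ (P.n - 2) ∧
      ∀ R, P.IsRootChoice R →
        ∃ (d : P.Tab → ℂ) (S : P.Tab → ℕ → ℂ),
          (∀ ξ, d ξ ≠ 0) ∧
          (∀ (ξ : P.Tab) (s : ℕ), 2 ≤ s → s < P.n → S ξ s ^ 2 = P.radMin ξ.1 s) ∧
          (∀ ξ : P.Tab, P.op R 1 (Finsupp.single ξ (d ξ)) =
            Finsupp.single ξ (Complex.I * P.qn (P.mm ξ.1 2) * d ξ)) ∧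
          ∀ (ξ : P.Tab) (s : ℕ), 2 ≤ s → s < P.n →
            P.op R s (Finsupp.single ξ (d ξ)) =
              P.ket (P.shift ξ.1 1 s 1) (fun η => P.c 1 s * S ξ s * d η) -
              P.ket (P.shift ξ.1 1 s (-1)) (fun η => (P.c 1 s)⁻¹ * S η s * d η)) := by
  refine ⟨⟨fun h => (NonstdSo.Omega.low_iff hP).1 (NonstdSo.Omega.Regular.low hP h),
    fun h => NonstdSo.Omega.Low.regular hP ((NonstdSo.Omega.low_iff hP).2 h)⟩, fun h => ?_,
    fun hM => ⟨NonstdSo.Omega.numParams_of_minimal hP hM, NonstdSo.Omega.finrank_of_minimal hP hM,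
      fun R hR => NonstdSo.Omega.minimal_form hP hM hR⟩⟩
  -- Regularity enters the construction and the irreducibility proof only through the bound `Low`.
  have hLM : P.Low ∨ P.IsMinimal := h.imp_left (NonstdSo.Omega.Regular.low hP)
  have := NonstdSo.Omega.finite_tab hP
  exact ⟨inferInstanceAs (Module.Finite ℂ (P.Tab →₀ ℂ)), NonstdSo.Omega.exists_rep hP hLM,
    fun R hR T hT => NonstdSo.Omega.isIrreducibleRep hP hLM hR hT⟩
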